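/- Consider on $\mathbb R^2$ the system with odd viscosity $$\partial_t\rho+\nabla\cdot(\rho u)=0,\qquad \partial_t(\rho u)+\nabla\cdot(\rho\,u\otimes u)+\nabla\pi+\nabla\cdot(\rho\,\nabla u^\perp)=0,\qquad \nabla\cdot u=0,$$ where $\nabla=(\partial_1,\partial_2)$, $\nabla^\perp=(-\partial_2,\partial_1)$, $u^\perp=(-u_2,u_1)$, $(\nabla u^\perp)_{ij}=\partial_i(u^\perp)_j$ and $(\nabla\cdot A)_j=\sum_i\partial_iA_{ij}$. Write $\omega=\partial_1u_2-\partial_2u_1$ and $\theta=\nabla^\perp\cdot(\rho u)-\Delta\rho$ (a distribution in $x$ for each $t$). Let $0<T<\infty$, and let $(\rho_1,u_1,\nabla\pi_1)$ and $(\rho_2,u_2,\nabla\pi_2)$ be two weak (distributional) solutions on $[0,T]\times\mathbb R^2$ with initial data $(\rho_{0,1},u_{0,1})$ and $(\rho_{0,2},u_{0,2})$, the $\pi_j$ being locally integrable on $[0,T]\times\mathbb R^2$. Assume that: (i) there are constants $0<\rho_*\le\rho^*$ with $\rho_*\le\rho_j\le\rho^*$ for $j=1,2$; (ii) $\rho_{0,1}$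 and $u_{0,2}$ belong to $W^{1,\infty}(\mathbb R^2)$; (iii) $\rho_1-\rho_2\in C^1([0,T];H^2)$ and $u_1-u_2\in C^1([0,T];H^1)$; (iv) $\theta_1-\theta_2\in C^1([0,T];L^2)$; (v) $\nabla\rho_1,\nabla\rho_2\in L^\infty([0,T]\times\mathbb R^2)$; (vi) $u_1,u_2\in L^\infty([0,T];W^{1,\infty})$; (vii) $\nabla(\pi_2-\rho_2\omega_2)\in L^2([0,T];L^\infty)$ and $\nabla^2\rho_2\in L^1([0,T];L^\infty)$; (viii) for some $q\in\,]2,+\infty]$, $\nabla\pi_2$ and $\nabla\Delta\rho_2$ belong to $L^1([0,T];L^q)$ and $\nabla^2u_2\in L^{2q/(q-2)}([0,T];L^q)$ (with $2q/(q-2)=2$ if $q=\infty$). Let $M<\infty$ be a bound for the norms (of all components) of the functions in (v)–(viii) in the spaces given there. Then $\rho_{0,1}-\rho_{0,2}\in H^2$, $u_{0,1}-u_{0,2}\in H^1$, and there exists a nonnegative function $I\in L^1([0,T])$ such that $$\sup_{t\in[0,T]}\Big(\|\rho_1(t)-\rho_2(t)\|_{H^2}^2+\|u_1(t)-u_2(t)\|_{H^1}^2\Big)\le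 \mathcal K_0\Big(\|\rho_{0,1}-\rho_{0,2}\|_{H^2}^2+\|u_{0,1}-u_{0,2}\|_{H^1}^2\Big)\exp\Big(C\int_0^T\big(1+I(\tau)\big)\,d\tau\Big).$$ Here $C>0$ is an absolute constant, independent of the data and of the solutions; $\mathcal K_0$ depends only on $\rho_*$, $\rho^*$ and the $L^\infty$ norms of $\nabla\rho_{0,1}$, $u_{0,2}$ and $\nabla u_{0,2}$; and $\int_0^TI(\tau)\,d\tau$ is bounded by a quantity depending only on $T$, $\rho_*$, $\rho^*$, $q$ and $M$. -/

import Mathlib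

open MeasureTheory Set
open scoped ENNReal NNReal

noncomputable section

namespace OddFluid

/-- The Euclidean plane. -/
abbrev Plane : Type := EuclideanSpace ℝ (Fin 2)

/-! ### Weak derivatives in the plane -/

/-- The classical partial derivative of `φ : ℝ² → ℝ` (used on test functions only). -/
def pd (i : Fin 2) (φ : Plane → ℝ) (x : Plane) : ℝ :=
  fderiv ℝ φ x (EuclideanSpace.single i 1)

/-- The classical Laplacian of `φ : ℝ² → ℝ` (used on test functions only). -/
def lap (φ : Plane → ℝ) (x : Plane) : ℝ := ∑ i, pd i (pd i φ) x

/-- Test functions: smooth and compactly supported. -/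
def IsTest (φ : Plane → ℝ) : Prop :=
  ContDiff ℝ ((⊤ : ℕ∞) : WithTop ℕ∞) φ ∧ HasCompactSupport φ

/-- `g` is the weak partial derivative `∂ᵢ f`. -/
def HasWeakPartial (i : Fin 2) (f g : Plane → ℝ) : Prop :=
  LocallyIntegrable f ∧ LocallyIntegrable g ∧
    ∀ φ : Plane → ℝ, IsTest φ → ∫ x, f x * pd i φ x = - ∫ x, g x * φ x

/-- `l` is the weak Laplacian `Δ f`. -/
def HasWeakLaplacian (f l : Plane → ℝ) : Prop :=
  LocallyIntegrable f ∧ LocallyIntegrable l ∧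
    ∀ φ : Plane → ℝ, IsTest φ → ∫ x, f x * lap φ x = ∫ x, l x * φ x

/-- The norm `‖∂ᵢ f‖_{L^∞}` of the weak derivative; it is `∞` if `∂ᵢ f` does not exist as a locally
integrable function (the infimum runs over the representatives of one class, or over nothing). -/
def partialSup (i : Fin 2) (f : Plane → ℝ) : ℝ≥0∞ :=
  ⨅ (g : Plane → ℝ) (_ : HasWeakPartial i f g), eLpNorm g ⊤ volume

/-- `f ∈ W^{1,∞}(ℝ²)`. -/
def MemW1Infty (f : Plane → ℝ) : Prop :=
  MemLp f ⊤ volume ∧ ∀ i, partialSup i f < ⊤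

/-- The square of the `H^k(ℝ²)` norm, i.e. the sum of the squares of the `L²` norms of all iterated
weak partial derivatives of order at most `k`; it is `∞` if one of them does not exist. -/
def sobolevSq : ℕ → (Plane → ℝ) → ℝ≥0∞
  | 0, f => eLpNorm f 2 volume ^ 2
  | k + 1, f => eLpNorm f 2 volume ^ 2 +
      ∑ i, ⨅ (g : Plane → ℝ) (_ : HasWeakPartial i f g), sobolevSq k g

/-! ### Functions of time and space -/

/-- Local integrability on `[0,T] × ℝ²`. -/
def LocInt (T : ℝ) (f : ℝ → Plane → ℝ) : Prop :=
  ∀ K : Set Plane, IsCompact K →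
    IntegrableOn (fun z : ℝ × Plane => f z.1 z.2) (Icc 0 T ×ˢ K) volume

/-- `f ∈ L^r([0,T]; L^p(ℝ²))` with norm at most `M`. -/
def MemLrLp (T : ℝ) (r p : ℝ≥0∞) (f : ℝ → Plane → ℝ) (M : ℝ≥0) : Prop :=
  AEStronglyMeasurable (fun z : ℝ × Plane => f z.1 z.2) (volume.restrict (Icc 0 T ×ˢ univ)) ∧
    eLpNorm (fun t => eLpNorm (f t) p volume) r (volume.restrict (Icc 0 T)) ≤ M

/-- `G = ∇f`, the weak gradient in the space variables, at almost every time. -/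
def IsSpaceGrad (T : ℝ) (f : ℝ → Plane → ℝ) (G : Fin 2 → ℝ → Plane → ℝ) : Prop :=
  ∀ i, ∀ᵐ t ∂(volume.restrict (Icc 0 T)), HasWeakPartial i (f t) (G i t)

/-- `∇f ∈ L^r([0,T]; L^p(ℝ²))`, each component having norm at most `M`. -/
def GradMem (T : ℝ) (r p : ℝ≥0∞) (f : ℝ → Plane → ℝ) (M : ℝ≥0) : Prop :=
  ∃ G : Fin 2 → ℝ → Plane → ℝ, IsSpaceGrad T f G ∧ ∀ i, MemLrLp T r p (G i) M

/-- `∇²f ∈ L^r([0,T]; L^p(ℝ²))`, each component having norm at most `M`. -/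
def HessMem (T : ℝ) (r p : ℝ≥0∞) (f : ℝ → Plane → ℝ) (M : ℝ≥0) : Prop :=
  ∃ G : Fin 2 → ℝ → Plane → ℝ, IsSpaceGrad T f G ∧ ∀ i, GradMem T r p (G i) M

/-- `∇Δf ∈ L^r([0,T]; L^p(ℝ²))`, each component having norm at most `M`. -/
def GradLapMem (T : ℝ) (r p : ℝ≥0∞) (f : ℝ → Plane → ℝ) (M : ℝ≥0) : Prop :=
  ∃ L : ℝ → Plane → ℝ,
    (∀ᵐ t ∂(volume.restrict (Icc 0 T)), HasWeakLaplacian (f t) (L t)) ∧ GradMem T r p L M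

/-- `f ∈ C¹([0,T]; L²(ℝ²))`. -/
def C1L2 (T : ℝ) (f : ℝ → Plane → ℝ) : Prop :=
  ∃ F : ℝ → Lp ℝ 2 (volume : Measure Plane),
    ContDiffOn ℝ 1 F (Icc 0 T) ∧ ∀ t ∈ Icc 0 T, F t =ᵐ[volume] f t

/-- `f ∈ C¹([0,T]; H^k(ℝ²))`: the function and its weak derivatives up to order `k` are `C¹` curves
in `L²`. This is the same as being a `C¹` curve in `H^k`, since `H^k` is isomorphic, through the list
of derivatives, to a closed subspace of a power of `L²`. -/
def C1Sobolev (T : ℝ) : ℕ → (ℝ → Plane → ℝ) → Prop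
  | 0, f => C1L2 T f
  | k + 1, f => C1L2 T f ∧ ∃ G : Fin 2 → ℝ → Plane → ℝ,
      (∀ i, ∀ t ∈ Icc 0 T, HasWeakPartial i (f t) (G i t)) ∧ ∀ i, C1Sobolev T k (G i)

/-! ### The odd system -/

/-- The unknowns of the system together with initial data. Components are indexed by `Fin 2`. -/
structure Flow where
  /-- the density `ρ(t,x)` -/
  rho : ℝ → Plane → ℝ
  /-- the components of the velocity field `u(t,x)` -/
  u : Fin 2 → ℝ → Plane → ℝ
  /-- `gradu i j` is `∂ᵢ uⱼ` (as a predicate below requires) -/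
  gradu : Fin 2 → Fin 2 → ℝ → Plane → ℝ
  /-- the pressure `π(t,x)` -/
  press : ℝ → Plane → ℝ
  /-- the initial density -/
  rho0 : Plane → ℝ
  /-- the components of the initial velocity -/
  u0 : Fin 2 → Plane → ℝ

namespace Flow

/-- `∂ᵢ (u^⊥)ⱼ`, where `u^⊥ = (-u₂, u₁)`. -/
def graduPerp (S : Flow) (i j : Fin 2) (t : ℝ) (x : Plane) : ℝ :=
  ![- S.gradu i 1 t x, S.gradu i 0 t x] j

/-- The vorticity `ω = ∂₁u₂ - ∂₂u₁`. -/
def vort (S : Flow) (t : ℝ) (x : Plane) : ℝ := S.gradu 0 1 t x - S.gradu 1 0 t x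

/-- The pairing of the distribution `θ(t) = ∇^⊥·(ρu)(t) - Δρ(t)`, with `∇^⊥ = (-∂₂, ∂₁)`, and the test
function `φ`. -/
def thetaPairing (S : Flow) (t : ℝ) (φ : Plane → ℝ) : ℝ :=
  ∫ x, (S.rho t x * S.u 0 t x * pd 1 φ x - S.rho t x * S.u 1 t x * pd 0 φ x
    - S.rho t x * lap φ x)

end Flow

/-- Test functions for the Cauchy problem on `[0,T[ × ℝ²`: smooth, compactly supported, vanishing
near and after the time `T` (but not at the time `0`). -/
def IsTimeTest (T : ℝ) (φ : ℝ × Plane → ℝ) : Prop :=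
  ContDiff ℝ ((⊤ : ℕ∞) : WithTop ℕ∞) φ ∧ HasCompactSupport φ ∧ ∀ z ∈ tsupport φ, z.1 < T

/-- Time derivative of a test function. -/
def dt (φ : ℝ × Plane → ℝ) (z : ℝ × Plane) : ℝ := fderiv ℝ φ z (1, 0)

/-- Space derivative of a test function. -/
def dx (i : Fin 2) (φ : ℝ × Plane → ℝ) (z : ℝ × Plane) : ℝ :=
  fderiv ℝ φ z (0, EuclideanSpace.single i 1)

/-- `S` is a weak solution on `[0,T] × ℝ²`, with its initial data, of the system
`∂ₜρ + ∇·(ρu) = 0`, `∂ₜ(ρu) + ∇·(ρ u⊗u) + ∇π + ∇·(ρ ∇u^⊥) = 0`, `∇·u = 0`,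
where `(∇·A)ⱼ = ∑ᵢ ∂ᵢ Aᵢⱼ` and `(∇u^⊥)ᵢⱼ = ∂ᵢ(u^⊥)ⱼ`. -/
structure IsSolution (T : ℝ) (S : Flow) : Prop where
  locInt_rho : LocInt T S.rho
  locInt_u : ∀ j, LocInt T (S.u j)
  locInt_gradu : ∀ i j, LocInt T (S.gradu i j)
  locInt_press : LocInt T S.press
  locInt_momentum : ∀ j, LocInt T (fun t x => S.rho t x * S.u j t x)
  locInt_flux : ∀ i j, LocInt T (fun t x => S.rho t x * S.u i t x * S.u j t x)
  locInt_odd : ∀ i j, LocInt T (fun t x => S.rho t x * S.gradu i j t x)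
  locInt_rho0 : LocallyIntegrable S.rho0
  locInt_u0 : ∀ j, LocallyIntegrable (S.u0 j)
  locInt_momentum0 : ∀ j, LocallyIntegrable (fun x => S.rho0 x * S.u0 j x)
  /-- `gradu` is the weak gradient of `u` -/
  grad_u : ∀ j, IsSpaceGrad T (S.u j) (fun i => S.gradu i j)
  /-- conservation of mass -/
  mass : ∀ φ : ℝ × Plane → ℝ, IsTimeTest T φ →
    (∫ z in Icc 0 T ×ˢ univ,
        (S.rho z.1 z.2 * dt φ z + ∑ i, S.rho z.1 z.2 * S.u i z.1 z.2 * dx i φ z))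
      + ∫ x, S.rho0 x * φ (0, x) = 0
  /-- conservation of momentum, component `j` -/
  momentum : ∀ j : Fin 2, ∀ φ : ℝ × Plane → ℝ, IsTimeTest T φ →
    (∫ z in Icc 0 T ×ˢ univ,
        (S.rho z.1 z.2 * S.u j z.1 z.2 * dt φ z
          + (∑ i, S.rho z.1 z.2 * S.u i z.1 z.2 * S.u j z.1 z.2 * dx i φ z)
          + S.press z.1 z.2 * dx j φ z
          + ∑ i, S.rho z.1 z.2 * S.graduPerp i j z.1 z.2 * dx i φ z))
      + ∫ x, S.rho0 x * S.u0 j x * φ (0, x) = 0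
  /-- incompressibility -/
  div_free : ∀ᵐ z ∂((volume : Measure (ℝ × Plane)).restrict (Icc 0 T ×ˢ univ)),
    S.gradu 0 0 z.1 z.2 + S.gradu 1 1 z.1 z.2 = 0

/-- `‖ρ₁(t) - ρ₂(t)‖²_{H²} + ‖u₁(t) - u₂(t)‖²_{H¹}`. -/
def distSq (S₁ S₂ : Flow) (t : ℝ) : ℝ≥0∞ :=
  sobolevSq 2 (fun x => S₁.rho t x - S₂.rho t x)
    + ∑ j, sobolevSq 1 (fun x => S₁.u j t x - S₂.u j t x)

/-- `‖ρ₀₁ - ρ₀₂‖²_{H²} + ‖u₀₁ - u₀₂‖²_{H¹}`. -/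
def distSq0 (S₁ S₂ : Flow) : ℝ≥0∞ :=
  sobolevSq 2 (fun x => S₁.rho0 x - S₂.rho0 x)
    + ∑ j, sobolevSq 1 (fun x => S₁.u0 j x - S₂.u0 j x)

/-- The assumptions on two flows. Here `a` and `b` are the lower and upper bounds `ρ_*`, `ρ^*` of the
densities, and the finite number `M` is a common bound for the norms of `∇ρ₁`, `∇ρ₂`, `u₁`, `u₂` and of
the higher order quantities of the second flow, in the spaces to which they are assumed to belong. The exponent `(2⁻¹ - q⁻¹)⁻¹` is `2q/(q-2)`, equal to `2` for `q = ∞`. -/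
structure StabilityAssumptions (T a b : ℝ) (q : ℝ≥0∞) (M : ℝ≥0) (S₁ S₂ : Flow) : Prop where
  /-- bounds for the densities -/
  lower_pos : 0 < a
  lower_le_upper : a ≤ b
  bounds₁ : ∀ᵐ z ∂((volume : Measure (ℝ × Plane)).restrict (Icc 0 T ×ˢ univ)),
    a ≤ S₁.rho z.1 z.2 ∧ S₁.rho z.1 z.2 ≤ b
  bounds₂ : ∀ᵐ z ∂((volume : Measure (ℝ × Plane)).restrict (Icc 0 T ×ˢ univ)),
    a ≤ S₂.rho z.1 z.2 ∧ S₂.rho z.1 z.2 ≤ b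
  /-- Lipschitz data: `ρ₀₁` and `u₀₂` are in `W^{1,∞}` -/
  rho0_mem : MemW1Infty S₁.rho0
  u0_mem : ∀ j, MemW1Infty (S₂.u0 j)
  /-- `ρ₁ - ρ₂ ∈ C¹([0,T];H²)` and `u₁ - u₂ ∈ C¹([0,T];H¹)` -/
  diff_rho : C1Sobolev T 2 (fun t x => S₁.rho t x - S₂.rho t x)
  diff_u : ∀ j, C1Sobolev T 1 (fun t x => S₁.u j t x - S₂.u j t x)
  /-- `θ₁ - θ₂ ∈ C¹([0,T];L²)`: the distribution `θ₁(t) - θ₂(t)` is given by a `C¹` curve in `L²` -/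
  diff_theta : ∃ F : ℝ → Lp ℝ 2 (volume : Measure Plane), ContDiffOn ℝ 1 F (Icc 0 T) ∧
    ∀ t ∈ Icc 0 T, ∀ φ : Plane → ℝ, IsTest φ →
      ∫ x, F t x * φ x = S₁.thetaPairing t φ - S₂.thetaPairing t φ
  /-- `∇ρ₁, ∇ρ₂ ∈ L^∞` -/
  grad_rho₁ : GradMem T ⊤ ⊤ S₁.rho M
  grad_rho₂ : GradMem T ⊤ ⊤ S₂.rho M
  /-- `u₁, u₂ ∈ L^∞([0,T];W^{1,∞})` -/
  u₁_mem : ∀ j, MemLrLp T ⊤ ⊤ (S₁.u j) M ∧ GradMem T ⊤ ⊤ (S₁.u j) M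
  u₂_mem : ∀ j, MemLrLp T ⊤ ⊤ (S₂.u j) M ∧ GradMem T ⊤ ⊤ (S₂.u j) M
  /-- `∇(π₂ - ρ₂ω₂) ∈ L²([0,T];L^∞)` and `∇²ρ₂ ∈ L¹([0,T];L^∞)` -/
  grad_press_vort₂ : GradMem T 2 ⊤ (fun t x => S₂.press t x - S₂.rho t x * S₂.vort t x) M
  hess_rho₂ : HessMem T 1 ⊤ S₂.rho M
  /-- `∇π₂, ∇Δρ₂ ∈ L¹([0,T];L^q)` and `∇²u₂ ∈ L^{2q/(q-2)}([0,T];L^q)` -/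
  two_lt_q : 2 < q
  grad_press₂ : GradMem T 1 q S₂.press M
  grad_lap_rho₂ : GradLapMem T 1 q S₂.rho M
  hess_u₂ : ∀ j, HessMem T (2⁻¹ - q⁻¹)⁻¹ q (S₂.u j) M

end OddFluid

end

open OddFluid

/-! Write δ for the difference of the two flows. The odd stress satisfies `∇·(ρ∇u^⊥) = -∇(ρω) + Q`
with `Q = (-∂₂u·∇ρ, ∂₁u·∇ρ)`, so with `h = ∇(π - ρω)` the momentum equation becomes `ρ(∂ₜu + u·∇u) +
h + Q = 0`. The obstacle is the term `Δu·∇ρ` in the curl of `Q`, and two unknowns get around it. If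
one divides by `ρ` before taking the curl, then `Δu = ∇^⊥ω` turns this term into transport: `ω` is
carried by the divergence free field `b = u - ∇^⊥ log ρ` (`State.Valid.zeroInt_vorticity`). If one
does not divide, the Laplacian of the mass equation cancels it: `θ` is carried by `u`
(`State.Valid.zeroInt_theta`). Neither source contains second derivatives of `u`.

The energy is the sum of the squared L² norms of δρ, δu, δω, δθ. It is equivalent to the squared
distance (`Snapshot.exists_dist2_le`, `Snapshot.exists_en_le`): δω controls ∇δu because δu is
divergence free; Δδρ is the curl of δ(ρu) minus δθ and controls the Hessian of δρ; and ∇δρ is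
interpolated between δρ and Δδρ. The difference δh is bounded without elliptic regularity
(`Snapshot.δh_L2`): δ∂ₜu is divergence free and δh is curl free, so they are orthogonal in L²
(`integral_div_free_curl_free`), and testing the momentum balance with δh/ρ₁ leaves only controlled
terms.

In the equations for δω and δθ the transport by the first flow contributes nothing. As δω and δθ are
only in L², this rests on renormalisation and commutator estimates (`transport_skew`). The remaining
terms `δb·∇ω₂` and `δu·∇θ₂` are products of H¹ and L^q functions, estimated by `exists_n2_mul_le`,
or of L² and bounded functions. The result is `E' ≤ K κ E` with `κ` an integrable sum of norms of
the second flow (`Snapshot.exists_rate_le`), and Grönwall concludes.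

For the differentiation in time, nothing beyond local integrability is known of the first pressure.
Functions are followed along almost every time line (`Rep`), where products and quotients of
absolutely continuous functions are available: `ρ₂` and `ρ₂u₂` yield `∂ₜu₂`; adding the derivative
of δu yields `∂ₜu₁` and hence `∂ₜ(ρ₁u₁)`. Comparison with the weak momentum equation shows that the
residual `h₁` is curl free and that the initial values of the difference curves are the given data.

All integrations by parts at a fixed time are recorded as `ZeroInt` statements, so that each
differential identity reduces to a linear combination of integrands. A `Snapshot` collects what is
known at one time; since constants are chosen before the snapshot, they depend only on the bounds.
-/

noncomputable section

namespace OddFluid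

open Filter Topology
open scoped Convolution

/-! ### Test functions -/

lemma IsTest.continuous {φ : Plane → ℝ} (h : IsTest φ) : Continuous φ := h.1.continuous

lemma IsTest.differentiable {φ : Plane → ℝ} (h : IsTest φ) : Differentiable ℝ φ :=
  h.1.differentiable (by simp)

lemma contDiff_pd {f : Plane → ℝ} (h : ContDiff ℝ ((⊤ : ℕ∞) : WithTop ℕ∞) f) (i : Fin 2) :
    ContDiff ℝ ((⊤ : ℕ∞) : WithTop ℕ∞) (pd i f) := by
  have h1 : ContDiff ℝ ((⊤ : ℕ∞) : WithTop ℕ∞) (fderiv ℝ f) :=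
    h.fderiv_right (m := ((⊤ : ℕ∞) : WithTop ℕ∞)) (by simp)
  exact h1.clm_apply contDiff_const

lemma IsTest.pd {φ : Plane → ℝ} (h : IsTest φ) (i : Fin 2) : IsTest (pd i φ) := by
  refine ⟨contDiff_pd h.1 i, ?_⟩
  have : HasCompactSupport (fderiv ℝ φ) := h.2.fderiv (𝕜 := ℝ)
  exact this.comp_left (g := fun L : Plane →L[ℝ] ℝ => L (EuclideanSpace.single i 1)) (by simp)

lemma IsTest.memLp {φ : Plane → ℝ} (h : IsTest φ) (p : ℝ≥0∞) : MemLp φ p volume :=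
  h.continuous.memLp_of_hasCompactSupport h.2

lemma IsTest.integrable {φ : Plane → ℝ} (h : IsTest φ) : Integrable φ :=
  h.continuous.integrable_of_hasCompactSupport h.2

lemma IsTest.smooth_mul {f φ : Plane → ℝ} (hf : ContDiff ℝ ((⊤ : ℕ∞) : WithTop ℕ∞) f)
    (h : IsTest φ) : IsTest (fun x => f x * φ x) :=
  ⟨hf.mul h.1, h.2.mul_left⟩

lemma IsTest.add {φ ψ : Plane → ℝ} (h : IsTest φ) (h' : IsTest ψ) :
    IsTest (fun x => φ x + ψ x) := ⟨h.1.add h'.1, h.2.add h'.2⟩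

lemma IsTest.exists_bound {φ : Plane → ℝ} (h : IsTest φ) : ∃ C : ℝ, 0 ≤ C ∧ ∀ x, |φ x| ≤ C := by
  obtain ⟨C, hC⟩ := h.2.exists_bound_of_continuous h.continuous
  exact ⟨C, (abs_nonneg _).trans (hC 0), hC⟩

lemma pd_mul {f g : Plane → ℝ} (hf : Differentiable ℝ f) (hg : Differentiable ℝ g) (i : Fin 2)
    (x : Plane) : pd i (fun y => f y * g y) x = f x * pd i g x + pd i f x * g x := by
  unfold pd
  rw [fderiv_fun_mul (hf x) (hg x)]
  simp [mul_comm]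

lemma pd_comm {f : Plane → ℝ} (h : ContDiff ℝ ((⊤ : ℕ∞) : WithTop ℕ∞) f) (i j : Fin 2)
    (x : Plane) : pd i (pd j f) x = pd j (pd i f) x := by
  have h2 : ContDiffAt ℝ 2 f x := (h.of_le (WithTop.coe_le_coe.2 (le_top : (2 : ℕ∞) ≤ ⊤))).contDiffAt
  have hs : IsSymmSndFDerivAt ℝ f x := h2.isSymmSndFDerivAt (by simp)
  have h1 : DifferentiableAt ℝ (fderiv ℝ f) x :=
    ((h.fderiv_right (m := 1)
      (WithTop.coe_le_coe.2 (le_top : (2 : ℕ∞) ≤ ⊤))).differentiable (by simp)) x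
  have key : ∀ a b : Fin 2, OddFluid.pd a (OddFluid.pd b f) x =
      fderiv ℝ (fderiv ℝ f) x (EuclideanSpace.single a 1) (EuclideanSpace.single b 1) := by
    intro a b
    unfold OddFluid.pd
    rw [fderiv_clm_apply h1 (differentiableAt_const _)]
    simp
  rw [key, key]
  exact hs _ _

lemma integral_mul_pd {f φ : Plane → ℝ} (hf : ContDiff ℝ ((⊤ : ℕ∞) : WithTop ℕ∞) f)
    (h : IsTest φ) (i : Fin 2) : ∫ x, f x * pd i φ x = - ∫ x, pd i f x * φ x := by
  refine integral_mul_fderiv_eq_neg_fderiv_mul_of_integrable ?_ ?_ ?_ ?_ ?_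
  · exact (h.smooth_mul (contDiff_pd hf i)).integrable
  · exact ((h.pd i).smooth_mul hf).integrable
  · exact (h.smooth_mul hf).integrable
  · exact fun x _ => hf.differentiable (by simp) x
  · exact fun x _ => h.differentiable x

/-! ### Cutoffs -/

/-- A fixed bump function around the origin. -/
def baseBump : ContDiffBump (0 : Plane) := ⟨1, 2, one_pos, one_lt_two⟩

/-- Smooth cutoffs, equal to one on balls of growing radius. -/
def cutoff (n : ℕ) (x : Plane) : ℝ := baseBump (((n : ℝ) + 1)⁻¹ • x)

lemma baseBump_isTest : IsTest (fun x => baseBump x) :=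
  ⟨baseBump.contDiff, baseBump.hasCompactSupport⟩

lemma IsTest.comp_smul {φ : Plane → ℝ} (h : IsTest φ) {c : ℝ} (hc : c ≠ 0) :
    IsTest (fun x => φ (c • x)) := by
  refine ⟨h.1.comp (contDiff_const_smul c), ?_⟩
  exact h.2.comp_homeomorph (Homeomorph.smulOfNeZero c hc)

lemma pd_comp_smul {φ : Plane → ℝ} (h : Differentiable ℝ φ) (c : ℝ) (i : Fin 2) (x : Plane) :
    pd i (fun y => φ (c • y)) x = c * pd i φ (c • x) := by
  unfold pd
  have h1 : HasFDerivAt (fun y : Plane => c • y) (c • ContinuousLinearMap.id ℝ Plane) x :=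
    (hasFDerivAt_id x).const_smul c
  have h2 := (h (c • x)).hasFDerivAt.comp x h1
  rw [show (fun y => φ (c • y)) = φ ∘ (fun y : Plane => c • y) from rfl, h2.fderiv]
  simp

lemma cutoff_isTest (n : ℕ) : IsTest (cutoff n) :=
  baseBump_isTest.comp_smul (inv_ne_zero (by positivity))

lemma cutoff_nonneg (n : ℕ) (x : Plane) : 0 ≤ cutoff n x := baseBump.nonneg

lemma cutoff_le_one (n : ℕ) (x : Plane) : cutoff n x ≤ 1 := baseBump.le_one

lemma abs_cutoff_le (n : ℕ) (x : Plane) : |cutoff n x| ≤ 1 :=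
  abs_le.2 ⟨by linarith [cutoff_nonneg n x], cutoff_le_one n x⟩

lemma cutoff_eq_one {n : ℕ} {x : Plane} (hx : ‖x‖ ≤ n + 1) : cutoff n x = 1 := by
  refine baseBump.one_of_mem_closedBall ?_
  have hn : (0 : ℝ) < n + 1 := by positivity
  simp only [baseBump, Metric.mem_closedBall, dist_zero_right, norm_smul, norm_inv,
    Real.norm_of_nonneg hn.le]
  rw [inv_mul_le_iff₀ hn]; linarith

lemma tendsto_cutoff (x : Plane) : Tendsto (fun n => cutoff n x) atTop (𝓝 1) := by
  refine tendsto_const_nhds.congr' ?_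
  obtain ⟨N, hN⟩ := exists_nat_ge ‖x‖
  filter_upwards [eventually_ge_atTop N] with n hn
  rw [cutoff_eq_one]
  have : (N : ℝ) ≤ n := by exact_mod_cast hn
  linarith

/-- Each derivative of the rescaled bump gains a factor `1/(n+1)`. This decay removes the cutoff
terms in the density argument and in the flux at infinity. -/
lemma exists_pd_cutoff_bound : ∃ C : ℝ, 0 ≤ C ∧ ∀ n i x, |pd i (cutoff n) x| ≤ C / (n + 1) := by
  obtain ⟨C0, h0, hC0⟩ := (baseBump_isTest.pd 0).exists_bound
  obtain ⟨C1, h1, hC1⟩ := (baseBump_isTest.pd 1).exists_bound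
  refine ⟨C0 + C1, by positivity, fun n i x => ?_⟩
  have hn : (0 : ℝ) < n + 1 := by positivity
  rw [show cutoff n = fun y => baseBump (((n : ℝ) + 1)⁻¹ • y) from rfl,
    pd_comp_smul baseBump_isTest.differentiable, abs_mul, abs_of_pos (inv_pos.2 hn), div_eq_inv_mul]
  gcongr
  fin_cases i
  · exact (hC0 _).trans (by linarith)
  · exact (hC1 _).trans (by linarith)

/-- Compact sets are eventually inside the region where the cutoffs are one. -/
lemma exists_cutoff_eq_one {K : Set Plane} (hK : IsCompact K) :
    ∃ N : ℕ, ∀ n ≥ N, ∀ x ∈ K, cutoff n x = 1 ∧ ∀ i, pd i (cutoff n) x = 0 := by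
  obtain ⟨R, hR⟩ := hK.isBounded.exists_norm_le
  obtain ⟨N, hN⟩ := exists_nat_ge R
  refine ⟨N, fun n hn x hx => ?_⟩
  have hn' : (N : ℝ) ≤ n := by exact_mod_cast hn
  have hlt : ‖x‖ < n + 1 := by linarith [hR x hx]
  refine ⟨cutoff_eq_one hlt.le, fun i => ?_⟩
  have : cutoff n =ᶠ[𝓝 x] fun _ => 1 := by
    have : Metric.ball (0 : Plane) (n + 1) ∈ 𝓝 x :=
      Metric.isOpen_ball.mem_nhds (by simpa using hlt)
    filter_upwards [this] with y hy
    exact cutoff_eq_one (by simpa using (le_of_lt (by simpa using hy)))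
  unfold pd
  rw [this.fderiv_eq]
  simp

/-! ### Square integrable functions -/

/-- The `L²` norm as a real number. -/
def n2 (f : Plane → ℝ) : ℝ := (eLpNorm f 2 volume).toReal

lemma n2_nonneg (f : Plane → ℝ) : 0 ≤ n2 f := ENNReal.toReal_nonneg

lemma n2_eq_norm {f : Plane → ℝ} (hf : MemLp f 2 volume) : n2 f = ‖hf.toLp f‖ := by
  rw [Lp.norm_toLp]; rfl

lemma n2_congr {f g : Plane → ℝ} (h : f =ᵐ[volume] g) : n2 f = n2 g := by
  unfold n2; rw [eLpNorm_congr_ae h]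

lemma integrable_mul_of_memLp {f g : Plane → ℝ} (hf : MemLp f 2 volume) (hg : MemLp g 2 volume) :
    Integrable (fun x => f x * g x) := hf.integrable_mul hg

lemma inner_toLp {f g : Plane → ℝ} (hf : MemLp f 2 volume) (hg : MemLp g 2 volume) :
    inner ℝ (hf.toLp f) (hg.toLp g) = ∫ x, f x * g x := by
  rw [L2.inner_def]
  refine integral_congr_ae ?_
  filter_upwards [hf.coeFn_toLp, hg.coeFn_toLp] with x h1 h2
  rw [h1, h2]; simp [mul_comm]

lemma abs_integral_mul_le {f g : Plane → ℝ} (hf : MemLp f 2 volume) (hg : MemLp g 2 volume) :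
    |∫ x, f x * g x| ≤ n2 f * n2 g := by
  rw [← inner_toLp hf hg, n2_eq_norm hf, n2_eq_norm hg]
  exact abs_real_inner_le_norm _ _

lemma n2_sq {f : Plane → ℝ} (hf : MemLp f 2 volume) : n2 f ^ 2 = ∫ x, f x * f x := by
  rw [← inner_toLp hf hf, n2_eq_norm hf, real_inner_self_eq_norm_sq]

lemma n2_add_le {f g : Plane → ℝ} (hf : MemLp f 2 volume) (hg : MemLp g 2 volume) :
    n2 (fun x => f x + g x) ≤ n2 f + n2 g := by
  unfold n2
  rw [← ENNReal.toReal_add hf.2.ne hg.2.ne]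
  exact ENNReal.toReal_mono (ENNReal.add_ne_top.2 ⟨hf.2.ne, hg.2.ne⟩)
    (eLpNorm_add_le hf.1 hg.1 (by norm_num))

lemma n2_le_of_abs_le {f g : Plane → ℝ} (hg : MemLp g 2 volume) (h : ∀ᵐ x, |f x| ≤ |g x|) :
    n2 f ≤ n2 g :=
  ENNReal.toReal_mono hg.2.ne (eLpNorm_mono_ae h)

lemma n2_const_mul (c : ℝ) (f : Plane → ℝ) : n2 (fun x => c * f x) = |c| * n2 f := by
  unfold n2
  have := eLpNorm_const_smul (p := 2) (μ := (volume : Measure Plane)) c f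
  rw [show (fun x => c * f x) = c • f from rfl, this, ENNReal.toReal_mul]
  simp

/-- Convergence in `L²`. -/
def T2 (F : ℕ → Plane → ℝ) (f : Plane → ℝ) : Prop :=
  (∀ n, MemLp (F n) 2 volume) ∧ MemLp f 2 volume ∧
    Tendsto (fun n => n2 (fun x => F n x - f x)) atTop (𝓝 0)

lemma T2.integral_mul {F : ℕ → Plane → ℝ} {f g : Plane → ℝ} (h : T2 F f) (hg : MemLp g 2 volume) :
    Tendsto (fun n => ∫ x, F n x * g x) atTop (𝓝 (∫ x, f x * g x)) := by
  rw [tendsto_iff_norm_sub_tendsto_zero]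
  refine squeeze_zero (fun _ => norm_nonneg _) (fun n => ?_) (by simpa using h.2.2.mul_const (n2 g))
  rw [← integral_sub (integrable_mul_of_memLp (h.1 n) hg) (integrable_mul_of_memLp h.2.1 hg)]
  simp_rw [← sub_mul]
  exact abs_integral_mul_le ((h.1 n).sub h.2.1) hg

lemma T2.add {F G : ℕ → Plane → ℝ} {f g : Plane → ℝ} (h : T2 F f) (h' : T2 G g) :
    T2 (fun n x => F n x + G n x) (fun x => f x + g x) := by
  refine ⟨fun n => (h.1 n).add (h'.1 n), h.2.1.add h'.2.1, ?_⟩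
  refine squeeze_zero (fun _ => n2_nonneg _) (fun n => ?_) (by simpa using h.2.2.add h'.2.2)
  refine le_trans (le_of_eq ?_) (n2_add_le ((h.1 n).sub h.2.1) ((h'.1 n).sub h'.2.1))
  congr 1; ext x; simp; ring

lemma memLp_bdd_mul {f g : Plane → ℝ} {C : ℝ} (hg : MemLp g 2 volume)
    (hf : AEStronglyMeasurable f volume) (hC : ∀ᵐ x, |f x| ≤ C) :
    MemLp (fun x => f x * g x) 2 volume :=
  hg.of_le_mul (c := C) (hf.mul hg.1) (by
    filter_upwards [hC] with x hx
    rw [norm_mul]; gcongr; exact hx)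

lemma n2_bdd_mul_le {f g : Plane → ℝ} {C : ℝ} (hg : MemLp g 2 volume) (hC0 : 0 ≤ C)
    (hC : ∀ᵐ x, |f x| ≤ C) : n2 (fun x => f x * g x) ≤ C * n2 g := by
  have := n2_const_mul C g
  rw [abs_of_nonneg hC0] at this
  rw [← this]
  refine n2_le_of_abs_le (hg.const_mul C) ?_
  filter_upwards [hC] with x hx
  rw [abs_mul, abs_mul, abs_of_nonneg hC0]; gcongr

lemma T2.bdd_mul {F : ℕ → Plane → ℝ} {f g : Plane → ℝ} {C : ℝ} (h : T2 F f)
    (hg : AEStronglyMeasurable g volume) (hC : ∀ᵐ x, |g x| ≤ C) :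
    T2 (fun n x => g x * F n x) (fun x => g x * f x) := by
  have hC' : ∀ᵐ x, |g x| ≤ |C| := hC.mono fun x hx => hx.trans (le_abs_self C)
  refine ⟨fun n => memLp_bdd_mul (h.1 n) hg hC, memLp_bdd_mul h.2.1 hg hC, ?_⟩
  refine squeeze_zero (fun _ => n2_nonneg _) (fun n => ?_) (by simpa using h.2.2.const_mul |C|)
  simp_rw [← mul_sub]
  exact n2_bdd_mul_le ((h.1 n).sub h.2.1) (abs_nonneg C) hC'

lemma T2.norm {F : ℕ → Plane → ℝ} {f : Plane → ℝ} (h : T2 F f) :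
    Tendsto (fun n => n2 (F n)) atTop (𝓝 (n2 f)) := by
  rw [tendsto_iff_norm_sub_tendsto_zero]
  refine squeeze_zero (fun _ => norm_nonneg _) (fun n => ?_) h.2.2
  have e : n2 (fun x => F n x - f x) = ‖(h.1 n).toLp (F n) - h.2.1.toLp f‖ := by
    rw [← MemLp.toLp_sub, ← n2_eq_norm]; rfl
  rw [e, n2_eq_norm (h.1 n), n2_eq_norm h.2.1]
  exact abs_norm_sub_norm_le _ _

/-- Locally square integrable functions. -/
def L2loc (f : Plane → ℝ) : Prop :=
  AEStronglyMeasurable f volume ∧ LocallyIntegrable (fun x => f x ^ 2) volume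

lemma L2loc.mul_test {f φ : Plane → ℝ} (hf : L2loc f) (hφ : Continuous φ)
    (hc : HasCompactSupport φ) : MemLp (fun x => f x * φ x) 2 volume := by
  refine (memLp_two_iff_integrable_sq (hf.1.mul hφ.aestronglyMeasurable)).2 ?_
  have := hf.2.integrable_smul_left_of_hasCompactSupport (g := fun x => φ x ^ 2) (by fun_prop)
    (hc.comp_left (g := fun y : ℝ => y ^ 2) (by simp))
  refine this.congr (ae_of_all _ fun x => ?_)
  simp only [smul_eq_mul, Pi.mul_apply]; ring

lemma L2loc.locallyIntegrable_mul {f g : Plane → ℝ} (hf : L2loc f) (hg : L2loc g) :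
    LocallyIntegrable (fun x => f x * g x) volume := by
  refine (hf.2.add hg.2).mono (hf.1.mul hg.1) (ae_of_all _ fun x => ?_)
  simp only [Pi.add_apply, Real.norm_eq_abs, abs_mul]
  rw [abs_of_nonneg (by positivity : (0 : ℝ) ≤ f x ^ 2 + g x ^ 2)]
  nlinarith [sq_nonneg (|f x| - |g x|), sq_abs (f x), sq_abs (g x), sq_nonneg (|f x|)]

lemma memLp_l2loc {f : Plane → ℝ} (hf : MemLp f 2 volume) : L2loc f :=
  ⟨hf.1, hf.integrable_sq.locallyIntegrable⟩

lemma continuous_l2loc {f : Plane → ℝ} (hf : Continuous f) : L2loc f :=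
  ⟨hf.aestronglyMeasurable, (hf.pow 2).locallyIntegrable⟩

lemma L2loc.locallyIntegrable {f : Plane → ℝ} (hf : L2loc f) : LocallyIntegrable f volume := by
  simpa using hf.locallyIntegrable_mul (continuous_l2loc (f := fun _ => 1) continuous_const)

lemma L2loc.bdd_mul {f g : Plane → ℝ} {C : ℝ} (hg : L2loc g)
    (hf : AEStronglyMeasurable f volume) (hC : ∀ᵐ x, |f x| ≤ C) : L2loc (fun x => f x * g x) := by
  refine ⟨hf.mul hg.1, (hg.2.smul (C ^ 2)).mono ((hf.mul hg.1).pow 2) ?_⟩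
  filter_upwards [hC] with x hx
  simp only [Pi.smul_apply, smul_eq_mul, Real.norm_eq_abs, mul_pow]
  rw [abs_of_nonneg (by positivity), abs_of_nonneg (by positivity), ← sq_abs (f x)]
  gcongr

lemma L2loc.add {f g : Plane → ℝ} (hf : L2loc f) (hg : L2loc g) : L2loc (fun x => f x + g x) := by
  refine ⟨hf.1.add hg.1, ?_⟩
  refine ((hf.2.add hg.2).smul (2 : ℝ)).mono ((hf.1.add hg.1).pow 2) (ae_of_all _ fun x => ?_)
  simp only [Pi.smul_apply, Pi.add_apply, smul_eq_mul, Real.norm_eq_abs]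
  rw [abs_of_nonneg (by positivity), abs_of_nonneg (by positivity)]
  nlinarith [sq_nonneg (f x - g x)]

lemma L2loc.neg {f : Plane → ℝ} (hf : L2loc f) : L2loc (fun x => - f x) :=
  ⟨hf.1.neg, by simpa using hf.2⟩

lemma L2loc.sub {f g : Plane → ℝ} (hf : L2loc f) (hg : L2loc g) : L2loc (fun x => f x - g x) := by
  simpa [sub_eq_add_neg] using hf.add hg.neg

lemma bdd_l2loc {f : Plane → ℝ} {C : ℝ} (hf : AEStronglyMeasurable f volume)
    (hC : ∀ᵐ x, |f x| ≤ C) : L2loc f := by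
  simpa using (continuous_l2loc (f := fun _ => 1) continuous_const).bdd_mul hf hC

lemma L2loc.congr {f g : Plane → ℝ} (hf : L2loc f) (h : f =ᵐ[volume] g) : L2loc g :=
  ⟨hf.1.congr h, hf.2.congr (h.mono fun x hx => by simp [hx])⟩

lemma l2loc_of_memLp {f : Plane → ℝ} {q : ℝ≥0∞} (hq : 2 ≤ q) (hf : MemLp f q volume) : L2loc f := by
  refine ⟨hf.1, fun x => ?_⟩
  obtain ⟨K, hK, hx⟩ := exists_compact_mem_nhds x
  refine ⟨K, hx, ?_⟩
  have : IsFiniteMeasure (volume.restrict K) := ⟨by simpa using hK.measure_lt_top⟩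
  exact ((hf.restrict K).mono_exponent hq).integrable_sq

lemma integrable_mul_test {f φ : Plane → ℝ} (hf : LocallyIntegrable f volume) (hφ : IsTest φ) :
    Integrable (fun x => f x * φ x) := by
  simpa [mul_comm] using
    hf.integrable_smul_left_of_hasCompactSupport hφ.continuous hφ.2

/-! ### Mollification -/

/-- The standard mollifiers. -/
def eta (n : ℕ) (x : Plane) : ℝ :=
  ((n : ℝ) + 1) ^ 2 * baseBump.normed volume (((n : ℝ) + 1) • x)

lemma normed_isTest : IsTest (baseBump.normed volume) :=
  ⟨baseBump.contDiff_normed, baseBump.hasCompactSupport_normed⟩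

lemma eta_isTest (n : ℕ) : IsTest (eta n) :=
  (normed_isTest.comp_smul (by positivity)).smooth_mul contDiff_const

lemma eta_nonneg (n : ℕ) (x : Plane) : 0 ≤ eta n x :=
  mul_nonneg (by positivity) (baseBump.nonneg_normed _)

lemma finrank_plane : Module.finrank ℝ Plane = 2 := by simp

lemma integral_scale (f : Plane → ℝ) (n : ℕ) :
    ((n : ℝ) + 1) ^ 2 * ∫ x, f (((n : ℝ) + 1) • x) = ∫ x, f x := by
  have hn : (0 : ℝ) < n + 1 := by positivity
  rw [Measure.integral_comp_smul_of_nonneg volume f _ (hR := hn.le), finrank_plane, smul_eq_mul,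
    ← mul_assoc, mul_inv_cancel₀ (by positivity), one_mul]

lemma integral_eta (n : ℕ) : ∫ x, eta n x = 1 := by
  unfold eta
  rw [integral_const_mul, integral_scale, baseBump.integral_normed]

lemma norm_le_of_eta_ne_zero {n : ℕ} {x : Plane} (h : eta n x ≠ 0) : ‖x‖ ≤ 2 / (n + 1) := by
  have hn : (0 : ℝ) < n + 1 := by positivity
  have h1 : baseBump.normed volume (((n : ℝ) + 1) • x) ≠ 0 := right_ne_zero_of_mul h
  have h2 : ((n : ℝ) + 1) • x ∈ Function.support (baseBump.normed volume) := h1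
  rw [baseBump.support_normed_eq] at h2
  simp only [baseBump, Metric.mem_ball, dist_zero_right, norm_smul, Real.norm_of_nonneg hn.le] at h2
  rw [le_div_iff₀ hn]; linarith

/-- Mollification. -/
def moll (n : ℕ) (f : Plane → ℝ) (x : Plane) : ℝ := ∫ t, eta n (x - t) * f t

lemma conv_eq (k f : Plane → ℝ) (x : Plane) :
    (k ⋆[ContinuousLinearMap.lsmul ℝ ℝ, volume] f) x = ∫ t, k (x - t) * f t := by
  rw [convolution_eq_swap]; rfl

lemma conv_eq' (k f : Plane → ℝ) (x : Plane) :
    ∫ t, k (x - t) * f t = ∫ t, k t * f (x - t) := by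
  rw [← conv_eq]; rfl

lemma contDiff_conv {k f : Plane → ℝ} (hk : IsTest k) (hf : LocallyIntegrable f volume) :
    ContDiff ℝ ((⊤ : ℕ∞) : WithTop ℕ∞) (fun x => ∫ t, k (x - t) * f t) := by
  have := hk.2.contDiff_convolution_left (ContinuousLinearMap.lsmul ℝ ℝ) (n := ⊤)
    hk.1 hf
  have e : (fun x => ∫ t, k (x - t) * f t) =
      (k ⋆[ContinuousLinearMap.lsmul ℝ ℝ, volume] f) := by
    ext x; rw [conv_eq]
  rw [e]; exact this

lemma isTest_comp_sub {k : Plane → ℝ} (hk : IsTest k) (x : Plane) : IsTest (fun t => k (x - t)) :=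
  ⟨hk.1.comp (contDiff_const.sub contDiff_id),
    hk.2.comp_homeomorph (Homeomorph.subLeft x)⟩

lemma pd_comp_sub {k : Plane → ℝ} (hk : Differentiable ℝ k) (i : Fin 2) (x t : Plane) :
    pd i (fun s => k (x - s)) t = - pd i k (x - t) := by
  unfold pd
  have h1 : HasFDerivAt (fun s : Plane => x - s) (-(ContinuousLinearMap.id ℝ Plane)) t :=
    (hasFDerivAt_id t).const_sub x
  have h2 := (hk (x - t)).hasFDerivAt.comp t h1
  rw [show (fun s => k (x - s)) = k ∘ (fun s : Plane => x - s) from rfl, h2.fderiv]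
  simp

lemma pd_conv {k f : Plane → ℝ} (hk : IsTest k) (hf : LocallyIntegrable f volume) (i : Fin 2)
    (x : Plane) : pd i (fun x => ∫ t, k (x - t) * f t) x = ∫ t, pd i k (x - t) * f t := by
  have h := hk.2.hasFDerivAt_convolution_left (𝕜 := ℝ) (ContinuousLinearMap.lsmul ℝ ℝ)
    (μ := (volume : Measure Plane)) (hk.1.of_le (by simp)) hf x
  have e : (fun x => ∫ t, k (x - t) * f t) =
      (k ⋆[ContinuousLinearMap.lsmul ℝ ℝ, volume] f) := by
    ext x; rw [conv_eq]
  unfold pd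
  rw [e, h.fderiv, convolution_eq_swap, ContinuousLinearMap.integral_apply]
  · rfl
  · have hc : HasCompactSupport (fun t => fderiv ℝ k (x - t)) :=
      (hk.2.fderiv (𝕜 := ℝ)).comp_homeomorph (Homeomorph.subLeft x)
    have hcont : Continuous (fun t => fderiv ℝ k (x - t)) :=
      (hk.1.continuous_fderiv (by simp)).comp (continuous_const.sub continuous_id)
    have := hf.integrable_smul_right_of_hasCompactSupport hcont hc
    refine this.congr (ae_of_all _ fun t => ?_)
    ext v; simp [mul_comm]

lemma moll_contDiff {f : Plane → ℝ} (hf : LocallyIntegrable f volume) (n : ℕ) :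
    ContDiff ℝ ((⊤ : ℕ∞) : WithTop ℕ∞) (moll n f) := contDiff_conv (eta_isTest n) hf

lemma pd_moll {f : Plane → ℝ} (hf : LocallyIntegrable f volume) (n : ℕ) (i : Fin 2) (x : Plane) :
    pd i (moll n f) x = ∫ t, pd i (eta n) (x - t) * f t := pd_conv (eta_isTest n) hf i x

lemma HasWeakPartial.pd_moll {f g : Plane → ℝ} {i : Fin 2} (h : HasWeakPartial i f g) (n : ℕ)
    (x : Plane) : pd i (moll n f) x = moll n g x := by
  rw [OddFluid.pd_moll h.1]
  have := h.2.2 _ (isTest_comp_sub (eta_isTest n) x)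
  simp_rw [pd_comp_sub (eta_isTest n).differentiable] at this
  unfold moll
  simp only [mul_neg, integral_neg, neg_inj] at this
  simp_rw [mul_comm (pd i (eta n) _), this, mul_comm]

lemma memLp_comp_sub {f : Plane → ℝ} (hf : MemLp f 2 volume) (y : Plane) :
    MemLp (fun x => f (x - y)) 2 volume :=
  hf.comp_measurePreserving (measurePreserving_sub_right volume y)

/-- Translations form a continuous family of measure preserving maps, and composition with such a
family is continuous in L². -/
lemma tendsto_translate {f : Plane → ℝ} (hf : MemLp f 2 volume) :
    Tendsto (fun y => n2 (fun x => f (x - y) - f x)) (𝓝 0) (𝓝 0) := by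
  let g : C(Plane, C(Plane, Plane)) := ContinuousMap.curry ⟨fun p => p.2 - p.1, by fun_prop⟩
  have hg : Tendsto (fun y => g y) (𝓝 0) (𝓝 (g 0)) := g.continuous.tendsto 0
  have hm : ∀ y, MeasurePreserving (g y) (volume : Measure Plane) volume :=
    fun y => measurePreserving_sub_right volume y
  have h := (tendsto_const_nhds (x := hf.toLp f)).compMeasurePreservingLp hg hm (hm 0) (by norm_num)
  rw [tendsto_iff_norm_sub_tendsto_zero] at h
  refine h.congr fun y => ?_
  rw [Lp.toLp_compMeasurePreserving, Lp.toLp_compMeasurePreserving, ← MemLp.toLp_sub, ← n2_eq_norm]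
  congr 1; ext x
  simp [g]

/-- Jensen's inequality for the probability measure with density `eta n`, obtained from the
monotonicity of L^p norms on a probability space. -/
lemma enorm_integral_eta_sq_le (n : ℕ) {g : Plane → ℝ} (hg : AEStronglyMeasurable g volume) :
    ‖∫ y, eta n y * g y‖ₑ ^ 2 ≤ ∫⁻ y, ENNReal.ofReal (eta n y) * ‖g y‖ₑ ^ 2 := by
  set ν := (volume : Measure Plane).withDensity (fun y => ENNReal.ofReal (eta n y))
  have hm : Measurable (fun y => ENNReal.ofReal (eta n y)) :=
    (eta_isTest n).continuous.measurable.ennreal_ofReal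
  have hν : IsProbabilityMeasure ν := by
    constructor
    rw [withDensity_apply _ MeasurableSet.univ, Measure.restrict_univ,
      ← ofReal_integral_eq_lintegral_ofReal (eta_isTest n).integrable
        (ae_of_all _ (eta_nonneg n)), integral_eta]
    simp
  have hac : ν ≪ volume := withDensity_absolutelyContinuous _ _
  have hgν : AEStronglyMeasurable g ν := hg.mono_ac hac
  have h1 : ‖∫ y, eta n y * g y‖ₑ ≤ eLpNorm g 1 ν := by
    refine (enorm_integral_le_lintegral_enorm _).trans ?_
    rw [eLpNorm_one_eq_lintegral_enorm, lintegral_withDensity_eq_lintegral_mul₀ hm.aemeasurable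
      hg.enorm]
    refine lintegral_mono fun y => ?_
    simp only [Pi.mul_apply, enorm_mul]
    gcongr
    rw [Real.enorm_of_nonneg (eta_nonneg n y)]
  have h2 := h1.trans (eLpNorm_le_eLpNorm_of_exponent_le (p := 1) (q := 2) (by norm_num) hgν)
  calc _ ≤ eLpNorm g 2 ν ^ 2 := by gcongr
    _ = ∫⁻ y, ‖g y‖ₑ ^ 2 ∂ν := by
      have := eLpNorm_nnreal_pow_eq_lintegral (f := g) (μ := ν) (p := 2) (by norm_num)
      simpa using this
    _ = _ := by
      rw [lintegral_withDensity_eq_lintegral_mul₀ hm.aemeasurable (hg.enorm.pow_const 2)]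
      rfl

lemma eLpNorm_two_sq (f : Plane → ℝ) : eLpNorm f 2 volume ^ 2 = ∫⁻ x, ‖f x‖ₑ ^ 2 := by
  have := eLpNorm_nnreal_pow_eq_lintegral (f := f) (μ := volume) (p := 2) (by norm_num)
  simpa using this

lemma aestronglyMeasurable_comp_sub {f : Plane → ℝ} (hf : AEStronglyMeasurable f volume) :
    AEStronglyMeasurable (fun z : Plane × Plane => f (z.1 - z.2)) (volume.prod volume) :=
  hf.comp_quasiMeasurePreserving (quasiMeasurePreserving_sub volume volume)

lemma le_of_sq_le_sq {a b : ℝ≥0∞} (h : a ^ 2 ≤ b ^ 2) : a ≤ b :=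
  (ENNReal.pow_le_pow_left_iff two_ne_zero).1 h

/-- Jensen pointwise, then Tonelli and translation invariance. -/
lemma eLpNorm_moll_le {f : Plane → ℝ} (hf : MemLp f 2 volume) (n : ℕ) :
    eLpNorm (moll n f) 2 volume ≤ eLpNorm f 2 volume := by
  refine le_of_sq_le_sq ?_
  rw [eLpNorm_two_sq]
  calc _ ≤ ∫⁻ x, ∫⁻ y, ENNReal.ofReal (eta n y) * ‖f (x - y)‖ₑ ^ 2 := by
        refine lintegral_mono fun x => ?_
        unfold moll
        rw [conv_eq']
        exact enorm_integral_eta_sq_le n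
          (hf.1.comp_measurePreserving (Measure.measurePreserving_sub_left volume x))
    _ = ∫⁻ y, ∫⁻ x, ENNReal.ofReal (eta n y) * ‖f (x - y)‖ₑ ^ 2 := by
        rw [lintegral_lintegral_swap]
        refine AEMeasurable.mul ?_ ((aestronglyMeasurable_comp_sub hf.1).enorm.pow_const 2)
        exact ((eta_isTest n).continuous.measurable.ennreal_ofReal.comp
          measurable_snd).aemeasurable
    _ = ∫⁻ y, ENNReal.ofReal (eta n y) * eLpNorm f 2 volume ^ 2 := by
        refine lintegral_congr fun y => ?_
        rw [lintegral_const_mul' _ _ ENNReal.ofReal_ne_top, eLpNorm_two_sq,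
          lintegral_sub_right_eq_self (fun x => ‖f x‖ₑ ^ 2)]
    _ = eLpNorm f 2 volume ^ 2 := by
        rw [lintegral_mul_const _ ((eta_isTest n).continuous.measurable.ennreal_ofReal),
          ← ofReal_integral_eq_lintegral_ofReal (eta_isTest n).integrable
          (ae_of_all _ (eta_nonneg n)), integral_eta]
        simp

lemma memLp_moll {f : Plane → ℝ} (hf : MemLp f 2 volume) (n : ℕ) : MemLp (moll n f) 2 volume :=
  ⟨(moll_contDiff (memLp_l2loc hf).locallyIntegrable n).continuous.aestronglyMeasurable,
    (eLpNorm_moll_le hf n).trans_lt hf.2⟩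

lemma n2_moll_le {f : Plane → ℝ} (hf : MemLp f 2 volume) (n : ℕ) : n2 (moll n f) ≤ n2 f :=
  ENNReal.toReal_mono hf.2.ne (eLpNorm_moll_le hf n)

/-- The argument of `eLpNorm_moll_le` applied to `f(x - y) - f(x)`; the kernel only sees
translations of length at most `2/(n+1)`. -/
lemma T2_moll {f : Plane → ℝ} (hf : MemLp f 2 volume) : T2 (fun n => moll n f) f := by
  refine ⟨memLp_moll hf, hf, ?_⟩
  have hloc := (memLp_l2loc hf).locallyIntegrable
  rw [Metric.tendsto_atTop]
  intro ε hε
  have h1 := (Metric.tendsto_nhds_nhds.1 (tendsto_translate hf)) (ε / 2) (by positivity)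
  obtain ⟨δ, hδ, h1⟩ := h1
  obtain ⟨N, hN⟩ := exists_nat_gt (2 / δ)
  refine ⟨N, fun n hn => ?_⟩
  have hn' : 2 / ((n : ℝ) + 1) < δ := by
    have : (N : ℝ) ≤ n := by exact_mod_cast hn
    rw [div_lt_iff₀ (by positivity)]
    rw [div_lt_iff₀ hδ] at hN
    nlinarith
  have key : eLpNorm (fun x => moll n f x - f x) 2 volume ^ 2 ≤ ENNReal.ofReal (ε / 2) ^ 2 := by
    rw [eLpNorm_two_sq]
    calc _ ≤ ∫⁻ x, ∫⁻ y, ENNReal.ofReal (eta n y) * ‖f (x - y) - f x‖ₑ ^ 2 := by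
          refine lintegral_mono fun x => ?_
          have hfx := hf.1.comp_measurePreserving (Measure.measurePreserving_sub_left volume x)
          have e : moll n f x - f x = ∫ y, eta n y * (f (x - y) - f x) := by
            have hi : Integrable (fun y => eta n y * f (x - y)) := by
              have := integrable_mul_test hloc (isTest_comp_sub (eta_isTest n) x)
              have h2 := this.comp_sub_left x
              refine h2.congr (ae_of_all _ fun y => ?_)
              simp [mul_comm]
            simp_rw [mul_sub]
            rw [integral_sub hi ((eta_isTest n).integrable.mul_const _), integral_mul_const,
              integral_eta, one_mul]
            unfold moll
            rw [conv_eq']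
          simp only [e]
          exact enorm_integral_eta_sq_le n (hfx.sub aestronglyMeasurable_const)
      _ = ∫⁻ y, ∫⁻ x, ENNReal.ofReal (eta n y) * ‖f (x - y) - f x‖ₑ ^ 2 := by
          rw [lintegral_lintegral_swap]
          refine AEMeasurable.mul ?_
            (((aestronglyMeasurable_comp_sub hf.1).sub hf.1.comp_fst).enorm.pow_const 2)
          exact ((eta_isTest n).continuous.measurable.ennreal_ofReal.comp
            measurable_snd).aemeasurable
      _ ≤ ∫⁻ y, ENNReal.ofReal (eta n y) * ENNReal.ofReal (ε / 2) ^ 2 := by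
          refine lintegral_mono fun y => ?_
          simp only
          rw [lintegral_const_mul' _ _ ENNReal.ofReal_ne_top]
          -- Large translations have weight zero; on the support of the kernel the translation is
          -- shorter than `δ`.
          by_cases hy : eta n y = 0
          · simp [hy]
          gcongr
          rw [← eLpNorm_two_sq (fun x => f (x - y) - f x)]
          gcongr
          have h3 := h1 (x := y) (by
            simpa using (norm_le_of_eta_ne_zero hy).trans_lt hn')
          rw [Real.dist_eq, sub_zero, abs_of_nonneg (n2_nonneg _)] at h3
          exact (ENNReal.le_ofReal_iff_toReal_le ((memLp_comp_sub hf y).sub hf).2.ne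
            (by positivity)).2 h3.le
      _ = _ := by
          rw [lintegral_mul_const _ ((eta_isTest n).continuous.measurable.ennreal_ofReal),
            ← ofReal_integral_eq_lintegral_ofReal (eta_isTest n).integrable
            (ae_of_all _ (eta_nonneg n)), integral_eta]
          simp
  have key2 : eLpNorm (fun x => moll n f x - f x) 2 volume ≤ ENNReal.ofReal (ε / 2) := by
    exact le_of_sq_le_sq key
  rw [Real.dist_eq, sub_zero, abs_of_nonneg (n2_nonneg _)]
  have := ENNReal.toReal_mono ENNReal.ofReal_ne_top key2
  rw [ENNReal.toReal_ofReal (by positivity)] at this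
  exact lt_of_le_of_lt this (by linarith)

/-! ### Algebra of weak derivatives -/

lemma ae_eq_zero_of_test {f : Plane → ℝ} (hf : LocallyIntegrable f volume)
    (h : ∀ φ, IsTest φ → ∫ x, f x * φ x = 0) : f =ᵐ[volume] 0 := by
  refine ae_eq_zero_of_integral_contDiff_smul_eq_zero hf fun g hg hc => ?_
  rw [← h g ⟨hg, hc⟩]
  exact integral_congr_ae (ae_of_all _ fun x => by simp [mul_comm])

lemma ae_eq_of_test {f g : Plane → ℝ} (hf : LocallyIntegrable f volume)
    (hg : LocallyIntegrable g volume)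
    (h : ∀ φ, IsTest φ → ∫ x, f x * φ x = ∫ x, g x * φ x) : f =ᵐ[volume] g := by
  have := ae_eq_zero_of_test (hf.sub hg) fun φ hφ => by
    simp_rw [Pi.sub_apply, sub_mul]
    rw [integral_sub (integrable_mul_test hf hφ) (integrable_mul_test hg hφ), h φ hφ, sub_self]
  filter_upwards [this] with x hx
  simpa [sub_eq_zero] using hx

namespace HasWeakPartial

variable {i : Fin 2} {f f' g g' : Plane → ℝ}

lemma unique (h : HasWeakPartial i f g) (h' : HasWeakPartial i f' g') (he : f =ᵐ[volume] f') :
    g =ᵐ[volume] g' := by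
  refine ae_eq_of_test h.2.1 h'.2.1 fun φ hφ => ?_
  have h1 := h.2.2 φ hφ
  have h2 := h'.2.2 φ hφ
  have h3 : ∫ x, f x * pd i φ x = ∫ x, f' x * pd i φ x :=
    integral_congr_ae (he.mono fun x hx => by simp [hx])
  linarith

lemma congr (h : HasWeakPartial i f g) (he : f =ᵐ[volume] f') (he' : g =ᵐ[volume] g') :
    HasWeakPartial i f' g' := by
  refine ⟨h.1.congr he, h.2.1.congr he', fun φ hφ => ?_⟩
  have h3 : ∫ x, f x * pd i φ x = ∫ x, f' x * pd i φ x :=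
    integral_congr_ae (he.mono fun x hx => by simp [hx])
  have h4 : ∫ x, g x * φ x = ∫ x, g' x * φ x :=
    integral_congr_ae (he'.mono fun x hx => by simp [hx])
  rw [← h3, ← h4, h.2.2 φ hφ]

lemma add (h : HasWeakPartial i f g) (h' : HasWeakPartial i f' g') :
    HasWeakPartial i (fun x => f x + f' x) (fun x => g x + g' x) := by
  refine ⟨h.1.add h'.1, h.2.1.add h'.2.1, fun φ hφ => ?_⟩
  simp_rw [add_mul]
  rw [integral_add (integrable_mul_test h.1 (hφ.pd i)) (integrable_mul_test h'.1 (hφ.pd i)),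
    integral_add (integrable_mul_test h.2.1 hφ) (integrable_mul_test h'.2.1 hφ), h.2.2 φ hφ,
    h'.2.2 φ hφ]
  ring

lemma const_mul (h : HasWeakPartial i f g) (c : ℝ) :
    HasWeakPartial i (fun x => c * f x) (fun x => c * g x) := by
  refine ⟨h.1.smul c, h.2.1.smul c, fun φ hφ => ?_⟩
  simp_rw [mul_assoc]
  rw [integral_const_mul, integral_const_mul, h.2.2 φ hφ]
  ring

lemma neg (h : HasWeakPartial i f g) : HasWeakPartial i (fun x => - f x) (fun x => - g x) := by
  simpa using h.const_mul (-1)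

lemma sub (h : HasWeakPartial i f g) (h' : HasWeakPartial i f' g') :
    HasWeakPartial i (fun x => f x - f' x) (fun x => g x - g' x) := by
  simpa [sub_eq_add_neg] using h.add h'.neg

lemma of_smooth (hf : ContDiff ℝ ((⊤ : ℕ∞) : WithTop ℕ∞) f) : HasWeakPartial i f (pd i f) :=
  ⟨hf.continuous.locallyIntegrable, (contDiff_pd hf i).continuous.locallyIntegrable,
    fun _ hφ => integral_mul_pd hf hφ i⟩

end HasWeakPartial

/-- Mixed weak derivatives commute. -/
lemma weak_mixed {f p q r s : Plane → ℝ} (h0 : HasWeakPartial 0 f p) (h1 : HasWeakPartial 1 f q)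
    (h01 : HasWeakPartial 1 p r) (h10 : HasWeakPartial 0 q s) : r =ᵐ[volume] s := by
  refine ae_eq_of_test h01.2.1 h10.2.1 fun φ hφ => ?_
  have e1 := h01.2.2 φ hφ
  have e2 := h10.2.2 φ hφ
  have e3 := h0.2.2 _ (hφ.pd 1)
  have e4 := h1.2.2 _ (hφ.pd 0)
  have e5 : ∫ x, f x * pd 0 (pd 1 φ) x = ∫ x, f x * pd 1 (pd 0 φ) x := by
    simp_rw [pd_comm hφ.1 0 1]
  linarith

/-- `f` is locally square integrable, together with its weak gradient `D`. -/
structure H1loc (f : Plane → ℝ) (D : Fin 2 → Plane → ℝ) : Prop where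
  l2 : L2loc f
  dl2 : ∀ i, L2loc (D i)
  weak : ∀ i, HasWeakPartial i f (D i)

/-- `f` is square integrable, together with its weak gradient `D`. -/
structure H1 (f : Plane → ℝ) (D : Fin 2 → Plane → ℝ) : Prop where
  l2 : MemLp f 2 volume
  dl2 : ∀ i, MemLp (D i) 2 volume
  weak : ∀ i, HasWeakPartial i f (D i)

lemma H1.loc {f : Plane → ℝ} {D : Fin 2 → Plane → ℝ} (h : H1 f D) : H1loc f D :=
  ⟨memLp_l2loc h.l2, fun i => memLp_l2loc (h.dl2 i), h.weak⟩

lemma H1loc.add {f g : Plane → ℝ} {D E : Fin 2 → Plane → ℝ} (h : H1loc f D) (h' : H1loc g E) :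
    H1loc (fun x => f x + g x) (fun i x => D i x + E i x) :=
  ⟨h.l2.add h'.l2, fun i => (h.dl2 i).add (h'.dl2 i), fun i => (h.weak i).add (h'.weak i)⟩

lemma H1loc.neg {f : Plane → ℝ} {D : Fin 2 → Plane → ℝ} (h : H1loc f D) :
    H1loc (fun x => - f x) (fun i x => - D i x) :=
  ⟨h.l2.neg, fun i => (h.dl2 i).neg, fun i => (h.weak i).neg⟩

lemma H1loc.sub {f g : Plane → ℝ} {D E : Fin 2 → Plane → ℝ} (h : H1loc f D) (h' : H1loc g E) :
    H1loc (fun x => f x - g x) (fun i x => D i x - E i x) :=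
  ⟨h.l2.sub h'.l2, fun i => (h.dl2 i).sub (h'.dl2 i), fun i => (h.weak i).sub (h'.weak i)⟩

lemma H1loc.congr {f g : Plane → ℝ} {D E : Fin 2 → Plane → ℝ} (h : H1loc f D)
    (e : f =ᵐ[volume] g) (e' : ∀ i, D i =ᵐ[volume] E i) : H1loc g E :=
  ⟨h.l2.congr e, fun i => (h.dl2 i).congr (e' i), fun i => (h.weak i).congr e (e' i)⟩

/-! ### Local convergence of mollifications -/

/-- The kernels all have radius at most 2, so the value at `x` only involves points where the cutoff
is one. -/
lemma moll_congr_cutoff {f : Plane → ℝ} {N : ℕ} {x : Plane} (hx : ‖x‖ + 2 ≤ N + 1) (n : ℕ) :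
    moll n f x = moll n (fun t => cutoff N t * f t) x := by
  unfold moll
  refine integral_congr_ae (ae_of_all _ fun t => ?_)
  by_cases h : eta n (x - t) = 0
  · simp [h]
  have h1 := norm_le_of_eta_ne_zero h
  have h2 : (2 : ℝ) / (n + 1) ≤ 2 := div_le_self (by norm_num) (by linarith [n.cast_nonneg (α := ℝ)])
  have h3 : ‖t‖ ≤ N + 1 := by
    have := norm_sub_norm_le t x
    rw [norm_sub_rev] at this
    linarith
  simp [cutoff_eq_one h3]

/-- On the support of `φ` a locally square integrable function may be replaced by a truncation in
L², to which `T2_moll` applies. -/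
lemma T2_moll_test {f φ : Plane → ℝ} (hf : L2loc f) (hφ : IsTest φ) :
    T2 (fun n x => φ x * moll n f x) (fun x => φ x * f x) := by
  obtain ⟨R, hR⟩ := hφ.2.isCompact.isBounded.exists_norm_le
  obtain ⟨N, hN⟩ := exists_nat_ge (R + 2)
  obtain ⟨C, -, hC⟩ := hφ.exists_bound
  have h0 : MemLp (fun t => cutoff N t * f t) 2 volume := by
    simpa [mul_comm] using hf.mul_test (cutoff_isTest N).continuous (cutoff_isTest N).2
  have h1 := (T2_moll h0).bdd_mul hφ.continuous.aestronglyMeasurable (ae_of_all _ hC)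
  have hx : ∀ x, φ x ≠ 0 → ‖x‖ + 2 ≤ N + 1 := fun x hx => by
    have := hR x (subset_tsupport _ hx); linarith
  have e1 : ∀ n x, φ x * moll n (fun t => cutoff N t * f t) x = φ x * moll n f x := fun n x => by
    by_cases h : φ x = 0
    · rw [h, zero_mul, zero_mul]
    · rw [← moll_congr_cutoff (hx x h)]
  have e2 : ∀ x, φ x * (cutoff N x * f x) = φ x * f x := fun x => by
    by_cases h : φ x = 0
    · rw [h, zero_mul, zero_mul]
    · rw [cutoff_eq_one (by linarith [hx x h]), one_mul]
  simpa only [e1, e2] using h1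

/-- A cutoff equal to one on the support of a test function. -/
lemma exists_cutoff_mul_eq {φ : Plane → ℝ} (hφ : IsTest φ) :
    ∃ N : ℕ, ∀ x, φ x * cutoff N x = φ x := by
  obtain ⟨N, hN⟩ := exists_cutoff_eq_one hφ.2.isCompact
  refine ⟨N, fun x => ?_⟩
  by_cases h : φ x = 0
  · simp [h]
  · rw [(hN N le_rfl x (subset_tsupport _ h)).1, mul_one]

lemma tendsto_moll_pair {f g φ : Plane → ℝ} (hf : L2loc f) (hg : L2loc g) (hφ : IsTest φ) :
    Tendsto (fun n => ∫ x, φ x * moll n f x * g x) atTop (𝓝 (∫ x, φ x * f x * g x)) := by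
  obtain ⟨N, hN⟩ := exists_cutoff_mul_eq hφ
  have h := (T2_moll_test hf hφ).integral_mul (hg.mul_test (cutoff_isTest N).continuous
    (cutoff_isTest N).2)
  have e : ∀ k : Plane → ℝ, (fun x => φ x * k x * (g x * cutoff N x)) = fun x => φ x * k x * g x := by
    intro k; ext x
    rw [show φ x * k x * (g x * cutoff N x) = (φ x * cutoff N x) * k x * g x by ring, hN]
  simpa only [e] using h

lemma integrable_test_pair {f g φ : Plane → ℝ} (hf : L2loc f) (hg : L2loc g) (hφ : IsTest φ) :
    Integrable (fun x => φ x * f x * g x) := by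
  refine (integrable_mul_test (hf.locallyIntegrable_mul hg) hφ).congr (ae_of_all _ fun x => ?_)
  ring

lemma moll_l2loc {f : Plane → ℝ} (hf : L2loc f) (n : ℕ) : L2loc (moll n f) :=
  continuous_l2loc (moll_contDiff hf.locallyIntegrable n).continuous

/-- The product rule. -/
lemma H1loc.mul_weak {f g : Plane → ℝ} {D E : Fin 2 → Plane → ℝ} (hf : H1loc f D)
    (hg : H1loc g E) (i : Fin 2) :
    HasWeakPartial i (fun x => f x * g x) (fun x => f x * E i x + D i x * g x) := by
  refine ⟨hf.l2.locallyIntegrable_mul hg.l2, (hf.l2.locallyIntegrable_mul (hg.dl2 i)).add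
    ((hf.dl2 i).locallyIntegrable_mul hg.l2), fun φ hφ => ?_⟩
  have hsm := fun n => moll_contDiff hf.l2.locallyIntegrable n
  -- Once `f` is mollified, `moll n f * φ` is a test function for the weak derivative of `g`. The
  -- three integrals then converge separately.
  have key : ∀ n, ∫ x, pd i φ x * moll n f x * g x =
      -(∫ x, φ x * moll n f x * E i x) - ∫ x, φ x * moll n (D i) x * g x := by
    intro n
    have ht : IsTest (fun x => moll n f x * φ x) := hφ.smooth_mul (hsm n)
    have h := (hg.weak i).2.2 _ ht
    simp_rw [pd_mul ((hsm n).differentiable (by simp)) hφ.differentiable,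
      (hf.weak i).pd_moll] at h
    have i1 := integrable_test_pair (moll_l2loc hf.l2 n) hg.l2 (hφ.pd i)
    have i2 := integrable_test_pair (moll_l2loc (hf.dl2 i) n) hg.l2 hφ
    have e : ∫ x, g x * (moll n f x * pd i φ x + moll n (D i) x * φ x) =
        (∫ x, pd i φ x * moll n f x * g x) + ∫ x, φ x * moll n (D i) x * g x := by
      rw [← integral_add i1 i2]
      exact integral_congr_ae (ae_of_all _ fun x => by simp only; ring)
    have e2 : ∫ x, E i x * (moll n f x * φ x) = ∫ x, φ x * moll n f x * E i x :=
      integral_congr_ae (ae_of_all _ fun x => by simp only; ring)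
    rw [e, e2] at h
    linarith
  have l1 := tendsto_moll_pair hf.l2 hg.l2 (hφ.pd i)
  have l2 := tendsto_moll_pair hf.l2 (hg.dl2 i) hφ
  have l3 := tendsto_moll_pair (hf.dl2 i) hg.l2 hφ
  have h := tendsto_nhds_unique l1 (((l2.neg).sub l3).congr fun n => (key n).symm)
  have i1 := integrable_test_pair hf.l2 (hg.dl2 i) hφ
  have i2 := integrable_test_pair (hf.dl2 i) hg.l2 hφ
  have e1 : ∫ x, f x * g x * pd i φ x = ∫ x, pd i φ x * f x * g x :=
    integral_congr_ae (ae_of_all _ fun x => by simp only; ring)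
  have e2 : ∫ x, (f x * E i x + D i x * g x) * φ x =
      (∫ x, φ x * f x * E i x) + ∫ x, φ x * D i x * g x := by
    rw [← integral_add i1 i2]
    exact integral_congr_ae (ae_of_all _ fun x => by simp only; ring)
  rw [e1, e2, h]; ring

lemma H1loc.mul {f g : Plane → ℝ} {D E : Fin 2 → Plane → ℝ} (hf : H1loc f D)
    (hg : H1loc g E) (h0 : L2loc (fun x => f x * g x))
    (h1 : ∀ i, L2loc (fun x => f x * E i x + D i x * g x)) :
    H1loc (fun x => f x * g x) (fun i x => f x * E i x + D i x * g x) :=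
  ⟨h0, h1, hf.mul_weak hg⟩

/-- The product rule when one factor is bounded with bounded gradient. -/
lemma H1loc.bdd_mul {f g : Plane → ℝ} {D E : Fin 2 → Plane → ℝ} {C C' : ℝ} (hf : H1loc f D)
    (hg : H1loc g E) (hC : ∀ᵐ x, |f x| ≤ C) (hC' : ∀ i, ∀ᵐ x, |D i x| ≤ C') :
    H1loc (fun x => f x * g x) (fun i x => f x * E i x + D i x * g x) :=
  hf.mul hg (hg.l2.bdd_mul hf.l2.1 hC) fun i =>
    ((hg.dl2 i).bdd_mul hf.l2.1 hC).add (hg.l2.bdd_mul (hf.dl2 i).1 (hC' i))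

lemma IsTest.h1loc {φ : Plane → ℝ} (h : IsTest φ) : H1loc φ (fun i => OddFluid.pd i φ) :=
  ⟨continuous_l2loc h.continuous, fun i => continuous_l2loc (h.pd i).continuous,
    fun _ => HasWeakPartial.of_smooth h.1⟩

/-- `∫ ∂₀f ∂₁(ψk) = ∫ ∂₁f ∂₀(ψk)`. -/
lemma integral_cross_local {f k ψ : Plane → ℝ} {D E : Fin 2 → Plane → ℝ} (hf : H1loc f D)
    (hk : H1loc k E) (hψ : IsTest ψ) :
    ∫ x, D 0 x * (ψ x * E 1 x + pd 1 ψ x * k x) = ∫ x, D 1 x * (ψ x * E 0 x + pd 0 ψ x * k x) := by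
  have hsm := fun n => moll_contDiff hk.l2.locallyIntegrable n
  have split : ∀ i j (K L : Plane → ℝ), L2loc K → L2loc L →
      ∫ x, D j x * (ψ x * L x + pd i ψ x * K x) =
      (∫ x, ψ x * L x * D j x) + ∫ x, pd i ψ x * K x * D j x := by
    intro i j K L hK hL
    rw [← integral_add (integrable_test_pair hL (hf.dl2 j) hψ)
      (integrable_test_pair hK (hf.dl2 j) (hψ.pd i))]
    exact integral_congr_ae (ae_of_all _ fun x => by simp only; ring)
  have lim : ∀ i j, Tendsto (fun n => ∫ x, D j x * (ψ x * moll n (E i) x + pd i ψ x * moll n k x))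
      atTop (𝓝 (∫ x, D j x * (ψ x * E i x + pd i ψ x * k x))) := by
    intro i j
    rw [split i j _ _ hk.l2 (hk.dl2 i)]
    simp_rw [fun n => split i j _ _ (moll_l2loc hk.l2 n) (moll_l2loc (hk.dl2 i) n)]
    exact (tendsto_moll_pair (hk.dl2 i) (hf.dl2 j) hψ).add
      (tendsto_moll_pair hk.l2 (hf.dl2 j) (hψ.pd i))
  -- With `k` mollified, `ψ * moll n k` is a test function, and both sides are `f` tested with its
  -- mixed second derivative.
  have key : ∀ n, ∫ x, D 0 x * (ψ x * moll n (E 1) x + pd 1 ψ x * moll n k x) =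
      ∫ x, D 1 x * (ψ x * moll n (E 0) x + pd 0 ψ x * moll n k x) := by
    intro n
    have ht : IsTest (fun x => ψ x * moll n k x) := by
      simpa only [mul_comm] using hψ.smooth_mul (hsm n)
    have e : ∀ i x, ψ x * moll n (E i) x + pd i ψ x * moll n k x =
        pd i (fun x => ψ x * moll n k x) x := fun i x => by
      rw [pd_mul hψ.differentiable ((hsm n).differentiable (by simp)), (hk.weak i).pd_moll]
    simp_rw [e]
    have e3 := (hf.weak 0).2.2 _ (ht.pd 1)
    have e4 := (hf.weak 1).2.2 _ (ht.pd 0)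
    have e5 : ∫ x, f x * pd 0 (pd 1 (fun x => ψ x * moll n k x)) x =
        ∫ x, f x * pd 1 (pd 0 (fun x => ψ x * moll n k x)) x := by
      simp_rw [pd_comm ht.1 0 1]
    linarith
  exact tendsto_nhds_unique (lim 1 0) ((lim 0 1).congr fun n => (key n).symm)

/-! ### The inverse of a function bounded from below -/

/-- The kernel is nonnegative of mass one. The lower bound makes the reciprocals of the
mollifications smooth. -/
lemma le_moll {r : Plane → ℝ} {a : ℝ} (hr : LocallyIntegrable r volume) (h : ∀ᵐ x, a ≤ r x)
    (n : ℕ) (x : Plane) : a ≤ moll n r x := by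
  have e : a = ∫ t, eta n (x - t) * a := by
    rw [integral_mul_const, integral_sub_left_eq_self (eta n), integral_eta, one_mul]
  rw [e]
  refine integral_mono_ae ((isTest_comp_sub (eta_isTest n) x).integrable.mul_const a) ?_ ?_
  · simpa [mul_comm] using integrable_mul_test hr (isTest_comp_sub (eta_isTest n) x)
  · filter_upwards [h] with t ht
    exact mul_le_mul_of_nonneg_left ht (eta_nonneg _ _)

lemma abs_inv_sub_inv_le {a s t : ℝ} (ha : 0 < a) (hs : a ≤ s) (ht : a ≤ t) :
    |s⁻¹ - t⁻¹| ≤ a⁻¹ ^ 2 * |s - t| := by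
  have hs0 : 0 < s := ha.trans_le hs
  have ht0 : 0 < t := ha.trans_le ht
  rw [show s⁻¹ - t⁻¹ = (s⁻¹ * t⁻¹) * (t - s) by field_simp, abs_mul, abs_sub_comm t s,
    abs_of_pos (by positivity), pow_two]
  gcongr

/-- The classical formula holds for the mollifications, which stay above `a`. Both sides pass to the
limit because inversion is Lipschitz on `[a, ∞)`. -/
lemma H1loc.inv {r : Plane → ℝ} {p : Fin 2 → Plane → ℝ} {a : ℝ} (h : H1loc r p) (ha : 0 < a)
    (hr : ∀ᵐ x, a ≤ r x) : H1loc (fun x => (r x)⁻¹) (fun i x => -((r x)⁻¹ ^ 2 * p i x)) := by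
  have hm : AEStronglyMeasurable (fun x => (r x)⁻¹) volume :=
    h.l2.1.aemeasurable.inv.aestronglyMeasurable
  have hb : ∀ᵐ x, |(r x)⁻¹| ≤ a⁻¹ := by
    filter_upwards [hr] with x hx
    rw [abs_of_pos (inv_pos.2 (ha.trans_le hx))]
    exact inv_anti₀ ha hx
  have hb2 : ∀ᵐ x, |(r x)⁻¹ ^ 2| ≤ a⁻¹ ^ 2 := by
    filter_upwards [hb] with x hx
    rw [abs_pow]; gcongr
  have hm2 : AEStronglyMeasurable (fun x => (r x)⁻¹ ^ 2) volume := hm.pow 2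
  have hL := bdd_l2loc hm hb
  have hL2 : ∀ i, L2loc (fun x => -((r x)⁻¹ ^ 2 * p i x)) := fun i =>
    ((h.dl2 i).bdd_mul hm2 hb2).neg
  refine ⟨hL, hL2, fun i => ⟨hL.locallyIntegrable, (hL2 i).locallyIntegrable, fun φ hφ => ?_⟩⟩
  have hloc := h.l2.locallyIntegrable
  have hsm := fun n => moll_contDiff hloc n
  have hge := fun n x => le_moll hloc hr n x
  have hne := fun n x => (ha.trans_le (hge n x)).ne'
  have hsi : ∀ n, ContDiff ℝ ((⊤ : ℕ∞) : WithTop ℕ∞) (fun x => (moll n r x)⁻¹) :=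
    fun n => (hsm n).inv (hne n)
  have hpd : ∀ n x, pd i (fun x => (moll n r x)⁻¹) x = -((moll n r x)⁻¹ ^ 2 * moll n (p i) x) := by
    intro n x
    rw [← (h.weak i).pd_moll]
    unfold pd
    have h1 := ((hsm n).differentiable (by simp) x).hasFDerivAt
    have h2 := (hasDerivAt_inv (hne n x)).comp_hasFDerivAt x h1
    rw [show (fun x => (moll n r x)⁻¹) = Inv.inv ∘ moll n r from rfl, h2.fderiv]
    simp
  have key : ∀ n, ∫ x, (moll n r x)⁻¹ * pd i φ x = ∫ x, (moll n r x)⁻¹ ^ 2 * moll n (p i) x * φ x := by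
    intro n
    rw [integral_mul_pd (hsi n) hφ, ← integral_neg]
    refine integral_congr_ae (ae_of_all _ fun x => ?_)
    simp only [hpd]; ring
  have hbn : ∀ n x, |(moll n r x)⁻¹| ≤ a⁻¹ := fun n x => by
    rw [abs_of_pos (inv_pos.2 (ha.trans_le (hge n x)))]
    exact inv_anti₀ ha (hge n x)
  -- convergence of the inverses
  have conv : ∀ ψ, IsTest ψ → T2 (fun n x => ψ x * (moll n r x)⁻¹) (fun x => ψ x * (r x)⁻¹) := by
    intro ψ hψ
    have mem : ∀ s : Plane → ℝ, L2loc s → MemLp (fun x => ψ x * s x) 2 volume := fun s hs => by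
      simpa only [mul_comm] using hs.mul_test hψ.continuous hψ.2
    have hr1 := T2_moll_test h.l2 hψ
    refine ⟨fun n => mem _ (continuous_l2loc (hsi n).continuous), mem _ hL, ?_⟩
    refine squeeze_zero (fun _ => n2_nonneg _) (fun n => ?_) (by simpa using hr1.2.2.const_mul (a⁻¹ ^ 2))
    have h3 := n2_const_mul (a⁻¹ ^ 2) (fun x => ψ x * moll n r x - ψ x * r x)
    rw [abs_of_nonneg (by positivity)] at h3
    rw [← h3]
    refine n2_le_of_abs_le (((hr1.1 n).sub hr1.2.1).const_mul _) ?_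
    filter_upwards [hr] with x hx
    rw [← mul_sub, ← mul_sub, abs_mul, abs_mul, abs_mul, abs_of_nonneg (by positivity : 0 ≤ a⁻¹ ^ 2)]
    have := abs_inv_sub_inv_le ha (hge n x) hx
    nlinarith [abs_nonneg (ψ x)]
  obtain ⟨N, hN⟩ := exists_cutoff_mul_eq hφ
  obtain ⟨N', hN'⟩ := exists_cutoff_mul_eq (hφ.pd i)
  have l1 : Tendsto (fun n => ∫ x, (moll n r x)⁻¹ * pd i φ x) atTop
      (𝓝 (∫ x, (r x)⁻¹ * pd i φ x)) := by
    have := (conv _ (hφ.pd i)).integral_mul ((cutoff_isTest N').memLp 2)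
    have e : ∀ s : Plane → ℝ, ∫ x, pd i φ x * s x * cutoff N' x = ∫ x, s x * pd i φ x := fun s =>
      integral_congr_ae (ae_of_all _ fun x => by
        simp only
        rw [show pd i φ x * s x * cutoff N' x = (pd i φ x * cutoff N' x) * s x by ring, hN', mul_comm])
    simpa only [e] using this
  have l2 : Tendsto (fun n => ∫ x, (moll n r x)⁻¹ ^ 2 * moll n (p i) x * φ x) atTop
      (𝓝 (∫ x, (r x)⁻¹ ^ 2 * p i x * φ x)) := by
    have hp1 := T2_moll_test (h.dl2 i) hφ
    have hc := conv _ (cutoff_isTest N)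
    rw [tendsto_iff_norm_sub_tendsto_zero]
    have hmp : MemLp (fun x => φ x * p i x) 2 volume := hp1.2.1
    have hz : Tendsto (fun n => a⁻¹ ^ 2 * n2 (fun x => φ x * moll n (p i) x - φ x * p i x) *
        n2 (cutoff N) + 2 * a⁻¹ * n2 (fun x => cutoff N x * (moll n r x)⁻¹ - cutoff N x * (r x)⁻¹) *
        n2 (fun x => φ x * p i x)) atTop (𝓝 0) := by
      have := ((hp1.2.2.const_mul (a⁻¹ ^ 2)).mul_const (n2 (cutoff N))).add
        ((hc.2.2.const_mul (2 * a⁻¹)).mul_const (n2 (fun x => φ x * p i x)))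
      simpa using this
    refine squeeze_zero (fun _ => norm_nonneg _) (fun n => ?_) hz
    have hbd2 : ∀ᵐ x, |(moll n r x)⁻¹ ^ 2| ≤ a⁻¹ ^ 2 := ae_of_all _ fun x => by
      rw [abs_pow]; have := hbn n x; gcongr
    have hbd3 : ∀ᵐ x, |(moll n r x)⁻¹ + (r x)⁻¹| ≤ 2 * a⁻¹ := by
      filter_upwards [hb] with x hx
      refine (abs_add_le _ _).trans ?_
      linarith [hbn n x]
    have hmn : AEStronglyMeasurable (fun x => (moll n r x)⁻¹) volume :=
      (hsi n).continuous.aestronglyMeasurable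
    have hmn2 : AEStronglyMeasurable (fun x => (moll n r x)⁻¹ ^ 2) volume := hmn.pow 2
    have m1 : MemLp (fun x => (moll n r x)⁻¹ ^ 2 * (φ x * moll n (p i) x - φ x * p i x)) 2 volume :=
      memLp_bdd_mul ((hp1.1 n).sub hp1.2.1) hmn2 hbd2
    have m2 : MemLp (fun x => ((moll n r x)⁻¹ + (r x)⁻¹) *
        (cutoff N x * (moll n r x)⁻¹ - cutoff N x * (r x)⁻¹)) 2 volume :=
      memLp_bdd_mul ((hc.1 n).sub hc.2.1) (hmn.add hm) hbd3
    -- The two factors are exchanged one at a time, the change of the squared reciprocal being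
    -- factored as a difference of squares. The cutoff is one on the support of `φ` and is inserted
    -- to keep every factor in L².
    have e : (∫ x, (moll n r x)⁻¹ ^ 2 * moll n (p i) x * φ x) - ∫ x, (r x)⁻¹ ^ 2 * p i x * φ x =
        (∫ x, ((moll n r x)⁻¹ ^ 2 * (φ x * moll n (p i) x - φ x * p i x)) * cutoff N x) +
        ∫ x, (((moll n r x)⁻¹ + (r x)⁻¹) *
        (cutoff N x * (moll n r x)⁻¹ - cutoff N x * (r x)⁻¹)) * (φ x * p i x) := by
      have i1 := integrable_mul_test ((moll_l2loc (h.dl2 i) n).bdd_mul hmn2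
        hbd2).locallyIntegrable hφ
      have i2 := integrable_mul_test ((h.dl2 i).bdd_mul hm2 hb2).locallyIntegrable hφ
      rw [← integral_sub i1 i2, ← integral_add
        (integrable_mul_of_memLp m1 ((cutoff_isTest N).memLp 2)) (integrable_mul_of_memLp m2 hmp)]
      refine integral_congr_ae (ae_of_all _ fun x => ?_)
      have := hN x
      simp only
      linear_combination (-(moll n r x)⁻¹ ^ 2 * (moll n (p i) x - p i x) -
        ((moll n r x)⁻¹ + (r x)⁻¹) * ((moll n r x)⁻¹ - (r x)⁻¹) * p i x) * this
    rw [e]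
    refine (norm_add_le _ _).trans (add_le_add ?_ ?_)
    · refine (abs_integral_mul_le m1 ((cutoff_isTest N).memLp 2)).trans ?_
      gcongr
      · exact n2_nonneg _
      · exact n2_bdd_mul_le ((hp1.1 n).sub hp1.2.1) (by positivity) hbd2
    · refine (abs_integral_mul_le m2 hmp).trans ?_
      gcongr
      · exact n2_nonneg _
      · exact n2_bdd_mul_le ((hc.1 n).sub hc.2.1) (by positivity) hbd3
  have := tendsto_nhds_unique l1 (l2.congr fun n => (key n).symm)
  rw [this, ← integral_neg]
  refine integral_congr_ae (ae_of_all _ fun x => ?_)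
  simp only; ring

/-! ### Density of test functions in `H¹` -/

lemma T2_cutoff {f : Plane → ℝ} (hf : MemLp f 2 volume) : T2 (fun n x => cutoff n x * f x) f := by
  have hm : ∀ n, MemLp (fun x => cutoff n x * f x) 2 volume := fun n =>
    memLp_bdd_mul hf (cutoff_isTest n).continuous.aestronglyMeasurable (ae_of_all _ (abs_cutoff_le n))
  refine ⟨hm, hf, ?_⟩
  have key : Tendsto (fun n => n2 (fun x => cutoff n x * f x - f x) ^ 2) atTop (𝓝 0) := by
    have hs : ∀ n, MemLp (fun x => cutoff n x * f x - f x) 2 volume := fun n => (hm n).sub hf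
    simp_rw [fun n => n2_sq (hs n)]
    have : Tendsto (fun n => ∫ x, (cutoff n x * f x - f x) * (cutoff n x * f x - f x)) atTop
        (𝓝 (∫ _ : Plane, (0 : ℝ))) := by
      refine tendsto_integral_of_dominated_convergence (fun x => f x * f x) (fun n => ?_)
        (integrable_mul_of_memLp hf hf) (fun n => ae_of_all _ fun x => ?_) (ae_of_all _ fun x => ?_)
      · exact ((hm n).sub hf).1.mul ((hm n).sub hf).1
      · rw [show (cutoff n x * f x - f x) * (cutoff n x * f x - f x) =
          (1 - cutoff n x) ^ 2 * (f x * f x) by ring, norm_mul, Real.norm_of_nonneg (mul_self_nonneg _),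
          Real.norm_of_nonneg (sq_nonneg _)]
        have h1 := cutoff_nonneg n x
        have h2 := cutoff_le_one n x
        nlinarith [mul_self_nonneg (f x), mul_nonneg h1 (sub_nonneg.2 h2)]
      · have h := ((tendsto_cutoff x).mul_const (f x)).sub_const (f x)
        simpa using h.mul h
    simpa using this
  have := key.sqrt
  simpa [Real.sqrt_sq (n2_nonneg _)] using this

lemma T2.cutoff {F : ℕ → Plane → ℝ} {f : Plane → ℝ} (h : T2 F f) :
    T2 (fun n x => cutoff n x * F n x) f := by
  have hm : ∀ n, MemLp (fun x => OddFluid.cutoff n x * F n x) 2 volume := fun n =>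
    memLp_bdd_mul (h.1 n) (cutoff_isTest n).continuous.aestronglyMeasurable
      (ae_of_all _ (abs_cutoff_le n))
  have hc := T2_cutoff h.2.1
  refine ⟨hm, h.2.1, ?_⟩
  refine squeeze_zero (fun _ => n2_nonneg _) (fun n => ?_) (by simpa using h.2.2.add hc.2.2)
  have e : (fun x => OddFluid.cutoff n x * F n x - f x) = fun x =>
      OddFluid.cutoff n x * (F n x - f x) + (OddFluid.cutoff n x * f x - f x) := by ext x; ring
  rw [e]
  refine (n2_add_le (memLp_bdd_mul ((h.1 n).sub h.2.1)
    (cutoff_isTest n).continuous.aestronglyMeasurable (ae_of_all _ (abs_cutoff_le n)))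
    ((hc.1 n).sub hc.2.1)).trans ?_
  exact add_le_add ((n2_bdd_mul_le ((h.1 n).sub h.2.1) zero_le_one
    (ae_of_all _ (abs_cutoff_le n))).trans_eq (one_mul _)) le_rfl

/-- Truncated mollifications: the derivative falling on the cutoff is `O(1/n)` against the uniformly
bounded L² norm of the mollification. -/
lemma H1.exists_test_approx {f : Plane → ℝ} {D : Fin 2 → Plane → ℝ} (h : H1 f D) :
    ∃ F : ℕ → Plane → ℝ, (∀ n, IsTest (F n)) ∧ T2 F f ∧ ∀ i, T2 (fun n => pd i (F n)) (D i) := by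
  have hloc := (memLp_l2loc h.l2).locallyIntegrable
  have hsm := fun n => moll_contDiff hloc n
  have ht : ∀ n, IsTest (fun x => cutoff n x * moll n f x) := fun n => by
    simpa only [mul_comm] using (cutoff_isTest n).smooth_mul (hsm n)
  refine ⟨fun n x => cutoff n x * moll n f x, ht, (T2_moll h.l2).cutoff, fun i => ?_⟩
  have e : (fun n => pd i (fun x => cutoff n x * moll n f x)) = fun n x =>
      cutoff n x * moll n (D i) x + pd i (cutoff n) x * moll n f x := by
    ext n x
    rw [pd_mul (cutoff_isTest n).differentiable ((hsm n).differentiable (by simp)),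
      (h.weak i).pd_moll]
  rw [e]
  obtain ⟨C, hC0, hC⟩ := exists_pd_cutoff_bound
  have h0 : T2 (fun n x => pd i (cutoff n) x * moll n f x) (fun _ => 0) := by
    refine ⟨fun n => memLp_bdd_mul (memLp_moll h.l2 n)
      ((cutoff_isTest n).pd i).continuous.aestronglyMeasurable (ae_of_all _ (hC n i)), by simp, ?_⟩
    have hz : Tendsto (fun n : ℕ => C / ((n : ℝ) + 1) * n2 f) atTop (𝓝 0) := by
      have := (tendsto_one_div_add_atTop_nhds_zero_nat (𝕜 := ℝ)).const_mul C
      simpa [div_eq_mul_inv] using this.mul_const (n2 f)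
    refine squeeze_zero (fun _ => n2_nonneg _) (fun n => ?_) hz
    simp only [sub_zero]
    refine (n2_bdd_mul_le (memLp_moll h.l2 n) (by positivity) (ae_of_all _ (hC n i))).trans ?_
    gcongr
    exact n2_moll_le h.l2 n
  simpa using (T2_moll (h.dl2 i)).cutoff.add h0

/-- Integration by parts in `H¹`. -/
lemma H1.integral_by_parts {f g : Plane → ℝ} {D E : Fin 2 → Plane → ℝ} (hf : H1 f D) (hg : H1 g E)
    (i : Fin 2) : ∫ x, D i x * g x = - ∫ x, f x * E i x := by
  obtain ⟨G, hG, h0, h1⟩ := hg.exists_test_approx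
  have l1 := h0.integral_mul (hf.dl2 i)
  have l2 := (h1 i).integral_mul hf.l2
  simp_rw [mul_comm (D i _), mul_comm (f _)]
  refine tendsto_nhds_unique l1 (l2.neg.congr fun n => ?_)
  have := (hf.weak i).2.2 _ (hG n)
  simp_rw [mul_comm (f _), mul_comm (D i _)] at this
  rw [this, neg_neg]

lemma fderiv_apply_eq (f : Plane → ℝ) (x v : Plane) :
    fderiv ℝ f x v = v 0 * pd 0 f x + v 1 * pd 1 f x := by
  have hv : v = v 0 • EuclideanSpace.single 0 (1 : ℝ) + v 1 • EuclideanSpace.single 1 (1 : ℝ) := by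
    ext i; fin_cases i <;> simp
  conv_lhs => rw [hv]
  simp [pd]

lemma pd_const_mul {f : Plane → ℝ} (hf : Differentiable ℝ f) (c : ℝ) (i : Fin 2) (x : Plane) :
    pd i (fun y => c * f y) x = c * pd i f x := by
  unfold pd
  rw [fderiv_const_mul (hf x)]
  simp

/-- Scaling gives the rate `(n+1)⁻²`; the weaker rate is all that is needed. -/
lemma exists_lap_cutoff_bound :
    ∃ C : ℝ, 0 ≤ C ∧ ∀ n x, |lap (cutoff n) x| ≤ C * (1 / ((n : ℝ) + 1)) := by
  obtain ⟨C0, h0, hC0⟩ := ((baseBump_isTest.pd 0).pd 0).exists_bound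
  obtain ⟨C1, h1, hC1⟩ := ((baseBump_isTest.pd 1).pd 1).exists_bound
  refine ⟨C0 + C1, by positivity, fun n x => ?_⟩
  have hn : (1 : ℝ) ≤ n + 1 := by linarith [n.cast_nonneg (α := ℝ)]
  set c : ℝ := ((n : ℝ) + 1)⁻¹ with hc
  have hc1 : c ≤ 1 := inv_le_one_of_one_le₀ hn
  have hc0 : 0 ≤ c := by positivity
  have e : ∀ i, pd i (pd i (cutoff n)) x = c * (c * pd i (pd i (fun x => baseBump x)) (c • x)) := by
    intro i
    have e1 : pd i (cutoff n) = fun y => c * pd i (fun x => baseBump x) (c • y) := by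
      ext y
      exact pd_comp_smul baseBump_isTest.differentiable c i y
    have hd : Differentiable ℝ (fun y : Plane => c • y) := differentiable_id.const_smul c
    have hd2 : Differentiable ℝ (fun y => pd i (fun x => baseBump x) (c • y)) :=
      (baseBump_isTest.pd i).differentiable.comp hd
    rw [e1, pd_const_mul hd2, pd_comp_smul (baseBump_isTest.pd i).differentiable]
  have hb : ∀ i C, 0 ≤ C → (∀ y, |pd i (pd i (fun x => baseBump x)) y| ≤ C) →
      |pd i (pd i (cutoff n)) x| ≤ C * c := by
    intro i C hC hh
    rw [e, abs_mul, abs_mul, abs_of_nonneg hc0]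
    have := hh (c • x)
    calc c * (c * |pd i (pd i (fun x => baseBump x)) (c • x)|) ≤ c * (1 * C) := by gcongr
      _ = C * c := by ring
  simp only [lap, Fin.sum_univ_two, one_div]
  refine (abs_add_le _ _).trans ?_
  rw [add_mul]
  exact add_le_add (hb 0 C0 h0 hC0) (hb 1 C1 h1 hC1)

/-- A square integrable weakly harmonic function vanishes. -/
lemma ae_eq_zero_of_weak_harmonic {q : Plane → ℝ} (hq : MemLp q 2 volume)
    (h : ∀ φ, IsTest φ → ∫ x, q x * lap φ x = 0) : q =ᵐ[volume] 0 := by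
  have hloc := (memLp_l2loc hq).locallyIntegrable
  -- The mollification `f` is smooth and harmonic, so `Δ(f²) = 2|∇f|²`. Integrated against cutoffs,
  -- the right side is bounded by the L² norm of `f` times a vanishing constant, so `f` is constant,
  -- and zero because it is in L².
  have main : ∀ n x, moll n q x = 0 := by
    intro n
    have hsm := moll_contDiff hloc n
    set f := moll n q with hf
    have hlap : ∀ x, pd 0 (pd 0 f) x + pd 1 (pd 1 f) x = 0 := by
      intro x
      have e : ∀ i, pd i (pd i f) x = ∫ t, pd i (pd i (eta n)) (x - t) * q t := by
        intro i
        have e1 : pd i f = fun x => ∫ t, pd i (eta n) (x - t) * q t := by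
          ext x; exact pd_moll hloc n i x
        rw [e1, pd_conv ((eta_isTest n).pd i) hloc]
      have hl := h _ (isTest_comp_sub (eta_isTest n) x)
      have e2 : ∀ i t, pd i (pd i (fun s => eta n (x - s))) t = pd i (pd i (eta n)) (x - t) := by
        intro i t
        have e1 : pd i (fun s => eta n (x - s)) = fun s => (-1) * pd i (eta n) (x - s) := by
          ext s; rw [pd_comp_sub (eta_isTest n).differentiable]; ring
        rw [e1, pd_const_mul (isTest_comp_sub ((eta_isTest n).pd i) x).differentiable,
          pd_comp_sub ((eta_isTest n).pd i).differentiable]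
        ring
      have ii : ∀ i, Integrable (fun t => pd i (pd i (eta n)) (x - t) * q t) := fun i => by
        simpa only [mul_comm] using
          integrable_mul_test hloc (isTest_comp_sub (((eta_isTest n).pd i).pd i) x)
      rw [e 0, e 1, ← integral_add (ii 0) (ii 1), ← hl]
      refine integral_congr_ae (ae_of_all _ fun t => ?_)
      simp only [lap, Fin.sum_univ_two, e2]; ring
    have hdf := hsm.differentiable (by simp)
    have hdf' := fun i => (contDiff_pd hsm i).differentiable (by simp)
    have ident : ∀ χ, IsTest χ → ∫ x, 2 * (pd 0 f x ^ 2 + pd 1 f x ^ 2) * χ x =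
        ∫ x, (f x * f x) * lap χ x := by
      intro χ hχ
      have step : ∀ i, ∫ x, (f x * f x) * pd i (pd i χ) x =
          ∫ x, 2 * (pd i f x ^ 2 + f x * pd i (pd i f) x) * χ x := by
        intro i
        have s1 : ContDiff ℝ ((⊤ : ℕ∞) : WithTop ℕ∞) (fun x => f x * f x) := hsm.mul hsm
        have e1 : pd i (fun x => f x * f x) = fun x => 2 * (f x * pd i f x) := by
          ext x; rw [pd_mul hdf hdf]; ring
        rw [integral_mul_pd s1 (hχ.pd i), e1]
        have s2 : ContDiff ℝ ((⊤ : ℕ∞) : WithTop ℕ∞) (fun x => 2 * (f x * pd i f x)) :=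
          contDiff_const.mul (hsm.mul (contDiff_pd hsm i))
        rw [integral_mul_pd s2 hχ, neg_neg]
        refine integral_congr_ae (ae_of_all _ fun x => ?_)
        simp only
        have hd2 : Differentiable ℝ (fun x => f x * pd i f x) := hdf.mul (hdf' i)
        rw [pd_const_mul hd2, pd_mul hdf (hdf' i)]
        ring
      have ii : ∀ i, Integrable (fun x => 2 * (pd i f x ^ 2 + f x * pd i (pd i f) x) * χ x) :=
        fun i => (hχ.smooth_mul (contDiff_const.mul (((contDiff_pd hsm i).pow 2).add
          (hsm.mul (contDiff_pd (contDiff_pd hsm i) i))))).integrable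
      have ij : ∀ i, Integrable (fun x => f x * f x * pd i (pd i χ) x) :=
        fun i => (((hχ.pd i).pd i).smooth_mul (hsm.mul hsm)).integrable
      have el : ∫ x, (f x * f x) * lap χ x =
          ∫ x, (f x * f x * pd 0 (pd 0 χ) x + f x * f x * pd 1 (pd 1 χ) x) :=
        integral_congr_ae (ae_of_all _ fun x => by simp only [lap, Fin.sum_univ_two]; ring)
      rw [el, integral_add (ij 0) (ij 1), step 0, step 1, ← integral_add (ii 0) (ii 1)]
      refine integral_congr_ae (ae_of_all _ fun x => ?_)
      have := hlap x
      simp only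
      linear_combination (-2 * f x * χ x) * this
    obtain ⟨C, hC0, hC⟩ := exists_lap_cutoff_bound
    have hfm := memLp_moll hq n
    have hbound : ∀ m : ℕ, ∫⁻ x, ENNReal.ofReal (2 * (pd 0 f x ^ 2 + pd 1 f x ^ 2) * cutoff m x) ≤
        ENNReal.ofReal (C * (1 / ((m : ℝ) + 1)) * n2 f ^ 2) := by
      intro m
      rw [← ofReal_integral_eq_lintegral_ofReal]
      · refine ENNReal.ofReal_le_ofReal ?_
        rw [ident _ (cutoff_isTest m), n2_sq hfm, ← integral_const_mul]
        refine integral_mono ?_ ((integrable_mul_of_memLp hfm hfm).const_mul _) fun x => ?_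
        · have := fun i => ((((cutoff_isTest m).pd i).pd i).smooth_mul (hsm.mul hsm)).integrable
          refine ((this 0).add (this 1)).congr (ae_of_all _ fun x => ?_)
          simp only [lap, Fin.sum_univ_two, Pi.add_apply]; ring
        · have := (abs_le.1 (hC m x)).2
          simp only
          nlinarith [mul_self_nonneg (f x)]
      · exact ((cutoff_isTest m).smooth_mul (contDiff_const.mul (((contDiff_pd hsm 0).pow 2).add
          ((contDiff_pd hsm 1).pow 2)))).integrable
      · exact ae_of_all _ fun x => mul_nonneg (by positivity) (cutoff_nonneg m x)
    -- Fatou's lemma as the cutoffs increase to one; no integrability of the gradient is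
    -- presupposed.
    have hzero : ∫⁻ x, ENNReal.ofReal (2 * (pd 0 f x ^ 2 + pd 1 f x ^ 2)) = 0 := by
      have hlim : ∀ x, Tendsto (fun m => ENNReal.ofReal
          (2 * (pd 0 f x ^ 2 + pd 1 f x ^ 2) * cutoff m x)) atTop
          (𝓝 (ENNReal.ofReal (2 * (pd 0 f x ^ 2 + pd 1 f x ^ 2)))) := fun x => by
        refine ENNReal.tendsto_ofReal ?_
        simpa using (tendsto_cutoff x).const_mul (2 * (pd 0 f x ^ 2 + pd 1 f x ^ 2))
      have hc := fun i => (contDiff_pd hsm i).continuous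
      have hfat := lintegral_liminf_le (μ := (volume : Measure Plane)) (u := atTop) (f := fun m x => ENNReal.ofReal
          (2 * (pd 0 f x ^ 2 + pd 1 f x ^ 2) * cutoff m x)) (fun m => by
          have h0 := hc 0; have h1 := hc 1; have h2 := (cutoff_isTest m).continuous
          exact (ENNReal.continuous_ofReal.comp (by fun_prop)).measurable)
      simp_rw [fun x => (hlim x).liminf_eq] at hfat
      have hz : Tendsto (fun m : ℕ => ENNReal.ofReal (C * (1 / ((m : ℝ) + 1)) * n2 f ^ 2)) atTop
          (𝓝 0) := by
        rw [← ENNReal.ofReal_zero]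
        refine ENNReal.tendsto_ofReal ?_
        simpa using ((tendsto_one_div_add_atTop_nhds_zero_nat (𝕜 := ℝ)).const_mul C).mul_const
          (n2 f ^ 2)
      have := tendsto_of_tendsto_of_tendsto_of_le_of_le tendsto_const_nhds hz
        (fun _ => zero_le) hbound
      rw [this.liminf_eq] at hfat
      exact le_antisymm hfat zero_le
    have hg : ∀ x, pd 0 f x = 0 ∧ pd 1 f x = 0 := by
      have hc := fun i => (contDiff_pd hsm i).continuous
      have h0 := hc 0
      have h1 := hc 1
      have hcont : Continuous fun x => ENNReal.ofReal (2 * (pd 0 f x ^ 2 + pd 1 f x ^ 2)) :=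
        ENNReal.continuous_ofReal.comp (by fun_prop)
      rw [lintegral_eq_zero_iff hcont.measurable] at hzero
      have hz := (hcont.ae_eq_iff_eq (μ := (volume : Measure Plane)) (g := 0) continuous_const).1 hzero
      intro x
      have h2 := congrFun hz x
      simp only [Pi.zero_apply, ENNReal.ofReal_eq_zero] at h2
      constructor
      · nlinarith [sq_nonneg (pd 0 f x), sq_nonneg (pd 1 f x)]
      · nlinarith [sq_nonneg (pd 0 f x), sq_nonneg (pd 1 f x)]
    have hfd : ∀ x, fderiv ℝ f x = 0 := fun x => by
      ext v
      rw [fderiv_apply_eq, (hg x).1, (hg x).2]; simp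
    have hconst : ∀ x, f x = f 0 := fun x => is_const_of_fderiv_eq_zero hdf hfd x 0
    have hm : MemLp (fun _ : Plane => f 0) 2 volume := by
      refine hfm.congr_norm aestronglyMeasurable_const (ae_of_all _ fun x => ?_)
      rw [← hf, hconst x]
    rw [memLp_const_iff (by norm_num) (by norm_num)] at hm
    intro x
    rw [hconst x]
    rcases hm with hm | hm
    · exact hm
    · simp at hm
  have h1 := (T2_moll hq).2.2
  simp_rw [main] at h1
  have h2 : n2 q = 0 := by
    have := tendsto_nhds_unique tendsto_const_nhds h1
    rw [← this]
    unfold n2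
    rw [show (fun x => 0 - q x) = -q by ext x; simp, eLpNorm_neg]
  have h3 : eLpNorm q 2 volume = 0 := by
    have := (ENNReal.toReal_eq_zero_iff _).1 h2
    exact this.resolve_right hq.2.ne
  exact (eLpNorm_eq_zero_iff hq.1 (by norm_num)).1 h3

/-- Pairs of square integrable functions. -/
abbrev L2Pair : Type :=
  WithLp 2 (Lp ℝ 2 (volume : Measure Plane) × Lp ℝ 2 (volume : Measure Plane))

/-- Square integrable divergence free fields are orthogonal to square integrable curl free fields. -/
lemma integral_div_free_curl_free {v h : Fin 2 → Plane → ℝ} (hv : ∀ i, MemLp (v i) 2 volume)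
    (hh : ∀ i, MemLp (h i) 2 volume)
    (hdiv : ∀ φ, IsTest φ → (∫ x, v 0 x * pd 0 φ x) + ∫ x, v 1 x * pd 1 φ x = 0)
    (hcurl : ∀ φ, IsTest φ → (∫ x, h 0 x * pd 1 φ x) - ∫ x, h 1 x * pd 0 φ x = 0) :
    (∫ x, v 0 x * h 0 x) + ∫ x, v 1 x * h 1 x = 0 := by
  let mk : ∀ f g : Plane → ℝ, MemLp f 2 volume → MemLp g 2 volume → L2Pair := fun f g hf hg =>
    WithLp.toLp 2 (hf.toLp f, hg.toLp g)
  have inner_mk : ∀ f g f' g' (hf : MemLp f 2 volume) (hg : MemLp g 2 volume)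
      (hf' : MemLp f' 2 volume) (hg' : MemLp g' 2 volume),
      inner ℝ (mk f g hf hg) (mk f' g' hf' hg') = (∫ x, f x * f' x) + ∫ x, g x * g' x := by
    intro f g f' g' hf hg hf' hg'
    rw [WithLp.prod_inner_apply]
    simp only [mk, inner_toLp]
  have exi : ∀ z : L2Pair, ∃ f g, ∃ (hf : MemLp f 2 volume) (hg : MemLp g 2 volume), z = mk f g hf hg := by
    intro z
    refine ⟨z.fst, z.snd, Lp.memLp _, Lp.memLp _, ?_⟩
    simp only [mk, Lp.toLp_coeFn]
    rfl
  let S : Set L2Pair := {z | ∃ φ, ∃ h : IsTest φ, z = mk _ _ ((h.pd 0).memLp 2) ((h.pd 1).memLp 2)}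
  -- `K` consists of the square integrable divergence free fields. The projection of `h` to `K`
  -- turns out to be curl free too, hence harmonic, hence zero; so `h` is orthogonal to `K`, which
  -- contains `v`.
  let K : Submodule ℝ L2Pair := (Submodule.span ℝ S)ᗮ
  have memK : ∀ f g (hf : MemLp f 2 volume) (hg : MemLp g 2 volume),
      (mk f g hf hg ∈ K ↔
        ∀ φ, IsTest φ → (∫ x, f x * pd 0 φ x) + ∫ x, g x * pd 1 φ x = 0) := by
    intro f g hf hg
    rw [Submodule.mem_orthogonal']
    constructor
    · intro hz φ hφ
      have := hz _ (Submodule.subset_span ⟨φ, hφ, rfl⟩)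
      rwa [inner_mk] at this
    · intro hz u hu
      induction hu using Submodule.span_induction with
      | mem u hu =>
        obtain ⟨φ, hφ, rfl⟩ := hu
        rw [inner_mk]; exact hz φ hφ
      | zero => simp
      | add u w _ _ hu hw => rw [inner_add_right, hu, hw, add_zero]
      | smul c u _ hu => rw [inner_smul_right, hu, mul_zero]
  have : CompleteSpace K := (Submodule.isClosed_orthogonal _).completeSpace_coe
  have : K.HasOrthogonalProjection := Submodule.HasOrthogonalProjection.ofCompleteSpace K
  obtain ⟨y, hy, z, hz, hsum⟩ := K.exists_add_mem_mem_orthogonal (mk _ _ (hh 0) (hh 1))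
  have hvK : mk _ _ (hv 0) (hv 1) ∈ K := (memK _ _ _ _).2 hdiv
  obtain ⟨q0, q1, m0, m1, rfl⟩ := exi y
  have hqd := (memK _ _ _ _).1 hy
  have hqc : ∀ φ, IsTest φ → (∫ x, q0 x * pd 1 φ x) - ∫ x, q1 x * pd 0 φ x = 0 := by
    intro φ hφ
    -- The rotated gradient of `φ` belongs to `K`, so it has the same product with `h` as with the
    -- projection of `h`.
    have hn : MemLp (fun x => - pd 0 φ x) 2 volume := ((hφ.pd 0).memLp 2).neg
    have hc : mk _ _ ((hφ.pd 1).memLp 2) hn ∈ K := by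
      rw [memK]
      intro ψ hψ
      have e1 := integral_mul_pd (hφ.pd 1).1 hψ 0
      have e2 := integral_mul_pd (hφ.pd 0).1 hψ 1
      simp_rw [pd_comm hφ.1 1 0] at e2
      simp only [neg_mul, integral_neg]
      linarith
    have h1 := (Submodule.mem_orthogonal _ _).1 hz _ hc
    have h2 := congrArg (fun w => inner ℝ (mk _ _ ((hφ.pd 1).memLp 2) hn) w) hsum
    simp only [inner_add_right, h1, add_zero, inner_mk, neg_mul, integral_neg] at h2
    have h3 := hcurl φ hφ
    simp_rw [mul_comm (q0 _), mul_comm (q1 _)]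
    simp_rw [mul_comm (h 0 _), mul_comm (h 1 _)] at h3
    linarith
  -- Combining `div q = 0` tested with one derivative of `φ` and `curl q = 0` tested with the other
  -- leaves the Laplacian on a single component.
  have q0z : q0 =ᵐ[volume] 0 := by
    refine ae_eq_zero_of_weak_harmonic m0 fun φ hφ => ?_
    have e1 := hqd _ (hφ.pd 0)
    have e2 := hqc _ (hφ.pd 1)
    simp_rw [pd_comm hφ.1 1 0] at e1
    have i0 := integrable_mul_of_memLp m0 (((hφ.pd 0).pd 0).memLp 2)
    have i1 := integrable_mul_of_memLp m0 (((hφ.pd 1).pd 1).memLp 2)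
    simp only [lap, Fin.sum_univ_two, mul_add]
    rw [integral_add i0 i1]
    linarith
  have q1z : q1 =ᵐ[volume] 0 := by
    refine ae_eq_zero_of_weak_harmonic m1 fun φ hφ => ?_
    have e1 := hqd _ (hφ.pd 1)
    have e2 := hqc _ (hφ.pd 0)
    simp_rw [pd_comm hφ.1 1 0] at e2
    have i0 := integrable_mul_of_memLp m1 (((hφ.pd 0).pd 0).memLp 2)
    have i1 := integrable_mul_of_memLp m1 (((hφ.pd 1).pd 1).memLp 2)
    simp only [lap, Fin.sum_univ_two, mul_add]
    rw [integral_add i0 i1]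
    linarith
  have hyz : mk q0 q1 m0 m1 = 0 := by
    have a0 : m0.toLp q0 = 0 := (Lp.eq_zero_iff_ae_eq_zero).2
      (m0.coeFn_toLp.trans q0z)
    have a1 : m1.toLp q1 = 0 := (Lp.eq_zero_iff_ae_eq_zero).2
      (m1.coeFn_toLp.trans q1z)
    simp only [mk, a0, a1]
    rfl
  rw [hyz, zero_add] at hsum
  have := (Submodule.mem_orthogonal _ _).1 hz _ hvK
  rw [← hsum, inner_mk] at this
  exact this

/-- `∫ ∂₀f ∂₁g = ∫ ∂₁f ∂₀g` in `H¹`. -/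
lemma H1.integral_cross {f g : Plane → ℝ} {D E : Fin 2 → Plane → ℝ} (hf : H1 f D) (hg : H1 g E) :
    ∫ x, D 0 x * E 1 x = ∫ x, D 1 x * E 0 x := by
  obtain ⟨G, hG, -, h1⟩ := hg.exists_test_approx
  have l0 := (h1 1).integral_mul (hf.dl2 0)
  have l1 := (h1 0).integral_mul (hf.dl2 1)
  simp_rw [mul_comm (D _ _)]
  refine tendsto_nhds_unique l0 (l1.congr fun n => ?_)
  have e3 := (hf.weak 0).2.2 _ ((hG n).pd 1)
  have e4 := (hf.weak 1).2.2 _ ((hG n).pd 0)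
  simp_rw [pd_comm (hG n).1 1 0] at e4
  simp_rw [mul_comm (pd _ _ _)]
  linarith

/-! ### Translations of `H¹` functions -/

lemma eLpNorm_one_sq_le_of_prob {α : Type*} [MeasurableSpace α] {ν : Measure α}
    [IsProbabilityMeasure ν] {g : α → ℝ} (hg : AEStronglyMeasurable g ν) :
    ‖∫ y, g y ∂ν‖ₑ ^ 2 ≤ ∫⁻ y, ‖g y‖ₑ ^ 2 ∂ν := by
  have h1 : ‖∫ y, g y ∂ν‖ₑ ≤ eLpNorm g 1 ν := by
    rw [eLpNorm_one_eq_lintegral_enorm]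
    exact enorm_integral_le_lintegral_enorm _
  have h2 := h1.trans (eLpNorm_le_eLpNorm_of_exponent_le (p := 1) (q := 2) (by norm_num) hg)
  calc _ ≤ eLpNorm g 2 ν ^ 2 := by gcongr
    _ = ∫⁻ y, ‖g y‖ₑ ^ 2 ∂ν := by
      have := eLpNorm_nnreal_pow_eq_lintegral (f := g) (μ := ν) (p := 2) (by norm_num)
      simpa using this

/-- The fundamental theorem of calculus along the segment, Jensen in its parameter, and translation
invariance in space. -/
lemma IsTest.translate_le {φ : Plane → ℝ} (h : IsTest φ) (y : Plane) :
    n2 (fun x => φ x - φ (x - y)) ≤ n2 (fun x => y 0 * OddFluid.pd 0 φ x + y 1 * OddFluid.pd 1 φ x) := by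
  have hg : Continuous (fun x => fderiv ℝ φ x y) :=
    (h.1.continuous_fderiv (by simp)).clm_apply continuous_const
  have hpt : ∀ x, φ x - φ (x - y) = ∫ s in Ioc (0 : ℝ) 1, fderiv ℝ φ (x - s • y) y := by
    intro x
    have hd : ∀ s ∈ uIcc (0 : ℝ) 1, HasDerivAt (fun s : ℝ => - φ (x - s • y))
        (fderiv ℝ φ (x - s • y) y) s := by
      intro s _
      have h1 : HasDerivAt (fun s : ℝ => x - s • y) (-y) s := by
        simpa using ((hasDerivAt_id s).smul_const y).const_sub x
      have h2 := (h.differentiable (x - s • y)).hasFDerivAt.comp_hasDerivAt s h1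
      have h3 : HasDerivAt (fun s : ℝ => - φ (x - s • y)) (-(fderiv ℝ φ (x - s • y) (-y))) s :=
        h2.neg
      simpa using h3
    have := intervalIntegral.integral_eq_sub_of_hasDerivAt hd
      ((hg.comp (by fun_prop : Continuous fun s : ℝ => x - s • y)).intervalIntegrable _ _)
    rw [intervalIntegral.integral_of_le zero_le_one] at this
    rw [this]; simp; ring
  have e : (fun x => y 0 * OddFluid.pd 0 φ x + y 1 * OddFluid.pd 1 φ x) = fun x => fderiv ℝ φ x y := by
    ext x; rw [fderiv_apply_eq]
  rw [e]
  have hmem : MemLp (fun x => fderiv ℝ φ x y) 2 volume := by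
    rw [← e]
    exact (((h.pd 0).memLp 2).const_mul _).add (((h.pd 1).memLp 2).const_mul _)
  refine ENNReal.toReal_mono hmem.2.ne (le_of_sq_le_sq ?_)
  rw [eLpNorm_two_sq, eLpNorm_two_sq]
  have hP : IsProbabilityMeasure ((volume : Measure ℝ).restrict (Ioc 0 1)) := ⟨by simp⟩
  calc _ ≤ ∫⁻ x, ∫⁻ s in Ioc (0 : ℝ) 1, ‖fderiv ℝ φ (x - s • y) y‖ₑ ^ 2 := by
        refine lintegral_mono fun x => ?_
        simp only [hpt]
        exact eLpNorm_one_sq_le_of_prob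
          (hg.comp (by fun_prop : Continuous fun s : ℝ => x - s • y)).aestronglyMeasurable
    _ = ∫⁻ s in Ioc (0 : ℝ) 1, ∫⁻ x, ‖fderiv ℝ φ (x - s • y) y‖ₑ ^ 2 := by
        rw [lintegral_lintegral_swap]
        have : Continuous (fun z : Plane × ℝ => fderiv ℝ φ (z.1 - z.2 • y) y) :=
          hg.comp (by fun_prop)
        exact (this.enorm.measurable.pow_const 2).aemeasurable
    _ = ∫⁻ s in Ioc (0 : ℝ) 1, ∫⁻ x, ‖fderiv ℝ φ x y‖ₑ ^ 2 := by
        refine lintegral_congr fun s => ?_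
        exact lintegral_sub_right_eq_self (fun x => ‖fderiv ℝ φ x y‖ₑ ^ 2) (s • y)
    _ = _ := by simp

/-- By density from the smooth case. The factor `‖y‖` will compensate the derivative of the
mollifying kernel. -/
lemma H1.translate_le {b : Plane → ℝ} {B : Fin 2 → Plane → ℝ} (h : H1 b B) (y : Plane) :
    n2 (fun x => b x - b (x - y)) ≤ ‖y‖ * (n2 (B 0) + n2 (B 1)) := by
  obtain ⟨F, hF, h0, h1⟩ := h.exists_test_approx
  have ht : T2 (fun n x => F n x - F n (x - y)) (fun x => b x - b (x - y)) := by
    refine ⟨fun n => (h0.1 n).sub (memLp_comp_sub (h0.1 n) y), h0.2.1.sub (memLp_comp_sub h0.2.1 y), ?_⟩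
    refine squeeze_zero (fun _ => n2_nonneg _) (fun n => ?_) (by simpa using h0.2.2.add h0.2.2)
    have hd : MemLp (fun x => F n x - b x) 2 volume := (h0.1 n).sub h0.2.1
    have e : (fun x => F n x - F n (x - y) - (b x - b (x - y))) =
        fun x => (F n x - b x) + (-1) * (F n (x - y) - b (x - y)) := by ext x; ring
    rw [e]
    refine (n2_add_le hd ((memLp_comp_sub hd y).const_mul _)).trans (add_le_add le_rfl ?_)
    rw [n2_const_mul]
    simp only [abs_neg, abs_one, one_mul]
    unfold n2
    have := eLpNorm_comp_measurePreserving (p := 2) hd.1 (measurePreserving_sub_right volume y)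
    exact (congrArg ENNReal.toReal this).le
  refine le_of_tendsto_of_tendsto' ht.norm (((h1 0).norm.add (h1 1).norm).const_mul ‖y‖) fun n => ?_
  refine ((hF n).translate_le y).trans ?_
  refine (n2_add_le ((h1 0).1 n |>.const_mul _) ((h1 1).1 n |>.const_mul _)).trans ?_
  rw [n2_const_mul, n2_const_mul, mul_add]
  have hy : ∀ i, |y i| ≤ ‖y‖ := fun i => PiLp.norm_apply_le y i
  have := n2_nonneg (pd 0 (F n))
  have := n2_nonneg (pd 1 (F n))
  have := hy 0
  have := hy 1
  gcongr

/-! ### The commutator of a transport operator and a mollification -/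

lemma norm_le_of_pd_eta_ne_zero {n : ℕ} {i : Fin 2} {x : Plane} (h : pd i (eta n) x ≠ 0) :
    ‖x‖ ≤ 2 / (n + 1) := by
  have h1 : x ∈ tsupport (eta n) := by
    by_contra hx
    have : eta n =ᶠ[𝓝 x] 0 := notMem_tsupport_iff_eventuallyEq.1 hx
    refine h ?_
    unfold pd
    rw [this.fderiv_eq]; simp
  have h2 : tsupport (eta n) ⊆ Metric.closedBall 0 (2 / (n + 1)) :=
    closure_minimal (fun z hz => by simpa using norm_le_of_eta_ne_zero hz) Metric.isClosed_closedBall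
  simpa using h2 h1

/-- Scale invariance: differentiating the kernel costs `n + 1`, and the factor `‖y‖` gains it back.
-/
lemma exists_pd_eta_bound : ∃ C : ℝ, 0 ≤ C ∧ ∀ n i, ∫ y, ‖y‖ * |pd i (eta n) y| ≤ C := by
  let g : Fin 2 → Plane → ℝ := fun i y => ‖y‖ * |pd i (baseBump.normed volume) y|
  refine ⟨(∫ y, g 0 y) + ∫ y, g 1 y, ?_, fun n i => ?_⟩
  · have : ∀ i, 0 ≤ ∫ y, g i y := fun i => integral_nonneg fun y => by positivity
    linarith [this 0, this 1]
  · have hn : (0 : ℝ) < n + 1 := by positivity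
    have hd : Differentiable ℝ (fun x => baseBump.normed volume (((n : ℝ) + 1) • x)) :=
      (normed_isTest.comp_smul hn.ne').differentiable
    have e : ∀ y, ‖y‖ * |pd i (eta n) y| = ((n : ℝ) + 1) ^ 2 * g i (((n : ℝ) + 1) • y) := by
      intro y
      have : pd i (eta n) y = ((n : ℝ) + 1) ^ 2 *
          (((n : ℝ) + 1) * pd i (baseBump.normed volume) (((n : ℝ) + 1) • y)) := by
        rw [show eta n = fun x => ((n : ℝ) + 1) ^ 2 * baseBump.normed volume (((n : ℝ) + 1) • x) from rfl,
          pd_const_mul hd, pd_comp_smul normed_isTest.differentiable]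
      rw [this]
      simp only [g, norm_smul, Real.norm_of_nonneg hn.le, abs_mul, abs_pow, abs_of_pos hn]
      ring
    simp_rw [e]
    rw [integral_const_mul, integral_scale]
    have : ∀ i, 0 ≤ ∫ y, g i y := fun i => integral_nonneg fun y => by positivity
    fin_cases i
    · simpa using this 1
    · simpa using this 0

/-- The commutator of `b ∂ₖ` and mollification. -/
def comm (n : ℕ) (k : Fin 2) (b w : Plane → ℝ) (x : Plane) : ℝ :=
  b x * pd k (moll n w) x - pd k (moll n (fun t => b t * w t)) x

/-- In both terms the derivative falls on the kernel, which leaves a difference of `b` against the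
singular kernel. -/
lemma comm_eq {b w : Plane → ℝ} (hb : L2loc b) (hw : L2loc w) (n : ℕ) (k : Fin 2) (x : Plane) :
    comm n k b w x = ∫ y, pd k (eta n) y * ((b x - b (x - y)) * w (x - y)) := by
  unfold comm
  rw [pd_moll hw.locallyIntegrable, pd_moll (hb.locallyIntegrable_mul hw), ← integral_const_mul,
    ← integral_sub]
  · rw [← integral_sub_left_eq_self _ volume x]
    refine integral_congr_ae (ae_of_all _ fun y => ?_)
    simp only [sub_sub_cancel]; ring
  · simpa [mul_comm] using (integrable_mul_test hw.locallyIntegrable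
      (isTest_comp_sub ((eta_isTest n).pd k) x)).const_mul (b x)
  · simpa [mul_comm] using integrable_mul_test (hb.locallyIntegrable_mul hw)
      (isTest_comp_sub ((eta_isTest n).pd k) x)

lemma lintegral_mul_le_n2 {f g : Plane → ℝ} (hf : MemLp f 2 volume) (hg : MemLp g 2 volume) :
    ∫⁻ x, ‖f x * g x‖ₑ ≤ ENNReal.ofReal (n2 f * n2 g) := by
  have h := (integrable_mul_of_memLp hf hg)
  rw [← ofReal_integral_norm_eq_lintegral_enorm h]
  refine ENNReal.ofReal_le_ofReal ?_
  have := abs_integral_mul_le hf.norm hg.norm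
  simp only [norm_mul]
  refine (le_abs_self _).trans (this.trans_eq ?_)
  simp only [n2, eLpNorm_norm]

/-- Tonelli and Cauchy–Schwarz in `x` reduce the bound to the modulus of continuity of `b` in L² and
to `exists_pd_eta_bound`, so it is uniform in `n`. -/
lemma exists_comm_bound : ∃ C : ℝ, 0 ≤ C ∧ ∀ n k (b w : Plane → ℝ) (B : Fin 2 → Plane → ℝ),
    H1 b B → MemLp w 2 volume →
    ∫⁻ x, ‖comm n k b w x‖ₑ ≤ ENNReal.ofReal (C * ((n2 (B 0) + n2 (B 1)) * n2 w)) := by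
  obtain ⟨C, hC0, hC⟩ := exists_pd_eta_bound
  refine ⟨C, hC0, fun n k b w B hb hw => ?_⟩
  have hm := aestronglyMeasurable_comp_sub hw.1
  have hmb := aestronglyMeasurable_comp_sub hb.l2.1
  have hpc := ((eta_isTest n).pd k).continuous
  have hK : 0 ≤ (n2 (B 0) + n2 (B 1)) * n2 w :=
    mul_nonneg (add_nonneg (n2_nonneg _) (n2_nonneg _)) (n2_nonneg _)
  calc _ ≤ ∫⁻ x, ∫⁻ y, ‖pd k (eta n) y‖ₑ * ‖(b x - b (x - y)) * w (x - y)‖ₑ := by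
        refine lintegral_mono fun x => ?_
        simp only
        rw [comm_eq (memLp_l2loc hb.l2) (memLp_l2loc hw)]
        refine (enorm_integral_le_lintegral_enorm _).trans (le_of_eq ?_)
        simp_rw [enorm_mul]
    _ = ∫⁻ y, ∫⁻ x, ‖pd k (eta n) y‖ₑ * ‖(b x - b (x - y)) * w (x - y)‖ₑ := by
        rw [lintegral_lintegral_swap]
        refine AEMeasurable.mul (hpc.comp continuous_snd).enorm.measurable.aemeasurable ?_
        exact ((hb.l2.1.comp_fst.sub hmb).mul hm).enorm
    _ ≤ ∫⁻ y, ENNReal.ofReal (‖y‖ * |pd k (eta n) y|) *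
          ENNReal.ofReal ((n2 (B 0) + n2 (B 1)) * n2 w) := by
        refine lintegral_mono fun y => ?_
        simp only
        rw [lintegral_const_mul' _ _ enorm_ne_top]
        have h1 := lintegral_mul_le_n2 (hb.l2.sub (memLp_comp_sub hb.l2 y)) (memLp_comp_sub hw y)
        have h2 := hb.translate_le y
        have h3 : n2 (fun x => w (x - y)) = n2 w := congrArg ENNReal.toReal
          (eLpNorm_comp_measurePreserving (p := 2) hw.1 (measurePreserving_sub_right volume y))
        refine (mul_le_mul_right h1 _).trans ?_
        rw [Real.enorm_eq_ofReal_abs, ← ENNReal.ofReal_mul (abs_nonneg _),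
          ← ENNReal.ofReal_mul (by positivity), h3]
        refine ENNReal.ofReal_le_ofReal ?_
        have h4 : n2 ((b : Plane → ℝ) - fun x => b (x - y)) ≤ ‖y‖ * (n2 (B 0) + n2 (B 1)) := h2
        calc |pd k (eta n) y| * (n2 (b - fun x => b (x - y)) * n2 w)
            ≤ |pd k (eta n) y| * ((‖y‖ * (n2 (B 0) + n2 (B 1))) * n2 w) := by
              have := n2_nonneg w
              gcongr
          _ = _ := by ring
    _ = (∫⁻ y, ENNReal.ofReal (‖y‖ * |pd k (eta n) y|)) *
          ENNReal.ofReal ((n2 (B 0) + n2 (B 1)) * n2 w) := by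
        rw [lintegral_mul_const]
        exact (ENNReal.continuous_ofReal.comp (continuous_norm.mul hpc.abs)).measurable
    _ ≤ _ := by
        rw [ENNReal.ofReal_mul hC0]
        gcongr
        rw [← ofReal_integral_eq_lintegral_ofReal]
        · exact ENNReal.ofReal_le_ofReal (hC n k)
        · exact (continuous_norm.mul hpc.abs).integrable_of_hasCompactSupport
            (((eta_isTest n).pd k).2.abs.mul_left)
        · exact ae_of_all _ fun y => by positivity

lemma moll_sub {f g : Plane → ℝ} (hf : LocallyIntegrable f volume) (hg : LocallyIntegrable g volume)
    (n : ℕ) (x : Plane) : moll n (fun t => f t - g t) x = moll n f x - moll n g x := by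
  unfold moll
  rw [← integral_sub]
  · refine integral_congr_ae (ae_of_all _ fun t => ?_); simp only; ring
  · simpa [mul_comm] using integrable_mul_test hf (isTest_comp_sub (eta_isTest n) x)
  · simpa [mul_comm] using integrable_mul_test hg (isTest_comp_sub (eta_isTest n) x)

lemma exists_test_close {w : Plane → ℝ} (hw : MemLp w 2 volume) {ε : ℝ} (hε : 0 < ε) :
    ∃ φ, IsTest φ ∧ n2 (fun x => w x - φ x) < ε := by
  have h := (T2_moll hw).cutoff
  obtain ⟨n, hn⟩ := ((Metric.tendsto_atTop.1 h.2.2) ε hε)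
  refine ⟨_, (cutoff_isTest n).smooth_mul (moll_contDiff (memLp_l2loc hw).locallyIntegrable n), ?_⟩
  have := hn n le_rfl
  rw [Real.dist_eq, sub_zero, abs_of_nonneg (n2_nonneg _)] at this
  refine lt_of_le_of_lt (le_of_eq ?_) this
  unfold n2
  rw [← eLpNorm_neg]
  congr 2
  ext x
  simp [mul_comm]

/-- The commutators converge in `L¹`. -/
lemma tendsto_comm {b w χ : Plane → ℝ} {B : Fin 2 → Plane → ℝ} {Cb : ℝ} (hb : H1 b B)
    (hbd : ∀ᵐ x, |b x| ≤ Cb) (hw : MemLp w 2 volume) (hχ : IsTest χ) (hχ1 : ∀ x, |χ x| ≤ 1)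
    (k : Fin 2) :
    Tendsto (fun n => ∫⁻ x, ‖χ x * (comm n k b w x + B k x * w x)‖ₑ) atTop (𝓝 0) := by
  obtain ⟨C, hC0, hC⟩ := exists_comm_bound
  rw [ENNReal.tendsto_nhds_zero]
  intro ε hε
  wlog hεt : ε ≠ ⊤ generalizing ε
  · rw [not_not] at hεt
    exact Eventually.of_forall fun n => hεt ▸ le_top
  set S := n2 (B 0) + n2 (B 1) with hS
  have hS0 : 0 ≤ S := add_nonneg (n2_nonneg _) (n2_nonneg _)
  have hSk : n2 (B k) ≤ S := by
    fin_cases k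
    · simpa [hS] using n2_nonneg (B 1)
    · simpa [hS] using n2_nonneg (B 0)
  have he : 0 < ε.toReal := ENNReal.toReal_pos hε.ne' hεt
  -- The commutator is linear in `w` and uniformly bounded, so it suffices to treat a nearby test
  -- function. The uniform bound costs `C * S` and the limit term `B k * w` costs at most `S`, which
  -- gives the denominator.
  obtain ⟨φ, hφ, hφw⟩ := exists_test_close hw (ε := ε.toReal / (2 * (C * S + S + 1))) (by positivity)
  have hd : MemLp (fun x => w x - φ x) 2 volume := hw.sub (hφ.memLp 2)
  have hbl := memLp_l2loc hb.l2
  -- the smooth part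
  have hu : MemLp (fun x => b x * pd k φ x + B k x * φ x) 2 volume :=
    (memLp_bdd_mul ((hφ.pd k).memLp 2) hb.l2.1 hbd).add
      ((memLp_l2loc (hb.dl2 k)).mul_test hφ.continuous hφ.2)
  have hT : T2 (fun n x => b x * moll n (pd k φ) x) (fun x => b x * pd k φ x) :=
    (T2_moll ((hφ.pd k).memLp 2)).bdd_mul hb.l2.1 hbd
  have hT2 := T2_moll hu
  -- For smooth `φ` the derivative commutes with mollification, and both brackets tend to zero in
  -- L².
  have e : ∀ n x, comm n k b φ x + B k x * φ x = (b x * moll n (pd k φ) x - b x * pd k φ x) -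
      (moll n (fun x => b x * pd k φ x + B k x * φ x) x - (b x * pd k φ x + B k x * φ x)) := by
    intro n x
    unfold comm
    rw [(HasWeakPartial.of_smooth hφ.1 (i := k)).pd_moll, (hb.loc.mul_weak hφ.h1loc k).pd_moll]
    ring
  have hsm : Tendsto (fun n => n2 χ * (n2 (fun x => b x * moll n (pd k φ) x - b x * pd k φ x) +
      n2 (fun x => moll n (fun x => b x * pd k φ x + B k x * φ x) x -
        (b x * pd k φ x + B k x * φ x)))) atTop (𝓝 0) := by
    simpa using (hT.2.2.add hT2.2.2).const_mul (n2 χ)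
  filter_upwards [hsm.eventually_lt_const (half_pos he)] with n hn
  have hcd : ∀ x, comm n k b w x = comm n k b (fun x => w x - φ x) x + comm n k b φ x := by
    intro x
    have hwl := memLp_l2loc hw
    have h1 : moll n (fun x => w x - φ x) = fun x => moll n w x - moll n φ x := by
      ext x; exact moll_sub hwl.locallyIntegrable hφ.continuous.locallyIntegrable n x
    have h2 : moll n (fun t => b t * (w t - φ t)) =
        fun x => moll n (fun t => b t * w t) x - moll n (fun t => b t * φ t) x := by
      ext x
      simp_rw [mul_sub]
      exact moll_sub (hbl.locallyIntegrable_mul hwl)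
        (hbl.locallyIntegrable_mul (continuous_l2loc hφ.continuous)) n x
    have d : ∀ f : Plane → ℝ, LocallyIntegrable f volume → Differentiable ℝ (moll n f) :=
      fun f hf => (moll_contDiff hf n).differentiable (by simp)
    have pdsub : ∀ f g : Plane → ℝ, Differentiable ℝ f → Differentiable ℝ g →
        pd k (fun x => f x - g x) x = pd k f x - pd k g x := by
      intro f g hf hg
      unfold pd
      rw [fderiv_fun_sub (hf x) (hg x)]; simp
    unfold comm
    rw [h1, h2, pdsub _ _ (d _ hwl.locallyIntegrable) (d _ hφ.continuous.locallyIntegrable),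
      pdsub _ _ (d _ (hbl.locallyIntegrable_mul hwl))
        (d _ (hbl.locallyIntegrable_mul (continuous_l2loc hφ.continuous)))]
    ring
  have m1 : MemLp (fun x => comm n k b φ x + B k x * φ x) 2 volume := by
    simp_rw [e]
    exact ((hT.1 n).sub hT.2.1).sub ((hT2.1 n).sub hT2.2.1)
  calc ∫⁻ x, ‖χ x * (comm n k b w x + B k x * w x)‖ₑ
      ≤ ∫⁻ x, (‖comm n k b (fun x => w x - φ x) x‖ₑ + (‖B k x * (w x - φ x)‖ₑ +
        ‖χ x * (comm n k b φ x + B k x * φ x)‖ₑ)) := by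
        refine lintegral_mono fun x => ?_
        have e3 : χ x * (comm n k b w x + B k x * w x) = χ x * comm n k b (fun x => w x - φ x) x +
            (χ x * (B k x * (w x - φ x)) + χ x * (comm n k b φ x + B k x * φ x)) := by
          rw [hcd]; ring
        have hle : ∀ z : ℝ, ‖χ x * z‖ₑ ≤ ‖z‖ₑ := fun z => by
          rw [enorm_mul]
          refine mul_le_of_le_one_left' ?_
          rw [Real.enorm_eq_ofReal_abs]
          simpa using ENNReal.ofReal_le_ofReal (hχ1 x)
        simp only [e3]
        refine (enorm_add_le _ _).trans (add_le_add (hle _) ?_)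
        exact (enorm_add_le _ _).trans (add_le_add (hle _) le_rfl)
    _ = (∫⁻ x, ‖comm n k b (fun x => w x - φ x) x‖ₑ) + ((∫⁻ x, ‖B k x * (w x - φ x)‖ₑ) +
        ∫⁻ x, ‖χ x * (comm n k b φ x + B k x * φ x)‖ₑ) := by
        rw [lintegral_add_right', lintegral_add_left']
        · exact ((hb.dl2 k).1.mul hd.1).enorm
        · exact ((hb.dl2 k).1.mul hd.1).enorm.add (hχ.continuous.aestronglyMeasurable.mul m1.1).enorm
    _ ≤ ENNReal.ofReal (C * (S * n2 (fun x => w x - φ x))) +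
        (ENNReal.ofReal (n2 (B k) * n2 (fun x => w x - φ x)) +
          ENNReal.ofReal (n2 χ * n2 (fun x => comm n k b φ x + B k x * φ x))) :=
        add_le_add (hC n k b _ B hb hd) (add_le_add (lintegral_mul_le_n2 (hb.dl2 k) hd)
          (lintegral_mul_le_n2 (hχ.memLp 2) m1))
    _ = ENNReal.ofReal (C * (S * n2 (fun x => w x - φ x)) + (n2 (B k) * n2 (fun x => w x - φ x) +
          n2 χ * n2 (fun x => comm n k b φ x + B k x * φ x))) := by
        have := n2_nonneg (fun x => w x - φ x)
        have := n2_nonneg (B k)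
        have := n2_nonneg χ
        have := n2_nonneg (fun x => comm n k b φ x + B k x * φ x)
        rw [ENNReal.ofReal_add (by positivity) (by positivity),
          ENNReal.ofReal_add (by positivity) (by positivity)]
    _ ≤ ENNReal.ofReal ε.toReal := by
        refine ENNReal.ofReal_le_ofReal ?_
        have h0 := n2_nonneg (fun x => w x - φ x)
        have h5 : n2 (fun x => comm n k b φ x + B k x * φ x) ≤
            n2 (fun x => b x * moll n (pd k φ) x - b x * pd k φ x) +
            n2 (fun x => moll n (fun x => b x * pd k φ x + B k x * φ x) x -
              (b x * pd k φ x + B k x * φ x)) := by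
          have a1 : MemLp (fun x => b x * moll n (pd k φ) x - b x * pd k φ x) 2 volume :=
            (hT.1 n).sub hT.2.1
          have a2 : MemLp (fun x => moll n (fun x => b x * pd k φ x + B k x * φ x) x -
              (b x * pd k φ x + B k x * φ x)) 2 volume := (hT2.1 n).sub hT2.2.1
          have := n2_add_le a1 (a2.const_mul (-1))
          rw [n2_const_mul] at this
          simp only [abs_neg, abs_one, one_mul] at this
          refine le_trans (le_of_eq ?_) this
          congr 1; ext x; rw [e]; ring
        have h6 : n2 χ * n2 (fun x => comm n k b φ x + B k x * φ x) < ε.toReal / 2 :=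
          lt_of_le_of_lt (mul_le_mul_of_nonneg_left h5 (n2_nonneg χ)) hn
        have h7 : (C * S + S + 1) * n2 (fun x => w x - φ x) ≤ ε.toReal / 2 := by
          have := mul_le_mul_of_nonneg_left hφw.le (by positivity : 0 ≤ C * S + S + 1)
          refine this.trans (le_of_eq ?_)
          field_simp
        nlinarith [mul_le_mul_of_nonneg_right hSk h0]
    _ = ε := ENNReal.ofReal_toReal hεt

/-! ### The transport operator of a divergence free field is skew symmetric -/

lemma T2.integral_mul_T2 {F G : ℕ → Plane → ℝ} {f g : Plane → ℝ} (hF : T2 F f) (hG : T2 G g) :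
    Tendsto (fun n => ∫ x, F n x * G n x) atTop (𝓝 (∫ x, f x * g x)) := by
  rw [tendsto_iff_norm_sub_tendsto_zero]
  have hz := (hF.2.2.mul hG.norm).add (hG.2.2.const_mul (n2 f))
  simp only [zero_mul, mul_zero, add_zero] at hz
  refine squeeze_zero (fun _ => norm_nonneg _) (fun n => ?_) hz
  have d1 : MemLp (fun x => F n x - f x) 2 volume := (hF.1 n).sub hF.2.1
  have d2 : MemLp (fun x => G n x - g x) 2 volume := (hG.1 n).sub hG.2.1
  have e : (∫ x, F n x * G n x) - ∫ x, f x * g x =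
      (∫ x, (F n x - f x) * G n x) + ∫ x, f x * (G n x - g x) := by
    rw [← integral_sub (integrable_mul_of_memLp (hF.1 n) (hG.1 n))
      (integrable_mul_of_memLp hF.2.1 hG.2.1), ← integral_add (integrable_mul_of_memLp d1 (hG.1 n))
      (integrable_mul_of_memLp hF.2.1 d2)]
    exact integral_congr_ae (ae_of_all _ fun x => by simp only; ring)
  rw [e]
  refine (norm_add_le _ _).trans (add_le_add ?_ ?_)
  · exact abs_integral_mul_le d1 (hG.1 n)
  · exact (abs_integral_mul_le hF.2.1 d2)

/-- A bounded smooth approximation of the identity function. -/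
def truncLin (δ s : ℝ) : ℝ := s / (1 + δ * s ^ 2)

/-- A primitive of `truncLin`. -/
def truncSq (δ s : ℝ) : ℝ := Real.log (1 + δ * s ^ 2) / (2 * δ)

lemma abs_truncLin_le {δ : ℝ} (hδ : 0 < δ) (s : ℝ) : |truncLin δ s| ≤ |s| := by
  unfold truncLin
  rw [abs_div, abs_of_pos (by positivity : 0 < 1 + δ * s ^ 2)]
  exact div_le_self (abs_nonneg s) (by nlinarith [sq_nonneg s])

lemma abs_truncLin_le' {δ : ℝ} (hδ : 0 < δ) (s : ℝ) : |truncLin δ s| ≤ 1 + 1 / δ := by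
  unfold truncLin
  rw [abs_div, abs_of_pos (by positivity : 0 < 1 + δ * s ^ 2), div_le_iff₀ (by positivity)]
  have : (1 + 1 / δ) * (1 + δ * s ^ 2) = 1 + s ^ 2 + δ * s ^ 2 + 1 / δ := by field_simp; ring
  rw [this]
  have h1 : 0 < 1 / δ := by positivity
  nlinarith [sq_nonneg (|s| - 1), sq_abs s, mul_nonneg hδ.le (sq_nonneg s)]

lemma abs_truncLin_sub_le {δ : ℝ} (hδ : 0 < δ) (s t : ℝ) :
    |truncLin δ s - truncLin δ t| ≤ |s - t| := by
  unfold truncLin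
  have h1 : 0 < 1 + δ * s ^ 2 := by positivity
  have h2 : 0 < 1 + δ * t ^ 2 := by positivity
  rw [show s / (1 + δ * s ^ 2) - t / (1 + δ * t ^ 2) =
    (s - t) * ((1 - δ * s * t) / ((1 + δ * s ^ 2) * (1 + δ * t ^ 2))) by field_simp; ring, abs_mul]
  refine mul_le_of_le_one_right (abs_nonneg _) ?_
  rw [abs_div, abs_of_pos (mul_pos h1 h2), div_le_one (mul_pos h1 h2), abs_le]
  constructor <;> nlinarith [mul_nonneg hδ.le (sq_nonneg (s - t)), mul_nonneg hδ.le (sq_nonneg (s + t)),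
    mul_nonneg (mul_nonneg hδ.le (sq_nonneg s)) (mul_nonneg hδ.le (sq_nonneg t))]

lemma abs_truncSq_le {δ : ℝ} (hδ : 0 < δ) (s : ℝ) : |truncSq δ s| ≤ s * s := by
  unfold truncSq
  have h1 : 0 ≤ Real.log (1 + δ * s ^ 2) := Real.log_nonneg (by nlinarith [mul_nonneg hδ.le (sq_nonneg s)])
  have h2 : Real.log (1 + δ * s ^ 2) ≤ δ * s ^ 2 := by
    have := Real.log_le_sub_one_of_pos (by positivity : 0 < 1 + δ * s ^ 2); linarith
  rw [abs_of_nonneg (by positivity), div_le_iff₀ (by positivity)]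
  nlinarith [mul_nonneg hδ.le (sq_nonneg s)]

lemma contDiff_truncSq {δ : ℝ} (hδ : 0 < δ) : ContDiff ℝ ((⊤ : ℕ∞) : WithTop ℕ∞) (truncSq δ) := by
  unfold truncSq
  exact (ContDiff.log (by fun_prop) (fun s => by positivity)).div_const _

lemma hasDerivAt_truncSq {δ : ℝ} (hδ : 0 < δ) (s : ℝ) :
    HasDerivAt (truncSq δ) (truncLin δ s) s := by
  have h0 : HasDerivAt (fun s : ℝ => 1 + δ * s ^ 2) (δ * (2 * s)) s := by
    simpa using ((hasDerivAt_pow 2 s).const_mul δ).const_add 1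
  have h := (h0.log (by positivity)).div_const (2 * δ)
  refine h.congr_deriv ?_
  unfold truncLin
  field_simp

lemma H1loc.cutoff {b : Plane → ℝ} {B : Fin 2 → Plane → ℝ} (hb : H1loc b B) {χ : Plane → ℝ}
    (hχ : IsTest χ) : H1 (fun x => χ x * b x) (fun i x => χ x * B i x + pd i χ x * b x) := by
  have m : ∀ {ψ f : Plane → ℝ}, IsTest ψ → L2loc f → MemLp (fun x => ψ x * f x) 2 volume :=
    fun hψ hf => by simpa only [mul_comm] using hf.mul_test hψ.continuous hψ.2
  exact ⟨m hχ hb.l2, fun i => (m hχ (hb.dl2 i)).add (m (hχ.pd i) hb.l2), hχ.h1loc.mul_weak hb⟩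

/-- On the support of the cutoff the commutator only sees `b` within distance 2, so `b` may be
truncated to an H¹ function. -/
lemma tendsto_comm_local {b w : Plane → ℝ} {B : Fin 2 → Plane → ℝ} {Cb : ℝ} (hb : H1loc b B)
    (hbd : ∀ᵐ x, |b x| ≤ Cb) (hw : MemLp w 2 volume) (N : ℕ) (k : Fin 2) :
    Tendsto (fun n => ∫⁻ x, ‖cutoff N x * (comm n k b w x + B k x * w x)‖ₑ) atTop (𝓝 0) := by
  obtain ⟨R, hR⟩ := (cutoff_isTest N).2.isCompact.isBounded.exists_norm_le
  obtain ⟨M, hM⟩ := exists_cutoff_eq_one (isCompact_closedBall (0 : Plane) (R + 2))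
  have hM' := fun x hx => hM M le_rfl x hx
  have hH := hb.cutoff (cutoff_isTest M)
  have hbd' : ∀ᵐ x, |cutoff M x * b x| ≤ Cb := by
    filter_upwards [hbd] with x hx
    rw [abs_mul]
    exact (mul_le_of_le_one_left (abs_nonneg _) (abs_cutoff_le M x)).trans hx
  refine (tendsto_comm hH hbd' hw (cutoff_isTest N) (abs_cutoff_le N) k).congr fun n => ?_
  refine lintegral_congr fun x => ?_
  by_cases hx : cutoff N x = 0
  · simp [hx]
  have hxR : ‖x‖ ≤ R := hR x (subset_tsupport _ hx)
  have hx2 := hM' x (by simpa using hxR.trans (by linarith))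
  have hc : comm n k (fun x => cutoff M x * b x) w x = comm n k b w x := by
    rw [comm_eq (memLp_l2loc hH.l2) (memLp_l2loc hw), comm_eq hb.l2 (memLp_l2loc hw)]
    refine integral_congr_ae (ae_of_all _ fun y => ?_)
    by_cases hy : pd k (eta n) y = 0
    · simp [hy]
    have h1 := norm_le_of_pd_eta_ne_zero hy
    have h2 : (2 : ℝ) / (n + 1) ≤ 2 :=
      div_le_self (by norm_num) (by linarith [n.cast_nonneg (α := ℝ)])
    have h3 := hM' (x - y) (by
      have := norm_sub_le x y
      simp only [Metric.mem_closedBall, dist_zero_right]; linarith)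
    simp only [hx2.1, h3.1, one_mul]
  rw [hc, hx2.1, hx2.2 k]; simp

/-- The hypothesis `heq` says `div(bw) = h`, and formally `∫ w h = ∫ b·∇(w²/2) = 0`. As `w` is
merely in L², this is renormalisation: mollify, multiply by the bounded function `truncLin δ` of the
mollified `w`, use that commutators vanish in L¹, then remove the cutoff and finally the truncation.
-/
lemma transport_skew {b : Fin 2 → Plane → ℝ} {B : Fin 2 → Fin 2 → Plane → ℝ} {Cb : ℝ}
    {w h : Plane → ℝ} (hb : ∀ k, H1loc (b k) (B k)) (hCb : 0 ≤ Cb)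
    (hbd : ∀ k, ∀ᵐ x, |b k x| ≤ Cb)
    (hdiv : ∀ᵐ x, B 0 0 x + B 1 1 x = 0) (hw : MemLp w 2 volume) (hh : MemLp h 2 volume)
    (heq : ∀ φ, IsTest φ → (∫ x, w x * b 0 x * pd 0 φ x) + (∫ x, w x * b 1 x * pd 1 φ x) =
      - ∫ x, h x * φ x) : ∫ x, w x * h x = 0 := by
  have hwl := memLp_l2loc hw
  have hbw : ∀ k, LocallyIntegrable (fun x => b k x * w x) volume :=
    fun k => (hb k).l2.locallyIntegrable_mul hwl
  have hmollh : ∀ n x, pd 0 (moll n (fun t => b 0 t * w t)) x +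
      pd 1 (moll n (fun t => b 1 t * w t)) x = moll n h x := by
    intro n x
    have := heq _ (isTest_comp_sub (eta_isTest n) x)
    simp_rw [pd_comp_sub (eta_isTest n).differentiable] at this
    simp only [mul_neg, integral_neg] at this
    rw [pd_moll (hbw 0), pd_moll (hbw 1)]
    unfold moll
    have e : ∀ k, ∫ t, pd k (eta n) (x - t) * (b k t * w t) =
        ∫ t, w t * b k t * pd k (eta n) (x - t) := fun k =>
      integral_congr_ae (ae_of_all _ fun t => by simp only; ring)
    rw [e, e]
    simp_rw [mul_comm (eta n _)]
    linarith
  obtain ⟨C, hC0, hC⟩ := exists_pd_cutoff_bound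
  have main : ∀ δ, 0 < δ → ∫ x, truncLin δ (w x) * h x = 0 := by
    intro δ hδ
    have hβ := contDiff_truncSq hδ
    have hγc : Continuous (truncLin δ) := by
      unfold truncLin
      exact continuous_id.div (by fun_prop) (fun s => by positivity)
    have hγm : ∀ f : Plane → ℝ, MemLp f 2 volume → MemLp (fun x => truncLin δ (f x)) 2 volume :=
      fun f hf => hf.of_le (hγc.comp_aestronglyMeasurable hf.1)
        (ae_of_all _ fun x => abs_truncLin_le hδ _)
    have hTγ : T2 (fun n x => truncLin δ (moll n w x)) (fun x => truncLin δ (w x)) := by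
      have hT := T2_moll hw
      refine ⟨fun n => hγm _ (hT.1 n), hγm _ hw, ?_⟩
      refine squeeze_zero (fun _ => n2_nonneg _) (fun n => ?_) hT.2.2
      exact n2_le_of_abs_le ((hT.1 n).sub hw) (ae_of_all _ fun x => abs_truncLin_sub_le hδ _ _)
    -- After the mollification is removed, what survives is the flux of `truncSq δ w` through the
    -- gradient of the cutoff, once for each of the two components of `b`.
    have bound : ∀ N : ℕ, |∫ x, cutoff N x * truncLin δ (w x) * h x| ≤
        2 * Cb * n2 w ^ 2 * (C * (1 / ((N : ℝ) + 1))) := by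
      intro N
      have hc := cutoff_isTest N
      -- The chain rule makes `truncLin δ (wₙ) ∇wₙ` the gradient of `truncSq δ (wₙ)`; integrating by
      -- parts against the divergence free `b` moves it to the cutoff.
      have ident : ∀ n, (∫ x, cutoff N x * truncLin δ (moll n w x) * moll n h x) =
          -(∫ x, cutoff N x * truncLin δ (moll n w x) *
              (comm n 0 (b 0) w x + comm n 1 (b 1) w x))
          - ((∫ x, b 0 x * (pd 0 (cutoff N) x * truncSq δ (moll n w x)))
            + ∫ x, b 1 x * (pd 1 (cutoff N) x * truncSq δ (moll n w x))) := by
        intro n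
        have hsm := moll_contDiff hwl.locallyIntegrable n
        have hs2 : ContDiff ℝ ((⊤ : ℕ∞) : WithTop ℕ∞) (fun x => truncSq δ (moll n w x)) :=
          hβ.comp hsm
        have hφ : IsTest (fun x => cutoff N x * truncSq δ (moll n w x)) := by
          simpa only [mul_comm] using hc.smooth_mul hs2
        have hpd : ∀ k x, pd k (fun x => cutoff N x * truncSq δ (moll n w x)) x =
            cutoff N x * (truncLin δ (moll n w x) * pd k (moll n w) x) +
              pd k (cutoff N) x * truncSq δ (moll n w x) := by
          intro k x
          rw [pd_mul hc.differentiable (hs2.differentiable (by simp))]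
          congr 2
          have h1 := (hsm.differentiable (by simp) x).hasFDerivAt
          have h2 := (hasDerivAt_truncSq hδ (moll n w x)).comp_hasFDerivAt x h1
          unfold pd
          rw [show (fun x => truncSq δ (moll n w x)) = truncSq δ ∘ moll n w from rfl, h2.fderiv]
          simp
        have hcγ : Continuous (fun x => truncLin δ (moll n w x)) := hγc.comp hsm.continuous
        have s1 : ∀ k, Integrable (fun x => b k x * (cutoff N x *
            (truncLin δ (moll n w x) * pd k (moll n w) x))) := fun k => by
          refine (integrable_mul_test ((hb k).l2.locallyIntegrable_mul (continuous_l2loc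
            (hcγ.mul (contDiff_pd hsm k).continuous))) hc).congr (ae_of_all _ fun x => ?_)
          simp only [Pi.mul_apply]; ring
        have s2 : ∀ k, Integrable (fun x => b k x * (pd k (cutoff N) x *
            truncSq δ (moll n w x))) := fun k => by
          refine (integrable_mul_test ((hb k).l2.locallyIntegrable_mul (continuous_l2loc
            hs2.continuous)) (hc.pd k)).congr (ae_of_all _ fun x => ?_)
          simp only; ring
        have hk : ∀ k, (∫ x, b k x * (cutoff N x * (truncLin δ (moll n w x) * pd k (moll n w) x))) +
            ∫ x, b k x * (pd k (cutoff N) x * truncSq δ (moll n w x)) =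
            - ∫ x, B k k x * (cutoff N x * truncSq δ (moll n w x)) := by
          intro k
          rw [← integral_add (s1 k) (s2 k), ← ((hb k).weak k).2.2 _ hφ]
          refine integral_congr_ae (ae_of_all _ fun x => ?_)
          simp only [hpd]; ring
        have hd0 : (∫ x, B 0 0 x * (cutoff N x * truncSq δ (moll n w x))) +
            ∫ x, B 1 1 x * (cutoff N x * truncSq δ (moll n w x)) = 0 := by
          rw [← integral_add (integrable_mul_test ((hb 0).weak 0).2.1 hφ)
            (integrable_mul_test ((hb 1).weak 1).2.1 hφ), ← integral_zero Plane ℝ]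
          refine integral_congr_ae ?_
          filter_upwards [hdiv] with x hx
          rw [← add_mul, hx, zero_mul]
        have s3 : Integrable (fun x => cutoff N x * truncLin δ (moll n w x) * moll n h x) := by
          refine ((continuous_l2loc hcγ).locallyIntegrable_mul (moll_l2loc (memLp_l2loc hh) n)
            |> (integrable_mul_test · hc)).congr (ae_of_all _ fun x => ?_)
          simp only; ring
        have hsum : ∀ x, cutoff N x * truncLin δ (moll n w x) *
              (comm n 0 (b 0) w x + comm n 1 (b 1) w x) =
            b 0 x * (cutoff N x * (truncLin δ (moll n w x) * pd 0 (moll n w) x)) +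
            b 1 x * (cutoff N x * (truncLin δ (moll n w x) * pd 1 (moll n w) x)) -
            cutoff N x * truncLin δ (moll n w x) * moll n h x := by
          intro x
          rw [← hmollh]; unfold comm; ring
        simp_rw [hsum]
        have s01 : Integrable (fun x =>
            b 0 x * (cutoff N x * (truncLin δ (moll n w x) * pd 0 (moll n w) x)) +
            b 1 x * (cutoff N x * (truncLin δ (moll n w x) * pd 1 (moll n w) x))) :=
          (s1 0).add (s1 1)
        have e1 : ∫ x, (b 0 x * (cutoff N x * (truncLin δ (moll n w x) * pd 0 (moll n w) x)) +
            b 1 x * (cutoff N x * (truncLin δ (moll n w x) * pd 1 (moll n w) x)) -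
            cutoff N x * truncLin δ (moll n w x) * moll n h x) =
            (∫ x, b 0 x * (cutoff N x * (truncLin δ (moll n w x) * pd 0 (moll n w) x))) +
            (∫ x, b 1 x * (cutoff N x * (truncLin δ (moll n w x) * pd 1 (moll n w) x))) -
            ∫ x, cutoff N x * truncLin δ (moll n w x) * moll n h x := by
          rw [integral_sub s01 s3, integral_add (s1 0) (s1 1)]
        rw [e1]
        linarith [hk 0, hk 1]
      -- the limit
      have hTc : T2 (fun n x => cutoff N x * truncLin δ (moll n w x))
          (fun x => cutoff N x * truncLin δ (w x)) :=
        hTγ.bdd_mul hc.continuous.aestronglyMeasurable (ae_of_all _ (abs_cutoff_le N))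
      have lim1 := (hTc.integral_mul_T2 (T2_moll hh)).abs
      have lim2 : Tendsto (fun n => |∫ x, cutoff N x * truncLin δ (moll n w x) *
              (comm n 0 (b 0) w x + comm n 1 (b 1) w x)|) atTop (𝓝 0) := by
        have hz : Tendsto (fun n => ENNReal.ofReal (1 + 1 / δ) *
            ((∫⁻ x, ‖cutoff N x * (comm n 0 (b 0) w x + B 0 0 x * w x)‖ₑ) +
            ∫⁻ x, ‖cutoff N x * (comm n 1 (b 1) w x + B 1 1 x * w x)‖ₑ)) atTop (𝓝 0) := by
          have := ENNReal.Tendsto.const_mul ((tendsto_comm_local (hb 0) (hbd 0) hw N 0).add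
            (tendsto_comm_local (hb 1) (hbd 1) hw N 1)) (a := ENNReal.ofReal (1 + 1 / δ))
            (Or.inr ENNReal.ofReal_ne_top)
          simpa using this
        have hz2 : Tendsto (fun n => ‖∫ x, cutoff N x * truncLin δ (moll n w x) *
              (comm n 0 (b 0) w x + comm n 1 (b 1) w x)‖ₑ) atTop (𝓝 0) := by
          refine tendsto_of_tendsto_of_tendsto_of_le_of_le tendsto_const_nhds hz
            (fun _ => zero_le) fun n => ?_
          refine (enorm_integral_le_lintegral_enorm _).trans ?_
          have hsm := fun f (hf : LocallyIntegrable f volume) k =>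
            (contDiff_pd (moll_contDiff hf n) k).continuous.aestronglyMeasurable
              (μ := (volume : Measure Plane))
          have hcm : ∀ k, AEStronglyMeasurable (comm n k (b k) w) volume := fun k =>
            ((hb k).l2.1.mul (hsm _ hwl.locallyIntegrable k)).sub (hsm _ (hbw k) k)
          have hmeas : AEMeasurable (fun x => ‖cutoff N x *
              (comm n 0 (b 0) w x + B 0 0 x * w x)‖ₑ) volume :=
            (hc.continuous.aestronglyMeasurable.mul
              ((hcm 0).add (((hb 0).dl2 0).1.mul hw.1))).enorm
          rw [← lintegral_add_left' hmeas, ← lintegral_const_mul' _ _ ENNReal.ofReal_ne_top]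
          refine lintegral_mono_ae ?_
          filter_upwards [hdiv] with x hx
          -- Adding `(B 0 0 + B 1 1) w = 0` completes the commutators to the combinations that
          -- converge. The multiplier must be bounded because this convergence is only in L¹.
          have e1 : cutoff N x * truncLin δ (moll n w x) *
              (comm n 0 (b 0) w x + comm n 1 (b 1) w x) = truncLin δ (moll n w x) *
              (cutoff N x * (comm n 0 (b 0) w x + B 0 0 x * w x) +
              cutoff N x * (comm n 1 (b 1) w x + B 1 1 x * w x)) := by
            linear_combination (- truncLin δ (moll n w x) * cutoff N x * w x) * hx
          rw [e1, enorm_mul]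
          gcongr
          · rw [Real.enorm_eq_ofReal_abs]
            exact ENNReal.ofReal_le_ofReal (abs_truncLin_le' hδ _)
          · exact enorm_add_le _ _
        have := (ENNReal.tendsto_toReal ENNReal.zero_ne_top).comp hz2
        simpa only [Function.comp_def, toReal_enorm, Real.norm_eq_abs, ENNReal.toReal_zero] using this
      have bd3 : ∀ n k, |∫ x, b k x * (pd k (cutoff N) x * truncSq δ (moll n w x))| ≤
          Cb * n2 w ^ 2 * (C * (1 / ((N : ℝ) + 1))) := by
        intro n k
        have hmw := memLp_moll hw n
        have hle : n2 (moll n w) ^ 2 ≤ n2 w ^ 2 :=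
          pow_le_pow_left₀ (n2_nonneg _) (n2_moll_le hw n) 2
        calc _ ≤ ∫ x, Cb * (C * (1 / ((N : ℝ) + 1))) * (moll n w x * moll n w x) := by
              rw [← Real.norm_eq_abs]
              refine norm_integral_le_of_norm_le ((integrable_mul_of_memLp hmw hmw).const_mul
                (Cb * (C * (1 / ((N : ℝ) + 1))))) ?_
              filter_upwards [hbd k] with x hx
              rw [norm_mul, norm_mul, mul_assoc]
              have h1 := hC N k x
              rw [div_eq_mul_one_div] at h1
              have h2 := abs_truncSq_le hδ (moll n w x)
              simp only [Real.norm_eq_abs]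
              gcongr
          _ = Cb * (C * (1 / ((N : ℝ) + 1))) * n2 (moll n w) ^ 2 := by
              rw [integral_const_mul, n2_sq hmw]
          _ ≤ Cb * (C * (1 / ((N : ℝ) + 1))) * n2 w ^ 2 := by gcongr
          _ = _ := by ring
      refine le_of_tendsto_of_tendsto' lim1 (lim2.add_const
        (2 * Cb * n2 w ^ 2 * (C * (1 / ((N : ℝ) + 1))))) (fun n => ?_) |>.trans_eq (by ring)
      rw [ident n]
      refine (abs_sub _ _).trans ?_
      rw [abs_neg]
      refine add_le_add le_rfl ((abs_add_le _ _).trans ?_)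
      have := bd3 n 0
      have := bd3 n 1
      linarith
    have l1 : Tendsto (fun N => ∫ x, cutoff N x * truncLin δ (w x) * h x) atTop
        (𝓝 (∫ x, truncLin δ (w x) * h x)) := (T2_cutoff (hγm _ hw)).integral_mul hh
    have l2 : Tendsto (fun N : ℕ => 2 * Cb * n2 w ^ 2 * (C * (1 / ((N : ℝ) + 1)))) atTop (𝓝 0) := by
      simpa using ((tendsto_one_div_add_atTop_nhds_zero_nat (𝕜 := ℝ)).const_mul C).const_mul
        (2 * Cb * n2 w ^ 2)
    have := le_of_tendsto_of_tendsto' l1.abs l2 bound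
    exact abs_nonpos_iff.1 this
  -- Removal of the truncation, dominated by `|w h|`.
  have lim : Tendsto (fun m : ℕ => ∫ x, truncLin (1 / ((m : ℝ) + 1)) (w x) * h x) atTop
      (𝓝 (∫ x, w x * h x)) := by
    refine tendsto_integral_of_dominated_convergence (fun x => |w x * h x|) (fun m => ?_)
      (integrable_mul_of_memLp hw hh).abs (fun m => ae_of_all _ fun x => ?_)
      (ae_of_all _ fun x => ?_)
    · have hγc : Continuous (truncLin (1 / ((m : ℝ) + 1))) := by
        unfold truncLin
        exact continuous_id.div (by fun_prop) (fun s => by positivity)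
      exact (hγc.comp_aestronglyMeasurable hw.1).mul hh.1
    · rw [norm_mul, abs_mul]
      have := abs_truncLin_le (δ := 1 / ((m : ℝ) + 1)) (by positivity) (w x)
      simp only [Real.norm_eq_abs]
      gcongr
    · refine Tendsto.mul_const _ ?_
      have h0 := tendsto_one_div_add_atTop_nhds_zero_nat (𝕜 := ℝ)
      have h1 := ((h0.mul_const (w x ^ 2)).const_add 1)
      have := (tendsto_const_nhds (x := w x)).div h1 (by simp)
      simpa [truncLin, Pi.div_def] using this
  refine tendsto_nhds_unique lim (tendsto_const_nhds.congr fun m => ?_)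
  rw [main _ (by positivity)]

/-! ### The Sobolev embedding of `H¹(ℝ²)` in `L^r` -/

lemma IsTest.pow {u : Plane → ℝ} (hu : IsTest u) (k : ℕ) : IsTest (fun x => u x ^ (k + 1)) := by
  induction k with
  | zero => simpa using hu
  | succ k ih => simpa only [pow_succ] using hu.smooth_mul ih.1

lemma pd_pow {u : Plane → ℝ} (hu : Differentiable ℝ u) (k : ℕ) (i : Fin 2) (x : Plane) :
    pd i (fun x => u x ^ (k + 1)) x = (k + 1) * (u x ^ k * pd i u x) := by
  unfold pd
  rw [((hu x).hasFDerivAt.pow (k + 1)).fderiv]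
  simp [mul_assoc]

/-- The Sobolev inequality `‖v‖_{L²} ≤ C ‖∇v‖_{L¹}`. -/
lemma exists_sobolev_one : ∃ C : ℝ≥0, ∀ v : Plane → ℝ, IsTest v →
    eLpNorm v 2 volume ≤ C * ((∫⁻ x, ‖pd 0 v x‖ₑ) + ∫⁻ x, ‖pd 1 v x‖ₑ) := by
  refine ⟨eLpNormLESNormFDerivOneConst (volume : Measure Plane) 2, fun v hv => ?_⟩
  have h := eLpNorm_le_eLpNorm_fderiv_one (μ := (volume : Measure Plane)) (p := 2)
    (hv.1.of_le (by norm_cast)) hv.2 (by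
      rw [finrank_euclideanSpace_fin]
      constructor <;> norm_num)
  refine h.trans (mul_le_mul_right ?_ _)
  rw [eLpNorm_one_eq_lintegral_enorm]
  rw [← lintegral_add_left (hv.pd 0).continuous.enorm.measurable]
  refine lintegral_mono fun x => ?_
  rw [← ofReal_norm, ← ofReal_norm, ← ofReal_norm, ← ENNReal.ofReal_add (norm_nonneg _) (norm_nonneg _)]
  refine ENNReal.ofReal_le_ofReal (ContinuousLinearMap.opNorm_le_bound _ (by positivity) fun w => ?_)
  rw [fderiv_apply_eq, add_mul]
  refine (norm_add_le _ _).trans (add_le_add ?_ ?_) <;>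
  · rw [norm_mul, mul_comm]
    exact mul_le_mul_of_nonneg_left (PiLp.norm_apply_le w _) (norm_nonneg _)

/-- The `H¹` norm, with gradient `D`. -/
def h1n (f : Plane → ℝ) (D : Fin 2 → Plane → ℝ) : ℝ := n2 f + n2 (D 0) + n2 (D 1)

lemma h1n_nonneg (f : Plane → ℝ) (D : Fin 2 → Plane → ℝ) : 0 ≤ h1n f D :=
  add_nonneg (add_nonneg (n2_nonneg _) (n2_nonneg _)) (n2_nonneg _)

/-- Induction on the power: the Sobolev inequality from W^{1,1} to L² is applied to `u^(k+2)`, whose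
gradient `(k+2) u^(k+1) ∇u` is bounded in L¹ by Cauchy–Schwarz. -/
lemma exists_n2_pow_le (k : ℕ) : ∃ C : ℝ, 0 ≤ C ∧ ∀ u : Plane → ℝ, IsTest u →
    n2 (fun x => u x ^ (k + 1)) ≤ C * h1n u (fun i => pd i u) ^ (k + 1) := by
  obtain ⟨C₁, hC₁⟩ := exists_sobolev_one
  induction k with
  | zero =>
    refine ⟨1, zero_le_one, fun u _ => ?_⟩
    have h0 := n2_nonneg (pd 0 u)
    have h1 := n2_nonneg (pd 1 u)
    simp only [zero_add, pow_one, one_mul, h1n]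
    linarith
  | succ k ih =>
    obtain ⟨C, hC0, hC⟩ := ih
    refine ⟨C₁ * ((k + 2) * (2 * C)), by positivity, fun u hu => ?_⟩
    have hn := h1n_nonneg u (fun i => pd i u)
    have hi : ∀ i, ∫⁻ x, ‖pd i (fun x => u x ^ (k + 1 + 1)) x‖ₑ ≤
        ENNReal.ofReal ((k + 2) * (C * h1n u (fun i => pd i u) ^ (k + 2))) := by
      intro i
      simp_rw [pd_pow hu.differentiable]
      have e : ∀ x, ‖((k + 1 : ℕ) + 1 : ℝ) * (u x ^ (k + 1) * pd i u x)‖ₑ =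
          ENNReal.ofReal (k + 2) * ‖u x ^ (k + 1) * pd i u x‖ₑ := by
        intro x
        rw [enorm_mul, Real.enorm_eq_ofReal (by positivity)]
        push_cast; congr 2; ring
      simp_rw [e]
      rw [lintegral_const_mul' _ _ ENNReal.ofReal_ne_top, ENNReal.ofReal_mul (by positivity)]
      refine mul_le_mul_right ?_ _
      refine (lintegral_mul_le_n2 ((hu.pow k).memLp 2) ((hu.pd i).memLp 2)).trans
        (ENNReal.ofReal_le_ofReal ?_)
      have h2 : n2 (pd i u) ≤ h1n u (fun i => pd i u) := by
        have h0 := n2_nonneg (pd 0 u)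
        have h1 := n2_nonneg (pd 1 u)
        have h2 := n2_nonneg u
        unfold h1n
        fin_cases i <;> simp <;> linarith
      calc _ ≤ (C * h1n u (fun i => pd i u) ^ (k + 1)) * h1n u (fun i => pd i u) :=
            mul_le_mul (hC u hu) h2 (n2_nonneg _) (by positivity)
        _ = _ := by ring
    have h := (hC₁ _ (hu.pow (k + 1))).trans (mul_le_mul_right (add_le_add (hi 0) (hi 1)) _)
    rw [← ENNReal.ofReal_add (by positivity) (by positivity), ← ENNReal.ofReal_coe_nnreal,
      ← ENNReal.ofReal_mul (by positivity)] at h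
    refine (ENNReal.toReal_le_of_le_ofReal (by positivity) h).trans_eq ?_
    ring

/-- Pointwise, `|u|^r ≤ |u|² + |u|^(2k+2)` when `2 ≤ r ≤ 2k + 2`, and the even powers are covered by
`exists_n2_pow_le`. -/
lemma exists_eLpNorm_le_of_h1n_le_one {r : ℝ≥0∞} (hr : 2 ≤ r) (hr' : r ≠ ⊤) :
    ∃ C : ℝ, 0 ≤ C ∧ ∀ u : Plane → ℝ, IsTest u → h1n u (fun i => pd i u) ≤ 1 →
      eLpNorm u r volume ≤ ENNReal.ofReal C := by
  obtain ⟨k, hk⟩ := exists_nat_ge r.toReal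
  obtain ⟨C, hC0, hC⟩ := exists_n2_pow_le k
  have hr2 : 2 ≤ r.toReal := by
    rw [← ENNReal.toReal_ofNat]; exact ENNReal.toReal_mono hr' hr
  refine ⟨(1 + C ^ 2) ^ (1 / r.toReal), by positivity, fun u hu h1 => ?_⟩
  have hr0 : r ≠ 0 := by rintro rfl; simp at hr
  rw [eLpNorm_eq_lintegral_rpow_enorm_toReal hr0 hr',
    ← ENNReal.ofReal_rpow_of_nonneg (by positivity) (by positivity)]
  refine ENNReal.rpow_le_rpow ?_ (by positivity)
  have hint : ∀ v : Plane → ℝ, IsTest v → ∫⁻ x, ‖v x * v x‖ₑ = ENNReal.ofReal (n2 v ^ 2) := by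
    intro v hv
    rw [n2_sq (hv.memLp 2), ofReal_integral_eq_lintegral_ofReal
      (integrable_mul_of_memLp (hv.memLp 2) (hv.memLp 2)) (ae_of_all _ fun x => mul_self_nonneg _)]
    exact lintegral_congr fun x => Real.enorm_eq_ofReal (mul_self_nonneg _)
  have hle : ∀ x, ‖u x‖ₑ ^ r.toReal ≤ ‖u x * u x‖ₑ + ‖u x ^ (k + 1) * u x ^ (k + 1)‖ₑ := by
    intro x
    rcases le_total ‖u x‖ₑ 1 with h | h
    · refine le_trans ?_ le_self_add
      rw [enorm_mul, ← pow_two, ← ENNReal.rpow_two]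
      exact ENNReal.rpow_le_rpow_of_exponent_ge h hr2
    · refine le_trans ?_ le_add_self
      rw [enorm_mul, enorm_pow, ← pow_add, ← ENNReal.rpow_natCast]
      refine ENNReal.rpow_le_rpow_of_exponent_le h (hk.trans ?_)
      push_cast; linarith [k.cast_nonneg (α := ℝ)]
  refine (lintegral_mono hle).trans ?_
  have hmeas : Measurable (fun x => ‖u x * u x‖ₑ) :=
    (hu.continuous.mul hu.continuous).enorm.measurable
  rw [lintegral_add_left hmeas, hint u hu, hint _ (hu.pow k),
    ← ENNReal.ofReal_add (by positivity) (by positivity)]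
  refine ENNReal.ofReal_le_ofReal (add_le_add ?_ ?_)
  · have h0 := n2_nonneg (pd 0 u)
    have h2 := n2_nonneg (pd 1 u)
    refine pow_le_one₀ (n2_nonneg _) ?_
    unfold h1n at h1; linarith
  · refine pow_le_pow_left₀ (n2_nonneg _) ((hC u hu).trans ?_) 2
    exact mul_le_of_le_one_right hC0 (pow_le_one₀ (h1n_nonneg _ _) h1)

lemma exists_eLpNorm_le_h1n {r : ℝ≥0∞} (hr : 2 ≤ r) (hr' : r ≠ ⊤) :
    ∃ C : ℝ, 0 ≤ C ∧ ∀ f D, H1 f D → eLpNorm f r volume ≤ ENNReal.ofReal (C * h1n f D) := by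
  obtain ⟨C, hC0, hC⟩ := exists_eLpNorm_le_of_h1n_le_one hr hr'
  -- Homogeneity, with any positive upper bound `s` in place of the norm so that division is safe.
  -- For general `f` one takes `s` slightly above the limit norm and applies Fatou along a
  -- subsequence converging almost everywhere.
  have htest : ∀ u, IsTest u → ∀ s, 0 < s → h1n u (fun i => pd i u) ≤ s →
      eLpNorm u r volume ≤ ENNReal.ofReal (C * s) := by
    intro u hu s hs hle
    have hv : IsTest (fun x => s⁻¹ * u x) := by
      simpa only [mul_comm] using hu.smooth_mul (f := fun _ => s⁻¹) contDiff_const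
    have hpd : ∀ i, pd i (fun x => s⁻¹ * u x) = fun x => s⁻¹ * pd i u x := fun i =>
      funext fun x => pd_const_mul hu.differentiable _ _ _
    have h1 := hC _ hv (by
      simp only [h1n, hpd, n2_const_mul, abs_of_pos (inv_pos.2 hs)] at hle ⊢
      rw [← mul_add, ← mul_add, inv_mul_le_one₀ hs]; exact hle)
    have e : u = s • (fun x => s⁻¹ * u x) := by
      funext x; simp [hs.ne']
    rw [e, eLpNorm_const_smul, mul_comm C, ENNReal.ofReal_mul hs.le, Real.enorm_eq_ofReal hs.le]
    exact mul_le_mul_right h1 _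
  refine ⟨C, hC0, fun f D h => ?_⟩
  obtain ⟨F, hF, h0, h1⟩ := h.exists_test_approx
  have hlim : Tendsto (fun n => h1n (F n) (fun i => pd i (F n))) atTop (𝓝 (h1n f D)) :=
    (h0.norm.add (h1 0).norm).add (h1 1).norm
  have hm : TendstoInMeasure volume F atTop f := by
    refine tendstoInMeasure_of_tendsto_eLpNorm (p := 2) (by norm_num) (fun n => ((hF n).memLp 2).1) h.l2.1 ?_
    have := (ENNReal.continuous_ofReal.tendsto 0).comp h0.2.2
    rw [ENNReal.ofReal_zero] at this
    refine this.congr fun n => ?_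
    exact ENNReal.ofReal_toReal ((h0.1 n).sub h.l2).2.ne
  obtain ⟨ns, hns, hae⟩ := hm.exists_seq_tendsto_ae
  refine (Lp.eLpNorm_lim_le_liminf_eLpNorm (fun n => ((hF (ns n)).memLp 2).1) f hae).trans ?_
  refine ENNReal.le_of_forall_pos_le_add fun ε hε _ => ?_
  have hlim2 : Tendsto (fun δ : ℝ => ENNReal.ofReal (C * (h1n f D + δ))) (𝓝[>] 0)
      (𝓝 (ENNReal.ofReal (C * (h1n f D + 0)))) := by
    refine (Continuous.tendsto ?_ 0).mono_left nhdsWithin_le_nhds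
    exact ENNReal.continuous_ofReal.comp (by fun_prop)
  rw [add_zero] at hlim2
  refine le_add_right (ge_of_tendsto hlim2 ?_)
  filter_upwards [self_mem_nhdsWithin] with δ hδ
  have hδ : 0 < δ := hδ
  have hev := ((hlim.comp hns.tendsto_atTop).eventually (ge_mem_nhds (lt_add_of_pos_right _ hδ)))
  refine (liminf_le_liminf (v := fun _ => ENNReal.ofReal (C * (h1n f D + δ))) ?_).trans_eq
    (by simp)
  filter_upwards [hev] with n hn
  exact htest _ (hF _) _ (by linarith [h1n_nonneg f D]) hn

/-- Products of `H¹` and `L^q` functions, `q > 2`, are square integrable. -/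
lemma exists_n2_mul_le {q : ℝ≥0∞} (hq : 2 < q) :
    ∃ C : ℝ, 0 ≤ C ∧ ∀ f D g, H1 f D → MemLp g q volume →
      MemLp (fun x => f x * g x) 2 volume ∧
        n2 (fun x => f x * g x) ≤ C * h1n f D * (eLpNorm g q volume).toReal := by
  have hlt : q⁻¹ < 2⁻¹ := ENNReal.inv_lt_inv.2 hq
  have hr2 : 2 ≤ (2⁻¹ - q⁻¹)⁻¹ := by
    rw [ENNReal.le_inv_iff_le_inv]; exact tsub_le_self
  have hrtop : (2⁻¹ - q⁻¹)⁻¹ ≠ ⊤ := ENNReal.inv_ne_top.2 (tsub_pos_of_lt hlt).ne'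
  obtain ⟨C, hC0, hC⟩ := exists_eLpNorm_le_h1n hr2 hrtop
  refine ⟨C, hC0, fun f D g hf hg => ?_⟩
  -- Hölder with the exponent `2q/(q-2)`, which is finite exactly because `q > 2`.
  have : ENNReal.HolderTriple (2⁻¹ - q⁻¹)⁻¹ q 2 := ⟨by
    rw [inv_inv, tsub_add_cancel_of_le hlt.le]⟩
  have h := eLpNorm_smul_le_mul_eLpNorm (p := (2⁻¹ - q⁻¹)⁻¹) (q := q) (r := 2) hg.1 hf.l2.1
  have h2 := h.trans (mul_le_mul_left (hC f D hf) _)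
  have hfin : ENNReal.ofReal (C * h1n f D) * eLpNorm g q volume < ⊤ :=
    ENNReal.mul_lt_top ENNReal.ofReal_lt_top hg.2
  refine ⟨⟨hf.l2.1.mul hg.1, h2.trans_lt hfin⟩, ?_⟩
  refine (ENNReal.toReal_mono hfin.ne h2).trans_eq ?_
  rw [ENNReal.toReal_mul, ENNReal.toReal_ofReal (mul_nonneg hC0 (h1n_nonneg _ _))]

/-! ### Functions with vanishing integral -/

/-- `f` is integrable with integral zero. -/
def ZeroInt (f : Plane → ℝ) : Prop := Integrable f volume ∧ ∫ x, f x = 0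

namespace ZeroInt

variable {f g : Plane → ℝ}

lemma add (hf : ZeroInt f) (hg : ZeroInt g) : ZeroInt (fun x => f x + g x) :=
  ⟨hf.1.add hg.1, by rw [integral_add hf.1 hg.1, hf.2, hg.2, add_zero]⟩

lemma neg (hf : ZeroInt f) : ZeroInt (fun x => - f x) :=
  ⟨hf.1.neg, by rw [integral_neg, hf.2, neg_zero]⟩

lemma sub (hf : ZeroInt f) (hg : ZeroInt g) : ZeroInt (fun x => f x - g x) :=
  ⟨hf.1.sub hg.1, by rw [integral_sub hf.1 hg.1, hf.2, hg.2, sub_zero]⟩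

lemma congr (hf : ZeroInt f) (h : ∀ᵐ x, g x = f x) : ZeroInt g :=
  ⟨hf.1.congr (h.mono fun _ hx => hx.symm), by rw [integral_congr_ae h, hf.2]⟩

lemma of_eq {F G : Plane → ℝ} (hF : Integrable F) (hG : Integrable G)
    (h : ∫ x, F x = ∫ x, G x) : ZeroInt (fun x => F x - G x) :=
  ⟨hF.sub hG, by rw [integral_sub hF hG, h, sub_self]⟩

end ZeroInt

/-- The product rule against `ψ` in a form that can be added to other identities under one integral
sign. -/
lemma H1loc.zeroInt_mul {f g ψ : Plane → ℝ} {D E : Fin 2 → Plane → ℝ} (hf : H1loc f D)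
    (hg : H1loc g E) (hψ : IsTest ψ) (i : Fin 2) :
    ZeroInt (fun x => f x * (E i x * ψ x + g x * pd i ψ x) + D i x * g x * ψ x) := by
  have h := hf.mul_weak hg i
  have h1 := integrable_mul_test h.1 (hψ.pd i)
  have h2 := integrable_mul_test h.2.1 hψ
  have h3 : ∫ x, f x * g x * pd i ψ x = ∫ x, -((f x * E i x + D i x * g x) * ψ x) := by
    rw [integral_neg]; exact h.2.2 ψ hψ
  exact (ZeroInt.of_eq h1 h2.neg h3).congr (ae_of_all _ fun x => by
    simp only [Pi.neg_apply]; ring)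

lemma H1loc.zeroInt_cross {f k ψ : Plane → ℝ} {D E : Fin 2 → Plane → ℝ} (hf : H1loc f D)
    (hk : H1loc k E) (hψ : IsTest ψ) :
    ZeroInt (fun x => D 0 x * (ψ x * E 1 x + pd 1 ψ x * k x) -
      D 1 x * (ψ x * E 0 x + pd 0 ψ x * k x)) := by
  have hi : ∀ i j, Integrable (fun x => D i x * (ψ x * E j x + pd j ψ x * k x)) := fun i j => by
    refine ((integrable_test_pair (hf.dl2 i) (hk.dl2 j) hψ).add
      (integrable_test_pair (hf.dl2 i) hk.l2 (hψ.pd j))).congr (ae_of_all _ fun x => ?_)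
    simp only [Pi.add_apply]; ring
  exact ZeroInt.of_eq (hi 0 1) (hi 1 0) (integral_cross_local hf hk hψ)

/-- Weakly curl free fields can be tested with compactly supported `H¹` functions. -/
lemma zeroInt_curl_free {h : Fin 2 → Plane → ℝ} (hh : ∀ k, L2loc (h k))
    (hc : ∀ ψ, IsTest ψ → ∫ x, h 0 x * pd 1 ψ x = ∫ x, h 1 x * pd 0 ψ x)
    {s : Plane → ℝ} {S : Fin 2 → Plane → ℝ} (hs : H1loc s S) {ψ : Plane → ℝ} (hψ : IsTest ψ) :
    ZeroInt (fun x => h 0 x * (s x * pd 1 ψ x + S 1 x * ψ x) -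
      h 1 x * (s x * pd 0 ψ x + S 0 x * ψ x)) := by
  have hsm := fun n => moll_contDiff hs.l2.locallyIntegrable n
  have hi : ∀ {s S : Plane → ℝ} (_ : L2loc s) (_ : L2loc S) (i j : Fin 2),
      Integrable (fun x => h i x * (s x * pd j ψ x + S x * ψ x)) ∧
      ∫ x, h i x * (s x * pd j ψ x + S x * ψ x) =
        (∫ x, pd j ψ x * s x * h i x) + ∫ x, ψ x * S x * h i x := fun {s S} hs hS i j => by
    have i1 := integrable_test_pair hs (hh i) (hψ.pd j)
    have i2 := integrable_test_pair hS (hh i) hψ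
    have e : ∀ x, pd j ψ x * s x * h i x + ψ x * S x * h i x = h i x * (s x * pd j ψ x + S x * ψ x) :=
      fun x => by ring
    refine ⟨(i1.add i2).congr (ae_of_all _ e), ?_⟩
    rw [← integral_add i1 i2]
    exact integral_congr_ae (ae_of_all _ fun x => (e x).symm)
  refine ZeroInt.of_eq (hi hs.l2 (hs.dl2 1) 0 1).1 (hi hs.l2 (hs.dl2 0) 1 0).1 ?_
  have lim : ∀ i j, Tendsto (fun n => ∫ x, h i x * (moll n s x * pd j ψ x + moll n (S j) x * ψ x))
      atTop (𝓝 (∫ x, h i x * (s x * pd j ψ x + S j x * ψ x))) := fun i j => by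
    rw [(hi hs.l2 (hs.dl2 j) i j).2]
    refine ((tendsto_moll_pair hs.l2 (hh i) (hψ.pd j)).add
      (tendsto_moll_pair (hs.dl2 j) (hh i) hψ)).congr fun n => ?_
    rw [(hi (moll_l2loc hs.l2 n) (moll_l2loc (hs.dl2 j) n) i j).2]
  refine tendsto_nhds_unique (lim 0 1) ((lim 1 0).congr fun n => ?_)
  have hp : ∀ j x, pd j (fun x => moll n s x * ψ x) x = moll n s x * pd j ψ x + moll n (S j) x * ψ x := by
    intro j x
    rw [pd_mul ((hsm n).differentiable (by simp)) hψ.differentiable, (hs.weak j).pd_moll]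
  have := hc _ (hψ.smooth_mul (hsm n))
  simp_rw [hp] at this
  exact this.symm

/-! ### One flow at a fixed time -/

/-- The values at a fixed time of the density, its gradient `p` and Hessian `H`, of the velocity, its
gradient `D` and its time derivative `v`, and of `h = ∇(π - ρω)`. -/
structure State where
  r : Plane → ℝ
  p : Fin 2 → Plane → ℝ
  H : Fin 2 → Fin 2 → Plane → ℝ
  u : Fin 2 → Plane → ℝ
  D : Fin 2 → Fin 2 → Plane → ℝ
  v : Fin 2 → Plane → ℝ
  h : Fin 2 → Plane → ℝ

namespace State

variable (X : State)

/-- The vorticity. -/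
def om (x : Plane) : ℝ := X.D 0 1 x - X.D 1 0 x

/-- The part of the odd stress that is not a gradient. -/
def Q (k : Fin 2) (x : Plane) : ℝ :=
  ![-(X.D 1 0 x * X.p 0 x + X.D 1 1 x * X.p 1 x), X.D 0 0 x * X.p 0 x + X.D 0 1 x * X.p 1 x] k

/-- The time derivative of the density. -/
def dr (x : Plane) : ℝ := -(X.u 0 x * X.p 0 x + X.u 1 x * X.p 1 x)

/-- The good unknown `θ`. -/
def th (x : Plane) : ℝ := X.p 0 x * X.u 1 x + X.r x * X.D 0 1 x - X.p 1 x * X.u 0 x -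
  X.r x * X.D 1 0 x - X.H 0 0 x - X.H 1 1 x

/-- Half the gradient of `|u|²`. -/
def en (k : Fin 2) (x : Plane) : ℝ := X.u 0 x * X.D k 0 x + X.u 1 x * X.D k 1 x

/-- The source term in the equation for `θ`. -/
def thSource (x : Plane) : ℝ := X.en 1 x * X.p 0 x - X.en 0 x * X.p 1 x +
  (X.D 0 0 x * X.H 0 0 x + X.D 0 1 x * X.H 0 1 x + X.D 1 0 x * X.H 0 1 x + X.D 1 1 x * X.H 1 1 x)

/-- The inverse of the density. -/
def s (x : Plane) : ℝ := (X.r x)⁻¹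

/-- The gradient of the logarithm of the density. -/
def l (i : Fin 2) (x : Plane) : ℝ := X.s x * X.p i x

/-- The gradient of the inverse density. -/
def ds (i : Fin 2) (x : Plane) : ℝ := -(X.s x ^ 2 * X.p i x)

/-- The Hessian of the logarithm of the density. -/
def S (k i : Fin 2) (x : Plane) : ℝ := X.s x * X.H k i x - X.s x ^ 2 * (X.p k x * X.p i x)

/-- The velocity transporting the vorticity. -/
def b (k : Fin 2) (x : Plane) : ℝ := X.u k x + ![X.l 1 x, - X.l 0 x] k

/-- The gradient of `b`. -/
def B (i k : Fin 2) (x : Plane) : ℝ := X.D i k x + ![X.S i 1 x, - X.S i 0 x] k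

/-- The source term in the equation for the vorticity. -/
def omSource (x : Plane) : ℝ := X.h 0 x * X.ds 1 x - X.h 1 x * X.ds 0 x -
  (X.D 0 0 x * X.S 0 0 x + X.D 0 1 x * X.S 0 1 x + X.D 1 0 x * X.S 1 0 x + X.D 1 1 x * X.S 1 1 x)

/-- The bounds and equations satisfied by a weak solution at almost every time. -/
structure Valid (a c : ℝ) (M : ℝ) (X : State) : Prop where
  a_pos : 0 < a
  lower : ∀ᵐ x, a ≤ X.r x
  upper : ∀ᵐ x, X.r x ≤ c
  M_nonneg : 0 ≤ M
  weak_r : ∀ i, HasWeakPartial i X.r (X.p i)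
  weak_p : ∀ i k, HasWeakPartial i (X.p k) (X.H i k)
  H_l2loc : ∀ i k, L2loc (X.H i k)
  weak_u : ∀ i k, HasWeakPartial i (X.u k) (X.D i k)
  p_le : ∀ i, ∀ᵐ x, |X.p i x| ≤ M
  u_le : ∀ i, ∀ᵐ x, |X.u i x| ≤ M
  D_le : ∀ i k, ∀ᵐ x, |X.D i k x| ≤ M
  div : ∀ᵐ x, X.D 0 0 x + X.D 1 1 x = 0
  h_l2loc : ∀ k, L2loc (X.h k)
  momentum : ∀ k, ∀ᵐ x, X.r x * X.v k x + X.r x * (X.u 0 x * X.D 0 k x + X.u 1 x * X.D 1 k x) +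
    X.h k x + X.Q k x = 0
  curl_h : ∀ ψ, IsTest ψ → ∫ x, X.h 0 x * pd 1 ψ x = ∫ x, X.h 1 x * pd 0 ψ x

variable {X} {a c M : ℝ}

namespace Valid

variable (hX : X.Valid a c M)
include hX

lemma r_le : ∀ᵐ x, |X.r x| ≤ c := by
  filter_upwards [hX.lower, hX.upper] with x h1 h2
  rwa [abs_of_nonneg (hX.a_pos.le.trans h1)]

lemma h1_p (k : Fin 2) : H1loc (X.p k) (fun i => X.H i k) :=
  ⟨bdd_l2loc (hX.weak_r k).2.1.aestronglyMeasurable (hX.p_le k), fun i => hX.H_l2loc i k,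
    fun i => hX.weak_p i k⟩

lemma h1_r : H1loc X.r X.p :=
  ⟨bdd_l2loc (hX.weak_r 0).1.aestronglyMeasurable hX.r_le, fun i => (hX.h1_p i).l2, hX.weak_r⟩

lemma h1_u (k : Fin 2) : H1loc (X.u k) (fun i => X.D i k) :=
  ⟨bdd_l2loc (hX.weak_u 0 k).1.aestronglyMeasurable (hX.u_le k), fun i =>
    bdd_l2loc (hX.weak_u i k).2.1.aestronglyMeasurable (hX.D_le i k), fun i => hX.weak_u i k⟩

lemma h1_m (k : Fin 2) : H1loc (fun x => X.r x * X.u k x)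
    (fun i x => X.r x * X.D i k x + X.p i x * X.u k x) :=
  hX.h1_r.bdd_mul (hX.h1_u k) hX.r_le hX.p_le

lemma s_le : ∀ᵐ x, |X.s x| ≤ a⁻¹ := by
  filter_upwards [hX.lower] with x h1
  rw [State.s, abs_inv, abs_of_nonneg (hX.a_pos.le.trans h1)]
  exact inv_anti₀ hX.a_pos h1

lemma ds_le (i : Fin 2) : ∀ᵐ x, |X.ds i x| ≤ a⁻¹ ^ 2 * M := by
  filter_upwards [hX.s_le, hX.p_le i] with x h1 h2
  rw [State.ds, abs_neg, abs_mul, abs_pow]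
  have := hX.M_nonneg
  gcongr

lemma h1_s : H1loc X.s X.ds := hX.h1_r.inv hX.a_pos hX.lower

lemma h1_l (k : Fin 2) : H1loc (X.l k) (fun i => X.S i k) :=
  (hX.h1_s.bdd_mul (hX.h1_p k) hX.s_le hX.ds_le).congr (ae_of_all _ fun _ => rfl)
    fun i => ae_of_all _ fun x => by simp only [State.S, State.ds]; ring

lemma h1_b (k : Fin 2) : H1loc (X.b k) (fun i => X.B i k) := by
  fin_cases k
  · exact (hX.h1_u 0).add (hX.h1_l 1)
  · exact (hX.h1_u 1).add (hX.h1_l 0).neg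

lemma symm_H : ∀ᵐ x, X.H 1 0 x = X.H 0 1 x :=
  weak_mixed (hX.weak_r 0) (hX.weak_r 1) (hX.weak_p 1 0) (hX.weak_p 0 1)

/-- The part added to `u` is a rotated gradient; its divergence vanishes by symmetry of the Hessian.
-/
lemma div_b : ∀ᵐ x, X.B 0 0 x + X.B 1 1 x = 0 := by
  filter_upwards [hX.div, hX.symm_H] with x h1 h2
  simp only [State.B, State.S, Matrix.cons_val_zero, Matrix.cons_val_one, h2]
  linear_combination h1

lemma b_le (k : Fin 2) : ∀ᵐ x, |X.b k x| ≤ M + a⁻¹ * M := by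
  have hl : ∀ i, ∀ᵐ x, |X.l i x| ≤ a⁻¹ * M := fun i => by
    filter_upwards [hX.s_le, hX.p_le i] with x h1 h2
    rw [State.l, abs_mul]
    have := hX.a_pos
    gcongr
  filter_upwards [hX.u_le k, hl 0, hl 1] with x h1 h2 h3
  refine (abs_add_le _ _).trans (add_le_add h1 ?_)
  fin_cases k
  · exact h3
  · simpa using h2

/-- The common part of the equations for `∇^⊥·(ρu)` and for the vorticity. -/
lemma zeroInt_convection {m : Fin 2 → Plane → ℝ} {Dm : Fin 2 → Fin 2 → Plane → ℝ}
    (hm : ∀ k, H1loc (m k) (fun i => Dm i k)) {ψ : Plane → ℝ} (hψ : IsTest ψ) :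
    ZeroInt (fun x => -(X.u 0 x * Dm 0 0 x + X.u 1 x * Dm 1 0 x) * pd 1 ψ x +
      (X.u 0 x * Dm 0 1 x + X.u 1 x * Dm 1 1 x) * pd 0 ψ x -
      (Dm 0 1 x - Dm 1 0 x) * (X.u 0 x * pd 0 ψ x + X.u 1 x * pd 1 ψ x) -
      (Dm 0 0 x * X.D 1 0 x - Dm 1 0 x * X.D 0 0 x + Dm 0 1 x * X.D 1 1 x - Dm 1 1 x * X.D 0 1 x) *
        ψ x) := by
  -- The cross identities for `(m k, u k)` express the curl of `u·∇m` as transport of the curl of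
  -- `m` plus terms quadratic in first derivatives.
  have z := fun k => (hm k).zeroInt_cross (hX.h1_u k) hψ
  exact ((z 0).add (z 1)).neg.congr (ae_of_all _ fun x => by ring)

/-- Weak form of `∂ₜθ + u·∇θ = thSource`. The curl removes `h`; the curl of `Q` is `Δu·∇ρ + ∇u:∇²ρ`,
and its second order part cancels against the one in `Δ∂ₜρ = -Δ(u·∇ρ)`. This cancellation is the
reason for the choice of `θ`. -/
lemma zeroInt_theta {ψ : Plane → ℝ} (hψ : IsTest ψ) :
    ZeroInt (fun x => (X.dr x * X.u 0 x + X.r x * X.v 0 x) * pd 1 ψ x -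
      (X.dr x * X.u 1 x + X.r x * X.v 1 x) * pd 0 ψ x - X.dr x * lap ψ x -
      X.th x * (X.u 0 x * pd 0 ψ x + X.u 1 x * pd 1 ψ x) - X.thSource x * ψ x) := by
  have z1 : ZeroInt (fun x => X.h 0 x * pd 1 ψ x - X.h 1 x * pd 0 ψ x) :=
    .of_eq (integrable_mul_test (hX.h_l2loc 0).locallyIntegrable (hψ.pd 1))
      (integrable_mul_test (hX.h_l2loc 1).locallyIntegrable (hψ.pd 0)) (hX.curl_h ψ hψ)
  have z2 := hX.zeroInt_convection hX.h1_m hψ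
  -- These move one derivative off the Laplacian of `ψ` in the term `u·∇ρ`; `z4` and `z5` rearrange
  -- the Hessian terms that appear. No second derivative of `u` is ever formed.
  have z3 := fun k i => (hX.h1_p i).zeroInt_mul (hX.h1_u i) (hψ.pd k) k
  have z4 := (hX.h1_p 0).zeroInt_cross (hX.h1_u 1) hψ
  have z5 := (hX.h1_p 1).zeroInt_cross (hX.h1_u 0) hψ
  refine ((((((z2.sub z1).add (z3 0 0)).add (z3 0 1)).add (z3 1 0)).add (z3 1 1)).add
    (z4.sub z5)).congr ?_
  filter_upwards [hX.div, hX.symm_H, hX.momentum 0, hX.momentum 1] with x h1 h2 h3 h4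
  have h1' : X.D 1 1 x = - X.D 0 0 x := by linear_combination h1
  simp only [State.dr, State.th, State.thSource, State.en, State.Q, lap, Fin.sum_univ_two,
    Matrix.cons_val_zero, Matrix.cons_val_one] at h3 h4 ⊢
  rw [h2]
  rw [h1'] at h3 h4 ⊢
  linear_combination (pd 1 ψ x) * h3 - (pd 0 ψ x) * h4

/-- Weak form of `∂ₜω + b·∇ω = omSource`, from the curl of the momentum equation divided by `ρ`. The
curl of `Q/ρ` contains `Δu·∇ log ρ`, and `Δu = ∇^⊥ω` for divergence free `u`, which is the transport
added to `u` in `b`. The division leaves `h` only against the gradient of `1/ρ`. -/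
lemma zeroInt_vorticity {ψ : Plane → ℝ} (hψ : IsTest ψ) :
    ZeroInt (fun x => X.v 0 x * pd 1 ψ x - X.v 1 x * pd 0 ψ x -
      X.om x * (X.b 0 x * pd 0 ψ x + X.b 1 x * pd 1 ψ x) - X.omSource x * ψ x) := by
  have z1 := zeroInt_curl_free hX.h_l2loc hX.curl_h hX.h1_s hψ
  have z2 := hX.zeroInt_convection hX.h1_u hψ
  have z4 := (hX.h1_u 0).zeroInt_cross (hX.h1_l 1) hψ
  have z5 := (hX.h1_u 1).zeroInt_cross (hX.h1_l 0) hψ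
  refine ((z2.sub z1).add (z5.sub z4)).congr ?_
  filter_upwards [hX.div, hX.symm_H, hX.momentum 0, hX.momentum 1, hX.lower] with x h1 h2 h3 h4 h5
  have h1' : X.D 1 1 x = - X.D 0 0 x := by linear_combination h1
  have hr : X.s x * X.r x = 1 := inv_mul_cancel₀ (hX.a_pos.trans_le h5).ne'
  simp only [State.om, State.omSource, State.b, State.l, State.S, State.ds, State.Q,
    Matrix.cons_val_zero, Matrix.cons_val_one] at h3 h4 ⊢
  rw [h2]
  rw [h1'] at h3 h4 ⊢
  linear_combination (pd 1 ψ x) * X.s x * h3 - (pd 0 ψ x) * X.s x * h4 -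
    hr * (pd 1 ψ x * (X.v 0 x + X.u 0 x * X.D 0 0 x + X.u 1 x * X.D 1 0 x) -
      pd 0 ψ x * (X.v 1 x + X.u 0 x * X.D 0 1 x - X.u 1 x * X.D 0 0 x))

end Valid

end State

/-! ### Uniform bounds for families of functions -/

section Families

variable {σ : Type}

/-- `|f s| ≤ K w(s)` almost everywhere, with `K` independent of `s`. -/
def Unif (w : σ → ℝ) (f : σ → Plane → ℝ) : Prop :=
  ∃ K : ℝ, 0 ≤ K ∧ ∀ s, 0 ≤ w s ∧ AEStronglyMeasurable (f s) volume ∧ ∀ᵐ x, |f s x| ≤ K * w s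

/-- `‖f s‖_{L²} ≤ K w(s)`, with `K` independent of `s`. -/
def UnifL2 (w : σ → ℝ) (f : σ → Plane → ℝ) : Prop :=
  ∃ K : ℝ, 0 ≤ K ∧ ∀ s, 0 ≤ w s ∧ MemLp (f s) 2 volume ∧ n2 (f s) ≤ K * w s

variable {w w' : σ → ℝ} {f g : σ → Plane → ℝ}

lemma Unif.congr (h : Unif w f) (he : ∀ s, ∀ᵐ x, g s x = f s x) : Unif w g := by
  obtain ⟨K, hK, h⟩ := h
  refine ⟨K, hK, fun s => ⟨(h s).1, (h s).2.1.congr ((he s).mono fun _ hx => hx.symm), ?_⟩⟩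
  filter_upwards [(h s).2.2, he s] with x h1 h2
  rwa [h2]

lemma Unif.add (hf : Unif w f) (hg : Unif w g) : Unif w (fun s x => f s x + g s x) := by
  obtain ⟨K, hK, hf⟩ := hf
  obtain ⟨L, hL, hg⟩ := hg
  refine ⟨K + L, by positivity, fun s => ⟨(hf s).1, (hf s).2.1.add (hg s).2.1, ?_⟩⟩
  filter_upwards [(hf s).2.2, (hg s).2.2] with x h1 h2
  rw [add_mul]
  exact (abs_add_le _ _).trans (add_le_add h1 h2)

lemma Unif.neg (hf : Unif w f) : Unif w (fun s x => - f s x) := by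
  obtain ⟨K, hK, hf⟩ := hf
  exact ⟨K, hK, fun s => ⟨(hf s).1, (hf s).2.1.neg, by simpa only [abs_neg] using (hf s).2.2⟩⟩

lemma Unif.one_mul (hf : Unif (fun _ => 1) f) (hg : Unif w g) :
    Unif w (fun s x => f s x * g s x) := by
  obtain ⟨K, hK, hf⟩ := hf
  obtain ⟨L, hL, hg⟩ := hg
  refine ⟨K * L, by positivity, fun s => ⟨(hg s).1, (hf s).2.1.mul (hg s).2.1, ?_⟩⟩
  filter_upwards [(hf s).2.2, (hg s).2.2] with x h1 h2
  rw [abs_mul, mul_assoc]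
  rw [mul_one] at h1
  gcongr

lemma Unif.mono (hf : Unif w f) {C : ℝ} (hC : 0 ≤ C) (h : ∀ s, w s ≤ C * w' s)
    (h0 : ∀ s, 0 ≤ w' s) : Unif w' f := by
  obtain ⟨K, hK, hf⟩ := hf
  refine ⟨K * C, by positivity, fun s => ⟨h0 s, (hf s).2.1, ?_⟩⟩
  filter_upwards [(hf s).2.2] with x h1
  rw [mul_assoc]
  exact h1.trans (mul_le_mul_of_nonneg_left (h s) hK)

lemma UnifL2.congr (h : UnifL2 w f) (he : ∀ s, ∀ᵐ x, g s x = f s x) : UnifL2 w g := by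
  obtain ⟨K, hK, h⟩ := h
  exact ⟨K, hK, fun s => ⟨(h s).1, (h s).2.1.ae_eq ((he s).mono fun _ hx => hx.symm),
    (n2_congr (he s)).trans_le (h s).2.2⟩⟩

lemma UnifL2.add (hf : UnifL2 w f) (hg : UnifL2 w g) : UnifL2 w (fun s x => f s x + g s x) := by
  obtain ⟨K, hK, hf⟩ := hf
  obtain ⟨L, hL, hg⟩ := hg
  refine ⟨K + L, by positivity, fun s => ⟨(hf s).1, (hf s).2.1.add (hg s).2.1, ?_⟩⟩
  rw [add_mul]
  exact (n2_add_le (hf s).2.1 (hg s).2.1).trans (add_le_add (hf s).2.2 (hg s).2.2)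

lemma UnifL2.neg (hf : UnifL2 w f) : UnifL2 w (fun s x => - f s x) := by
  obtain ⟨K, hK, hf⟩ := hf
  refine ⟨K, hK, fun s => ⟨(hf s).1, (hf s).2.1.neg, ?_⟩⟩
  have := n2_const_mul (-1) (f s)
  simp only [neg_mul, _root_.one_mul, abs_neg, abs_one] at this
  rw [this]; exact (hf s).2.2

lemma UnifL2.sub (hf : UnifL2 w f) (hg : UnifL2 w g) : UnifL2 w (fun s x => f s x - g s x) := by
  simpa only [sub_eq_add_neg] using hf.add hg.neg

lemma UnifL2.mono (hf : UnifL2 w f) {C : ℝ} (hC : 0 ≤ C) (h : ∀ s, w s ≤ C * w' s)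
    (h0 : ∀ s, 0 ≤ w' s) : UnifL2 w' f := by
  obtain ⟨K, hK, hf⟩ := hf
  refine ⟨K * C, by positivity, fun s => ⟨h0 s, (hf s).2.1, ?_⟩⟩
  rw [mul_assoc]
  exact (hf s).2.2.trans (mul_le_mul_of_nonneg_left (h s) hK)

lemma Unif.mul_L2 (hf : Unif w f) (hg : UnifL2 w' g) :
    UnifL2 (fun s => w s * w' s) (fun s x => f s x * g s x) := by
  obtain ⟨K, hK, hf⟩ := hf
  obtain ⟨L, hL, hg⟩ := hg
  refine ⟨K * L, by positivity, fun s => ⟨mul_nonneg (hf s).1 (hg s).1,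
    memLp_bdd_mul (hg s).2.1 (hf s).2.1 (hf s).2.2, ?_⟩⟩
  have h0 : 0 ≤ K * w s := mul_nonneg hK (hf s).1
  refine (n2_bdd_mul_le (hg s).2.1 h0 (hf s).2.2).trans ?_
  calc K * w s * n2 (g s) ≤ K * w s * (L * w' s) := mul_le_mul_of_nonneg_left (hg s).2.2 h0
    _ = _ := by ring

lemma Unif.one_mul_L2 (hf : Unif (fun _ => 1) f) (hg : UnifL2 w g) :
    UnifL2 w (fun s x => f s x * g s x) := by
  simpa only [_root_.one_mul] using hf.mul_L2 hg

/-- Cauchy-Schwarz. -/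
lemma UnifL2.integral_mul (hf : UnifL2 w f) (hg : UnifL2 w' g) :
    ∃ K : ℝ, 0 ≤ K ∧ ∀ s, |∫ x, f s x * g s x| ≤ K * (w s * w' s) := by
  obtain ⟨K, hK, hf⟩ := hf
  obtain ⟨L, hL, hg⟩ := hg
  refine ⟨K * L, by positivity, fun s => (abs_integral_mul_le (hf s).2.1 (hg s).2.1).trans ?_⟩
  calc _ ≤ (K * w s) * (L * w' s) :=
        mul_le_mul (hf s).2.2 (hg s).2.2 (n2_nonneg _) (mul_nonneg hK (hf s).1)
    _ = _ := by ring

end Families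

/-! ### Two flows at a fixed time -/

/-- The time derivative of the momentum. -/
def State.dm (X : State) (k : Fin 2) (x : Plane) : ℝ := X.dr x * X.u k x + X.r x * X.v k x

/-- The time derivative of the pairing of `θ` with a test function. -/
def State.thRate (X : State) (ψ : Plane → ℝ) : ℝ :=
  ∫ x, (X.dm 0 x * pd 1 ψ x - X.dm 1 x * pd 0 ψ x - X.dr x * lap ψ x)

/-- Two solutions at a fixed time, with the regularity of the second one and of the difference. -/
structure Snapshot (a c M : ℝ) (q : ℝ≥0∞) where
  X : State
  Y : State
  hX : X.Valid a c M
  hY : Y.Valid a c M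
  κ : ℝ
  one_le : 1 ≤ κ
  h_le : ∀ k, ∀ᵐ x, |Y.h k x| ≤ κ
  H_le : ∀ i k, ∀ᵐ x, |Y.H i k x| ≤ κ
  W : Fin 2 → Fin 2 → Fin 2 → Plane → ℝ
  weak_W : ∀ i j k, HasWeakPartial i (Y.D j k) (W i j k)
  W_mem : ∀ i j k, MemLp (W i j k) q volume
  W_le : ∀ i j k, (eLpNorm (W i j k) q volume).toReal ≤ κ
  Λ : Fin 2 → Plane → ℝ
  weak_Λ : ∀ i, HasWeakPartial i (fun x => Y.H 0 0 x + Y.H 1 1 x) (Λ i)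
  Λ_mem : ∀ i, MemLp (Λ i) q volume
  Λ_le : ∀ i, (eLpNorm (Λ i) q volume).toReal ≤ κ
  r_mem : MemLp (fun x => X.r x - Y.r x) 2 volume
  p_mem : ∀ i, MemLp (fun x => X.p i x - Y.p i x) 2 volume
  H_mem : ∀ i k, MemLp (fun x => X.H i k x - Y.H i k x) 2 volume
  u_mem : ∀ k, MemLp (fun x => X.u k x - Y.u k x) 2 volume
  D_mem : ∀ i k, MemLp (fun x => X.D i k x - Y.D i k x) 2 volume
  v_mem : ∀ k, MemLp (fun x => X.v k x - Y.v k x) 2 volume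
  V : Fin 2 → Fin 2 → Plane → ℝ
  weak_V : ∀ i k, HasWeakPartial i (fun x => X.v k x - Y.v k x) (V i k)
  V_mem : ∀ i k, MemLp (V i k) 2 volume
  V_div : ∀ᵐ x, V 0 0 x + V 1 1 x = 0
  T : Plane → ℝ
  T_mem : MemLp T 2 volume
  T_eq : ∀ ψ, IsTest ψ → ∫ x, T x * ψ x = X.thRate ψ - Y.thRate ψ

namespace Snapshot

variable {a c M : ℝ} {q : ℝ≥0∞}

/-- The difference of the values of a quantity for the two flows. -/
def δ (f : State → Plane → ℝ) (s : Snapshot a c M q) (x : Plane) : ℝ := f s.X x - f s.Y x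

/-- The energy of the difference. -/
def en (s : Snapshot a c M q) : ℝ :=
  n2 (δ State.r s) ^ 2 + n2 (δ (fun X => X.u 0) s) ^ 2 + n2 (δ (fun X => X.u 1) s) ^ 2 +
    n2 (δ State.om s) ^ 2 + n2 (δ State.th s) ^ 2

/-- The square root of the energy of the difference. -/
def e (s : Snapshot a c M q) : ℝ := √s.en

/-- A quantity bounded for both flows whose difference is controlled in `L²`. -/
structure Tame (w : Snapshot a c M q → ℝ) (f : State → Plane → ℝ) : Prop where
  left : Unif (fun _ => 1) (fun s : Snapshot a c M q => f s.X)
  right : Unif (fun _ => 1) (fun s : Snapshot a c M q => f s.Y)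
  diff : UnifL2 w (δ f)

/-- A quantity bounded by `κ` for the second flow whose difference is controlled in `L²`. -/
structure Wild (a c M : ℝ) (q : ℝ≥0∞) (f : State → Plane → ℝ) : Prop where
  right : Unif (fun s : Snapshot a c M q => s.κ) (fun s => f s.Y)
  diff : UnifL2 (fun s : Snapshot a c M q => s.κ * s.e) (δ f)

variable {w : Snapshot a c M q → ℝ} {f g : State → Plane → ℝ}

lemma e_nonneg (s : Snapshot a c M q) : 0 ≤ s.e := Real.sqrt_nonneg _

lemma κ_nonneg (s : Snapshot a c M q) : 0 ≤ s.κ := zero_le_one.trans s.one_le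

lemma κe_nonneg (s : Snapshot a c M q) : 0 ≤ s.κ * s.e := mul_nonneg s.κ_nonneg s.e_nonneg

lemma e_le (s : Snapshot a c M q) : s.e ≤ 1 * (s.κ * s.e) := by
  rw [one_mul]; exact le_mul_of_one_le_left s.e_nonneg s.one_le

namespace Tame

lemma add (hf : Tame w f) (hg : Tame w g) : Tame w (fun X x => f X x + g X x) :=
  ⟨hf.left.add hg.left, hf.right.add hg.right, (hf.diff.add hg.diff).congr fun s =>
    ae_of_all _ fun x => by simp only [δ]; ring⟩

lemma neg (hf : Tame w f) : Tame w (fun X x => - f X x) :=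
  ⟨hf.left.neg, hf.right.neg, hf.diff.neg.congr fun s => ae_of_all _ fun x => by
    simp only [δ]; ring⟩

lemma sub (hf : Tame w f) (hg : Tame w g) : Tame w (fun X x => f X x - g X x) := by
  simpa only [sub_eq_add_neg] using hf.add hg.neg

lemma mul (hf : Tame w f) (hg : Tame w g) : Tame w (fun X x => f X x * g X x) :=
  ⟨hf.left.one_mul hg.left, hf.right.one_mul hg.right,
    ((hf.left.one_mul_L2 hg.diff).add (hg.right.one_mul_L2 hf.diff)).congr fun s =>
      ae_of_all _ fun x => by simp only [δ]; ring⟩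

lemma wild (hf : Tame (e : Snapshot a c M q → ℝ) f) : Wild a c M q f :=
  ⟨hf.right.mono zero_le_one (fun s => by simpa using s.one_le) κ_nonneg,
    hf.diff.mono zero_le_one e_le κe_nonneg⟩

end Tame

namespace Wild

lemma add (hf : Wild a c M q f)
    (hg : Wild a c M q g) :
    Wild a c M q (fun X x => f X x + g X x) :=
  ⟨hf.right.add hg.right, (hf.diff.add hg.diff).congr fun s =>
    ae_of_all _ fun x => by simp only [δ]; ring⟩

lemma neg (hf : Wild a c M q f) :
    Wild a c M q (fun X x => - f X x) :=
  ⟨hf.right.neg, hf.diff.neg.congr fun s => ae_of_all _ fun x => by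
    simp only [δ]; ring⟩

lemma sub (hf : Wild a c M q f)
    (hg : Wild a c M q g) :
    Wild a c M q (fun X x => f X x - g X x) := by
  simpa only [sub_eq_add_neg] using hf.add hg.neg

/-- In `δ(fg) = f(X) δg + g(Y) δf` the wild factor stands undifferenced only at the second flow, the
one whose higher norms are controlled by `κ`. -/
lemma tame_mul (hf : Tame (e : Snapshot a c M q → ℝ) f)
    (hg : Wild a c M q g) :
    Wild a c M q (fun X x => f X x * g X x) :=
  ⟨hf.right.one_mul hg.right, ((hf.left.one_mul_L2 hg.diff).add
    (hg.right.mul_L2 hf.diff)).congr fun s =>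
      ae_of_all _ fun x => by simp only [δ]; ring⟩

end Wild

/-! ### The elliptic estimates -/

lemma n2_sq_le_en (s : Snapshot a c M q) : n2 (δ State.r s) ≤ s.e ∧
    n2 (δ (fun X => X.u 0) s) ≤ s.e ∧ n2 (δ (fun X => X.u 1) s) ≤ s.e ∧
    n2 (δ State.om s) ≤ s.e ∧ n2 (δ State.th s) ≤ s.e := by
  refine ⟨?_, ?_, ?_, ?_, ?_⟩ <;> refine Real.le_sqrt_of_sq_le ?_ <;> unfold en <;> nlinarith [
    sq_nonneg (n2 (δ State.r s)), sq_nonneg (n2 (δ (fun X => X.u 0) s)),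
    sq_nonneg (n2 (δ (fun X => X.u 1) s)), sq_nonneg (n2 (δ State.om s)),
    sq_nonneg (n2 (δ State.th s))]

lemma sq_e (s : Snapshot a c M q) : s.e ^ 2 = s.en :=
  Real.sq_sqrt (by unfold en; positivity)

lemma h1_δu (s : Snapshot a c M q) (k : Fin 2) :
    H1 (δ (fun X => X.u k) s) (fun i => δ (fun X => X.D i k) s) :=
  ⟨s.u_mem k, fun i => s.D_mem i k, fun i => (s.hX.weak_u i k).sub (s.hY.weak_u i k)⟩

lemma h1_δr (s : Snapshot a c M q) : H1 (δ State.r s) (fun i => δ (fun X => X.p i) s) :=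
  ⟨s.r_mem, s.p_mem, fun i => (s.hX.weak_r i).sub (s.hY.weak_r i)⟩

lemma h1_δp (s : Snapshot a c M q) (k : Fin 2) :
    H1 (δ (fun X => X.p k) s) (fun i => δ (fun X => X.H i k) s) :=
  ⟨s.p_mem k, fun i => s.H_mem i k, fun i => (s.hX.weak_p i k).sub (s.hY.weak_p i k)⟩

lemma δom_mem (s : Snapshot a c M q) : MemLp (δ State.om s) 2 volume :=
  ((s.D_mem 0 1).sub (s.D_mem 1 0)).ae_eq (ae_of_all _ fun x => by
    simp only [δ, State.om, Pi.sub_apply]; ring)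

/-- The `L²` norm of a gradient is controlled by the divergence and the curl. -/
lemma n2_grad_le {A B C D : Plane → ℝ} (hA : MemLp A 2 volume) (hB : MemLp B 2 volume)
    (hC : MemLp C 2 volume) (hD : MemLp D 2 volume) (h : ∫ x, A x * D x = ∫ x, B x * C x) :
    n2 A ^ 2 + n2 B ^ 2 + n2 C ^ 2 + n2 D ^ 2 =
      n2 (fun x => A x + D x) ^ 2 + n2 (fun x => B x - C x) ^ 2 := by
  have i := fun {f g : Plane → ℝ} (hf : MemLp f 2 volume) (hg : MemLp g 2 volume) =>
    integrable_mul_of_memLp hf hg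
  have hAD : MemLp (fun x => A x + D x) 2 volume := hA.add hD
  have hBC : MemLp (fun x => B x - C x) 2 volume := hB.sub hC
  have e1 : ∫ x, (A x + D x) * (A x + D x) =
      (∫ x, A x * A x) + (∫ x, D x * D x) + 2 * ∫ x, A x * D x := by
    have i1 : Integrable (fun x => A x * A x + D x * D x) := (i hA hA).add (i hD hD)
    rw [← integral_const_mul, ← integral_add (i hA hA) (i hD hD),
      ← integral_add i1 ((i hA hD).const_mul 2)]
    exact integral_congr_ae (ae_of_all _ fun x => by simp only; ring)
  have e2 : ∫ x, (B x - C x) * (B x - C x) =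
      (∫ x, B x * B x) + (∫ x, C x * C x) - 2 * ∫ x, B x * C x := by
    have i1 : Integrable (fun x => B x * B x + C x * C x) := (i hB hB).add (i hC hC)
    rw [← integral_const_mul, ← integral_add (i hB hB) (i hC hC),
      ← integral_sub i1 ((i hB hC).const_mul 2)]
    exact integral_congr_ae (ae_of_all _ fun x => by simp only; ring)
  rw [n2_sq hA, n2_sq hB, n2_sq hC, n2_sq hD, n2_sq hAD, n2_sq hBC, e1, e2, h]
  ring

lemma δdiv (s : Snapshot a c M q) :
    ∀ᵐ x, δ (fun X => X.D 0 0) s x + δ (fun X => X.D 1 1) s x = 0 := by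
  filter_upwards [s.hX.div, s.hY.div] with x h1 h2
  simp only [δ]; linear_combination h1 - h2

lemma n2_zero_of_ae {f : Plane → ℝ} (h : ∀ᵐ x, f x = 0) : n2 f = 0 := by
  rw [n2_congr (g := fun _ => 0) h]; simp [n2]

lemma n2_le_div_curl {A B C D : Plane → ℝ} (hA : MemLp A 2 volume) (hB : MemLp B 2 volume)
    (hC : MemLp C 2 volume) (hD : MemLp D 2 volume) (h : ∫ x, A x * D x = ∫ x, B x * C x)
    {t : ℝ} (ht : 0 ≤ t)
    (hs : n2 (fun x => A x + D x) ^ 2 + n2 (fun x => B x - C x) ^ 2 ≤ t ^ 2) :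
    n2 A ≤ t ∧ n2 B ≤ t ∧ n2 C ≤ t ∧ n2 D ≤ t := by
  rw [← n2_grad_le hA hB hC hD h] at hs
  have hsq : ∀ f, n2 f ^ 2 ≤ t ^ 2 → n2 f ≤ t := fun f hf =>
    (pow_le_pow_iff_left₀ (n2_nonneg f) ht two_ne_zero).1 hf
  refine ⟨hsq _ ?_, hsq _ ?_, hsq _ ?_, hsq _ ?_⟩ <;>
    linarith [sq_nonneg (n2 A), sq_nonneg (n2 B), sq_nonneg (n2 C), sq_nonneg (n2 D)]

/-- The velocity difference is divergence free, so the div-curl identity leaves only its vorticity.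
-/
lemma n2_δD_le (s : Snapshot a c M q) (i k : Fin 2) : n2 (δ (fun X => X.D i k) s) ≤ s.e := by
  have e1 := n2_zero_of_ae s.δdiv
  have e2 : n2 (fun x => δ (fun X => X.D 0 1) s x - δ (fun X => X.D 1 0) s x) =
      n2 (δ State.om s) := n2_congr (ae_of_all _ fun x => by simp only [δ, State.om]; ring)
  have h2 := pow_le_pow_left₀ (n2_nonneg _) (s.n2_sq_le_en.2.2.2.1) 2
  have h := n2_le_div_curl (A := δ (fun X => X.D 0 0) s) (B := δ (fun X => X.D 0 1) s)
    (C := δ (fun X => X.D 1 0) s) (D := δ (fun X => X.D 1 1) s)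
    (s.D_mem 0 0) (s.D_mem 0 1) (s.D_mem 1 0) (s.D_mem 1 1)
    (((s.h1_δu 0).integral_cross (s.h1_δu 1)).trans (by simp_rw [mul_comm])) s.e_nonneg
    (by rw [e1, e2]; linarith)
  fin_cases i <;> fin_cases k
  exacts [h.1, h.2.1, h.2.2.1, h.2.2.2]

/-- The Laplacian of the density. -/
def lapr (X : State) (x : Plane) : ℝ := X.H 0 0 x + X.H 1 1 x

/-- The div-curl identity for the gradient field ∇δρ, whose curl vanishes. -/
lemma n2_δH_le (s : Snapshot a c M q) (i k : Fin 2) :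
    n2 (δ (fun X => X.H i k) s) ≤ n2 (δ lapr s) := by
  have e1 : n2 (fun x => δ (fun X => X.H 0 0) s x + δ (fun X => X.H 1 1) s x) = n2 (δ lapr s) :=
    n2_congr (ae_of_all _ fun x => by simp only [δ, lapr]; ring)
  have e2 : n2 (fun x => δ (fun X => X.H 0 1) s x - δ (fun X => X.H 1 0) s x) = 0 := by
    refine n2_zero_of_ae ?_
    filter_upwards [s.hX.symm_H, s.hY.symm_H] with x h1 h2
    simp only [δ, h1, h2]; ring
  have h := n2_le_div_curl (A := δ (fun X => X.H 0 0) s) (B := δ (fun X => X.H 0 1) s)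
    (C := δ (fun X => X.H 1 0) s) (D := δ (fun X => X.H 1 1) s)
    (s.H_mem 0 0) (s.H_mem 0 1) (s.H_mem 1 0) (s.H_mem 1 1)
    (((s.h1_δp 0).integral_cross (s.h1_δp 1)).trans (by simp_rw [mul_comm])) (n2_nonneg (δ lapr s))
    (by rw [e1, e2]; simp)
  fin_cases i <;> fin_cases k
  exacts [h.1, h.2.1, h.2.2.1, h.2.2.2]

lemma tame_of {K : ℝ} (hf : ∀ X : State, X.Valid a c M →
    AEStronglyMeasurable (f X) volume ∧ ∀ᵐ x, |f X x| ≤ K)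
    (hδ : ∀ s : Snapshot a c M q, MemLp (δ f s) 2 volume) (hw : ∀ s, n2 (δ f s) ≤ w s) :
    Tame w f := by
  have key : ∀ X : State, X.Valid a c M →
      0 ≤ (1 : ℝ) ∧ AEStronglyMeasurable (f X) volume ∧ ∀ᵐ x, |f X x| ≤ |K| * 1 := fun X hX =>
    ⟨zero_le_one, (hf X hX).1, (hf X hX).2.mono fun x hx => by
      rw [mul_one]; exact hx.trans (le_abs_self K)⟩
  exact ⟨⟨|K|, abs_nonneg _, fun s => key _ s.hX⟩, ⟨|K|, abs_nonneg _, fun s => key _ s.hY⟩,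
    ⟨1, zero_le_one, fun s => ⟨(n2_nonneg _).trans (hw s), hδ s, by rw [one_mul]; exact hw s⟩⟩⟩

/-- A weight controlling the low order differences. -/
structure Dominates (w : Snapshot a c M q → ℝ) : Prop where
  r : ∀ s, n2 (δ State.r s) ≤ w s
  u : ∀ s k, n2 (δ (fun X => X.u k) s) ≤ w s
  D : ∀ s i k, n2 (δ (fun X => X.D i k) s) ≤ w s
  p : ∀ s i, n2 (δ (fun X => X.p i) s) ≤ w s

namespace Dominates

variable (hw : Dominates w)
include hw

lemma tame_r : Tame w State.r :=
  tame_of (fun _ hX => ⟨hX.h1_r.l2.1, hX.r_le⟩) r_mem hw.r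

lemma tame_u (k : Fin 2) : Tame w (fun X => X.u k) :=
  tame_of (fun _ hX => ⟨(hX.h1_u k).l2.1, hX.u_le k⟩) (fun s => s.u_mem k) fun s => hw.u s k

lemma tame_D (i k : Fin 2) : Tame w (fun X => X.D i k) :=
  tame_of (fun _ hX => ⟨((hX.h1_u k).dl2 i).1, hX.D_le i k⟩) (fun s => s.D_mem i k)
    fun s => hw.D s i k

lemma tame_p (k : Fin 2) : Tame w (fun X => X.p k) :=
  tame_of (fun _ hX => ⟨(hX.h1_p k).l2.1, hX.p_le k⟩) (fun s => s.p_mem k) fun s => hw.p s k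

lemma tame_curl : Tame w (fun X x => X.p 0 x * X.u 1 x + X.r x * X.D 0 1 x - X.p 1 x * X.u 0 x -
    X.r x * X.D 1 0 x) :=
  ((((hw.tame_p 0).mul (hw.tame_u 1)).add (hw.tame_r.mul (hw.tame_D 0 1))).sub
    ((hw.tame_p 1).mul (hw.tame_u 0))).sub (hw.tame_r.mul (hw.tame_D 1 0))

end Dominates

lemma δth_mem (s : Snapshot a c M q) : MemLp (δ State.th s) 2 volume := by
  -- Any dominating weight will do, since only membership in L² is extracted here.
  have hw : Dominates (fun s : Snapshot a c M q => n2 (δ State.r s) +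
      (n2 (δ (fun X => X.u 0) s) + n2 (δ (fun X => X.u 1) s)) +
      (n2 (δ (fun X => X.p 0) s) + n2 (δ (fun X => X.p 1) s)) + s.e) := by
    have n := fun f => n2_nonneg f
    refine ⟨fun s => ?_, fun s k => ?_, fun s i k => (s.n2_δD_le i k).trans ?_, fun s k => ?_⟩
    all_goals
      have n1 := n (δ State.r s)
      have n2 := n (δ (fun X => X.u 0) s)
      have n3 := n (δ (fun X => X.u 1) s)
      have n4 := n (δ (fun X => X.p 0) s)
      have n5 := n (δ (fun X => X.p 1) s)
      have n6 := s.e_nonneg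
    · linarith
    · fin_cases k <;> simp only [Fin.zero_eta, Fin.mk_one] <;> linarith
    · linarith
    · fin_cases k <;> simp only [Fin.zero_eta, Fin.mk_one] <;> linarith
  obtain ⟨K, -, h⟩ := hw.tame_curl.diff
  refine (((h s).2.1.sub (s.H_mem 0 0)).sub (s.H_mem 1 1)).ae_eq (ae_of_all _ fun x => ?_)
  simp only [δ, State.th, Pi.sub_apply]; ring

lemma δlapr_mem (s : Snapshot a c M q) : MemLp (δ lapr s) 2 volume :=
  ((s.H_mem 0 0).add (s.H_mem 1 1)).ae_eq (ae_of_all _ fun x => by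
    simp only [δ, lapr, Pi.add_apply]; ring)

lemma δth_L2 : UnifL2 (e : Snapshot a c M q → ℝ) (δ State.th) :=
  ⟨1, zero_le_one, fun s => ⟨s.e_nonneg, s.δth_mem, by rw [one_mul]; exact s.n2_sq_le_en.2.2.2.2⟩⟩

/-- By definition of `θ`, Δδρ is the curl of the momentum difference minus δθ. The weight is kept
abstract because the estimate is needed before ∇δρ is known to be controlled by the energy. -/
lemma Dominates.lapr (hw : Dominates w) (he : ∀ s, s.e ≤ w s) : UnifL2 w (δ lapr) :=
  (hw.tame_curl.diff.sub (δth_L2.mono zero_le_one (fun s => by rw [one_mul]; exact he s)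
    fun s => s.e_nonneg.trans (he s))).congr fun s => ae_of_all _ fun x => by
      simp only [δ, Snapshot.lapr, State.th]; ring

/-- Integration by parts: ∇δρ is interpolated between δρ and Δδρ. -/
lemma sq_δp (s : Snapshot a c M q) : n2 (δ (fun X => X.p 0) s) ^ 2 +
    n2 (δ (fun X => X.p 1) s) ^ 2 ≤ n2 (δ State.r s) * n2 (δ Snapshot.lapr s) := by
  rw [n2_sq (s.h1_δp 0).l2,
    n2_sq (s.h1_δp 1).l2,
    s.h1_δr.integral_by_parts (s.h1_δp 0) 0, s.h1_δr.integral_by_parts (s.h1_δp 1) 1]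
  have h := (neg_le_abs _).trans (abs_integral_mul_le s.r_mem s.δlapr_mem)
  refine le_trans (le_of_eq ?_) h
  rw [← neg_add, ← integral_add (integrable_mul_of_memLp s.h1_δr.l2 ((s.h1_δp 0).dl2 0))
    (integrable_mul_of_memLp s.h1_δr.l2 ((s.h1_δp 1).dl2 1))]
  congr 1
  exact integral_congr_ae (ae_of_all _ fun x => by simp only [δ, Snapshot.lapr]; ring)

/-- The gradient of the density difference is controlled by the energy. -/
lemma exists_δp_le : ∃ C : ℝ, 1 ≤ C ∧ ∀ (s : Snapshot a c M q) i,
    n2 (δ (fun X => X.p i) s) ≤ C * s.e := by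
  have hw : Dominates (fun s : Snapshot a c M q =>
      s.e + (n2 (δ (fun X => X.p 0) s) + n2 (δ (fun X => X.p 1) s))) := by
    have hp := fun s : Snapshot a c M q =>
      add_nonneg (n2_nonneg (δ (fun X => X.p 0) s)) (n2_nonneg (δ (fun X => X.p 1) s))
    refine ⟨fun s => ?_, fun s k => ?_, fun s i k => ?_, fun s k => ?_⟩
    · linarith [hp s, s.n2_sq_le_en.1]
    · fin_cases k
      · exact s.n2_sq_le_en.2.1.trans (by linarith [hp s])
      · exact s.n2_sq_le_en.2.2.1.trans (by linarith [hp s])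
    · linarith [hp s, s.n2_δD_le i k]
    · have h0 := n2_nonneg (δ (fun X => X.p 0) s)
      have h1 := n2_nonneg (δ (fun X => X.p 1) s)
      have := s.e_nonneg
      fin_cases k <;> simp only [Fin.zero_eta, Fin.mk_one] <;> linarith
  obtain ⟨K, hK, h⟩ := hw.lapr fun s => by
    linarith [n2_nonneg (δ (fun X => X.p 0) s), n2_nonneg (δ (fun X => X.p 1) s)]
  -- Interpolation gives `P₀² + P₁² ≤ e K (e + P₀ + P₁)`. The right side is only linear in `P₀ +
  -- P₁`, so it can be absorbed, with `4K + 1` as a sufficient constant.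
  refine ⟨4 * K + 1, by linarith, fun s i => ?_⟩
  have h1 := s.sq_δp
  have h2 := (h s).2.2
  have hr := s.n2_sq_le_en.1
  have he := s.e_nonneg
  set P0 := n2 (δ (fun X => X.p 0) s) with hP0
  set P1 := n2 (δ (fun X => X.p 1) s) with hP1
  have p0 : 0 ≤ P0 := n2_nonneg _
  have p1 : 0 ≤ P1 := n2_nonneg _
  have h3 : P0 ^ 2 + P1 ^ 2 ≤ s.e * (K * (s.e + (P0 + P1))) :=
    h1.trans (mul_le_mul hr h2 (n2_nonneg _) he)
  have h4 : P0 + P1 ≤ (4 * K + 1) * s.e := by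
    by_contra! hlt
    have hKe : 0 ≤ K * s.e := mul_nonneg hK he
    nlinarith [sq_nonneg (P0 - P1), mul_nonneg hK (mul_nonneg he he),
      mul_nonneg hKe (add_nonneg p0 p1), mul_nonneg he (add_nonneg p0 p1)]
  fin_cases i <;> simp only [Fin.zero_eta, Fin.mk_one, ← hP0, ← hP1] <;> linarith

end Snapshot

namespace Snapshot

variable {a c M : ℝ} {q : ℝ≥0∞} {w : Snapshot a c M q → ℝ} {f g : State → Plane → ℝ}

/-! ### Bounds for the differences of all quantities -/

lemma Tame.mono (h : Tame w f) {C : ℝ} (hC : 0 ≤ C) (hle : ∀ s, w s ≤ C * s.e) :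
    Tame (e : Snapshot a c M q → ℝ) f :=
  ⟨h.left, h.right, h.diff.mono hC hle e_nonneg⟩

lemma exists_dominates : ∃ C : ℝ, 0 ≤ C ∧ Dominates (fun s : Snapshot a c M q => C * s.e) := by
  obtain ⟨C, hC, h⟩ := exists_δp_le (a := a) (c := c) (M := M) (q := q)
  have hle := fun s : Snapshot a c M q => le_mul_of_one_le_left s.e_nonneg hC
  refine ⟨C, by linarith, fun s => s.n2_sq_le_en.1.trans (hle s), fun s k => ?_,
    fun s i k => (s.n2_δD_le i k).trans (hle s), h⟩
  fin_cases k
  · exact s.n2_sq_le_en.2.1.trans (hle s)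
  · exact s.n2_sq_le_en.2.2.1.trans (hle s)

lemma tame_r : Tame (e : Snapshot a c M q → ℝ) State.r := by
  obtain ⟨C, hC, h⟩ := exists_dominates (a := a) (c := c) (M := M) (q := q)
  exact h.tame_r.mono hC fun s => le_rfl

lemma tame_u (k : Fin 2) : Tame (e : Snapshot a c M q → ℝ) (fun X => X.u k) := by
  obtain ⟨C, hC, h⟩ := exists_dominates (a := a) (c := c) (M := M) (q := q)
  exact (h.tame_u k).mono hC fun s => le_rfl

lemma tame_D (i k : Fin 2) : Tame (e : Snapshot a c M q → ℝ) (fun X => X.D i k) := by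
  obtain ⟨C, hC, h⟩ := exists_dominates (a := a) (c := c) (M := M) (q := q)
  exact (h.tame_D i k).mono hC fun s => le_rfl

lemma tame_p (i : Fin 2) : Tame (e : Snapshot a c M q → ℝ) (fun X => X.p i) := by
  obtain ⟨C, hC, h⟩ := exists_dominates (a := a) (c := c) (M := M) (q := q)
  exact (h.tame_p i).mono hC fun s => le_rfl

lemma δH_L2 (i k : Fin 2) : UnifL2 (e : Snapshot a c M q → ℝ) (δ (fun X => X.H i k)) := by
  obtain ⟨C, hC, h⟩ := exists_δp_le (a := a) (c := c) (M := M) (q := q)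
  obtain ⟨C', hC', h'⟩ := exists_dominates (a := a) (c := c) (M := M) (q := q)
  -- The extra 1 makes the weight dominate the energy itself, as `Dominates.lapr` requires.
  have hw : Dominates (fun s : Snapshot a c M q => (C' + 1) * s.e) :=
    ⟨fun s => (h'.r s).trans (by linarith [s.e_nonneg]),
      fun s k => (h'.u s k).trans (by linarith [s.e_nonneg]),
      fun s i k => (h'.D s i k).trans (by linarith [s.e_nonneg]),
      fun s k => (h'.p s k).trans (by linarith [s.e_nonneg])⟩
  obtain ⟨K, hK, hl⟩ := hw.lapr fun s => by nlinarith [s.e_nonneg]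
  exact ⟨K * (C' + 1), by positivity, fun s => ⟨s.e_nonneg, s.H_mem i k,
    (s.n2_δH_le i k).trans ((hl s).2.2.trans_eq (by ring))⟩⟩

lemma UnifL2.toκ {f : Snapshot a c M q → Plane → ℝ} (h : UnifL2 e f) :
    UnifL2 (fun s => s.κ * s.e) f := h.mono zero_le_one e_le κe_nonneg

lemma unif_κ {f : Snapshot a c M q → Plane → ℝ} (h : ∀ s, AEStronglyMeasurable (f s) volume)
    (h' : ∀ s, ∀ᵐ x, |f s x| ≤ s.κ) : Unif (fun s => s.κ) f :=
  ⟨1, zero_le_one, fun s => ⟨s.κ_nonneg, h s, by simpa only [one_mul] using h' s⟩⟩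

lemma wild_H (i k : Fin 2) : Wild a c M q (fun X => X.H i k) :=
  ⟨unif_κ (fun s => (s.hY.H_l2loc i k).1) fun s => s.H_le i k, UnifL2.toκ (δH_L2 i k)⟩

lemma tame_s : Tame (e : Snapshot a c M q → ℝ) State.s := by
  have hb : ∀ X : State, X.Valid a c M →
      0 ≤ (1 : ℝ) ∧ AEStronglyMeasurable X.s volume ∧ ∀ᵐ x, |X.s x| ≤ |a⁻¹| * 1 := fun X hX =>
    ⟨zero_le_one, hX.h1_s.l2.1, hX.s_le.mono fun x hx => by
      rw [mul_one]; exact hx.trans (le_abs_self _)⟩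
  have hl : Unif (fun _ => 1) (fun s : Snapshot a c M q => s.X.s) :=
    ⟨|a⁻¹|, abs_nonneg _, fun s => hb _ s.hX⟩
  have hr : Unif (fun _ => 1) (fun s : Snapshot a c M q => s.Y.s) :=
    ⟨|a⁻¹|, abs_nonneg _, fun s => hb _ s.hY⟩
  -- `1/ρ₁ - 1/ρ₂ = -(1/ρ₁)(1/ρ₂)(ρ₁ - ρ₂)`.
  refine ⟨hl, hr, (hl.one_mul_L2 (hr.one_mul_L2 tame_r.diff)).neg.congr fun s => ?_⟩
  filter_upwards [s.hX.lower, s.hY.lower] with x h1 h2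
  have h1' := (s.hX.a_pos.trans_le h1).ne'
  have h2' := (s.hX.a_pos.trans_le h2).ne'
  simp only [δ, State.s]
  field_simp
  ring

lemma tame_Q (k : Fin 2) : Tame (e : Snapshot a c M q → ℝ) (fun X => X.Q k) := by
  fin_cases k
  · exact (((tame_D 1 0).mul (tame_p 0)).add ((tame_D 1 1).mul (tame_p 1))).neg
  · exact ((tame_D 0 0).mul (tame_p 0)).add ((tame_D 0 1).mul (tame_p 1))

/-- The convective acceleration. -/
def conv (k : Fin 2) (X : State) (x : Plane) : ℝ := X.u 0 x * X.D 0 k x + X.u 1 x * X.D 1 k x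

lemma tame_conv (k : Fin 2) : Tame (e : Snapshot a c M q → ℝ) (conv k) :=
  ((tame_u 0).mul (tame_D 0 k)).add ((tame_u 1).mul (tame_D 1 k))

lemma v_eq {X : State} (hX : X.Valid a c M) (k : Fin 2) :
    ∀ᵐ x, X.v k x = -(conv k X x + X.s x * (X.h k x + X.Q k x)) := by
  filter_upwards [hX.momentum k, hX.lower] with x h1 h2
  have h0 := (hX.a_pos.trans_le h2).ne'
  simp only [conv, State.s]
  field_simp
  linear_combination h1

lemma v_right (k : Fin 2) : Unif (fun s : Snapshot a c M q => s.κ) (fun s => s.Y.v k) := by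
  have hh : Unif (fun s : Snapshot a c M q => s.κ) (fun s => s.Y.h k) :=
    unif_κ (fun s => (s.hY.h_l2loc k).1) fun s => s.h_le k
  refine ((tame_conv k).wild.right.add
    (tame_s.right.one_mul (hh.add (tame_Q k).wild.right))).neg.congr fun s => ?_
  exact v_eq s.hY k

/-- The part of the momentum balance controlled by the energy. -/
lemma exists_rem (k : Fin 2) : ∃ R : Snapshot a c M q → Plane → ℝ,
    UnifL2 (fun s => s.κ * s.e) R ∧
      ∀ s, ∀ᵐ x, δ (fun X => X.h k) s x = R s x - s.X.r x * δ (fun X => X.v k) s x := by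
  -- In `δ(ρv) = ρ₁ δv + v₂ δρ` only the first term is set aside; `v₂` is bounded by a multiple of
  -- `κ`.
  refine ⟨fun s x => -(s.Y.v k x * δ State.r s x +
    δ (fun X x => X.r x * conv k X x) s x + δ (fun X => X.Q k) s x), ?_, fun s => ?_⟩
  · exact ((((v_right k).mul_L2 tame_r.diff).add (UnifL2.toκ (tame_r.mul (tame_conv k)).diff)).add
      (UnifL2.toκ (tame_Q k).diff)).neg
  · filter_upwards [s.hX.momentum k, s.hY.momentum k] with x h1 h2
    simp only [δ, conv]
    linear_combination h1 - h2

lemma δh_mem (s : Snapshot a c M q) (k : Fin 2) : MemLp (δ (fun X => X.h k) s) 2 volume := by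
  obtain ⟨R, ⟨K, -, hR⟩, h⟩ := exists_rem (a := a) (c := c) (M := M) (q := q) k
  exact ((hR s).2.1.sub (memLp_bdd_mul (s.v_mem k) s.hX.h1_r.l2.1 s.hX.r_le)).ae_eq
    ((h s).mono fun x hx => by rw [hx]; rfl)

/-- A divergence free field against a curl free one: the difference of accelerations has divergence
zero, and `h` is curl free for both flows. -/
lemma integral_δv_mul_δh (s : Snapshot a c M q) :
    (∫ x, δ (fun X => X.v 0) s x * δ (fun X => X.h 0) s x) +
      ∫ x, δ (fun X => X.v 1) s x * δ (fun X => X.h 1) s x = 0 := by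
  refine integral_div_free_curl_free (v := fun k => δ (fun X => X.v k) s)
    (h := fun k => δ (fun X => X.h k) s) s.v_mem s.δh_mem (fun φ hφ => ?_) fun φ hφ => ?_
  · have h0 := (s.weak_V 0 0).2.2 φ hφ
    have h1 := (s.weak_V 1 1).2.2 φ hφ
    have e : (∫ x, s.V 0 0 x * φ x) + ∫ x, s.V 1 1 x * φ x = 0 := by
      rw [← integral_add (integrable_mul_test (s.weak_V 0 0).2.1 hφ)
        (integrable_mul_test (s.weak_V 1 1).2.1 hφ), ← integral_zero Plane ℝ]
      refine integral_congr_ae ?_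
      filter_upwards [s.V_div] with x hx
      rw [← add_mul, hx, zero_mul]
    simp only [δ]
    rw [h0, h1]; linarith
  · have hi := fun (X : State) (hX : X.Valid a c M) k i =>
      integrable_mul_test (hX.h_l2loc k).locallyIntegrable (hφ.pd i)
    have h1 := s.hX.curl_h φ hφ
    have h2 := s.hY.curl_h φ hφ
    simp only [δ, sub_mul]
    rw [integral_sub (hi _ s.hX 0 1) (hi _ s.hY 0 1), integral_sub (hi _ s.hX 1 0) (hi _ s.hY 1 0),
      h1, h2]
    ring

/-- The pressure estimate. Testing `ρ₁ δv + δh = R` with `δh/ρ₁` removes δv by orthogonality and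
leaves `∫ |δh|²/ρ₁ = ∫ R·δh/ρ₁`. The density bounds then give the estimate although no bound on δv
is known yet. -/
lemma δh_L2 (k : Fin 2) :
    UnifL2 (fun s : Snapshot a c M q => s.κ * s.e) (δ (fun X => X.h k)) := by
  choose R hR h using fun k => exists_rem (a := a) (c := c) (M := M) (q := q) k
  choose K hK hR using hR
  refine ⟨2 * (|c| * |a⁻¹| * (K 0 + K 1)), by
    have := hK 0; have := hK 1; positivity, fun s => ⟨s.κe_nonneg, s.δh_mem k, ?_⟩⟩
  set t := s.κ * s.e with ht
  have ht0 : 0 ≤ t := s.κe_nonneg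
  have hm := s.δh_mem
  have hvm : ∀ k, MemLp (δ (fun X => X.v k) s) 2 volume := s.v_mem
  have hRm := fun k => (hR k s).2.1
  have hsl : ∀ {f : Plane → ℝ}, MemLp f 2 volume → MemLp (fun x => s.X.s x * f x) 2 volume :=
    fun hf => memLp_bdd_mul hf s.hX.h1_s.l2.1 s.hX.s_le
  have hle : ∀ k, n2 (δ (fun X => X.h k) s) ^ 2 ≤
      |c| * ∫ x, (s.X.s x * δ (fun X => X.h k) s x) * δ (fun X => X.h k) s x := by
    intro k
    rw [n2_sq (hm k), ← integral_const_mul]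
    refine integral_mono_ae (integrable_mul_of_memLp (hm k) (hm k))
      ((integrable_mul_of_memLp (hsl (hm k)) (hm k)).const_mul _) ?_
    filter_upwards [s.hX.lower, s.hX.upper] with x h1 h2
    have h0 := s.hX.a_pos.trans_le h1
    have : 1 ≤ |c| * s.X.s x := by
      rw [State.s, ← div_eq_mul_inv, le_div_iff₀ h0, one_mul]
      exact h2.trans (le_abs_self c)
    nlinarith [mul_self_nonneg (δ (fun X => X.h k) s x)]
  -- The integrals of `δv δh` vanish only after summation over `k`, so both components are estimated
  -- together.
  have heq : ∀ k, (∫ x, (s.X.s x * δ (fun X => X.h k) s x) * δ (fun X => X.h k) s x) =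
      (∫ x, (s.X.s x * R k s x) * δ (fun X => X.h k) s x) -
        ∫ x, δ (fun X => X.v k) s x * δ (fun X => X.h k) s x := by
    intro k
    rw [← integral_sub (integrable_mul_of_memLp (hsl (hRm k)) (hm k))
      (integrable_mul_of_memLp (hvm k) (hm k))]
    refine integral_congr_ae ?_
    filter_upwards [h k s, s.hX.lower] with x h1 h2
    have hr : s.X.s x * s.X.r x = 1 := inv_mul_cancel₀ (s.hX.a_pos.trans_le h2).ne'
    have h3 : s.X.s x * δ (fun X => X.h k) s x = s.X.s x * R k s x - δ (fun X => X.v k) s x := by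
      rw [h1]; linear_combination (- δ (fun X => X.v k) s x) * hr
    rw [h3, sub_mul]
  have hR2 : ∀ k, (∫ x, (s.X.s x * R k s x) * δ (fun X => X.h k) s x) ≤
      |a⁻¹| * (K k * t) * n2 (δ (fun X => X.h k) s) := by
    intro k
    refine (le_abs_self _).trans ((abs_integral_mul_le (hsl (hRm k)) (hm k)).trans ?_)
    refine mul_le_mul_of_nonneg_right ?_ (n2_nonneg _)
    refine (n2_bdd_mul_le (hRm k) (abs_nonneg _) (s.hX.s_le.mono fun x hx =>
      hx.trans (le_abs_self _))).trans ?_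
    exact mul_le_mul_of_nonneg_left (hR k s).2.2 (abs_nonneg _)
  have horth := s.integral_δv_mul_δh
  have h0 := hle 0
  have h1 := hle 1
  have h2 := hR2 0
  have h3 := hR2 1
  have e0 := heq 0
  have e1 := heq 1
  set N0 := n2 (δ (fun X => X.h 0) s) with hN0
  set N1 := n2 (δ (fun X => X.h 1) s) with hN1
  have n0 : 0 ≤ N0 := n2_nonneg _
  have n1 : 0 ≤ N1 := n2_nonneg _
  have hs : N0 ^ 2 + N1 ^ 2 ≤ |c| * (|a⁻¹| * (K 0 * t) * N0 + |a⁻¹| * (K 1 * t) * N1) := by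
    have : (∫ x, (s.X.s x * δ (fun X => X.h 0) s x) * δ (fun X => X.h 0) s x) +
        (∫ x, (s.X.s x * δ (fun X => X.h 1) s x) * δ (fun X => X.h 1) s x) ≤
        |a⁻¹| * (K 0 * t) * N0 + |a⁻¹| * (K 1 * t) * N1 := by linarith
    nlinarith [abs_nonneg c]
  set A := |c| * |a⁻¹| with hA
  have hA0 : 0 ≤ A := by positivity
  have hs' : N0 ^ 2 + N1 ^ 2 ≤ A * (K 0 + K 1) * t * (N0 + N1) := by
    refine hs.trans ?_
    have : |c| * (|a⁻¹| * (K 0 * t) * N0 + |a⁻¹| * (K 1 * t) * N1) =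
      A * (K 0 * t * N0 + K 1 * t * N1) := by rw [hA]; ring
    rw [this, show A * (K 0 + K 1) * t * (N0 + N1) = A * ((K 0 + K 1) * t * (N0 + N1)) by ring]
    refine mul_le_mul_of_nonneg_left ?_ hA0
    nlinarith [mul_nonneg (mul_nonneg (hK 0) ht0) n1, mul_nonneg (mul_nonneg (hK 1) ht0) n0]
  set B := A * (K 0 + K 1) * t with hB
  have hB0 : 0 ≤ B := by
    have := hK 0; have := hK 1; positivity
  have hsum : N0 + N1 ≤ 2 * B := by
    by_contra! hlt
    have := mul_pos (sub_pos.2 hlt) (hlt.trans_le' (by linarith))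
    nlinarith [sq_nonneg (N0 - N1), add_nonneg n0 n1]
  have : 2 * (A * (K 0 + K 1)) * t = 2 * B := by rw [hB]; ring
  rw [this]
  fin_cases k <;> simp only [Fin.zero_eta, Fin.mk_one, ← hN0, ← hN1] <;> linarith

lemma wild_h (k : Fin 2) : Wild a c M q (fun X => X.h k) :=
  ⟨unif_κ (fun s => (s.hY.h_l2loc k).1) fun s => s.h_le k, δh_L2 k⟩

lemma wild_v (k : Fin 2) : Wild a c M q (fun X => X.v k) := by
  obtain ⟨R, hR, h⟩ := exists_rem (a := a) (c := c) (M := M) (q := q) k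
  refine ⟨v_right k, (tame_s.left.one_mul_L2 (hR.sub (δh_L2 k))).congr fun s => ?_⟩
  filter_upwards [h s, s.hX.lower] with x h1 h2
  have hr : s.X.s x * s.X.r x = 1 := inv_mul_cancel₀ (s.hX.a_pos.trans_le h2).ne'
  rw [h1]; linear_combination (- δ (fun X => X.v k) s x) * hr

lemma tame_dr : Tame (e : Snapshot a c M q → ℝ) State.dr :=
  (((tame_u 0).mul (tame_p 0)).add ((tame_u 1).mul (tame_p 1))).neg

lemma tame_ds (i : Fin 2) : Tame (e : Snapshot a c M q → ℝ) (fun X => X.ds i) := by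
  have := ((tame_s.mul tame_s).mul (tame_p i)).neg (w := (e : Snapshot a c M q → ℝ))
  simp only [← pow_two] at this
  exact this

lemma wild_S (k i : Fin 2) : Wild a c M q (fun X => X.S k i) := by
  have := (Wild.tame_mul tame_s (wild_H (a := a) (c := c) (M := M) (q := q) k i)).sub
    ((tame_s.mul tame_s).mul ((tame_p k).mul (tame_p i))).wild
  simp only [← pow_two] at this
  exact this

lemma wild_omSource : Wild a c M q State.omSource := by
  have t := fun i k => Wild.tame_mul (tame_D i k) (wild_S (a := a) (c := c) (M := M) (q := q) i k)
  have h := fun i k => Wild.tame_mul (tame_ds i) (wild_h (a := a) (c := c) (M := M) (q := q) k)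
  have := ((h 1 0).sub (h 0 1)).sub ((((t 0 0).add (t 0 1)).add (t 1 0)).add (t 1 1))
  simp only [mul_comm (State.ds _ _ _)] at this
  exact this

lemma wild_thSource : Wild a c M q State.thSource := by
  have t := fun i k j l => Wild.tame_mul (tame_D i k)
    (wild_H (a := a) (c := c) (M := M) (q := q) j l)
  have h := fun k => ((tame_u 0).mul (tame_D (a := a) (c := c) (M := M) (q := q) k 0)).add
    ((tame_u 1).mul (tame_D k 1))
  exact (((h 1).mul (tame_p 0)).sub ((h 0).mul (tame_p 1))).wild.add
    ((((t 0 0 0 0).add (t 0 1 0 1)).add (t 1 0 0 1)).add (t 1 1 1 1))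

end Snapshot

lemma transport_skew_of_zeroInt {b : Fin 2 → Plane → ℝ} {B : Fin 2 → Fin 2 → Plane → ℝ} {Cb : ℝ}
    {w h : Plane → ℝ} (hb : ∀ k, H1loc (b k) (B k)) (hCb : 0 ≤ Cb)
    (hbd : ∀ k, ∀ᵐ x, |b k x| ≤ Cb)
    (hdiv : ∀ᵐ x, B 0 0 x + B 1 1 x = 0) (hw : MemLp w 2 volume) (hh : MemLp h 2 volume)
    (heq : ∀ φ, IsTest φ →
      ZeroInt (fun x => w x * (b 0 x * pd 0 φ x + b 1 x * pd 1 φ x) + h x * φ x)) :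
    ∫ x, w x * h x = 0 := by
  refine transport_skew hb hCb hbd hdiv hw hh fun φ hφ => ?_
  have i1 := fun k => integrable_mul_test ((memLp_l2loc hw).locallyIntegrable_mul (hb k).l2) (hφ.pd k)
  have i2 := integrable_mul_test (memLp_l2loc hh).locallyIntegrable hφ
  have i3 : Integrable (fun x => w x * b 0 x * pd 0 φ x + w x * b 1 x * pd 1 φ x) :=
    (i1 0).add (i1 1)
  rw [← integral_add (i1 0) (i1 1), eq_neg_iff_add_eq_zero, ← integral_add i3 i2]
  refine (integral_congr_ae (ae_of_all _ fun x => ?_)).trans (heq φ hφ).2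
  ring

namespace State.Valid

variable {X : State} {a c M : ℝ} (hX : X.Valid a c M)
include hX

lemma dr_l2loc : L2loc X.dr :=
  (((hX.h1_p 0).l2.bdd_mul (hX.h1_u 0).l2.1 (hX.u_le 0)).add
    ((hX.h1_p 1).l2.bdd_mul (hX.h1_u 1).l2.1 (hX.u_le 1))).neg

lemma v_l2loc (k : Fin 2) : L2loc (X.v k) := by
  have hQ : L2loc (X.Q k) := by
    have h := fun i j => (hX.h1_p i).l2.bdd_mul ((hX.h1_u j).dl2 i).1 (hX.D_le i j)
    have h' := fun i j k => (hX.h1_p k).l2.bdd_mul ((hX.h1_u j).dl2 i).1 (hX.D_le i j)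
    fin_cases k
    · exact ((h' 1 0 0).add (h' 1 1 1)).neg
    · exact (h' 0 0 0).add (h' 0 1 1)
  have hc := fun i => ((hX.h1_u k).dl2 i).bdd_mul (hX.h1_u i).l2.1 (hX.u_le i)
  exact (((hc 0).add (hc 1)).add (((hX.h_l2loc k).add hQ).bdd_mul hX.h1_s.l2.1 hX.s_le)).neg.congr
    ((Snapshot.v_eq hX k).mono fun _ hx => hx.symm)

lemma dm_l2loc (k : Fin 2) : L2loc (X.dm k) := by
  refine L2loc.add ?_ ((hX.v_l2loc k).bdd_mul hX.h1_r.l2.1 hX.r_le)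
  simpa only [mul_comm] using hX.dr_l2loc.bdd_mul (hX.h1_u k).l2.1 (hX.u_le k)

lemma integrable_thRate {ψ : Plane → ℝ} (hψ : IsTest ψ) :
    Integrable (fun x => X.dm 0 x * pd 1 ψ x - X.dm 1 x * pd 0 ψ x - X.dr x * lap ψ x) := by
  have hl : IsTest (lap ψ) := by
    have e : lap ψ = fun x => pd 0 (pd 0 ψ) x + pd 1 (pd 1 ψ) x :=
      funext fun x => by simp only [lap, Fin.sum_univ_two]
    rw [e]
    exact ((hψ.pd 0).pd 0).add ((hψ.pd 1).pd 1)
  exact ((integrable_mul_test (hX.dm_l2loc 0).locallyIntegrable (hψ.pd 1)).sub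
    (integrable_mul_test (hX.dm_l2loc 1).locallyIntegrable (hψ.pd 0))).sub
    (integrable_mul_test hX.dr_l2loc.locallyIntegrable hl)

end State.Valid

namespace Snapshot

variable {a c M : ℝ} {q : ℝ≥0∞}

/-! ### The energy estimate -/

/-- H¹ in the plane embeds in the Hölder partner of L^q. Only one power of `κ` appears, provided
that the H¹ norm of `f` is bounded by the energy alone. -/
lemma unifL2_mul_of_memLp (hq : 2 < q) {f : Snapshot a c M q → Plane → ℝ}
    {D : Snapshot a c M q → Fin 2 → Plane → ℝ} (hf : ∀ s, H1 (f s) (D s)) (h0 : UnifL2 e f)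
    (h1 : ∀ i, UnifL2 e (fun s => D s i)) {g : Snapshot a c M q → Plane → ℝ}
    (hg : ∀ s, MemLp (g s) q volume) (hg' : ∀ s, (eLpNorm (g s) q volume).toReal ≤ s.κ) :
    UnifL2 (fun s => s.κ * s.e) (fun s x => f s x * g s x) := by
  obtain ⟨C, hC, h⟩ := exists_n2_mul_le hq
  obtain ⟨K, hK, h0⟩ := h0
  choose L hL h1 using h1
  refine ⟨C * (K + L 0 + L 1), by have := hL 0; have := hL 1; positivity, fun s =>
    ⟨s.κe_nonneg, (h _ _ _ (hf s) (hg s)).1, (h _ _ _ (hf s) (hg s)).2.trans ?_⟩⟩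
  have h2 : h1n (f s) (D s) ≤ (K + L 0 + L 1) * s.e := by
    unfold h1n
    linarith [(h0 s).2.2, (h1 0 s).2.2, (h1 1 s).2.2]
  calc _ ≤ C * ((K + L 0 + L 1) * s.e) * s.κ :=
        mul_le_mul (mul_le_mul_of_nonneg_left h2 hC) (hg' s) ENNReal.toReal_nonneg
          (mul_nonneg hC ((h1n_nonneg _ _).trans h2))
    _ = _ := by ring

section Lq

variable (hq : 2 < q) {g : Snapshot a c M q → Plane → ℝ}
  (hg : ∀ s, MemLp (g s) q volume) (hg' : ∀ s, (eLpNorm (g s) q volume).toReal ≤ s.κ)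
include hq hg hg'

lemma δu_mul (k : Fin 2) :
    UnifL2 (fun s => s.κ * s.e) (fun s x => δ (fun X => X.u k) s x * g s x) :=
  unifL2_mul_of_memLp hq (fun s => s.h1_δu k) (tame_u k).diff (fun i => (tame_D i k).diff) hg hg'

/-- The H¹ norm of `δ∇ log ρ` already carries a factor `κ`, and using it directly would produce
`κ²`. Writing the difference as `δ∇ρ/ρ₁ - ∇ρ₂ δρ/(ρ₁ρ₂)` applies the embedding only to ∇δρ and δρ.
-/
lemma δl_mul (k : Fin 2) :
    UnifL2 (fun s => s.κ * s.e) (fun s x => δ (fun X => X.l k) s x * g s x) := by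
  have h1 := unifL2_mul_of_memLp hq (fun s => s.h1_δp k) (tame_p k).diff (fun i => δH_L2 i k) hg hg'
  have h2 := unifL2_mul_of_memLp hq (fun s => s.h1_δr) tame_r.diff (fun i => (tame_p i).diff) hg hg'
  refine ((tame_s.left.one_mul_L2 h1).sub (tame_s.left.one_mul_L2 (tame_s.right.one_mul_L2
    ((tame_p k).right.one_mul_L2 h2)))).congr fun s => ?_
  filter_upwards [s.hX.lower, s.hY.lower] with x h1 h2
  have h1' := (s.hX.a_pos.trans_le h1).ne'
  have h2' := (s.hX.a_pos.trans_le h2).ne'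
  simp only [δ, State.l, State.s]
  field_simp
  ring

end Lq

lemma h1_D (hq : 2 < q) (s : Snapshot a c M q) (j k : Fin 2) :
    H1loc (s.Y.D j k) (fun i => s.W i j k) :=
  ⟨((s.hY.h1_u k).dl2 j), fun i => l2loc_of_memLp hq.le (s.W_mem i j k), fun i => s.weak_W i j k⟩

/-- The gradient of the vorticity of the second flow. -/
def gradOm (s : Snapshot a c M q) (i : Fin 2) (x : Plane) : ℝ := s.W i 0 1 x - s.W i 1 0 x

lemma h1_om (hq : 2 < q) (s : Snapshot a c M q) : H1loc s.Y.om s.gradOm :=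
  (s.h1_D hq 0 1).sub (s.h1_D hq 1 0)

/-- The difference satisfies `∂ₜδω + b₁·∇δω = δ(omSource) - δb·∇ω₂`. Paired with δω the transport
term drops out by skew symmetry, and the right side is of size `κ e` in L². -/
lemma exists_vorticity_rate (hq : 2 < q) : ∃ K : ℝ, 0 ≤ K ∧ ∀ s : Snapshot a c M q,
    |∫ x, δ State.om s x * (s.V 0 1 x - s.V 1 0 x)| ≤ K * (s.κ * s.e ^ 2) := by
  have hW := fun (i j k l : Fin 2) => δu_mul (a := a) (c := c) (M := M) hq (g := fun s => s.W i j k)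
    (fun s => s.W_mem i j k) (fun s => s.W_le i j k) l
  have hW' := fun (i j k l : Fin 2) => δl_mul (a := a) (c := c) (M := M) hq (g := fun s => s.W i j k)
    (fun s => s.W_mem i j k) (fun s => s.W_le i j k) l
  have hP : UnifL2 (fun s : Snapshot a c M q => s.κ * s.e) (fun s x => δ State.omSource s x -
      (δ (fun X => X.b 0) s x * s.gradOm 0 x + δ (fun X => X.b 1) s x * s.gradOm 1 x)) := by
    refine (wild_omSource.diff.sub ((((hW 0 0 1 0).sub (hW 0 1 0 0)).add
      ((hW' 0 0 1 1).sub (hW' 0 1 0 1))).add (((hW 1 0 1 1).sub (hW 1 1 0 1)).sub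
      ((hW' 1 0 1 0).sub (hW' 1 1 0 0))))).congr fun s => ae_of_all _ fun x => ?_
    simp only [δ, State.b, gradOm, Matrix.cons_val_zero, Matrix.cons_val_one]
    ring
  have hom : UnifL2 (e : Snapshot a c M q → ℝ) (δ State.om) :=
    ⟨1, zero_le_one, fun s => ⟨s.e_nonneg, s.δom_mem, by
      rw [one_mul]; exact s.n2_sq_le_en.2.2.2.1⟩⟩
  obtain ⟨K, hK, h⟩ := hom.integral_mul hP
  refine ⟨K, hK, fun s => ?_⟩
  have hPs := (hP.choose_spec.2 s).2.1
  have hV : MemLp (fun x => s.V 0 1 x - s.V 1 0 x) 2 volume := (s.V_mem 0 1).sub (s.V_mem 1 0)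
  have key : ∫ x, δ State.om s x * ((δ State.omSource s x -
      (δ (fun X => X.b 0) s x * s.gradOm 0 x + δ (fun X => X.b 1) s x * s.gradOm 1 x)) -
        (s.V 0 1 x - s.V 1 0 x)) = 0 := by
    have hM := s.hX.M_nonneg
    have ha := s.hX.a_pos
    refine transport_skew_of_zeroInt (b := s.X.b) (B := fun k i => s.X.B i k)
      (Cb := M + a⁻¹ * M) s.hX.h1_b (by positivity) s.hX.b_le s.hX.div_b s.δom_mem
      (hPs.sub hV) fun φ hφ => ?_
    have z1 := s.hX.zeroInt_vorticity hφ
    have z2 := s.hY.zeroInt_vorticity hφ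
    have zV := fun i k => ZeroInt.of_eq (integrable_mul_test (s.weak_V i k).1 (hφ.pd i))
      (integrable_mul_test (s.weak_V i k).2.1 hφ).neg
      (((s.weak_V i k).2.2 φ hφ).trans (integral_neg _).symm)
    -- Turns the weak term `ω₂ δb·∇φ` into `-(δb·∇ω₂) φ`, as δb is divergence free.
    have zb := fun k => (s.h1_om hq).zeroInt_mul ((s.hX.h1_b k).sub (s.hY.h1_b k)) hφ k
    refine ((((z2.sub z1).add ((zV 1 0).sub (zV 0 1))).sub ((zb 0).add (zb 1)))).congr ?_
    filter_upwards [s.hX.div_b, s.hY.div_b] with x h1 h2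
    simp only [δ, State.om, Pi.neg_apply]
    linear_combination (s.Y.D 0 1 x - s.Y.D 1 0 x) * φ x * (h1 - h2)
  have i1 := integrable_mul_of_memLp s.δom_mem hPs
  have i2 := integrable_mul_of_memLp s.δom_mem hV
  have : ∫ x, δ State.om s x * (s.V 0 1 x - s.V 1 0 x) = ∫ x, δ State.om s x *
      (δ State.omSource s x - (δ (fun X => X.b 0) s x * s.gradOm 0 x +
        δ (fun X => X.b 1) s x * s.gradOm 1 x)) := by
    simp_rw [mul_sub (δ State.om s _) (δ State.omSource s _ - _)] at key
    rw [integral_sub i1 i2] at key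
    linarith
  rw [this]
  exact (h s).trans_eq (by ring)

/-- The gradient of `θ` for the second flow. -/
def gradTh (s : Snapshot a c M q) (i : Fin 2) (x : Plane) : ℝ :=
  (s.Y.u 1 x * s.Y.H i 0 x + s.Y.D i 1 x * s.Y.p 0 x) +
    (s.Y.r x * s.W i 0 1 x + s.Y.p i x * s.Y.D 0 1 x) -
    (s.Y.u 0 x * s.Y.H i 1 x + s.Y.D i 0 x * s.Y.p 1 x) -
    (s.Y.r x * s.W i 1 0 x + s.Y.p i x * s.Y.D 1 0 x) - s.Λ i x

lemma h1_th (hq : 2 < q) (s : Snapshot a c M q) : H1loc s.Y.th s.gradTh := by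
  have hu := fun k i => (s.hY.h1_u k).bdd_mul (s.hY.h1_p i) (s.hY.u_le k) (fun i => s.hY.D_le i k)
  have hr := fun j k => s.hY.h1_r.bdd_mul (s.h1_D hq j k) s.hY.r_le s.hY.p_le
  have hl : H1loc (fun x => s.Y.H 0 0 x + s.Y.H 1 1 x) s.Λ :=
    ⟨(s.hY.H_l2loc 0 0).add (s.hY.H_l2loc 1 1), fun i => l2loc_of_memLp hq.le (s.Λ_mem i), s.weak_Λ⟩
  refine (((((hu 1 0).add (hr 0 1)).sub (hu 0 1)).sub (hr 1 0)).sub hl).congr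
    (ae_of_all _ fun x => ?_) fun i => ae_of_all _ fun x => rfl
  simp only [State.th]; ring

/-- The same scheme for `∂ₜδθ + u₁·∇δθ = δ(thSource) - δu·∇θ₂`, with `u₁` in the role of `b₁`. -/
lemma exists_theta_rate (hq : 2 < q) : ∃ K : ℝ, 0 ≤ K ∧ ∀ s : Snapshot a c M q,
    |∫ x, δ State.th s x * s.T x| ≤ K * (s.κ * s.e ^ 2) := by
  have hW := fun (i j k l : Fin 2) => δu_mul (a := a) (c := c) (M := M) hq (g := fun s => s.W i j k)
    (fun s => s.W_mem i j k) (fun s => s.W_le i j k) l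
  have hΛ := fun (i l : Fin 2) => δu_mul (a := a) (c := c) (M := M) hq (g := fun s => s.Λ i)
    (fun s => s.Λ_mem i) (fun s => s.Λ_le i) l
  have hG : ∀ i, UnifL2 (fun s : Snapshot a c M q => s.κ * s.e)
      (fun s x => δ (fun X => X.u i) s x * s.gradTh i x) := by
    intro i
    -- The part of `∇θ₂` bounded by a multiple of `κ`, which meets δu in L². The rest, the second
    -- derivatives of `u₂` and `∇Δρ₂`, is only in L^q and needs δu in H¹.
    have hb : Unif (fun s : Snapshot a c M q => s.κ) (fun s x =>
        (s.Y.u 1 x * s.Y.H i 0 x + s.Y.D i 1 x * s.Y.p 0 x) + s.Y.p i x * s.Y.D 0 1 x -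
        (s.Y.u 0 x * s.Y.H i 1 x + s.Y.D i 0 x * s.Y.p 1 x) - s.Y.p i x * s.Y.D 1 0 x) :=
      (((((Wild.tame_mul (tame_u 1) (wild_H i 0)).add ((tame_D i 1).mul (tame_p 0)).wild).add
        ((tame_p i).mul (tame_D 0 1)).wild).sub ((Wild.tame_mul (tame_u 0) (wild_H i 1)).add
        ((tame_D i 0).mul (tame_p 1)).wild)).sub ((tame_p i).mul (tame_D 1 0)).wild).right
    refine (((hb.mul_L2 (tame_u i).diff).add (tame_r.right.one_mul_L2
      ((hW i 0 1 i).sub (hW i 1 0 i)))).sub (hΛ i i)).congr fun s => ae_of_all _ fun x => ?_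
    simp only [gradTh]; ring
  have hP : UnifL2 (fun s : Snapshot a c M q => s.κ * s.e) (fun s x => δ State.thSource s x -
      (δ (fun X => X.u 0) s x * s.gradTh 0 x + δ (fun X => X.u 1) s x * s.gradTh 1 x)) :=
    wild_thSource.diff.sub ((hG 0).add (hG 1))
  obtain ⟨K, hK, h⟩ := δth_L2.integral_mul hP
  refine ⟨K, hK, fun s => ?_⟩
  have hPs := (hP.choose_spec.2 s).2.1
  have key : ∫ x, δ State.th s x * ((δ State.thSource s x -
      (δ (fun X => X.u 0) s x * s.gradTh 0 x + δ (fun X => X.u 1) s x * s.gradTh 1 x)) -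
        s.T x) = 0 := by
    refine transport_skew_of_zeroInt (b := s.X.u) (B := fun k i => s.X.D i k)
      (Cb := M) s.hX.h1_u s.hX.M_nonneg s.hX.u_le s.hX.div s.δth_mem
      (hPs.sub s.T_mem) fun φ hφ => ?_
    have z1 := s.hX.zeroInt_theta hφ
    have z2 := s.hY.zeroInt_theta hφ
    have iX := s.hX.integrable_thRate hφ
    have iY := s.hY.integrable_thRate hφ
    have zT := ZeroInt.of_eq (integrable_mul_test (memLp_l2loc s.T_mem).locallyIntegrable hφ)
      (iX.sub iY) ((s.T_eq φ hφ).trans (integral_sub iX iY).symm)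
    have zb := fun k => (s.h1_th hq).zeroInt_mul ((s.hX.h1_u k).sub (s.hY.h1_u k)) hφ k
    refine ((((z2.sub z1).sub zT).sub ((zb 0).add (zb 1)))).congr ?_
    filter_upwards [s.hX.div, s.hY.div] with x h1 h2
    simp only [δ, State.dm, Pi.sub_apply]
    linear_combination s.Y.th x * φ x * (h1 - h2)
  have i1 := integrable_mul_of_memLp s.δth_mem hPs
  have i2 := integrable_mul_of_memLp s.δth_mem s.T_mem
  have : ∫ x, δ State.th s x * s.T x = ∫ x, δ State.th s x *
      (δ State.thSource s x - (δ (fun X => X.u 0) s x * s.gradTh 0 x +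
        δ (fun X => X.u 1) s x * s.gradTh 1 x)) := by
    simp_rw [mul_sub (δ State.th s _) (δ State.thSource s _ - _)] at key
    rw [integral_sub i1 i2] at key
    linarith
  rw [this]
  exact (h s).trans_eq (by ring)

/-- The time derivative of the energy of the difference. -/
def rate (s : Snapshot a c M q) : ℝ :=
  2 * ((∫ x, δ State.r s x * δ State.dr s x) +
    (∫ x, δ (fun X => X.u 0) s x * δ (fun X => X.v 0) s x) +
    (∫ x, δ (fun X => X.u 1) s x * δ (fun X => X.v 1) s x) +
    (∫ x, δ State.om s x * (s.V 0 1 x - s.V 1 0 x)) + ∫ x, δ State.th s x * s.T x)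

/-- Every pairing is a factor of size `e` times one of size `κ e`. The density and velocity terms
need only Cauchy–Schwarz, because their time derivatives are already controlled. -/
theorem exists_rate_le (a c M : ℝ) (hq : 2 < q) : ∃ K : ℝ, 0 ≤ K ∧ ∀ s : Snapshot a c M q,
    s.rate ≤ K * (s.κ * s.en) := by
  obtain ⟨K1, h1, H1⟩ := exists_vorticity_rate (a := a) (c := c) (M := M) hq
  obtain ⟨K2, h2, H2⟩ := exists_theta_rate (a := a) (c := c) (M := M) hq
  obtain ⟨K3, h3, H3⟩ := tame_r.diff.integral_mul
    (tame_dr (a := a) (c := c) (M := M) (q := q)).wild.diff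
  have hu := fun k => (tame_u k).diff.integral_mul (wild_v (a := a) (c := c) (M := M) (q := q) k).diff
  obtain ⟨K4, h4, H4⟩ := hu 0
  obtain ⟨K5, h5, H5⟩ := hu 1
  refine ⟨2 * (K1 + K2 + K3 + K4 + K5), by positivity, fun s => ?_⟩
  rw [← sq_e]
  have e : ∀ K : ℝ, K * (s.e * (s.κ * s.e)) = K * (s.κ * s.e ^ 2) := fun K => by ring
  have a1 := (le_abs_self _).trans (H1 s)
  have a2 := (le_abs_self _).trans (H2 s)
  have a3 := (le_abs_self _).trans (H3 s)
  have a4 := (le_abs_self _).trans (H4 s)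
  have a5 := (le_abs_self _).trans (H5 s)
  simp only [e] at a3 a4 a5
  unfold rate
  linarith

/-- The square of the distance between the two flows. -/
def dist2 (s : Snapshot a c M q) : ℝ :=
  n2 (δ State.r s) ^ 2 + (n2 (δ (fun X => X.p 0) s) ^ 2 + n2 (δ (fun X => X.p 1) s) ^ 2) +
    (n2 (δ (fun X => X.H 0 0) s) ^ 2 + n2 (δ (fun X => X.H 0 1) s) ^ 2 +
      n2 (δ (fun X => X.H 1 0) s) ^ 2 + n2 (δ (fun X => X.H 1 1) s) ^ 2) +
    (n2 (δ (fun X => X.u 0) s) ^ 2 + n2 (δ (fun X => X.u 1) s) ^ 2) +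
    (n2 (δ (fun X => X.D 0 0) s) ^ 2 + n2 (δ (fun X => X.D 0 1) s) ^ 2 +
      n2 (δ (fun X => X.D 1 0) s) ^ 2 + n2 (δ (fun X => X.D 1 1) s) ^ 2)

lemma exists_sq_le {w w' : Snapshot a c M q → ℝ} (hw : ∀ s, w s ^ 2 = w' s)
    {f : Snapshot a c M q → Plane → ℝ} (h : UnifL2 w f) :
    ∃ K : ℝ, 0 ≤ K ∧ ∀ s, n2 (f s) ^ 2 ≤ K * w' s := by
  obtain ⟨K, hK, h⟩ := h
  refine ⟨K ^ 2, by positivity, fun s => ?_⟩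
  rw [← hw, ← mul_pow]
  exact pow_le_pow_left₀ (n2_nonneg _) (h s).2.2 2

theorem exists_dist2_le (a c M : ℝ) (q : ℝ≥0∞) : ∃ K : ℝ, 0 ≤ K ∧ ∀ s : Snapshot a c M q,
    s.dist2 ≤ K * s.en := by
  obtain ⟨K0, h0, H0⟩ := exists_sq_le sq_e (tame_r (a := a) (c := c) (M := M) (q := q)).diff
  choose K1 h1 H1 using fun i => exists_sq_le sq_e (tame_p (a := a) (c := c) (M := M) (q := q) i).diff
  choose K2 h2 H2 using fun i => exists_sq_le sq_e (tame_u (a := a) (c := c) (M := M) (q := q) i).diff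
  choose K3 h3 H3 using fun i k => exists_sq_le sq_e
    (tame_D (a := a) (c := c) (M := M) (q := q) i k).diff
  choose K4 h4 H4 using fun i k => exists_sq_le sq_e (δH_L2 (a := a) (c := c) (M := M) (q := q) i k)
  refine ⟨K0 + (K1 0 + K1 1) + (K4 0 0 + K4 0 1 + K4 1 0 + K4 1 1) + (K2 0 + K2 1) +
    (K3 0 0 + K3 0 1 + K3 1 0 + K3 1 1), ?_, fun s => ?_⟩
  · have := h1 0; have := h1 1; have := h2 0; have := h2 1
    have := h3 0 0; have := h3 0 1; have := h3 1 0; have := h3 1 1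
    have := h4 0 0; have := h4 0 1; have := h4 1 0; have := h4 1 1
    positivity
  · unfold dist2
    linarith [H0 s, H1 0 s, H1 1 s, H2 0 s, H2 1 s, H3 0 0 s, H3 0 1 s, H3 1 0 s, H3 1 1 s,
      H4 0 0 s, H4 0 1 s, H4 1 0 s, H4 1 1 s]

/-- The converse comparison uses the algebra of tame quantities with the distance itself as weight:
`ω` and `θ` are polynomial in the listed derivatives. -/
theorem exists_en_le (a c M : ℝ) (q : ℝ≥0∞) : ∃ K : ℝ, 0 ≤ K ∧ ∀ s : Snapshot a c M q,
    s.en ≤ K * s.dist2 := by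
  have hd : ∀ s : Snapshot a c M q, 0 ≤ s.dist2 := fun s => by unfold dist2; positivity
  have hsq : ∀ s : Snapshot a c M q, √s.dist2 ^ 2 = s.dist2 := fun s => Real.sq_sqrt (hd s)
  have sq := fun f => sq_nonneg (n2 f)
  have hle : ∀ (s : Snapshot a c M q),
      (n2 (δ State.r s) ≤ √s.dist2 ∧ ∀ k, n2 (δ (fun X => X.u k) s) ≤ √s.dist2) ∧
      (∀ k, n2 (δ (fun X => X.p k) s) ≤ √s.dist2) ∧
      ∀ i k, n2 (δ (fun X => X.D i k) s) ≤ √s.dist2 ∧ n2 (δ (fun X => X.H i k) s) ≤ √s.dist2 := by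
    intro s
    have s0 := sq (δ State.r s)
    have s1 := sq (δ (fun X => X.p 0) s)
    have s2 := sq (δ (fun X => X.p 1) s)
    have s3 := sq (δ (fun X => X.u 0) s)
    have s4 := sq (δ (fun X => X.u 1) s)
    have t0 := sq (δ (fun X => X.D 0 0) s)
    have t1 := sq (δ (fun X => X.D 0 1) s)
    have t2 := sq (δ (fun X => X.D 1 0) s)
    have t3 := sq (δ (fun X => X.D 1 1) s)
    have h0 := sq (δ (fun X => X.H 0 0) s)
    have h1 := sq (δ (fun X => X.H 0 1) s)
    have h2 := sq (δ (fun X => X.H 1 0) s)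
    have h3 := sq (δ (fun X => X.H 1 1) s)
    refine ⟨⟨?_, fun k => ?_⟩, fun k => ?_, fun i k => ⟨?_, ?_⟩⟩ <;>
      refine Real.le_sqrt_of_sq_le ?_ <;> unfold dist2 <;> try fin_cases k
    all_goals try fin_cases i
    all_goals try simp only [Fin.zero_eta, Fin.mk_one]
    all_goals linarith
  have hw : Dominates (fun s : Snapshot a c M q => √s.dist2) :=
    ⟨fun s => (hle s).1.1, fun s k => (hle s).1.2 k, fun s i k => ((hle s).2.2 i k).1,
      fun s k => (hle s).2.1 k⟩
  have hH : ∀ i k, UnifL2 (fun s : Snapshot a c M q => √s.dist2) (δ (fun X => X.H i k)) :=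
    fun i k => ⟨1, zero_le_one, fun s => ⟨Real.sqrt_nonneg _, s.H_mem i k, by
      rw [one_mul]; exact ((hle s).2.2 i k).2⟩⟩
  have hth : UnifL2 (fun s : Snapshot a c M q => √s.dist2) (δ State.th) :=
    ((hw.tame_curl.diff.sub (hH 0 0)).sub (hH 1 1)).congr fun s => ae_of_all _ fun x => by
      simp only [δ, State.th]; ring
  have hom : UnifL2 (fun s : Snapshot a c M q => √s.dist2) (δ State.om) :=
    ((hw.tame_D 0 1).diff.sub (hw.tame_D 1 0).diff).congr fun s => ae_of_all _ fun x => by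
      simp only [δ, State.om]; ring
  obtain ⟨K0, h0, H0⟩ := exists_sq_le hsq hw.tame_r.diff
  obtain ⟨K1, h1, H1⟩ := exists_sq_le hsq (hw.tame_u 0).diff
  obtain ⟨K2, h2, H2⟩ := exists_sq_le hsq (hw.tame_u 1).diff
  obtain ⟨K3, h3, H3⟩ := exists_sq_le hsq hom
  obtain ⟨K4, h4, H4⟩ := exists_sq_le hsq hth
  refine ⟨K0 + K1 + K2 + K3 + K4, by positivity, fun s => ?_⟩
  unfold en
  linarith [H0 s, H1 s, H2 s, H3 s, H4 s]

end Snapshot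

/-! ### Functions of time with an integrable weak derivative -/

/-- `max F G` and `G` are continuous and agree almost everywhere. Relations known at almost every
time are transferred in this way to the initial time. -/
lemma forall_le_of_ae_Icc {T : ℝ} (hT : 0 < T) {F G : ℝ → ℝ} (hF : ContinuousOn F (Icc 0 T))
    (hG : ContinuousOn G (Icc 0 T)) (h : ∀ᵐ t ∂(volume.restrict (Icc 0 T)), F t ≤ G t) :
    ∀ t ∈ Icc 0 T, F t ≤ G t := by
  have := Measure.eqOn_Icc_of_ae_eq (μ := volume) hT.ne (f := fun t => max (F t) (G t)) (g := G)
    (h.mono fun t ht => max_eq_right ht) (hF.sup hG) hG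
  intro t ht
  rw [← this ht]
  exact le_max_left _ _

/-- `A(t) = c + ∫₀ᵗ N` for almost every `t ∈ [0,T]`. -/
def Rep1 (T : ℝ) (A : ℝ → ℝ) (c : ℝ) (N : ℝ → ℝ) : Prop :=
  IntegrableOn N (Icc 0 T) volume ∧
    ∀ᵐ t ∂(volume.restrict (Icc 0 T)), A t = c + ∫ s in (0)..t, N s

section OneDim

variable {T : ℝ} {A N A' N' : ℝ → ℝ} {c c' : ℝ}

lemma intervalIntegrable_of_Icc (hT : 0 ≤ T) (h : IntegrableOn N (Icc 0 T) volume) :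
    IntervalIntegrable N volume 0 T := by
  rw [intervalIntegrable_iff_integrableOn_Icc_of_le hT]; exact h

lemma ac_primitive (hT : 0 ≤ T) (h : IntegrableOn N (Icc 0 T) volume) (c : ℝ) :
    AbsolutelyContinuousOnInterval (fun t => c + ∫ s in (0)..t, N s) 0 T := by
  have h1 := (intervalIntegrable_of_Icc hT h).absolutelyContinuousOnInterval_intervalIntegral
    (c := 0) (by simp)
  have h2 : AbsolutelyContinuousOnInterval (fun _ : ℝ => c) 0 T :=
    (contDiff_const.contDiffOn (n := 1)).absolutelyContinuousOnInterval
  exact h2.add h1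

lemma ae_hasDerivAt_primitive (hT : 0 ≤ T) (h : IntegrableOn N (Icc 0 T) volume) (c : ℝ) :
    ∀ᵐ t ∂(volume.restrict (Icc 0 T)), HasDerivAt (fun t => c + ∫ s in (0)..t, N s) (N t) t := by
  rw [ae_restrict_iff' measurableSet_Icc]
  filter_upwards [(intervalIntegrable_of_Icc hT h).ae_hasDerivAt_integral] with t ht htT
  rw [uIcc_of_le hT] at ht
  exact (ht htT 0 ⟨le_rfl, hT⟩).const_add c

lemma Rep1.of_ac (hT : 0 ≤ T) {F : ℝ → ℝ} (hF : AbsolutelyContinuousOnInterval F 0 T)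
    (hd : ∀ᵐ t ∂(volume.restrict (Icc 0 T)), HasDerivAt F (N t) t)
    (hA : ∀ᵐ t ∂(volume.restrict (Icc 0 T)), A t = F t) : Rep1 T A (F 0) N := by
  have hi := hF.intervalIntegrable_deriv
  rw [intervalIntegrable_iff_integrableOn_Icc_of_le hT] at hi
  refine ⟨hi.congr (hd.mono fun t ht => ht.deriv), ?_⟩
  rw [ae_restrict_iff' measurableSet_Icc] at hd
  filter_upwards [hA, ae_restrict_mem measurableSet_Icc] with t ht htT
  have h1 := (hF.mono (c := 0) (d := t) (by
    rw [uIcc_of_le htT.1, uIcc_of_le hT]; exact Icc_subset_Icc_right htT.2)).integral_deriv_eq_sub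
  have h2 : ∫ s in (0)..t, N s = ∫ s in (0)..t, deriv F s := by
    refine intervalIntegral.integral_congr_ae ?_
    filter_upwards [hd] with s hs hst
    rw [uIoc_of_le htT.1] at hst
    exact (hs ⟨hst.1.le, hst.2.trans htT.2⟩).deriv.symm
  rw [ht, h2, h1]; ring

namespace Rep1

lemma congr (h : Rep1 T A c N) (hA : ∀ᵐ t ∂(volume.restrict (Icc 0 T)), A' t = A t)
    (hN : ∀ᵐ t ∂(volume.restrict (Icc 0 T)), N' t = N t) : Rep1 T A' c N' := by
  refine ⟨h.1.congr (hN.mono fun t ht => ht.symm), ?_⟩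
  rw [ae_restrict_iff' measurableSet_Icc] at hN
  filter_upwards [h.2, hA, ae_restrict_mem measurableSet_Icc] with t h1 h2 htT
  rw [h2, h1]
  congr 1
  refine intervalIntegral.integral_congr_ae ?_
  filter_upwards [hN] with s hs hst
  rw [uIoc_of_le htT.1] at hst
  exact (hs ⟨hst.1.le, hst.2.trans htT.2⟩).symm

lemma mul (hT : 0 ≤ T) (h : Rep1 T A c N) (h' : Rep1 T A' c' N') :
    Rep1 T (fun t => A t * A' t) (c * c') (fun t => N t * A' t + A t * N' t) := by
  have := of_ac hT (A := fun t => A t * A' t) (N := fun t => N t * A' t + A t * N' t)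
    ((ac_primitive hT h.1 c).fun_mul (ac_primitive hT h'.1 c')) (by
      filter_upwards [ae_hasDerivAt_primitive hT h.1 c, ae_hasDerivAt_primitive hT h'.1 c',
        h.2, h'.2] with t h1 h2 h3 h4
      rw [h3, h4]; exact h1.mul h2) (by
      filter_upwards [h.2, h'.2] with t h3 h4
      rw [h3, h4])
  simpa using this

lemma add (hT : 0 ≤ T) (h : Rep1 T A c N) (h' : Rep1 T A' c' N') :
    Rep1 T (fun t => A t + A' t) (c + c') (fun t => N t + N' t) := by
  have := of_ac hT (A := fun t => A t + A' t) (N := fun t => N t + N' t)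
    ((ac_primitive hT h.1 c).add (ac_primitive hT h'.1 c')) (by
      filter_upwards [ae_hasDerivAt_primitive hT h.1 c, ae_hasDerivAt_primitive hT h'.1 c']
        with t h1 h2
      exact h1.add h2) (by
      filter_upwards [h.2, h'.2] with t h3 h4
      rw [h3, h4]; rfl)
  simpa using this

lemma neg (hT : 0 ≤ T) (h : Rep1 T A c N) : Rep1 T (fun t => - A t) (-c) (fun t => - N t) := by
  have := of_ac hT (A := fun t => - A t) (N := fun t => - N t) (ac_primitive hT h.1 c).neg (by
      filter_upwards [ae_hasDerivAt_primitive hT h.1 c] with t h1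
      exact h1.neg) (by
      filter_upwards [h.2] with t h3
      rw [h3]; rfl)
  simpa using this

lemma sub (hT : 0 ≤ T) (h : Rep1 T A c N) (h' : Rep1 T A' c' N') :
    Rep1 T (fun t => A t - A' t) (c - c') (fun t => N t - N' t) := by
  simpa only [sub_eq_add_neg] using h.add hT (h'.neg hT)

lemma inv (hT : 0 < T) {a : ℝ} (ha : 0 < a) (h : Rep1 T A c N)
    (hA : ∀ᵐ t ∂(volume.restrict (Icc 0 T)), a ≤ A t) :
    Rep1 T (fun t => (A t)⁻¹) c⁻¹ (fun t => -((A t)⁻¹ ^ 2 * N t)) := by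
  have hac := ac_primitive hT.le h.1 c
  have hle : ∀ t ∈ Icc 0 T, a ≤ c + ∫ s in (0)..t, N s := by
    have hc := hac.continuousOn
    rw [uIcc_of_le hT.le] at hc
    refine forall_le_of_ae_Icc hT continuousOn_const hc ?_
    filter_upwards [h.2, hA] with t h1 h2
    rwa [← h1]
  -- Inversion is Lipschitz with constant `a⁻²` on `[a, ∞)`; the tolerance is divided by this
  -- constant.
  have hinv : AbsolutelyContinuousOnInterval (fun t => (c + ∫ s in (0)..t, N s)⁻¹) 0 T := by
    rw [absolutelyContinuousOnInterval_iff] at hac ⊢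
    intro ε hε
    obtain ⟨δ, hδ, H⟩ := hac (ε / a⁻¹ ^ 2) (by positivity)
    refine ⟨δ, hδ, fun E hE hsum => ?_⟩
    have h1 := H E hE hsum
    rw [lt_div_iff₀ (by positivity), mul_comm, Finset.mul_sum] at h1
    refine lt_of_le_of_lt (Finset.sum_le_sum fun i hi => ?_) h1
    have hm := hE.1 i (by simpa using hi)
    rw [uIcc_of_le hT.le] at hm
    exact abs_inv_sub_inv_le ha (hle _ hm.1) (hle _ hm.2)
  have := of_ac hT.le (A := fun t => (A t)⁻¹) (N := fun t => -((A t)⁻¹ ^ 2 * N t)) hinv (by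
      filter_upwards [ae_hasDerivAt_primitive hT.le h.1 c, h.2,
        ae_restrict_mem measurableSet_Icc] with t h1 h2 h3
      rw [h2]
      refine (h1.inv (ha.trans_le (hle t h3)).ne').congr_deriv ?_
      rw [inv_pow]; ring) (by
      filter_upwards [h.2] with t h3
      rw [h3])
  simpa using this

lemma unique (hT : 0 < T) (h : Rep1 T A c N) (h' : Rep1 T A c' N') :
    c = c' ∧ ∀ᵐ t ∂(volume.restrict (Icc 0 T)), N t = N' t := by
  have h1 := (ac_primitive hT.le h.1 c).continuousOn
  have h2 := (ac_primitive hT.le h'.1 c').continuousOn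
  rw [uIcc_of_le hT.le] at h1 h2
  have heq := Measure.eqOn_Icc_of_ae_eq (μ := volume) hT.ne (by
    filter_upwards [h.2, h'.2] with t h3 h4
    rw [← h3, h4]) h1 h2
  refine ⟨by simpa using heq ⟨le_rfl, hT.le⟩, ?_⟩
  have hIoo : ∀ᵐ t ∂(volume.restrict (Icc 0 T)), t ∈ Ioo 0 T := by
    rw [← restrict_Ioo_eq_restrict_Icc]; exact ae_restrict_mem measurableSet_Ioo
  filter_upwards [ae_hasDerivAt_primitive hT.le h.1 c, ae_hasDerivAt_primitive hT.le h'.1 c',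
    hIoo] with t h3 h4 h5
  refine h3.unique (h4.congr_of_eventuallyEq ?_)
  filter_upwards [Ioo_mem_nhds h5.1 h5.2] with s hs
  exact heq ⟨hs.1.le, hs.2.le⟩

/-- Integration by parts against `τ - t`. The integrated form does not mention values at single
times, so it is compatible with Fubini in space. -/
lemma integral_eq (h : Rep1 T A c N) {τ : ℝ} (hτ : τ ∈ Icc 0 T) :
    ∫ t in (0)..τ, A t = τ * c + ∫ t in (0)..τ, (τ - t) * N t := by
  have hN := h.1.mono_set (Icc_subset_Icc_right hτ.2)
  have hac := ac_primitive hτ.1 hN c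
  have hf : AbsolutelyContinuousOnInterval (fun t => τ - t) 0 τ :=
    ((contDiff_const.sub contDiff_id).contDiffOn (n := 1)).absolutelyContinuousOnInterval
  have hp := hf.integral_mul_deriv_eq_deriv_mul hac
  have hd : ∀ t : ℝ, deriv (fun t => τ - t) t = -1 := fun t => by
    simp
  simp only [hd, sub_self, zero_mul, sub_zero, intervalIntegral.integral_same, add_zero, neg_mul,
    one_mul, intervalIntegral.integral_neg] at hp
  have e1 : ∫ t in (0)..τ, A t = ∫ t in (0)..τ, (c + ∫ s in (0)..t, N s) := by
    refine intervalIntegral.integral_congr_ae ?_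
    have := h.2
    rw [ae_restrict_iff' measurableSet_Icc] at this
    filter_upwards [this] with t ht htm
    rw [uIoc_of_le hτ.1] at htm
    exact ht ⟨htm.1.le, htm.2.trans hτ.2⟩
  have e2 : ∫ t in (0)..τ, (τ - t) * N t =
      ∫ t in (0)..τ, (τ - t) * deriv (fun t => c + ∫ s in (0)..t, N s) t := by
    refine intervalIntegral.integral_congr_ae ?_
    have := ae_hasDerivAt_primitive hτ.1 hN c
    rw [ae_restrict_iff' measurableSet_Icc] at this
    filter_upwards [this] with t ht htm
    rw [uIoc_of_le hτ.1] at htm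
    rw [(ht ⟨htm.1.le, htm.2⟩).deriv]
  rw [e1, e2, hp]; ring

/-- Differentiating in `τ` recovers the representation. Rational `τ` suffice by continuity of the
primitive, and countability is what permits exceptional null sets depending on `τ`. -/
lemma of_integral_eq (hT : 0 < T) (hA : IntegrableOn A (Icc 0 T) volume)
    (hN : IntegrableOn N (Icc 0 T) volume)
    (h : ∀ τ : ℚ, (τ : ℝ) ∈ Ioo 0 T →
      ∫ t in (0)..τ, A t = τ * c + ∫ t in (0)..τ, (τ - t) * N t) : Rep1 T A c N := by
  refine ⟨hN, ?_⟩
  have hac := (ac_primitive hT.le hN c).continuousOn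
  rw [uIcc_of_le hT.le] at hac
  have hZ : IntegrableOn (fun t => A t - (c + ∫ s in (0)..t, N s)) (Icc 0 T) volume :=
    hA.sub hac.integrableOn_Icc
  have hzero : ∀ τ : ℚ, (τ : ℝ) ∈ Ioo 0 T →
      ∫ t in (0)..τ, (A t - (c + ∫ s in (0)..t, N s)) = 0 := by
    intro τ hτ
    have hτ' : (τ : ℝ) ∈ Icc 0 T := ⟨hτ.1.le, hτ.2.le⟩
    have hsub : Icc (0 : ℝ) τ ⊆ Icc 0 T := Icc_subset_Icc_right hτ.2.le
    have h1 := integral_eq (A := fun t => c + ∫ s in (0)..t, N s) ⟨hN, ae_of_all _ fun t => rfl⟩ hτ'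
    rw [intervalIntegral.integral_sub (intervalIntegrable_of_Icc hτ.1.le (hA.mono_set hsub))
      (intervalIntegrable_of_Icc hτ.1.le (hac.integrableOn_Icc.mono_set hsub)), h τ hτ, h1, sub_self]
  have hcont := (ac_primitive hT.le hZ 0).continuousOn
  rw [uIcc_of_le hT.le] at hcont
  simp only [zero_add] at hcont
  have hall : ∀ t ∈ Ioo 0 T, ∫ s in (0)..t, (A s - (c + ∫ r in (0)..s, N r)) = 0 := by
    intro t ht
    by_contra hne
    have hev := (hcont.continuousAt (Icc_mem_nhds ht.1 ht.2)).eventually_ne hne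
    obtain ⟨l, u, hlu, hsub⟩ := mem_nhds_iff_exists_Ioo_subset.1
      (hev.and (Ioo_mem_nhds ht.1 ht.2))
    obtain ⟨τ, h1, h2⟩ := exists_rat_btwn (hlu.1.trans hlu.2)
    have := hsub ⟨h1, h2⟩
    exact this.1 (hzero τ this.2)
  have hIoo : ∀ᵐ t ∂(volume.restrict (Icc 0 T)), t ∈ Ioo 0 T := by
    rw [← restrict_Ioo_eq_restrict_Icc]; exact ae_restrict_mem measurableSet_Ioo
  filter_upwards [ae_hasDerivAt_primitive hT.le hZ 0, hIoo] with t h1 h2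
  have h3 : HasDerivAt (fun t => 0 + ∫ s in (0)..t, (A s - (c + ∫ r in (0)..s, N r))) 0 t := by
    refine (hasDerivAt_const t (0 : ℝ)).congr_of_eventuallyEq ?_
    filter_upwards [Ioo_mem_nhds h2.1 h2.2] with s hs
    rw [hall s hs, zero_add]
  linarith [h1.unique h3]

/-- A function with weak derivative `N` and initial value `c`. -/
lemma of_weak (hT : 0 < T) (hA : IntegrableOn A (Icc 0 T) volume)
    (hN : IntegrableOn N (Icc 0 T) volume)
    (h : ∀ α : ℝ → ℝ, ContDiff ℝ ((⊤ : ℕ∞) : WithTop ℕ∞) α → HasCompactSupport α →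
      (∀ t ∈ tsupport α, t < T) →
      (∫ t in Icc 0 T, (A t * deriv α t + N t * α t)) + c * α 0 = 0) : Rep1 T A c N := by
  refine ⟨hN, ?_⟩
  have hac := ac_primitive hT.le hN c
  have hcont := hac.continuousOn
  rw [uIcc_of_le hT.le] at hcont
  have hZ : IntegrableOn (fun t => A t - (c + ∫ s in (0)..t, N s)) (Icc 0 T) volume :=
    hA.sub hcont.integrableOn_Icc
  -- Du Bois-Reymond: each `β` supported inside the interval is on `[0, T]` the derivative of an
  -- admissible `α` vanishing at `T`, whose value at 0 carries the initial value `c`.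
  have key := isOpen_Ioo (a := 0) (b := T) |>.ae_eq_zero_of_integral_contDiff_smul_eq_zero
    (μ := volume) (hZ.mono_set Ioo_subset_Icc_self).locallyIntegrableOn fun β hβ hβc hβs => ?_
  · rw [← restrict_Ioo_eq_restrict_Icc, ae_restrict_iff' measurableSet_Ioo]
    filter_upwards [key] with t ht htm
    linarith [ht htm]
  -- the test function with derivative `β` on `[0, T]`
  have hder : ∀ t, HasDerivAt (fun t => ∫ s in T..t, β s) (β t) t := fun t =>
    hβ.continuous.integral_hasStrictDerivAt T t |>.hasDerivAt
  have hB : ContDiff ℝ ((⊤ : ℕ∞) : WithTop ℕ∞) (fun t => ∫ s in T..t, β s) := by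
    rw [contDiff_infty_iff_deriv]
    refine ⟨fun t => (hder t).differentiableAt, ?_⟩
    rwa [show deriv (fun t => ∫ s in T..t, β s) = β from funext fun t => (hder t).deriv]
  obtain ⟨b, hbT, hb⟩ : ∃ b < T, ∀ t, b ≤ t → β t = 0 := by
    rcases (tsupport β).eq_empty_or_nonempty with he | hne
    · refine ⟨0, hT, fun t _ => image_eq_zero_of_notMem_tsupport (by simp [he])⟩
    · obtain ⟨m, hm, hmax⟩ := hβc.isCompact.exists_isMaxOn hne continuousOn_id
      refine ⟨(m + T) / 2, by linarith [(hβs hm).2], fun t ht =>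
        image_eq_zero_of_notMem_tsupport fun htm => ?_⟩
      have := hmax htm
      simp only [id] at this
      linarith [(hβs hm).2, show t ≤ m from this]
  have hB0 : ∀ t, b ≤ t → ∫ s in T..t, β s = 0 := by
    intro t ht
    refine intervalIntegral.integral_zero_ae (ae_of_all _ fun s hs => hb s ?_)
    rcases le_total T t with h1 | h1
    · rw [uIoc_of_le h1] at hs; linarith [hs.1]
    · rw [uIoc_of_ge h1] at hs; linarith [hs.1]
  -- The primitive of `β` need not vanish at negative times. The bump makes it compactly supported
  -- and is one near `[0, T]`.
  let χ : ContDiffBump (0 : ℝ) := ⟨T + 1, T + 2, by linarith, by linarith⟩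
  have hχ1 : ∀ t ∈ Ioo (-(T + 1)) (T + 1), χ t = 1 := fun t ht => by
    refine χ.one_of_mem_closedBall ?_
    rw [mem_closedBall_zero_iff, Real.norm_eq_abs, abs_le]
    exact ⟨ht.1.le, ht.2.le⟩
  have hα : ContDiff ℝ ((⊤ : ℕ∞) : WithTop ℕ∞) (fun t => χ t * ∫ s in T..t, β s) :=
    χ.contDiff.mul hB
  have hαs : tsupport (fun t => χ t * ∫ s in T..t, β s) ⊆ Iic b := by
    refine closure_minimal (fun t ht => ?_) isClosed_Iic
    by_contra hlt
    exact ht (by simp [hB0 t (not_le.1 hlt).le])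
  have hαd : ∀ t ∈ Icc 0 T, deriv (fun t => χ t * ∫ s in T..t, β s) t = β t := by
    intro t ht
    refine HasDerivAt.deriv ((hder t).congr_of_eventuallyEq ?_)
    filter_upwards [Ioo_mem_nhds (show -(T + 1) < t by linarith [ht.1])
      (show t < T + 1 by linarith [ht.2])] with s hs
    rw [hχ1 s hs, one_mul]
  have hαcs : HasCompactSupport (fun t => χ t * ∫ s in T..t, β s) :=
    χ.hasCompactSupport.mul_right
  generalize hαdef : (fun t => χ t * ∫ s in T..t, β s) = α at hα hαs hαd hαcs
  have hmain := h α hα hαcs fun t ht => lt_of_le_of_lt (hαs ht) hbT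
  have hαT : α T = 0 := by simp [← hαdef]
  have hαc := hα.continuous
  have hαac : AbsolutelyContinuousOnInterval α 0 T :=
    ((hα.of_le (by exact_mod_cast le_top)).contDiffOn (n := 1)).absolutelyContinuousOnInterval
  have hparts := hac.integral_mul_deriv_eq_deriv_mul hαac
  have e2 : ∫ t in (0)..T, deriv (fun t => c + ∫ s in (0)..t, N s) t * α t =
      ∫ t in (0)..T, N t * α t := by
    refine intervalIntegral.integral_congr_ae ?_
    have := ae_hasDerivAt_primitive hT.le hN c
    rw [ae_restrict_iff' measurableSet_Icc] at this
    filter_upwards [this] with t ht htm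
    rw [uIoc_of_le hT.le] at htm
    rw [(ht ⟨htm.1.le, htm.2⟩).deriv]
  rw [e2, hαT, intervalIntegral.integral_same] at hparts
  have hβi : ∀ {f : ℝ → ℝ}, IntegrableOn f (Icc 0 T) volume → ∀ {γ : ℝ → ℝ}, Continuous γ →
      IntegrableOn (fun t => f t * γ t) (Icc 0 T) volume := fun hf γ hγ =>
    hf.mul_continuousOn hγ.continuousOn isCompact_Icc
  have e3 : ∫ t in Icc 0 T, (A t * deriv α t + N t * α t) =
      (∫ t in Icc 0 T, A t * β t) + ∫ t in Icc 0 T, N t * α t := by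
    rw [← integral_add (hβi hA hβ.continuous) (hβi hN hαc)]
    exact setIntegral_congr_fun measurableSet_Icc fun t ht => by simp only [hαd t ht]
  have e4 : ∫ t in (0)..T, (c + ∫ s in (0)..t, N s) * deriv α t =
      ∫ t in Icc 0 T, (c + ∫ s in (0)..t, N s) * β t := by
    rw [intervalIntegral.integral_of_le hT.le, ← integral_Icc_eq_integral_Ioc]
    exact setIntegral_congr_fun measurableSet_Icc fun t ht => by simp only [hαd t ht]
  have e5 : ∫ t in (0)..T, N t * α t = ∫ t in Icc 0 T, N t * α t := by
    rw [intervalIntegral.integral_of_le hT.le, ← integral_Icc_eq_integral_Ioc]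
  have e6 : ∫ t, β t • (A t - (c + ∫ s in (0)..t, N s)) =
      (∫ t in Icc 0 T, A t * β t) - ∫ t in Icc 0 T, (c + ∫ s in (0)..t, N s) * β t := by
    rw [← integral_sub (hβi hA hβ.continuous) (hβi hcont.integrableOn_Icc hβ.continuous),
      ← setIntegral_eq_integral_of_forall_compl_eq_zero (s := Icc 0 T)]
    · exact setIntegral_congr_fun measurableSet_Icc fun t _ => by
        simp only [smul_eq_mul]; ring
    · intro t ht
      rw [image_eq_zero_of_notMem_tsupport fun h => ht (Ioo_subset_Icc_self (hβs h)), zero_smul]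
  rw [e6]
  rw [e3] at hmain
  rw [e4, e5] at hparts
  linarith

end Rep1

end OneDim

/-! ### Functions of time and space -/

/-- The measure on `[0,T] × ℝ²`. -/
abbrev slab (T : ℝ) : Measure (ℝ × Plane) := (volume.restrict (Icc 0 T)).prod volume

lemma restrict_prod_eq (T : ℝ) (K : Set Plane) :
    (volume : Measure (ℝ × Plane)).restrict (Icc 0 T ×ˢ K) =
      (volume.restrict (Icc 0 T)).prod (volume.restrict K) := by
  rw [Measure.volume_eq_prod, Measure.prod_restrict]

lemma restrict_slab (T : ℝ) :
    (volume : Measure (ℝ × Plane)).restrict (Icc 0 T ×ˢ univ) = slab T := by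
  rw [restrict_prod_eq, Measure.restrict_univ]

lemma locInt_iff {T : ℝ} {f : ℝ → Plane → ℝ} : LocInt T f ↔ ∀ K : Set Plane, IsCompact K →
    Integrable (fun z : ℝ × Plane => f z.1 z.2)
      ((volume.restrict (Icc 0 T)).prod (volume.restrict K)) := by
  simp only [LocInt, IntegrableOn, restrict_prod_eq]

namespace LocInt

variable {T : ℝ} {f g : ℝ → Plane → ℝ} {ψ : Plane → ℝ}

lemma integrable_test (h : LocInt T f) (hψ : IsTest ψ) :
    Integrable (fun z : ℝ × Plane => f z.1 z.2 * ψ z.2) (slab T) := by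
  have hK : IsCompact (tsupport ψ) := hψ.2
  obtain ⟨C, -, hC⟩ := hψ.exists_bound
  have h1 := locInt_iff.1 h _ hK
  have h2 : Integrable (fun z : ℝ × Plane => f z.1 z.2 * ψ z.2)
      ((volume.restrict (Icc 0 T)).prod (volume.restrict (tsupport ψ))) :=
    h1.mul_bdd (c := C) (hψ.continuous.comp continuous_snd).aestronglyMeasurable
      (ae_of_all _ fun z => hC z.2)
  have h3 : IntegrableOn (fun z : ℝ × Plane => f z.1 z.2 * ψ z.2) (univ ×ˢ tsupport ψ) (slab T) := by
    rw [IntegrableOn, slab, ← Measure.prod_restrict, Measure.restrict_univ]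
    exact h2
  refine (integrableOn_iff_integrable_of_support_subset fun z hz => ?_).1 h3
  exact ⟨mem_univ _, subset_tsupport _ (right_ne_zero_of_mul hz)⟩

lemma ae_slice (h : LocInt T f) :
    ∀ᵐ t ∂(volume.restrict (Icc 0 T)), LocallyIntegrable (f t) volume := by
  have : ∀ᵐ t ∂(volume.restrict (Icc 0 T)), ∀ n, Integrable (fun x => f t x * cutoff n x) volume :=
    ae_all_iff.2 fun n => (h.integrable_test (cutoff_isTest n)).prod_right_ae
  filter_upwards [this] with t ht
  rw [locallyIntegrable_iff]
  intro K hK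
  obtain ⟨n, hn⟩ := exists_cutoff_eq_one hK
  exact (ht n).integrableOn.congr_fun_ae (by
    filter_upwards [ae_restrict_mem hK.measurableSet] with x hx
    rw [(hn n le_rfl x hx).1, mul_one])

lemma ae_line (h : LocInt T f) : ∀ᵐ x, IntegrableOn (fun t => f t x) (Icc 0 T) volume := by
  have : ∀ᵐ x : Plane, ∀ n, Integrable (fun t => f t x * cutoff n x) (volume.restrict (Icc 0 T)) :=
    ae_all_iff.2 fun n => (h.integrable_test (cutoff_isTest n)).prod_left_ae
  filter_upwards [this] with x hx
  obtain ⟨n, hn⟩ := exists_cutoff_eq_one (isCompact_singleton (x := x))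
  have := hx n
  rwa [show (fun t => f t x * cutoff n x) = fun t => f t x by
    rw [(hn n le_rfl x rfl).1]; simp only [mul_one]] at this

lemma integrableOn_pair (h : LocInt T f) (hψ : IsTest ψ) :
    IntegrableOn (fun t => ∫ x, f t x * ψ x) (Icc 0 T) volume :=
  (h.integrable_test hψ).integral_prod_left

lemma mono (h : LocInt T f) {τ : ℝ} (hτ : τ ≤ T) : LocInt τ f := fun K hK =>
  (h K hK).mono_set (prod_mono_left (Icc_subset_Icc_right hτ))

lemma time_mul (h : LocInt T f) {w : ℝ → ℝ} (hw : Continuous w) :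
    LocInt T (fun t x => w t * f t x) := by
  obtain ⟨C, hC⟩ := (isCompact_Icc (a := (0 : ℝ)) (b := T)).exists_bound_of_continuousOn
    hw.continuousOn
  intro K hK
  refine (h K hK).bdd_mul (c := C) (hw.comp continuous_fst).aestronglyMeasurable ?_
  filter_upwards [ae_restrict_mem (measurableSet_Icc.prod hK.measurableSet)] with z hz
  exact hC _ hz.1

lemma add (h : LocInt T f) (h' : LocInt T g) : LocInt T (fun t x => f t x + g t x) :=
  fun K hK => (h K hK).add (h' K hK)

lemma neg (h : LocInt T f) : LocInt T (fun t x => - f t x) := fun K hK => (h K hK).neg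

lemma sub (h : LocInt T f) (h' : LocInt T g) : LocInt T (fun t x => f t x - g t x) :=
  fun K hK => (h K hK).sub (h' K hK)

lemma integral_swap (h : LocInt T f) (hT : 0 ≤ T) (hψ : IsTest ψ) :
    ∫ t in (0)..T, ∫ x, f t x * ψ x = ∫ x, (∫ t in (0)..T, f t x) * ψ x := by
  rw [intervalIntegral.integral_of_le hT, ← integral_Icc_eq_integral_Ioc,
    integral_integral_swap (h.integrable_test hψ)]
  refine integral_congr_ae (ae_of_all _ fun x => ?_)
  simp only
  rw [intervalIntegral.integral_of_le hT, ← integral_Icc_eq_integral_Ioc, integral_mul_const]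

lemma locallyIntegrable_primitive (h : LocInt T f) (hT : 0 ≤ T) :
    LocallyIntegrable (fun x => ∫ t in (0)..T, f t x) volume := by
  rw [locallyIntegrable_iff]
  intro K hK
  simp only [intervalIntegral.integral_of_le hT, ← integral_Icc_eq_integral_Ioc]
  exact (locInt_iff.1 h K hK).integral_prod_right

end LocInt

/-- `f` has initial value `f0` and time derivative `g`, along almost every vertical line. -/
def Rep (T : ℝ) (f : ℝ → Plane → ℝ) (f0 : Plane → ℝ) (g : ℝ → Plane → ℝ) : Prop :=
  ∀ᵐ x, Rep1 T (fun t => f t x) (f0 x) (fun t => g t x)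

/-- `f` has initial value `f0` and time derivative `g` in the sense of distributions in space. -/
def WeakRep (T : ℝ) (f : ℝ → Plane → ℝ) (f0 : Plane → ℝ) (g : ℝ → Plane → ℝ) : Prop :=
  ∀ ψ : Plane → ℝ, IsTest ψ →
    Rep1 T (fun t => ∫ x, f t x * ψ x) (∫ x, f0 x * ψ x) (fun t => ∫ x, g t x * ψ x)

/-- Fubini applied to the time-integrated identity on each line. -/
lemma Rep.weak {T : ℝ} (hT : 0 < T) {f g : ℝ → Plane → ℝ} {f0 : Plane → ℝ} (h : Rep T f f0 g)
    (hf : LocInt T f) (hg : LocInt T g) (hf0 : LocallyIntegrable f0 volume) : WeakRep T f f0 g := by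
  intro ψ hψ
  refine Rep1.of_integral_eq hT (hf.integrableOn_pair hψ) (hg.integrableOn_pair hψ) fun τ hτ => ?_
  have hw := (hg.time_mul (w := fun s => (τ : ℝ) - s) (by fun_prop)).mono hτ.2.le
  have e : ∫ t in (0)..(τ : ℝ), ((τ : ℝ) - t) * ∫ x, g t x * ψ x =
      ∫ x, (∫ t in (0)..(τ : ℝ), ((τ : ℝ) - t) * g t x) * ψ x := by
    rw [← hw.integral_swap hτ.1.le hψ]
    simp only [← integral_const_mul, mul_assoc]
  rw [(hf.mono hτ.2.le).integral_swap hτ.1.le hψ, e, ← integral_const_mul,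
    ← integral_add ((integrable_mul_test hf0 hψ).const_mul _)
      (integrable_mul_test (hw.locallyIntegrable_primitive hτ.1.le) hψ)]
  refine integral_congr_ae ?_
  filter_upwards [h] with x hx
  rw [hx.integral_eq ⟨hτ.1.le, hτ.2.le⟩]; ring

/-- The integrated identity at a rational `τ` holds as distributions, hence for almost every `x`.
Passing to lines is worthwhile because products and quotients in time are available there and not
under the pairing. -/
lemma WeakRep.rep {T : ℝ} (hT : 0 < T) {f g : ℝ → Plane → ℝ} {f0 : Plane → ℝ}
    (h : WeakRep T f f0 g) (hf : LocInt T f) (hg : LocInt T g)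
    (hf0 : LocallyIntegrable f0 volume) : Rep T f f0 g := by
  have key : ∀ᵐ x, ∀ τ : ℚ, (τ : ℝ) ∈ Ioo 0 T →
      ∫ t in (0)..(τ : ℝ), f t x = τ * f0 x + ∫ t in (0)..(τ : ℝ), (τ - t) * g t x := by
    rw [ae_all_iff]
    intro τ
    by_cases hτ : (τ : ℝ) ∈ Ioo 0 T
    swap
    · exact ae_of_all _ fun x hx => absurd hx hτ
    have hw := (hg.time_mul (w := fun s => (τ : ℝ) - s) (by fun_prop)).mono hτ.2.le
    have i1 := (hf.mono hτ.2.le).locallyIntegrable_primitive hτ.1.le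
    have i2 := hw.locallyIntegrable_primitive hτ.1.le
    have i3 : LocallyIntegrable (fun x => (τ : ℝ) * f0 x) volume := hf0.smul (τ : ℝ)
    have := ae_eq_of_test i1 (i3.add i2) fun ψ hψ => ?_
    · filter_upwards [this] with x hx _ using hx
    have e : ∫ t in (0)..(τ : ℝ), ((τ : ℝ) - t) * ∫ x, g t x * ψ x =
        ∫ x, (∫ t in (0)..(τ : ℝ), ((τ : ℝ) - t) * g t x) * ψ x := by
      rw [← hw.integral_swap hτ.1.le hψ]
      simp only [← integral_const_mul, mul_assoc]
    rw [← (hf.mono hτ.2.le).integral_swap hτ.1.le hψ, (h ψ hψ).integral_eq ⟨hτ.1.le, hτ.2.le⟩, e,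
      ← integral_const_mul, ← integral_add ((integrable_mul_test hf0 hψ).const_mul _)
      (integrable_mul_test i2 hψ)]
    refine integral_congr_ae (ae_of_all _ fun x => ?_)
    simp only [Pi.add_apply]; ring
  filter_upwards [key, hf.ae_line, hg.ae_line] with x h1 h2 h3
  exact Rep1.of_integral_eq hT h2 h3 h1

section BalanceLaw

variable {α : ℝ → ℝ} {ψ : Plane → ℝ}

lemma isTimeTest_mul {T : ℝ} (hα : ContDiff ℝ ((⊤ : ℕ∞) : WithTop ℕ∞) α) (hαc : HasCompactSupport α)
    (hαT : ∀ t ∈ tsupport α, t < T) (hψ : IsTest ψ) :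
    IsTimeTest T (fun z : ℝ × Plane => α z.1 * ψ z.2) := by
  have hsub : tsupport (fun z : ℝ × Plane => α z.1 * ψ z.2) ⊆ tsupport α ×ˢ tsupport ψ := by
    refine closure_minimal (fun z hz => ?_) ((isClosed_tsupport α).prod (isClosed_tsupport ψ))
    exact ⟨subset_tsupport _ (left_ne_zero_of_mul hz), subset_tsupport _ (right_ne_zero_of_mul hz)⟩
  exact ⟨(hα.comp contDiff_fst).mul (hψ.1.comp contDiff_snd),
    (hαc.isCompact.prod hψ.2.isCompact).of_isClosed_subset (isClosed_tsupport _) hsub,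
    fun z hz => hαT _ (hsub hz).1⟩

lemma hasFDerivAt_tensor (hα : Differentiable ℝ α) (hψ : Differentiable ℝ ψ) (z : ℝ × Plane) :
    HasFDerivAt (fun z : ℝ × Plane => α z.1 * ψ z.2)
      (α z.1 • (fderiv ℝ ψ z.2).comp (ContinuousLinearMap.snd ℝ ℝ Plane) +
        ψ z.2 • (fderiv ℝ α z.1).comp (ContinuousLinearMap.fst ℝ ℝ Plane)) z :=
  ((hα z.1).hasFDerivAt.comp z hasFDerivAt_fst).mul ((hψ z.2).hasFDerivAt.comp z hasFDerivAt_snd)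

lemma dt_tensor (hα : Differentiable ℝ α) (hψ : Differentiable ℝ ψ) (z : ℝ × Plane) :
    dt (fun z : ℝ × Plane => α z.1 * ψ z.2) z = deriv α z.1 * ψ z.2 := by
  rw [dt, (hasFDerivAt_tensor hα hψ z).fderiv]
  simp [mul_comm]

lemma dx_tensor (hα : Differentiable ℝ α) (hψ : Differentiable ℝ ψ) (i : Fin 2) (z : ℝ × Plane) :
    dx i (fun z : ℝ × Plane => α z.1 * ψ z.2) z = α z.1 * pd i ψ z.2 := by
  rw [dx, (hasFDerivAt_tensor hα hψ z).fderiv]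
  simp [pd]

/-- Testing with products `α(t) ψ(x)` gives the weak time derivative of the pairing with `ψ`. -/
lemma rep1_of_balance {T : ℝ} (hT : 0 < T) {f : ℝ → Plane → ℝ} {F : Fin 2 → ℝ → Plane → ℝ}
    {f0 : Plane → ℝ} (hf : LocInt T f) (hF : ∀ i, LocInt T (F i))
    (h : ∀ φ : ℝ × Plane → ℝ, IsTimeTest T φ →
      (∫ z in Icc 0 T ×ˢ univ, (f z.1 z.2 * dt φ z + ∑ i, F i z.1 z.2 * dx i φ z))
        + ∫ x, f0 x * φ (0, x) = 0) (hψ : IsTest ψ) :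
    Rep1 T (fun t => ∫ x, f t x * ψ x) (∫ x, f0 x * ψ x)
      (fun t => (∫ x, F 0 t x * pd 0 ψ x) + ∫ x, F 1 t x * pd 1 ψ x) := by
  refine Rep1.of_weak hT (hf.integrableOn_pair hψ)
    (((hF 0).integrableOn_pair (hψ.pd 0)).add ((hF 1).integrableOn_pair (hψ.pd 1)))
    fun α hα hαc hαT => ?_
  have h1 := h _ (isTimeTest_mul hα hαc hαT hψ)
  have hαd : Differentiable ℝ α := hα.differentiable (by simp)
  have hα' : Continuous (deriv α) := hα.continuous_deriv (by norm_cast)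
  have j1 := (hf.time_mul hα').integrable_test hψ
  have j2 := fun i => ((hF i).time_mul hα.continuous).integrable_test (hψ.pd i)
  rw [restrict_slab] at h1
  have e0 : ∫ x, f0 x * (α 0 * ψ x) = (∫ x, f0 x * ψ x) * α 0 := by
    rw [← integral_mul_const]
    exact integral_congr_ae (ae_of_all _ fun x => by ring)
  rw [e0] at h1
  refine Eq.trans ?_ h1
  congr 1
  have e1 : ∫ z, (f z.1 z.2 * dt (fun z : ℝ × Plane => α z.1 * ψ z.2) z +
        ∑ i, F i z.1 z.2 * dx i (fun z : ℝ × Plane => α z.1 * ψ z.2) z) ∂(slab T) =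
      ∫ z, ((deriv α z.1 * f z.1 z.2 * ψ z.2 + α z.1 * F 0 z.1 z.2 * pd 0 ψ z.2) +
        α z.1 * F 1 z.1 z.2 * pd 1 ψ z.2) ∂(slab T) := by
    refine integral_congr_ae (ae_of_all _ fun z => ?_)
    simp only [dt_tensor hαd hψ.differentiable, dx_tensor hαd hψ.differentiable, Fin.sum_univ_two]
    ring
  have j3 : Integrable (fun z : ℝ × Plane => deriv α z.1 * f z.1 z.2 * ψ z.2 +
    α z.1 * F 0 z.1 z.2 * pd 0 ψ z.2) (slab T) := j1.add (j2 0)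
  rw [e1, integral_add j3 (j2 1), integral_add j1 (j2 0), integral_prod _ j1,
    integral_prod _ (j2 0), integral_prod _ (j2 1),
    ← integral_add j1.integral_prod_left (j2 0).integral_prod_left, ← integral_add _ (j2 1).integral_prod_left]
  · refine integral_congr_ae (ae_of_all _ fun t => ?_)
    simp only [mul_assoc, integral_const_mul]
    ring
  · exact j1.integral_prod_left.add (j2 0).integral_prod_left

end BalanceLaw

/-! ### A countable determining family of test functions -/

/-- Translated and reflected mollifiers with centres in a countable dense set. -/
def testFam (n m : ℕ) (t : Plane) : ℝ := eta n (TopologicalSpace.denseSeq Plane m - t)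

lemma testFam_isTest (n m : ℕ) : IsTest (testFam n m) := isTest_comp_sub (eta_isTest n) _

lemma pd_pd_comp_sub {k : Plane → ℝ} (hk : IsTest k) (i : Fin 2) (x t : Plane) :
    pd i (pd i (fun s => k (x - s))) t = pd i (pd i k) (x - t) := by
  have e : pd i (fun s => k (x - s)) = fun s => (-1) * pd i k (x - s) := by
    ext s; rw [pd_comp_sub hk.differentiable]; ring
  rw [e, pd_const_mul (isTest_comp_sub (hk.pd i) x).differentiable,
    pd_comp_sub (hk.pd i).differentiable]
  ring

lemma tendsto_integral_moll_mul {f φ : Plane → ℝ} (hf : L2loc f) (hφ : IsTest φ) :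
    Tendsto (fun n => ∫ x, moll n f x * φ x) atTop (𝓝 (∫ x, f x * φ x)) := by
  simpa [mul_comm] using
    tendsto_moll_pair hf (continuous_l2loc (f := fun _ => (1 : ℝ)) continuous_const) hφ

/-- A second order distributional identity may be tested on a countable family. -/
lemma forall_test_of_testFam {A B₀ B₁ C : Plane → ℝ} (hA : L2loc A) (hB₀ : L2loc B₀) (hB₁ : L2loc B₁)
    (hC : L2loc C) (h : ∀ n m, (∫ x, A x * testFam n m x) + (∫ x, B₀ x * pd 0 (testFam n m) x) +
      (∫ x, B₁ x * pd 1 (testFam n m) x) + (∫ x, C x * lap (testFam n m) x) = 0)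
    {ψ : Plane → ℝ} (hψ : IsTest ψ) :
    (∫ x, A x * ψ x) + (∫ x, B₀ x * pd 0 ψ x) + (∫ x, B₁ x * pd 1 ψ x) + (∫ x, C x * lap ψ x) = 0 := by
  have hCl := hC.locallyIntegrable
  have sm : ∀ {f : Plane → ℝ}, L2loc f → ∀ n, ContDiff ℝ ((⊤ : ℕ∞) : WithTop ℕ∞) (moll n f) :=
    fun hf n => moll_contDiff hf.locallyIntegrable n
  have hpd : ∀ {f : Plane → ℝ}, L2loc f → ∀ n i (y : Plane),
      ∫ x, f x * pd i (fun t => eta n (y - t)) x = - pd i (moll n f) y := by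
    intro f hf n i y
    rw [pd_moll hf.locallyIntegrable, ← integral_neg]
    refine integral_congr_ae (ae_of_all _ fun x => ?_)
    simp only [pd_comp_sub (eta_isTest n).differentiable]; ring
  have hpd2 : ∀ n i (y : Plane),
      ∫ x, C x * pd i (pd i (fun t => eta n (y - t))) x = pd i (pd i (moll n C)) y := by
    intro n i y
    have e : pd i (moll n C) = fun x => ∫ t, pd i (eta n) (x - t) * C t := by
      ext x; exact pd_moll hCl n i x
    rw [e, pd_conv ((eta_isTest n).pd i) hCl]
    refine integral_congr_ae (ae_of_all _ fun x => ?_)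
    simp only [pd_pd_comp_sub (eta_isTest n)]; ring
  have hlap : ∀ n (y : Plane), ∫ x, C x * lap (fun t => eta n (y - t)) x = lap (moll n C) y := by
    intro n y
    simp only [lap, Fin.sum_univ_two, mul_add]
    have ht := fun i => ((isTest_comp_sub (eta_isTest n) y).pd i).pd i
    rw [integral_add (integrable_mul_test hCl (ht 0)) (integrable_mul_test hCl (ht 1)), hpd2, hpd2]
  have hlapc : ∀ n, ContDiff ℝ ((⊤ : ℕ∞) : WithTop ℕ∞) (lap (moll n C)) := fun n => by
    have := (contDiff_pd (contDiff_pd (sm hC n) 0) 0).add (contDiff_pd (contDiff_pd (sm hC n) 1) 1)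
    rwa [show lap (moll n C) = fun x => pd 0 (pd 0 (moll n C)) x + pd 1 (pd 1 (moll n C)) x from
      funext fun x => by simp [lap, Fin.sum_univ_two]]
  -- The family tests the mollified equation at a dense set of points, and continuity gives all
  -- points. A general `ψ` is reached by integrating and letting `n → ∞`. Countability of the family
  -- yields exceptional times independent of the test function.
  have hzero : ∀ n y, moll n A y - pd 0 (moll n B₀) y - pd 1 (moll n B₁) y + lap (moll n C) y = 0 := by
    intro n
    suffices h : (fun y => moll n A y - pd 0 (moll n B₀) y - pd 1 (moll n B₁) y + lap (moll n C) y) =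
      fun _ => 0 from fun y => congrFun h y
    refine Continuous.ext_on (TopologicalSpace.denseRange_denseSeq Plane) ?_ continuous_const ?_
    · exact (((sm hA n).continuous.sub (contDiff_pd (sm hB₀ n) 0).continuous).sub
        (contDiff_pd (sm hB₁ n) 1).continuous).add (hlapc n).continuous
    · rintro _ ⟨m, rfl⟩
      have := h n m
      unfold testFam at this
      rw [hpd hB₀, hpd hB₁, hlap] at this
      simp only
      rw [← this, moll]
      simp only [mul_comm (A _)]
      ring
  have hlapψ : ∀ x, lap ψ x = pd 0 (pd 0 ψ) x + pd 1 (pd 1 ψ) x := fun x => by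
    simp [lap, Fin.sum_univ_two]
  have hlapt : IsTest (lap ψ) := by
    rw [show lap ψ = fun x => pd 0 (pd 0 ψ) x + pd 1 (pd 1 ψ) x from funext hlapψ]
    exact ((hψ.pd 0).pd 0).add ((hψ.pd 1).pd 1)
  have happ : ∀ n, (∫ x, moll n A x * ψ x) + (∫ x, moll n B₀ x * pd 0 ψ x) +
      (∫ x, moll n B₁ x * pd 1 ψ x) + (∫ x, moll n C x * lap ψ x) = 0 := by
    intro n
    have hit : ∀ {f : Plane → ℝ}, ContDiff ℝ ((⊤ : ℕ∞) : WithTop ℕ∞) f →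
        ∀ {φ : Plane → ℝ}, IsTest φ → Integrable (fun x => f x * φ x) :=
      fun hf _ hφ => (hφ.smooth_mul hf).integrable
    have e : ∫ x, moll n C x * lap ψ x = ∫ x, lap (moll n C) x * ψ x := by
      simp only [hlapψ, mul_add]
      rw [integral_add (hit (sm hC n) ((hψ.pd 0).pd 0)) (hit (sm hC n) ((hψ.pd 1).pd 1)),
        integral_mul_pd (sm hC n) (hψ.pd 0), integral_mul_pd (sm hC n) (hψ.pd 1),
        integral_mul_pd (contDiff_pd (sm hC n) 0) hψ, integral_mul_pd (contDiff_pd (sm hC n) 1) hψ,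
        neg_neg, neg_neg, ← integral_add (hit (contDiff_pd (contDiff_pd (sm hC n) 0) 0) hψ)
          (hit (contDiff_pd (contDiff_pd (sm hC n) 1) 1) hψ)]
      refine integral_congr_ae (ae_of_all _ fun x => ?_)
      simp only [lap, Fin.sum_univ_two]; ring
    have i1 := hit (sm hA n) hψ
    have i2 := hit (contDiff_pd (sm hB₀ n) 0) hψ
    have i3 := hit (contDiff_pd (sm hB₁ n) 1) hψ
    have i4 := hit (hlapc n) hψ
    have i12 : Integrable (fun x => moll n A x * ψ x - pd 0 (moll n B₀) x * ψ x) := i1.sub i2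
    have i123 : Integrable (fun x => moll n A x * ψ x - pd 0 (moll n B₀) x * ψ x -
      pd 1 (moll n B₁) x * ψ x) := i12.sub i3
    rw [e, integral_mul_pd (sm hB₀ n) hψ, integral_mul_pd (sm hB₁ n) hψ, ← sub_eq_add_neg,
      ← sub_eq_add_neg, ← integral_sub i1 i2, ← integral_sub i12 i3, ← integral_add i123 i4]
    rw [← integral_zero Plane ℝ (μ := volume)]
    refine integral_congr_ae (ae_of_all _ fun x => ?_)
    linear_combination ψ x * hzero n x
  refine tendsto_nhds_unique ((((tendsto_integral_moll_mul hA hψ).add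
    (tendsto_integral_moll_mul hB₀ (hψ.pd 0))).add (tendsto_integral_moll_mul hB₁ (hψ.pd 1))).add
    (tendsto_integral_moll_mul hC hlapt)) ?_
  simp only [happ, tendsto_const_nhds_iff]

lemma ae_eq_of_testFam {A B : Plane → ℝ} (hA : L2loc A) (hB : L2loc B)
    (h : ∀ n m, ∫ x, A x * testFam n m x = ∫ x, B x * testFam n m x) : A =ᵐ[volume] B := by
  have hz : L2loc (fun _ : Plane => (0 : ℝ)) := continuous_l2loc continuous_const
  have e : ∀ {ψ : Plane → ℝ}, IsTest ψ →
      ∫ x, (A x - B x) * ψ x = (∫ x, A x * ψ x) - ∫ x, B x * ψ x := by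
    intro ψ hψ
    rw [← integral_sub (integrable_mul_test hA.locallyIntegrable hψ)
      (integrable_mul_test hB.locallyIntegrable hψ)]
    simp only [sub_mul]
  refine ae_eq_of_test hA.locallyIntegrable hB.locallyIntegrable fun ψ hψ => ?_
  have := forall_test_of_testFam (hA.sub hB) hz hz hz (fun n m => by
    rw [e (testFam_isTest n m), h n m]; simp) hψ
  rw [e hψ] at this
  simp only [zero_mul, integral_zero, add_zero] at this
  linarith

/-! ### Bounded and integrable functions on the slab -/

/-- The set in question need not be measurable, so the argument passes through a measurable
representative. -/
lemma ae_slab_of_ae_ae {T : ℝ} {f : ℝ → Plane → ℝ}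
    (hf : AEStronglyMeasurable (fun z : ℝ × Plane => f z.1 z.2) (slab T)) {s : Set ℝ}
    (hs : MeasurableSet s) (h : ∀ᵐ t ∂(volume.restrict (Icc 0 T)), ∀ᵐ x, f t x ∈ s) :
    ∀ᵐ z ∂(slab T), f z.1 z.2 ∈ s := by
  have h1 := hf.ae_eq_mk
  have h2 := Measure.ae_ae_of_ae_prod h1
  have h3 : ∀ᵐ z ∂(slab T), hf.mk _ z ∈ s := by
    refine (Measure.ae_prod_iff_ae_ae (hf.stronglyMeasurable_mk.measurable hs)).2 ?_
    filter_upwards [h, h2] with t h4 h5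
    filter_upwards [h4, h5] with x h6 h7
    rw [← h7]; exact h6
  filter_upwards [h1, h3] with z h4 h5
  rw [h4]; exact h5

/-- Functions on the slab bounded by `C`. -/
structure Bdd (T : ℝ) (f : ℝ → Plane → ℝ) (C : ℝ) : Prop where
  meas : AEStronglyMeasurable (fun z : ℝ × Plane => f z.1 z.2) (slab T)
  slice_le : ∀ᵐ t ∂(volume.restrict (Icc 0 T)), ∀ᵐ x, |f t x| ≤ C

namespace Bdd

variable {T C C' : ℝ} {f g : ℝ → Plane → ℝ}

lemma ae_le (h : Bdd T f C) : ∀ᵐ z ∂(slab T), |f z.1 z.2| ≤ C := by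
  have := ae_slab_of_ae_ae h.meas (s := Icc (-C) C) measurableSet_Icc
    (h.slice_le.mono fun t ht => ht.mono fun x hx => abs_le.1 hx)
  exact this.mono fun z hz => abs_le.2 hz

lemma mul_locInt (h : Bdd T f C) (hg : LocInt T g) : LocInt T (fun t x => f t x * g t x) := by
  intro K hK
  have hle : (volume : Measure (ℝ × Plane)).restrict (Icc 0 T ×ˢ K) ≤ slab T := by
    rw [← restrict_slab]; exact Measure.restrict_mono (prod_mono_right (subset_univ K)) le_rfl
  exact (hg K hK).bdd_mul (c := C) (h.meas.mono_measure hle)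
    ((Measure.absolutelyContinuous_of_le hle).ae_le h.ae_le)

lemma locInt (h : Bdd T f C) : LocInt T f := by
  have h1 : LocInt T (fun _ _ => (1 : ℝ)) := fun K hK =>
    continuousOn_const.integrableOn_compact (isCompact_Icc.prod hK)
  simpa using h.mul_locInt h1

lemma mul (h : Bdd T f C) (h' : Bdd T g C') : Bdd T (fun t x => f t x * g t x) (C * C') := by
  refine ⟨h.meas.mul h'.meas, ?_⟩
  filter_upwards [h.slice_le, h'.slice_le] with t h1 h2
  filter_upwards [h1, h2] with x h3 h4
  rw [abs_mul]
  exact mul_le_mul h3 h4 (abs_nonneg _) ((abs_nonneg _).trans h3)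

lemma add (h : Bdd T f C) (h' : Bdd T g C') : Bdd T (fun t x => f t x + g t x) (C + C') := by
  refine ⟨h.meas.add h'.meas, ?_⟩
  filter_upwards [h.slice_le, h'.slice_le] with t h1 h2
  filter_upwards [h1, h2] with x h3 h4
  exact (abs_add_le _ _).trans (add_le_add h3 h4)

lemma neg (h : Bdd T f C) : Bdd T (fun t x => - f t x) C :=
  ⟨h.meas.neg, by simpa using h.slice_le⟩

lemma sub (h : Bdd T f C) (h' : Bdd T g C') : Bdd T (fun t x => f t x - g t x) (C + C') := by
  simpa only [sub_eq_add_neg] using h.add h'.neg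

lemma congr (h : Bdd T f C) (hg : AEStronglyMeasurable (fun z : ℝ × Plane => g z.1 z.2) (slab T))
    (he : ∀ᵐ t ∂(volume.restrict (Icc 0 T)), f t =ᵐ[volume] g t) : Bdd T g C := by
  refine ⟨hg, ?_⟩
  filter_upwards [h.slice_le, he] with t h1 h2
  filter_upwards [h1, h2] with x h3 h4
  rwa [← h4]

lemma inv (hf : AEStronglyMeasurable (fun z : ℝ × Plane => f z.1 z.2) (slab T)) {a : ℝ} (ha : 0 < a)
    (h : ∀ᵐ t ∂(volume.restrict (Icc 0 T)), ∀ᵐ x, a ≤ f t x) : Bdd T (fun t x => (f t x)⁻¹) a⁻¹ := by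
  refine ⟨hf.aemeasurable.inv.aestronglyMeasurable, ?_⟩
  filter_upwards [h] with t ht
  filter_upwards [ht] with x hx
  rw [abs_inv, abs_of_pos (ha.trans_le hx)]
  exact inv_anti₀ ha hx

end Bdd

lemma LocInt.meas {T : ℝ} {f : ℝ → Plane → ℝ} (h : LocInt T f) :
    AEStronglyMeasurable (fun z : ℝ × Plane => f z.1 z.2) (slab T) := by
  have h1 : (univ : Set (ℝ × Plane)) = ⋃ n : ℕ, univ ×ˢ Metric.closedBall (0 : Plane) n := by
    rw [← prod_iUnion, Metric.iUnion_closedBall_nat, univ_prod_univ]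
  rw [← Measure.restrict_univ (μ := slab T), h1, aestronglyMeasurable_iUnion_iff]
  intro n
  rw [slab, ← Measure.prod_restrict, Measure.restrict_univ]
  exact (locInt_iff.1 h _ (isCompact_closedBall 0 (n : ℝ))).1

/-- A criterion for local integrability on the slab. -/
lemma locInt_of_lintegral_le {T : ℝ} {f : ℝ → Plane → ℝ}
    (hf : AEStronglyMeasurable (fun z : ℝ × Plane => f z.1 z.2) (slab T)) {n : ℝ → ℝ≥0∞}
    (hn : ∫⁻ t in Icc 0 T, n t ≠ ⊤) (h : ∀ K : Set Plane, IsCompact K → ∃ C : ℝ≥0∞, C ≠ ⊤ ∧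
      ∀ᵐ t ∂(volume.restrict (Icc 0 T)), ∫⁻ x in K, ‖f t x‖ₑ ≤ C * n t) : LocInt T f := by
  rw [locInt_iff]
  intro K hK
  have hle : (volume.restrict (Icc 0 T)).prod (volume.restrict K) ≤ slab T := by
    rw [← restrict_prod_eq, ← restrict_slab]
    exact Measure.restrict_mono (prod_mono_right (subset_univ K)) le_rfl
  obtain ⟨C, hC, hb⟩ := h K hK
  refine ⟨hf.mono_measure hle, ?_⟩
  rw [HasFiniteIntegral, lintegral_prod _ (hf.mono_measure hle).enorm]
  refine (lintegral_mono_ae hb).trans_lt ?_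
  rw [lintegral_const_mul' _ _ hC]
  exact ENNReal.mul_lt_top hC.lt_top hn.lt_top

/-! ### Norms of time slices -/

lemma measurable_eLpNorm_slice {g : ℝ × Plane → ℝ} (hg : Measurable g) (p : ℝ≥0∞) :
    Measurable (fun t => eLpNorm (fun x => g (t, x)) p volume) := by
  rcases eq_or_ne p 0 with rfl | h0
  · simp
  rcases eq_or_ne p ⊤ with rfl | hp
  · refine measurable_of_Iic fun c => ?_
    have hs : MeasurableSet {z : ℝ × Plane | c < ‖g z‖ₑ} := measurableSet_lt measurable_const hg.enorm
    have h1 := measurable_measure_prodMk_left (ν := (volume : Measure Plane)) hs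
    -- The essential supremum is at most `c` exactly when the slice of the superlevel set is null,
    -- and measures of slices are measurable in `t`.
    have e : (fun t => eLpNorm (fun x => g (t, x)) ⊤ volume) ⁻¹' Iic c =
        (fun t => volume (Prod.mk t ⁻¹' {z : ℝ × Plane | c < ‖g z‖ₑ})) ⁻¹' {0} := by
      ext t
      simp only [mem_preimage, mem_Iic, mem_singleton_iff, eLpNorm_exponent_top]
      have : (∀ᵐ x, ‖g (t, x)‖ₑ ≤ c) ↔
          volume (Prod.mk t ⁻¹' {z : ℝ × Plane | c < ‖g z‖ₑ}) = 0 := by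
        rw [ae_iff]; simp only [not_le]; rfl
      rw [← this]
      exact ⟨fun h => (enorm_ae_le_eLpNormEssSup (fun x => g (t, x)) volume).mono fun x hx =>
        hx.trans h, fun h => eLpNormEssSup_le_of_ae_enorm_bound h⟩
    rw [e]
    exact h1 (measurableSet_singleton 0)
  · simp only [eLpNorm_eq_lintegral_rpow_enorm_toReal h0 hp]
    exact ((hg.enorm.pow_const _).lintegral_prod_right').pow_const _

lemma aemeasurable_eLpNorm_slice {T : ℝ} {f : ℝ → Plane → ℝ}
    (hf : AEStronglyMeasurable (fun z : ℝ × Plane => f z.1 z.2) (slab T)) (p : ℝ≥0∞) :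
    AEMeasurable (fun t => eLpNorm (f t) p volume) (volume.restrict (Icc 0 T)) := by
  refine ⟨_, measurable_eLpNorm_slice hf.stronglyMeasurable_mk.measurable p, ?_⟩
  filter_upwards [Measure.ae_ae_of_ae_prod hf.ae_eq_mk] with t ht
  exact eLpNorm_congr_ae ht

/-- Integrates `n ≤ 1 + n^r`, which is cruder than Hölder but treats all finite exponents at once.
-/
lemma lintegral_le_of_eLpNorm_le {T : ℝ} {n : ℝ → ℝ≥0∞} {r : ℝ≥0∞} (h1 : 1 ≤ r) (hr : r ≠ ⊤)
    {M : ℝ≥0} (h : eLpNorm n r (volume.restrict (Icc 0 T)) ≤ M) :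
    ∫⁻ t in Icc 0 T, n t ≤ ENNReal.ofReal T + (M : ℝ≥0∞) ^ r.toReal := by
  have hr1 : 1 ≤ r.toReal := by
    rw [← ENNReal.toReal_one]; exact ENNReal.toReal_mono hr h1
  have hr0 : r ≠ 0 := (zero_lt_one.trans_le h1).ne'
  have h2 : ∫⁻ t in Icc 0 T, n t ^ r.toReal ≤ (M : ℝ≥0∞) ^ r.toReal := by
    rw [eLpNorm_eq_lintegral_rpow_enorm_toReal hr0 hr] at h
    have := ENNReal.rpow_le_rpow h (zero_le_one.trans hr1)
    rwa [← ENNReal.rpow_mul, one_div, inv_mul_cancel₀ (by positivity), ENNReal.rpow_one] at this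
  calc ∫⁻ t in Icc 0 T, n t ≤ ∫⁻ t in Icc 0 T, (1 + n t ^ r.toReal) := by
        refine lintegral_mono fun t => ?_
        rcases le_total (n t) 1 with h3 | h3
        · exact h3.trans le_self_add
        · calc n t = n t ^ (1 : ℝ) := (ENNReal.rpow_one _).symm
            _ ≤ n t ^ r.toReal := ENNReal.rpow_le_rpow_of_exponent_le h3 hr1
            _ ≤ _ := le_add_self
    _ = ENNReal.ofReal T + ∫⁻ t in Icc 0 T, n t ^ r.toReal := by
        rw [lintegral_add_left measurable_const]; simp
    _ ≤ _ := by gcongr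

namespace MemLrLp

variable {T : ℝ} {r p : ℝ≥0∞} {f : ℝ → Plane → ℝ} {M : ℝ≥0}

lemma meas (h : MemLrLp T r p f M) :
    AEStronglyMeasurable (fun z : ℝ × Plane => f z.1 z.2) (slab T) := by
  rw [← restrict_slab]; exact h.1

lemma bdd (h : MemLrLp T ⊤ ⊤ f M) : Bdd T f M := by
  refine ⟨h.meas, ?_⟩
  have h1 := enorm_ae_le_eLpNormEssSup (fun t => eLpNorm (f t) ⊤ volume) (volume.restrict (Icc 0 T))
  rw [← eLpNorm_exponent_top] at h1
  filter_upwards [h1] with t ht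
  have h2 := enorm_ae_le_eLpNormEssSup (f t) volume
  rw [← eLpNorm_exponent_top] at h2
  filter_upwards [h2] with x hx
  have h3 : ‖f t x‖ₑ ≤ (M : ℝ≥0∞) := hx.trans (ht.trans h.2)
  rw [enorm_le_coe] at h3
  exact h3

lemma ae_ne_top (h : MemLrLp T r p f M) (h1 : 1 ≤ r) (hr : r ≠ ⊤) :
    ∀ᵐ t ∂(volume.restrict (Icc 0 T)), eLpNorm (f t) p volume ≠ ⊤ := by
  have := lintegral_le_of_eLpNorm_le h1 hr h.2
  refine (ae_lt_top' (aemeasurable_eLpNorm_slice h.meas p) (ne_top_of_le_ne_top ?_ this)).mono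
    fun t ht => ht.ne
  exact ENNReal.add_ne_top.2 ⟨ENNReal.ofReal_ne_top, ENNReal.rpow_ne_top_of_nonneg
    ENNReal.toReal_nonneg ENNReal.coe_ne_top⟩

lemma ae_memLp (h : MemLrLp T r p f M) (h1 : 1 ≤ r) (hr : r ≠ ⊤) :
    ∀ᵐ t ∂(volume.restrict (Icc 0 T)), MemLp (f t) p volume := by
  filter_upwards [h.ae_ne_top h1 hr, h.meas.prodMk_left] with t ht hm using ⟨hm, ht.lt_top⟩

/-- The norms of the slices are integrable in time. -/
lemma integrableOn_norm (h : MemLrLp T r p f M) (h1 : 1 ≤ r) (hr : r ≠ ⊤) :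
    IntegrableOn (fun t => (eLpNorm (f t) p volume).toReal) (Icc 0 T) volume ∧
      ∫ t in Icc 0 T, (eLpNorm (f t) p volume).toReal ≤
        (ENNReal.ofReal T + (M : ℝ≥0∞) ^ r.toReal).toReal := by
  have hm := aemeasurable_eLpNorm_slice h.meas p
  have hle := lintegral_le_of_eLpNorm_le h1 hr h.2
  have hB : ENNReal.ofReal T + (M : ℝ≥0∞) ^ r.toReal ≠ ⊤ :=
    ENNReal.add_ne_top.2 ⟨ENNReal.ofReal_ne_top, ENNReal.rpow_ne_top_of_nonneg
      ENNReal.toReal_nonneg ENNReal.coe_ne_top⟩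
  refine ⟨integrable_toReal_of_lintegral_ne_top hm (ne_top_of_le_ne_top hB hle), ?_⟩
  rw [integral_toReal hm ((h.ae_ne_top h1 hr).mono fun t ht => ht.lt_top)]
  exact ENNReal.toReal_mono hB hle

lemma locInt (h : MemLrLp T r ⊤ f M) (h1 : 1 ≤ r) (hr : r ≠ ⊤) : LocInt T f := by
  refine locInt_of_lintegral_le (n := fun t => eLpNorm (f t) ⊤ volume) h.meas
    (ne_top_of_le_ne_top ?_ (lintegral_le_of_eLpNorm_le h1 hr h.2)) fun K hK =>
      ⟨volume K, hK.measure_lt_top.ne, ae_of_all _ fun t => ?_⟩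
  · exact ENNReal.add_ne_top.2 ⟨ENNReal.ofReal_ne_top, ENNReal.rpow_ne_top_of_nonneg
      ENNReal.toReal_nonneg ENNReal.coe_ne_top⟩
  · calc ∫⁻ x in K, ‖f t x‖ₑ ≤ ∫⁻ x in K, eLpNorm (f t) ⊤ volume := by
          refine lintegral_mono_ae (ae_restrict_of_ae ?_)
          rw [eLpNorm_exponent_top]
          exact enorm_ae_le_eLpNormEssSup (f t) volume
      _ = _ := by rw [setLIntegral_const, mul_comm]

end MemLrLp

/-! ### Curves in `L²` -/

lemma eLpNorm_sub_eq_enorm (A B : Lp ℝ 2 (volume : Measure Plane)) :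
    eLpNorm (fun x => A x - B x) 2 volume = ‖A - B‖ₑ := by
  rw [Lp.enorm_def]
  refine eLpNorm_congr_ae ?_
  filter_upwards [Lp.coeFn_sub A B] with x hx
  rw [hx]; rfl

/-- Geometrically fast convergence in `L²` implies convergence almost everywhere. -/
lemma ae_tendsto_of_geometric {A : ℕ → Lp ℝ 2 (volume : Measure Plane)}
    {B : Lp ℝ 2 (volume : Measure Plane)} (h : ∀ k, ‖A k - B‖ ≤ (1 / 2 : ℝ) ^ k) :
    ∀ᵐ x, Tendsto (fun k => A k x) atTop (𝓝 (B x)) := by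
  have hlt : ∀ k, ∫⁻ x, ‖A k x - B x‖ₑ ^ 2 ≤ (2⁻¹ : ℝ≥0∞) ^ k := by
    intro k
    rw [← eLpNorm_two_sq (fun x => A k x - B x), eLpNorm_sub_eq_enorm]
    have h2 : ‖A k - B‖ₑ ≤ (2⁻¹ : ℝ≥0∞) ^ k := by
      rw [← ofReal_norm]
      refine (ENNReal.ofReal_le_ofReal (h k)).trans (le_of_eq ?_)
      rw [ENNReal.ofReal_pow (by norm_num), one_div, ENNReal.ofReal_inv_of_pos (by norm_num)]
      simp
    calc _ ≤ ((2⁻¹ : ℝ≥0∞) ^ k) ^ 2 := by gcongr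
      _ ≤ (2⁻¹ : ℝ≥0∞) ^ k := by
        rw [pow_two]
        exact mul_le_of_le_one_left zero_le
          (pow_le_one₀ zero_le (ENNReal.inv_le_one.2 one_le_two))
  have hmeas : ∀ k, AEMeasurable (fun x => ‖A k x - B x‖ₑ ^ 2) volume := fun k =>
    (((Lp.stronglyMeasurable (A k)).measurable.sub
      (Lp.stronglyMeasurable B).measurable).enorm.pow_const 2).aemeasurable
  -- A summable series of squared norms: the pointwise series is finite almost everywhere, so its
  -- terms tend to zero.
  have hsum : ∫⁻ x, ∑' k, ‖A k x - B x‖ₑ ^ 2 ≠ ⊤ := by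
    rw [lintegral_tsum hmeas]
    refine ne_top_of_le_ne_top ?_ (ENNReal.tsum_le_tsum hlt)
    rw [ENNReal.tsum_geometric]
    simp
  filter_upwards [ae_lt_top' (AEMeasurable.tsum hmeas) hsum] with x hx
  have h0 := ENNReal.tendsto_atTop_zero_of_tsum_ne_top hx.ne
  rw [tendsto_iff_norm_sub_tendsto_zero]
  have h1 : Tendsto (fun k => ‖A k x - B x‖ ^ 2) atTop (𝓝 0) := by
    have := (ENNReal.tendsto_toReal ENNReal.zero_ne_top).comp h0
    simpa [Function.comp_def] using this
  have h2 := (Real.continuous_sqrt.tendsto 0).comp h1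
  simpa [Function.comp_def, Real.sqrt_sq_eq_abs] using h2

/-- A continuous curve in `L²` has a representative that is measurable in time and space. -/
lemma exists_joint_rep {T : ℝ} {G : ℝ → Lp ℝ 2 (volume : Measure Plane)}
    (hG : ContinuousOn G (Icc 0 T)) : ∃ w : ℝ → Plane → ℝ,
      AEStronglyMeasurable (fun z : ℝ × Plane => w z.1 z.2) (slab T) ∧
      ∀ t ∈ Icc 0 T, w t =ᵐ[volume] G t := by
  have huc := isCompact_Icc.uniformContinuousOn_of_continuous hG
  rw [Metric.uniformContinuousOn_iff] at huc
  have hN : ∀ k : ℕ, ∃ N : ℕ, ∀ s ∈ Icc 0 T, ∀ t ∈ Icc 0 T, |s - t| ≤ 1 / ((N : ℝ) + 1) →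
      ‖G s - G t‖ < (1 / 2 : ℝ) ^ k := by
    intro k
    obtain ⟨δ, hδ, h⟩ := huc ((1 / 2 : ℝ) ^ k) (by positivity)
    obtain ⟨N, hN⟩ := exists_nat_one_div_lt hδ
    refine ⟨N, fun s hs t ht hst => ?_⟩
    rw [← dist_eq_norm]
    exact h s hs t ht (hst.trans_lt hN)
  choose N hN using hN
  -- Times rounded down to a grid. Each sampled curve takes countably many values in L², hence is
  -- jointly measurable, and uniform continuity makes the samples converge geometrically fast.
  let σ : ℕ → ℝ → ℝ := fun k t => (⌊t * ((N k : ℝ) + 1)⌋ : ℝ) / ((N k : ℝ) + 1)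
  have hW : ∀ k, StronglyMeasurable (fun z : ℝ × Plane => G (σ k z.1) z.2) := fun k => by
    have hg : Measurable (fun z : ℤ × Plane => G ((z.1 : ℝ) / ((N k : ℝ) + 1)) z.2) :=
      measurable_from_prod_countable_right fun m =>
        (Lp.stronglyMeasurable (G ((m : ℝ) / ((N k : ℝ) + 1)))).measurable
    have hf : Measurable (fun z : ℝ × Plane => (⌊z.1 * ((N k : ℝ) + 1)⌋, z.2)) :=
      (Int.measurable_floor.comp (measurable_fst.mul_const _)).prodMk measurable_snd
    exact (hg.comp hf).stronglyMeasurable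
  refine ⟨fun t x => limUnder atTop fun k => G (σ k t) x,
    (StronglyMeasurable.limUnder hW).aestronglyMeasurable, fun t ht => ?_⟩
  have hs : ∀ k, σ k t ∈ Icc 0 T ∧ |σ k t - t| ≤ 1 / ((N k : ℝ) + 1) := by
    intro k
    have hpos : 0 < (N k : ℝ) + 1 := by positivity
    have h1 := Int.floor_le (t * ((N k : ℝ) + 1))
    have h2 := Int.lt_floor_add_one (t * ((N k : ℝ) + 1))
    have h3 : σ k t ≤ t := by
      simp only [σ]; rwa [div_le_iff₀ hpos]
    refine ⟨⟨div_nonneg ?_ hpos.le, h3.trans ht.2⟩, ?_⟩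
    · exact_mod_cast Int.floor_nonneg.2 (mul_nonneg ht.1 hpos.le)
    · rw [abs_sub_comm, abs_of_nonneg (sub_nonneg.2 h3), sub_le_iff_le_add, ← add_div,
        le_div_iff₀ hpos]
      linarith
  filter_upwards [ae_tendsto_of_geometric fun k =>
    (hN k _ (hs k).1 t ht (hs k).2).le] with x hx using hx.limUnder_eq

/-- `f` is represented by the `C¹` curve `F` with derivative `F'`. -/
structure Curve (T : ℝ) (f : ℝ → Plane → ℝ) (F F' : ℝ → Lp ℝ 2 (volume : Measure Plane)) : Prop where
  deriv : ∀ t ∈ Icc 0 T, HasDerivWithinAt F (F' t) (Icc 0 T) t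
  cont' : ContinuousOn F' (Icc 0 T)
  ae_eq : ∀ t ∈ Icc 0 T, F t =ᵐ[volume] f t

lemma C1L2.exists_curve {T : ℝ} (hT : 0 < T) {f : ℝ → Plane → ℝ} (h : C1L2 T f) :
    ∃ F F', Curve T f F F' := by
  obtain ⟨F, hF, hf⟩ := h
  exact ⟨F, fun t => derivWithin F (Icc 0 T) t, fun t ht =>
    (hF.differentiableOn (by simp) t ht).hasDerivWithinAt,
    hF.continuousOn_derivWithin (uniqueDiffOn_Icc hT) le_rfl, hf⟩

namespace Curve

variable {T : ℝ} {f g : ℝ → Plane → ℝ} {F F' G G' : ℝ → Lp ℝ 2 (volume : Measure Plane)}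

lemma cont (h : Curve T f F F') : ContinuousOn F (Icc 0 T) := fun t ht =>
  (h.deriv t ht).continuousWithinAt

lemma memLp (h : Curve T f F F') {t : ℝ} (ht : t ∈ Icc 0 T) : MemLp (f t) 2 volume :=
  (memLp_congr_ae (h.ae_eq t ht)).1 (Lp.memLp (F t))

lemma add (h : Curve T f F F') (h' : Curve T g G G') :
    Curve T (fun t x => f t x + g t x) (fun t => F t + G t) (fun t => F' t + G' t) := by
  refine ⟨fun t ht => (h.deriv t ht).add (h'.deriv t ht), h.cont'.add h'.cont', fun t ht => ?_⟩
  filter_upwards [h.ae_eq t ht, h'.ae_eq t ht, Lp.coeFn_add (F t) (G t)] with x h1 h2 h3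
  rw [h3, Pi.add_apply, h1, h2]

lemma sub (h : Curve T f F F') (h' : Curve T g G G') :
    Curve T (fun t x => f t x - g t x) (fun t => F t - G t) (fun t => F' t - G' t) := by
  refine ⟨fun t ht => (h.deriv t ht).sub (h'.deriv t ht), h.cont'.sub h'.cont', fun t ht => ?_⟩
  filter_upwards [h.ae_eq t ht, h'.ae_eq t ht, Lp.coeFn_sub (F t) (G t)] with x h1 h2 h3
  rw [h3, Pi.sub_apply, h1, h2]

lemma integral_eq_inner (A : Lp ℝ 2 (volume : Measure Plane)) {φ : Plane → ℝ}
    (hφ : MemLp φ 2 volume) : ∫ x, A x * φ x = inner ℝ (hφ.toLp φ) A := by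
  rw [L2.inner_def]
  refine integral_congr_ae ?_
  filter_upwards [hφ.coeFn_toLp] with x hx
  simp [hx]

lemma integral_eq (h : Curve T f F F') {t : ℝ} (ht : t ∈ Icc 0 T) (φ : Plane → ℝ) :
    ∫ x, f t x * φ x = ∫ x, F t x * φ x :=
  integral_congr_ae (by filter_upwards [h.ae_eq t ht] with x hx; rw [hx])

lemma hasDerivWithinAt_pair (h : Curve T f F F') {φ : Plane → ℝ} (hφ : MemLp φ 2 volume) {t : ℝ}
    (ht : t ∈ Icc 0 T) :
    HasDerivWithinAt (fun t => ∫ x, f t x * φ x) (∫ x, F' t x * φ x) (Icc 0 T) t := by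
  have h1 : HasDerivWithinAt (fun t => inner ℝ (hφ.toLp φ) (F t)) (inner ℝ (hφ.toLp φ) (F' t))
      (Icc 0 T) t := by
    simpa using (hasDerivWithinAt_const t (Icc 0 T) (hφ.toLp φ)).inner ℝ (h.deriv t ht)
  rw [integral_eq_inner _ hφ]
  refine h1.congr (fun s hs => ?_) ?_
  · rw [h.integral_eq hs, integral_eq_inner _ hφ]
  · rw [h.integral_eq ht, integral_eq_inner _ hφ]

lemma weakRep (hT : 0 < T) (h : Curve T f F F') : WeakRep T f (F 0) (fun t => F' t) := by
  intro ψ hψ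
  have hφ := hψ.memLp 2
  have hc : ContinuousOn (fun t => ∫ x, F' t x * ψ x) (Icc 0 T) := by
    simp only [integral_eq_inner _ hφ]
    exact continuousOn_const.inner h.cont'
  have hA : ContinuousOn (fun t => ∫ x, f t x * ψ x) (Icc 0 T) := fun t ht =>
    (h.hasDerivWithinAt_pair hφ ht).continuousWithinAt
  refine ⟨hc.integrableOn_Icc, ?_⟩
  filter_upwards [ae_restrict_mem measurableSet_Icc] with t ht
  have hsub : Icc 0 t ⊆ Icc 0 T := Icc_subset_Icc_right ht.2
  have := intervalIntegral.integral_eq_sub_of_hasDerivAt_of_le ht.1 (hA.mono hsub) (fun s hs =>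
    (h.hasDerivWithinAt_pair hφ ⟨hs.1.le, hs.2.le.trans ht.2⟩).hasDerivAt
      (Icc_mem_nhds hs.1 (hs.2.trans_le ht.2)))
    (intervalIntegrable_of_Icc ht.1 ((hc.mono hsub).integrableOn_Icc))
  rw [this, h.integral_eq ⟨le_rfl, hT.le⟩]; ring

/-- The defining identity of the weak derivative, differentiated in time. -/
lemma weak_partial (hT : 0 < T) (h : Curve T f F F') (h' : Curve T g G G') {i : Fin 2}
    (hw : ∀ t ∈ Icc 0 T, HasWeakPartial i (f t) (g t)) {t : ℝ} (ht : t ∈ Icc 0 T) :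
    HasWeakPartial i (F' t) (G' t) := by
  refine ⟨(Lp.memLp (F' t)).locallyIntegrable (by norm_num),
    (Lp.memLp (G' t)).locallyIntegrable (by norm_num), fun φ hφ => ?_⟩
  have h1 := h.hasDerivWithinAt_pair ((hφ.pd i).memLp 2) ht
  have h2 := (h'.hasDerivWithinAt_pair (hφ.memLp 2) ht).neg
  refine (uniqueDiffOn_Icc hT t ht).eq_deriv _ h1 (h2.congr (fun s hs => ?_) ?_)
  · exact (hw s hs).2.2 φ hφ
  · exact (hw t ht).2.2 φ hφ

/-- The sum curve vanishes at almost every time, hence everywhere by continuity, and so does its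
derivative. This transfers incompressibility to the time derivatives. -/
lemma add_eq_zero (hT : 0 < T) (h : Curve T f F F') (h' : Curve T g G G')
    (hz : ∀ᵐ t ∂(volume.restrict (Icc 0 T)), ∀ᵐ x, f t x + g t x = 0) {t : ℝ} (ht : t ∈ Icc 0 T) :
    ∀ᵐ x, F' t x + G' t x = 0 := by
  have hs := h.add h'
  have h0 : EqOn (fun t => F t + G t) (fun _ => 0) (Icc 0 T) := by
    refine Measure.eqOn_Icc_of_ae_eq (μ := volume) hT.ne ?_ hs.cont continuousOn_const
    filter_upwards [hz, ae_restrict_mem measurableSet_Icc] with t h1 h2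
    refine Lp.ext ?_
    filter_upwards [h1, hs.ae_eq t h2, Lp.coeFn_zero ℝ 2 (volume : Measure Plane)] with x h3 h4 h5
    rw [h4, h5, h3]; rfl
  have h1 : F' t + G' t = 0 := (uniqueDiffOn_Icc hT t ht).eq_deriv _ (hs.deriv t ht)
    ((hasDerivWithinAt_const t (Icc 0 T) (0 : Lp ℝ 2 (volume : Measure Plane))).congr h0 (h0 ht))
  filter_upwards [Lp.coeFn_add (F' t) (G' t), Lp.coeFn_zero ℝ 2 (volume : Measure Plane)] with x h2 h3
  rw [h1, h3, Pi.add_apply] at h2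
  exact h2.symm

lemma n2_eq (h : Curve T f F F') {t : ℝ} (ht : t ∈ Icc 0 T) : n2 (f t) = ‖F t‖ := by
  rw [← n2_congr (h.ae_eq t ht), n2_eq_norm (Lp.memLp (F t)), Lp.toLp_coeFn]

lemma continuousOn_sq (h : Curve T f F F') : ContinuousOn (fun t => n2 (f t) ^ 2) (Icc 0 T) :=
  (h.cont.norm.pow 2).congr fun t ht => by rw [h.n2_eq ht]; rfl

lemma hasDerivWithinAt_sq (h : Curve T f F F') {t : ℝ} (ht : t ∈ Icc 0 T) :
    HasDerivWithinAt (fun t => n2 (f t) ^ 2) (2 * ∫ x, f t x * F' t x) (Icc 0 T) t := by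
  have h1 := (h.deriv t ht).norm_sq
  have e : ∫ x, f t x * F' t x = inner ℝ (F t) (F' t) := by
    rw [h.integral_eq ht, integral_eq_inner _ (Lp.memLp (F' t)), Lp.toLp_coeFn, real_inner_comm]
  rw [e]
  exact h1.congr (fun s hs => by rw [h.n2_eq hs]) (by rw [h.n2_eq ht])

lemma continuousOn_deriv_sq (h : Curve T f F F') :
    ContinuousOn (fun t => 2 * ∫ x, f t x * F' t x) (Icc 0 T) := by
  refine ((h.cont.inner h.cont').const_smul (2 : ℝ)).congr fun t ht => ?_
  simp only [smul_eq_mul, Pi.smul_apply]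
  rw [h.integral_eq ht, integral_eq_inner _ (Lp.memLp (F' t)), Lp.toLp_coeFn, real_inner_comm]

end Curve

lemma locInt_of_curve {T : ℝ} {G : ℝ → Lp ℝ 2 (volume : Measure Plane)}
    (hG : ContinuousOn G (Icc 0 T)) {w : ℝ → Plane → ℝ}
    (hw : AEStronglyMeasurable (fun z : ℝ × Plane => w z.1 z.2) (slab T))
    (he : ∀ t ∈ Icc 0 T, w t =ᵐ[volume] G t) : LocInt T w := by
  obtain ⟨C, hC⟩ := isCompact_Icc.exists_bound_of_continuousOn hG
  refine locInt_of_lintegral_le (n := fun _ => 1) hw (by simp) fun K hK =>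
    ⟨ENNReal.ofReal C * volume K ^ (1 / (1 : ℝ≥0∞).toReal - 1 / (2 : ℝ≥0∞).toReal),
      ENNReal.mul_ne_top ENNReal.ofReal_ne_top (ENNReal.rpow_ne_top_of_nonneg (by norm_num)
        hK.measure_lt_top.ne), ?_⟩
  filter_upwards [ae_restrict_mem measurableSet_Icc] with t ht
  rw [lintegral_congr_ae (ae_restrict_of_ae ((he t ht).mono fun x hx => by
    simp only [hx] : ∀ᵐ x, ‖w t x‖ₑ = ‖G t x‖ₑ)), ← eLpNorm_one_eq_lintegral_enorm, mul_one]
  refine (eLpNorm_le_eLpNorm_mul_rpow_measure_univ (p := 1) (q := 2) (by norm_num)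
    (Lp.aestronglyMeasurable (G t)).restrict).trans ?_
  rw [Measure.restrict_apply_univ]
  gcongr
  refine (eLpNorm_mono_measure _ Measure.restrict_le_self).trans ?_
  rw [← Lp.enorm_def, ← ofReal_norm]
  exact ENNReal.ofReal_le_ofReal (hC t ht)

/-! ### Weak identities for mass and momentum at a fixed time. -/

namespace State

/-- The part of `Valid` that only involves first order derivatives of `r` and `u`. -/
structure Basic (a c : ℝ) (M : ℝ) (X : State) : Prop where
  a_pos : 0 < a
  lower : ∀ᵐ x, a ≤ X.r x
  upper : ∀ᵐ x, X.r x ≤ c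
  M_nonneg : 0 ≤ M
  weak_r : ∀ i, HasWeakPartial i X.r (X.p i)
  weak_u : ∀ i k, HasWeakPartial i (X.u k) (X.D i k)
  p_le : ∀ i, ∀ᵐ x, |X.p i x| ≤ M
  u_le : ∀ i, ∀ᵐ x, |X.u i x| ≤ M
  D_le : ∀ i k, ∀ᵐ x, |X.D i k x| ≤ M
  div : ∀ᵐ x, X.D 0 0 x + X.D 1 1 x = 0

/-- The convective derivative of the velocity. -/
def conv (X : State) (k : Fin 2) (x : Plane) : ℝ := X.u 0 x * X.D 0 k x + X.u 1 x * X.D 1 k x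

namespace Basic

variable {X : State} {a c M : ℝ} {ψ : Plane → ℝ} (hX : X.Basic a c M)
include hX

lemma r_le : ∀ᵐ x, |X.r x| ≤ c := by
  filter_upwards [hX.lower, hX.upper] with x h1 h2
  rwa [abs_of_nonneg (hX.a_pos.le.trans h1)]

lemma h1_r : H1loc X.r X.p :=
  ⟨bdd_l2loc (hX.weak_r 0).1.aestronglyMeasurable hX.r_le, fun i =>
    bdd_l2loc (hX.weak_r i).2.1.aestronglyMeasurable (hX.p_le i), hX.weak_r⟩

lemma h1_u (k : Fin 2) : H1loc (X.u k) (fun i => X.D i k) :=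
  ⟨bdd_l2loc (hX.weak_u 0 k).1.aestronglyMeasurable (hX.u_le k), fun i =>
    bdd_l2loc (hX.weak_u i k).2.1.aestronglyMeasurable (hX.D_le i k), fun i => hX.weak_u i k⟩

lemma h1_m (k : Fin 2) : H1loc (fun x => X.r x * X.u k x)
    (fun i x => X.r x * X.D i k x + X.p i x * X.u k x) :=
  hX.h1_r.bdd_mul (hX.h1_u k) hX.r_le hX.p_le

lemma h1_s : H1loc X.s X.ds := hX.h1_r.inv hX.a_pos hX.lower

lemma dr_l2loc : L2loc X.dr :=
  ((hX.h1_r.dl2 0).bdd_mul (hX.h1_u 0).l2.1 (hX.u_le 0)).add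
    ((hX.h1_r.dl2 1).bdd_mul (hX.h1_u 1).l2.1 (hX.u_le 1)) |>.neg

lemma conv_l2loc (k : Fin 2) : L2loc (X.conv k) :=
  (((hX.h1_u k).dl2 0).bdd_mul (hX.h1_u 0).l2.1 (hX.u_le 0)).add
    (((hX.h1_u k).dl2 1).bdd_mul (hX.h1_u 1).l2.1 (hX.u_le 1))

lemma Q_l2loc (k : Fin 2) : L2loc (X.Q k) := by
  have h := fun i j k => (hX.h1_r.dl2 k).bdd_mul ((hX.h1_u j).dl2 i).1 (hX.D_le i j)
  fin_cases k
  · exact ((h 1 0 0).add (h 1 1 1)).neg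
  · exact (h 0 0 0).add (h 0 1 1)

lemma zeroInt_mass (hψ : IsTest ψ) : ZeroInt (fun x =>
    X.r x * X.u 0 x * pd 0 ψ x + X.r x * X.u 1 x * pd 1 ψ x - X.dr x * ψ x) := by
  have z := fun i => hX.h1_r.zeroInt_mul (hX.h1_u i) hψ i
  refine ((z 0).add (z 1)).congr ?_
  filter_upwards [hX.div] with x h
  rw [State.dr]
  linear_combination - X.r x * ψ x * h

lemma zeroInt_flux (hψ : IsTest ψ) (k : Fin 2) : ZeroInt (fun x =>
    X.r x * X.u 0 x * X.u k x * pd 0 ψ x + X.r x * X.u 1 x * X.u k x * pd 1 ψ x +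
      (X.r x * X.conv k x - X.dr x * X.u k x) * ψ x) := by
  have z := fun i => (hX.h1_m i).zeroInt_mul (hX.h1_u k) hψ i
  refine ((z 0).add (z 1)).congr ?_
  filter_upwards [hX.div] with x h
  rw [State.dr, State.conv]
  linear_combination - X.r x * X.u k x * ψ x * h

/-- The odd stress is a gradient up to terms of lower order. -/
lemma zeroInt_odd (hψ : IsTest ψ) (k : Fin 2) : ZeroInt (fun x =>
    X.r x * ![- X.D 0 1 x, X.D 0 0 x] k * pd 0 ψ x + X.r x * ![- X.D 1 1 x, X.D 1 0 x] k * pd 1 ψ x +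
      X.r x * X.om x * pd k ψ x + X.Q k x * ψ x) := by
  -- The cross identity for a velocity component and the density; incompressibility makes the
  -- vorticity appear.
  have z := fun i => (hX.h1_u i).zeroInt_cross hX.h1_r hψ
  fin_cases k
  · refine (z 0).congr ?_
    filter_upwards [hX.div] with x h
    simp only [State.om, State.Q, Fin.zero_eta, Matrix.cons_val_zero]
    linear_combination (- X.r x * pd 1 ψ x - ψ x * X.p 1 x) * h
  · refine (z 1).congr ?_
    filter_upwards [hX.div] with x h
    simp only [State.om, State.Q, Fin.mk_one, Matrix.cons_val_one, Matrix.cons_val_zero]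
    linear_combination (X.r x * pd 0 ψ x + ψ x * X.p 0 x) * h

/-- The momentum flux tested with `ψ`, for a field `v` and `h = -(r v + r u·∇u + Q)`. -/
lemma zeroInt_momentum (hψ : IsTest ψ) (k : Fin 2) {π : Plane → ℝ}
    (hm : ∀ᵐ x, X.r x * X.v k x + X.r x * X.conv k x + X.h k x + X.Q k x = 0)
    (h : ZeroInt (fun x => X.r x * X.u 0 x * X.u k x * pd 0 ψ x +
      X.r x * X.u 1 x * X.u k x * pd 1 ψ x + π x * pd k ψ x +
      (X.r x * ![- X.D 0 1 x, X.D 0 0 x] k * pd 0 ψ x +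
        X.r x * ![- X.D 1 1 x, X.D 1 0 x] k * pd 1 ψ x) - X.dm k x * ψ x)) :
    ZeroInt (fun x => (π x - X.r x * X.om x) * pd k ψ x + X.h k x * ψ x) := by
  refine ((h.sub (hX.zeroInt_flux hψ k)).sub (hX.zeroInt_odd hψ k)).congr ?_
  filter_upwards [hm] with x hx
  rw [State.dm]
  linear_combination ψ x * hx

/-- The reverse implication serves the second flow, where the gradient of `π - ρω` is given and the
time derivative of the momentum is to be found. -/
lemma zeroInt_momentum_of_grad (hψ : IsTest ψ) (k : Fin 2) {π : Plane → ℝ}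
    (hπ : HasWeakPartial k (fun x => π x - X.r x * X.om x) (X.h k))
    (hm : ∀ᵐ x, X.r x * X.v k x + X.r x * X.conv k x + X.h k x + X.Q k x = 0) :
    ZeroInt (fun x => X.r x * X.u 0 x * X.u k x * pd 0 ψ x +
      X.r x * X.u 1 x * X.u k x * pd 1 ψ x + π x * pd k ψ x +
      (X.r x * ![- X.D 0 1 x, X.D 0 0 x] k * pd 0 ψ x +
        X.r x * ![- X.D 1 1 x, X.D 1 0 x] k * pd 1 ψ x) - X.dm k x * ψ x) := by
  have z : ZeroInt (fun x => (π x - X.r x * X.om x) * pd k ψ x - -(X.h k x * ψ x)) :=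
    .of_eq (integrable_mul_test hπ.1 (hψ.pd k)) (integrable_mul_test hπ.2.1 hψ).neg
      ((hπ.2.2 ψ hψ).trans (integral_neg _).symm)
  refine ((z.add (hX.zeroInt_flux hψ k)).add (hX.zeroInt_odd hψ k)).congr ?_
  filter_upwards [hm] with x hx
  rw [State.dm]
  linear_combination -ψ x * hx

end Basic

end State

/-! ### Paths of states -/

lemma ae_line_of_slab {T : ℝ} {P : ℝ × Plane → Prop} (h : ∀ᵐ z ∂(slab T), P z) :
    ∀ᵐ x : Plane, ∀ᵐ t ∂(volume.restrict (Icc 0 T)), P (t, x) := by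
  have h2 : ∀ᵐ z ∂((volume : Measure Plane).prod (volume.restrict (Icc 0 T))), P z.swap :=
    (Measure.measurePreserving_swap (μ := (volume : Measure Plane))
      (ν := volume.restrict (Icc 0 T))).quasiMeasurePreserving.ae h
  exact Measure.ae_ae_of_ae_prod h2

/-- Time dependent states with the bounds of `State.Basic` that are measurable on the slab. -/
structure Path (T a c : ℝ) (M : ℝ) (X : ℝ → State) : Prop where
  r_bdd : Bdd T (fun t => (X t).r) c
  p_bdd : ∀ i, Bdd T (fun t => (X t).p i) M
  u_bdd : ∀ i, Bdd T (fun t => (X t).u i) M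
  D_bdd : ∀ i k, Bdd T (fun t => (X t).D i k) M
  basic : ∀ᵐ t ∂(volume.restrict (Icc 0 T)), (X t).Basic a c M

namespace Path

variable {T a c M : ℝ} {X : ℝ → State} (hX : Path T a c M X)
include hX

lemma dr_bdd : Bdd T (fun t => (X t).dr) (M * M + M * M) :=
  (((hX.u_bdd 0).mul (hX.p_bdd 0)).add ((hX.u_bdd 1).mul (hX.p_bdd 1))).neg

lemma conv_bdd (k : Fin 2) : Bdd T (fun t => (X t).conv k) (M * M + M * M) :=
  ((hX.u_bdd 0).mul (hX.D_bdd 0 k)).add ((hX.u_bdd 1).mul (hX.D_bdd 1 k))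

lemma Q_bdd (k : Fin 2) : Bdd T (fun t => (X t).Q k) (M * M + M * M) := by
  fin_cases k
  · exact (((hX.D_bdd 1 0).mul (hX.p_bdd 0)).add ((hX.D_bdd 1 1).mul (hX.p_bdd 1))).neg
  · exact ((hX.D_bdd 0 0).mul (hX.p_bdd 0)).add ((hX.D_bdd 0 1).mul (hX.p_bdd 1))

lemma ae_lower_slab : ∀ᵐ z ∂(slab T), a ≤ (X z.1).r z.2 :=
  ae_slab_of_ae_ae hX.r_bdd.meas (s := Ici a) measurableSet_Ici (hX.basic.mono fun _ h => h.lower)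

lemma s_bdd (ha : 0 < a) : Bdd T (fun t => (X t).s) a⁻¹ :=
  Bdd.inv hX.r_bdd.meas ha (hX.basic.mono fun _ h => h.lower)

lemma dm_locInt (k : Fin 2) (hv : LocInt T (fun t => (X t).v k)) :
    LocInt T (fun t => (X t).dm k) :=
  (hX.dr_bdd.mul (hX.u_bdd k)).locInt.add (hX.r_bdd.mul_locInt hv)

end Path

lemma Rep1.le_init {T a : ℝ} (hT : 0 < T) {A N : ℝ → ℝ} {c : ℝ} (h : Rep1 T A c N)
    (hA : ∀ᵐ t ∂(volume.restrict (Icc 0 T)), a ≤ A t) : a ≤ c := by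
  have hc := (ac_primitive hT.le h.1 c).continuousOn
  rw [uIcc_of_le hT.le] at hc
  have := forall_le_of_ae_Icc hT (continuousOn_const (c := a)) hc (by
    filter_upwards [h.2, hA] with t h1 h2
    rwa [← h1]) 0 ⟨le_rfl, hT.le⟩
  simpa using this

namespace Path

variable {T a c M : ℝ} {X : ℝ → State}

/-- The velocity inherits a time derivative from the density and the momentum. -/
lemma rep_velocity (hT : 0 < T) (ha : 0 < a) (hX : Path T a c M X) {r0 u0 : Plane → ℝ} {k : Fin 2}
    (hr : Rep T (fun t => (X t).r) r0 (fun t => (X t).dr))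
    (hm : Rep T (fun t x => (X t).r x * (X t).u k x) (fun x => r0 x * u0 x) (fun t => (X t).dm k)) :
    Rep T (fun t => (X t).u k) u0 (fun t => (X t).v k) := by
  filter_upwards [hr, hm, ae_line_of_slab hX.ae_lower_slab] with x h1 h2 h3
  have h0 := h1.le_init hT h3
  have := (h1.inv hT ha h3).mul hT.le h2
  rw [inv_mul_cancel_left₀ (ha.trans_le h0).ne'] at this
  refine this.congr ?_ ?_
  · filter_upwards [h3] with t ht
    rw [inv_mul_cancel_left₀ (ha.trans_le ht).ne']
  · filter_upwards [h3] with t ht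
    have := (ha.trans_le ht).ne'
    simp only [State.dm] at this ⊢
    field_simp
    ring

end Path

/-- The state of a flow at time `t`, given its missing components. -/
def Flow.state (S : Flow) (p : Fin 2 → ℝ → Plane → ℝ) (H : Fin 2 → Fin 2 → ℝ → Plane → ℝ)
    (v h : Fin 2 → ℝ → Plane → ℝ) (t : ℝ) : State :=
  ⟨S.rho t, fun i => p i t, fun i k => H i k t, fun k => S.u k t, fun i k => S.gradu i k t,
    fun k => v k t, fun k => h k t⟩

/-! ### Consequences of the weak equations for a single flow. -/

section SingleFlow

variable {T a c : ℝ} {M : ℝ≥0} {S : Flow} {p : Fin 2 → ℝ → Plane → ℝ}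
  {H : Fin 2 → Fin 2 → ℝ → Plane → ℝ} {v h : Fin 2 → ℝ → Plane → ℝ}

lemma GradMem.bdd {f : ℝ → Plane → ℝ} {G : Fin 2 → ℝ → Plane → ℝ} (h : GradMem T ⊤ ⊤ f M)
    (hG : IsSpaceGrad T f G) (hm : ∀ i, AEStronglyMeasurable (fun z : ℝ × Plane => G i z.1 z.2) (slab T))
    (i : Fin 2) : Bdd T (G i) M := by
  obtain ⟨G', hG', hM⟩ := h
  refine (hM i).bdd.congr (hm i) ?_
  filter_upwards [hG i, hG' i] with t h1 h2
  exact h2.unique h1 (ae_eq_refl _)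

namespace IsSolution

variable (hS : IsSolution T S)
include hS

lemma path (ha : 0 < a)
    (hr : ∀ᵐ z ∂((volume : Measure (ℝ × Plane)).restrict (Icc 0 T ×ˢ univ)),
      a ≤ S.rho z.1 z.2 ∧ S.rho z.1 z.2 ≤ c)
    (hp : IsSpaceGrad T S.rho p) (hpM : ∀ i, MemLrLp T ⊤ ⊤ (p i) M)
    (hu : ∀ j, MemLrLp T ⊤ ⊤ (S.u j) M ∧ GradMem T ⊤ ⊤ (S.u j) M) :
    Path T a c M (S.state p H v h) := by
  rw [restrict_slab] at hr
  have hr' := Measure.ae_ae_of_ae_prod hr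
  have hD : ∀ i k, Bdd T (S.gradu i k) M := fun i k =>
    (hu k).2.bdd (hS.grad_u k) (fun i => (hS.locInt_gradu i k).meas) i
  have hdiv := hS.div_free
  rw [restrict_slab] at hdiv
  have hpB := fun i => (hpM i).bdd
  have huB := fun i => (hu i).1.bdd
  refine ⟨⟨hS.locInt_rho.meas, ?_⟩, hpB, huB, hD, ?_⟩
  · filter_upwards [hr'] with t ht
    filter_upwards [ht] with x hx
    have hx' : |S.rho t x| ≤ c := abs_le.2 ⟨by linarith [hx.1, hx.2], hx.2⟩
    exact hx'
  · filter_upwards [hr', ae_all_iff.2 hp, ae_all_iff.2 fun k => ae_all_iff.2 (hS.grad_u k),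
      ae_all_iff.2 fun i => (hpB i).slice_le, ae_all_iff.2 fun i => (huB i).slice_le,
      ae_all_iff.2 fun i => ae_all_iff.2 fun k => (hD i k).slice_le,
      Measure.ae_ae_of_ae_prod hdiv] with t h1 h2 h3 h4 h5 h6 h7
    exact ⟨ha, h1.mono fun _ hx => hx.1, h1.mono fun _ hx => hx.2, M.2, h2, fun i k => h3 k i, h4,
      h5, h6, h7⟩

lemma mass_weakRep (hT : 0 < T) {M : ℝ} (hX : Path T a c M (S.state p H v h)) :
    WeakRep T S.rho S.rho0 (fun t => (S.state p H v h t).dr) := by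
  intro ψ hψ
  have hF : ∀ i, LocInt T (fun t x => S.rho t x * S.u i t x) := hS.locInt_momentum
  have := rep1_of_balance (f := S.rho) (F := fun i t x => S.rho t x * S.u i t x) (f0 := S.rho0)
    hT hS.locInt_rho hF hS.mass hψ
  refine this.congr (ae_of_all _ fun t => rfl) ?_
  filter_upwards [hX.basic, (hF 0).ae_slice, (hF 1).ae_slice] with t h1 h2 h3
  have i0 := integrable_mul_test h2 (hψ.pd 0)
  have i1 := integrable_mul_test h3 (hψ.pd 1)
  have i2 := integrable_mul_test h1.dr_l2loc.locallyIntegrable hψ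
  have z := (h1.zeroInt_mass hψ).2
  have i01 : Integrable (fun x => S.rho t x * S.u 0 t x * pd 0 ψ x + S.rho t x * S.u 1 t x * pd 1 ψ x) :=
    i0.add i1
  have e := integral_sub i01 i2
  rw [integral_add i0 i1] at e
  have z' : ∫ x, (S.rho t x * S.u 0 t x * pd 0 ψ x + S.rho t x * S.u 1 t x * pd 1 ψ x -
    (S.state p H v h t).dr x * ψ x) = 0 := z
  linarith

/-- The integrand of the momentum flux tested with `ψ`. -/
lemma momentum_rep1 (hT : 0 < T) (k : Fin 2) {ψ : Plane → ℝ} (hψ : IsTest ψ) :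
    ∃ G : ℝ → Plane → ℝ, (∀ᵐ t ∂(volume.restrict (Icc 0 T)), Integrable (G t)) ∧
      (∀ t x, G t x = S.rho t x * S.u 0 t x * S.u k t x * pd 0 ψ x +
        S.rho t x * S.u 1 t x * S.u k t x * pd 1 ψ x + S.press t x * pd k ψ x +
        (S.rho t x * ![- S.gradu 0 1 t x, S.gradu 0 0 t x] k * pd 0 ψ x +
          S.rho t x * ![- S.gradu 1 1 t x, S.gradu 1 0 t x] k * pd 1 ψ x)) ∧
      Rep1 T (fun t => ∫ x, S.rho t x * S.u k t x * ψ x) (∫ x, S.rho0 x * S.u0 k x * ψ x)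
        (fun t => ∫ x, G t x) := by
  have hodd : ∀ i, LocInt T (fun t x => S.rho t x * S.graduPerp i k t x) := by
    intro i
    fin_cases k
    · have := (hS.locInt_odd i 1).neg
      simpa [Flow.graduPerp] using this
    · simpa [Flow.graduPerp] using hS.locInt_odd i 0
  -- Convection, pressure and odd stress form one flux; the pressure enters only its `k`-th entry.
  let F : Fin 2 → ℝ → Plane → ℝ := fun i t x => S.rho t x * S.u i t x * S.u k t x +
    (if i = k then S.press t x else 0) + S.rho t x * S.graduPerp i k t x
  have hF : ∀ i, LocInt T (F i) := by
    intro i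
    refine ((hS.locInt_flux i k).add ?_).add (hodd i)
    by_cases hik : i = k
    · simpa [hik] using hS.locInt_press
    · simp only [hik, if_false]
      exact fun K _ =>
        (integrableOn_zero : IntegrableOn (fun _ : ℝ × Plane => (0 : ℝ)) (Icc 0 T ×ˢ K) volume)
  have hbal := rep1_of_balance (f := fun t x => S.rho t x * S.u k t x) (F := F)
    (f0 := fun x => S.rho0 x * S.u0 k x) hT (hS.locInt_momentum k) hF (fun φ hφ => by
      refine Eq.trans ?_ (hS.momentum k φ hφ)
      congr 1
      refine integral_congr_ae (ae_of_all _ fun z => ?_)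
      simp only [F, Fin.sum_univ_two]
      fin_cases k <;> simp <;> ring) hψ
  refine ⟨fun t x => F 0 t x * pd 0 ψ x + F 1 t x * pd 1 ψ x, ?_, fun t x => ?_,
    hbal.congr (ae_of_all _ fun t => rfl) ?_⟩
  · filter_upwards [(hF 0).ae_slice, (hF 1).ae_slice] with t h0 h1
    exact (integrable_mul_test h0 (hψ.pd 0)).add (integrable_mul_test h1 (hψ.pd 1))
  · simp only [F, Flow.graduPerp]
    fin_cases k <;> simp <;> ring
  · filter_upwards [(hF 0).ae_slice, (hF 1).ae_slice] with t h0 h1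
    exact integral_add (integrable_mul_test h0 (hψ.pd 0)) (integrable_mul_test h1 (hψ.pd 1))

/-- If `h` is the gradient of `π - ρω`, the momentum has the expected time derivative. -/
lemma momentum_weakRep (hT : 0 < T) {M : ℝ} (hX : Path T a c M (S.state p H v h)) (k : Fin 2)
    (hh : ∀ᵐ t ∂(volume.restrict (Icc 0 T)),
      HasWeakPartial k (fun x => S.press t x - S.rho t x * S.vort t x) (h k t))
    (hm : ∀ᵐ t ∂(volume.restrict (Icc 0 T)), ∀ᵐ x, S.rho t x * v k t x +
      S.rho t x * (S.state p H v h t).conv k x + h k t x + (S.state p H v h t).Q k x = 0)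
    (hv : LocInt T (v k)) :
    WeakRep T (fun t x => S.rho t x * S.u k t x) (fun x => S.rho0 x * S.u0 k x)
      (fun t => (S.state p H v h t).dm k) := by
  intro ψ hψ
  obtain ⟨G, hG, hG', hrep⟩ := hS.momentum_rep1 hT k hψ
  refine hrep.congr (ae_of_all _ fun t => rfl) ?_
  filter_upwards [hX.basic, hh, hm, hG, (hX.dm_locInt k hv).ae_slice] with t h1 h2 h3 h4 h5
  have z := h1.zeroInt_momentum_of_grad hψ k (π := S.press t) h2 h3
  have e := integral_sub h4 (integrable_mul_test h5 hψ)
  have z' : ∫ x, (G t x - (S.state p H v h t).dm k x * ψ x) = 0 := by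
    rw [← z.2]
    exact integral_congr_ae (ae_of_all _ fun x => by simp only [hG']; rfl)
  linarith

end IsSolution

end SingleFlow

/-- Two solutions as in the stability estimate, with all the derivatives that are assumed to exist. -/
structure Pair (T a c : ℝ) (M : ℝ≥0) (q : ℝ≥0∞) (S₁ S₂ : Flow) where
  T_pos : 0 < T
  a_pos : 0 < a
  two_lt_q : 2 < q
  sol₁ : IsSolution T S₁
  sol₂ : IsSolution T S₂
  p₁ : Fin 2 → ℝ → Plane → ℝ
  p₂ : Fin 2 → ℝ → Plane → ℝ
  path₁ : ∀ H v h, Path T a c M (S₁.state p₁ H v h)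
  path₂ : ∀ H v h, Path T a c M (S₂.state p₂ H v h)
  H₂ : Fin 2 → Fin 2 → ℝ → Plane → ℝ
  weak_H₂ : ∀ i k, ∀ᵐ t ∂(volume.restrict (Icc 0 T)), HasWeakPartial i (p₂ k t) (H₂ i k t)
  H₂_mem : ∀ i k, MemLrLp T 1 ⊤ (H₂ i k) M
  h₂ : Fin 2 → ℝ → Plane → ℝ
  weak_h₂ : ∀ k, ∀ᵐ t ∂(volume.restrict (Icc 0 T)),
    HasWeakPartial k (fun x => S₂.press t x - S₂.rho t x * S₂.vort t x) (h₂ k t)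
  h₂_mem : ∀ k, MemLrLp T 2 ⊤ (h₂ k) M
  W : Fin 2 → Fin 2 → Fin 2 → ℝ → Plane → ℝ
  weak_W : ∀ i j k, ∀ᵐ t ∂(volume.restrict (Icc 0 T)),
    HasWeakPartial i (S₂.gradu j k t) (W i j k t)
  W_mem : ∀ i j k, MemLrLp T (2⁻¹ - q⁻¹)⁻¹ q (W i j k) M
  Λ : Fin 2 → ℝ → Plane → ℝ
  weak_Λ : ∀ i, ∀ᵐ t ∂(volume.restrict (Icc 0 T)),
    HasWeakPartial i (fun x => H₂ 0 0 t x + H₂ 1 1 t x) (Λ i t)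
  Λ_mem : ∀ i, MemLrLp T 1 q (Λ i) M
  rho0_mem : MemLp S₁.rho0 ⊤ volume
  u0_mem : ∀ k, MemLp (S₂.u0 k) ⊤ volume
  R : ℝ → Lp ℝ 2 (volume : Measure Plane)
  R' : ℝ → Lp ℝ 2 (volume : Measure Plane)
  curve_r : Curve T (fun t x => S₁.rho t x - S₂.rho t x) R R'
  dp : Fin 2 → ℝ → Plane → ℝ
  weak_dp : ∀ i, ∀ t ∈ Icc 0 T, HasWeakPartial i (fun x => S₁.rho t x - S₂.rho t x) (dp i t)
  P : Fin 2 → ℝ → Lp ℝ 2 (volume : Measure Plane)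
  P' : Fin 2 → ℝ → Lp ℝ 2 (volume : Measure Plane)
  curve_p : ∀ i, Curve T (dp i) (P i) (P' i)
  dH : Fin 2 → Fin 2 → ℝ → Plane → ℝ
  weak_dH : ∀ i k, ∀ t ∈ Icc 0 T, HasWeakPartial i (dp k t) (dH i k t)
  N : Fin 2 → Fin 2 → ℝ → Lp ℝ 2 (volume : Measure Plane)
  N' : Fin 2 → Fin 2 → ℝ → Lp ℝ 2 (volume : Measure Plane)
  curve_H : ∀ i k, Curve T (dH i k) (N i k) (N' i k)
  U : Fin 2 → ℝ → Lp ℝ 2 (volume : Measure Plane)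
  U' : Fin 2 → ℝ → Lp ℝ 2 (volume : Measure Plane)
  curve_u : ∀ k, Curve T (fun t x => S₁.u k t x - S₂.u k t x) (U k) (U' k)
  dD : Fin 2 → Fin 2 → ℝ → Plane → ℝ
  weak_dD : ∀ i k, ∀ t ∈ Icc 0 T, HasWeakPartial i (fun x => S₁.u k t x - S₂.u k t x) (dD i k t)
  E : Fin 2 → Fin 2 → ℝ → Lp ℝ 2 (volume : Measure Plane)
  E' : Fin 2 → Fin 2 → ℝ → Lp ℝ 2 (volume : Measure Plane)
  curve_D : ∀ i k, Curve T (dD i k) (E i k) (E' i k)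
  Θ : ℝ → Lp ℝ 2 (volume : Measure Plane)
  Θ' : ℝ → Lp ℝ 2 (volume : Measure Plane)
  curve_θ : Curve T (fun t => Θ t) Θ Θ'
  theta_eq : ∀ t ∈ Icc 0 T, ∀ φ : Plane → ℝ, IsTest φ →
    ∫ x, Θ t x * φ x = S₁.thetaPairing t φ - S₂.thetaPairing t φ
  w : Fin 2 → ℝ → Plane → ℝ
  w_meas : ∀ k, AEStronglyMeasurable (fun z : ℝ × Plane => w k z.1 z.2) (slab T)
  w_eq : ∀ k, ∀ t ∈ Icc 0 T, w k t =ᵐ[volume] U' k t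

/-! ### Time derivatives and initial values for the two flows. -/

namespace Pair

variable {T a c : ℝ} {M : ℝ≥0} {q : ℝ≥0∞} {S₁ S₂ : Flow} (d : Pair T a c M q S₁ S₂)

/-- The acceleration of the second flow, from the momentum equation. -/
def v₂ (k : Fin 2) (t : ℝ) (x : Plane) : ℝ :=
  let Z := S₂.state d.p₂ d.H₂ 0 d.h₂ t;
  -(Z.conv k x) - Z.s x * (Z.h k x + Z.Q k x)

/-- The second flow. -/
def Y : ℝ → State := S₂.state d.p₂ d.H₂ d.v₂ d.h₂

/-- The acceleration of the first flow. -/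
def v₁ (k : Fin 2) (t : ℝ) (x : Plane) : ℝ := d.v₂ k t x + d.w k t x

/-- The Hessian of the first density. -/
def H₁ (i k : Fin 2) (t : ℝ) (x : Plane) : ℝ := d.H₂ i k t x + d.dH i k t x

/-- The gradient of `π - ρω` for the first flow, from the momentum equation. -/
def h₁ (k : Fin 2) (t : ℝ) (x : Plane) : ℝ :=
  let Z := S₁.state d.p₁ d.H₁ d.v₁ 0 t;
  -(Z.r x * Z.v k x + Z.r x * Z.conv k x + Z.Q k x)

/-- The first flow. -/
def X : ℝ → State := S₁.state d.p₁ d.H₁ d.v₁ d.h₁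

lemma path_X : Path T a c M d.X := d.path₁ _ _ _

lemma path_Y : Path T a c M d.Y := d.path₂ _ _ _

lemma momentum_X (t : ℝ) (k : Fin 2) (x : Plane) : (d.X t).r x * (d.X t).v k x +
    (d.X t).r x * (d.X t).conv k x + (d.X t).h k x + (d.X t).Q k x = 0 := by
  have e : (d.X t).h k x = -((d.X t).r x * (d.X t).v k x +
    (d.X t).r x * (d.X t).conv k x + (d.X t).Q k x) := rfl
  rw [e]; ring

lemma momentum_Y : ∀ᵐ t ∂(volume.restrict (Icc 0 T)), ∀ k, ∀ᵐ x, (d.Y t).r x * (d.Y t).v k x +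
    (d.Y t).r x * (d.Y t).conv k x + (d.Y t).h k x + (d.Y t).Q k x = 0 := by
  filter_upwards [d.path_Y.basic] with t ht k
  filter_upwards [ht.lower] with x hx
  have e : (d.Y t).v k x = -((d.Y t).conv k x) - (d.Y t).s x * ((d.Y t).h k x + (d.Y t).Q k x) := rfl
  have hr : (d.Y t).r x * (d.Y t).s x = 1 := mul_inv_cancel₀ (d.a_pos.trans_le hx).ne'
  rw [e]
  linear_combination -((d.Y t).h k x + (d.Y t).Q k x) * hr

lemma locInt_v₂ (k : Fin 2) : LocInt T (d.v₂ k) :=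
  (d.path_Y.conv_bdd k).locInt.neg.sub ((d.path_Y.s_bdd d.a_pos).mul_locInt
    (((d.h₂_mem k).locInt one_le_two ENNReal.ofNat_ne_top).add (d.path_Y.Q_bdd k).locInt))

lemma locInt_w (k : Fin 2) : LocInt T (d.w k) :=
  locInt_of_curve (d.curve_u k).cont' (d.w_meas k) (d.w_eq k)

lemma locInt_v₁ (k : Fin 2) : LocInt T (d.v₁ k) := (d.locInt_v₂ k).add (d.locInt_w k)

lemma locInt_dm_X (k : Fin 2) : LocInt T (fun t => (d.X t).dm k) :=
  d.path_X.dm_locInt k (d.locInt_v₁ k)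

lemma locInt_dm_Y (k : Fin 2) : LocInt T (fun t => (d.Y t).dm k) :=
  d.path_Y.dm_locInt k (d.locInt_v₂ k)

lemma weakRep_r_X : WeakRep T S₁.rho S₁.rho0 (fun t => (d.X t).dr) :=
  d.sol₁.mass_weakRep d.T_pos d.path_X

lemma weakRep_r_Y : WeakRep T S₂.rho S₂.rho0 (fun t => (d.Y t).dr) :=
  d.sol₂.mass_weakRep d.T_pos d.path_Y

lemma rep_r_X : Rep T S₁.rho S₁.rho0 (fun t => (d.X t).dr) :=
  d.weakRep_r_X.rep d.T_pos d.sol₁.locInt_rho d.path_X.dr_bdd.locInt d.sol₁.locInt_rho0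

lemma rep_r_Y : Rep T S₂.rho S₂.rho0 (fun t => (d.Y t).dr) :=
  d.weakRep_r_Y.rep d.T_pos d.sol₂.locInt_rho d.path_Y.dr_bdd.locInt d.sol₂.locInt_rho0

lemma weakRep_m_Y (k : Fin 2) : WeakRep T (fun t x => S₂.rho t x * S₂.u k t x)
    (fun x => S₂.rho0 x * S₂.u0 k x) (fun t => (d.Y t).dm k) :=
  d.sol₂.momentum_weakRep d.T_pos d.path_Y k (d.weak_h₂ k) (d.momentum_Y.mono fun _ h => h k)
    (d.locInt_v₂ k)

lemma rep_u_Y (k : Fin 2) : Rep T (S₂.u k) (S₂.u0 k) (d.v₂ k) :=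
  d.path_Y.rep_velocity d.T_pos d.a_pos d.rep_r_Y ((d.weakRep_m_Y k).rep d.T_pos
    (d.sol₂.locInt_momentum k) (d.locInt_dm_Y k) (d.sol₂.locInt_momentum0 k))

lemma locallyIntegrable_U (k : Fin 2) : LocallyIntegrable (fun x => d.U k 0 x) volume :=
  (Lp.memLp (d.U k 0)).locallyIntegrable (by norm_num)

lemma rep_δu (k : Fin 2) : Rep T (fun t x => S₁.u k t x - S₂.u k t x) (d.U k 0) (d.w k) := by
  have h : WeakRep T (fun t x => S₁.u k t x - S₂.u k t x) (d.U k 0) (d.w k) := fun ψ hψ =>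
    ((d.curve_u k).weakRep d.T_pos ψ hψ).congr (ae_of_all _ fun _ => rfl) (by
      filter_upwards [ae_restrict_mem measurableSet_Icc] with t ht
      exact integral_congr_ae (by filter_upwards [d.w_eq k t ht] with x hx; rw [hx]))
  exact h.rep d.T_pos ((d.sol₁.locInt_u k).sub (d.sol₂.locInt_u k)) (d.locInt_w k)
    (d.locallyIntegrable_U k)

/-- The derivative of the first momentum comes from `ρ₁(u₂ + δu)`, whose factors are all known along
lines, and not from the momentum equation, where the first pressure has no gradient yet. The initial
value is therefore expressed through `u₀₂` and the curve δu at time 0. -/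
lemma rep_m_X (k : Fin 2) : Rep T (fun t x => S₁.rho t x * S₁.u k t x)
    (fun x => S₁.rho0 x * (S₂.u0 k x + d.U k 0 x)) (fun t => (d.X t).dm k) := by
  filter_upwards [d.rep_r_X, d.rep_u_Y k, d.rep_δu k] with x h1 h2 h3
  refine (h1.mul d.T_pos.le (h2.add d.T_pos.le h3)).congr ?_ ?_
  · exact ae_of_all _ fun t => by ring
  · exact ae_of_all _ fun t => by
      simp only [State.dm, X, Flow.state, v₁]; ring

/-- Boundedness of the data `ρ₀₁` and `u₀₂` enters here. -/
lemma locallyIntegrable_m0 (k : Fin 2) :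
    LocallyIntegrable (fun x => S₁.rho0 x * (S₂.u0 k x + d.U k 0 x)) volume :=
  (l2loc_of_memLp le_top d.rho0_mem).locallyIntegrable_mul
    ((l2loc_of_memLp le_top (d.u0_mem k)).add (memLp_l2loc (Lp.memLp (d.U k 0))))

lemma weakRep_m_X (k : Fin 2) : WeakRep T (fun t x => S₁.rho t x * S₁.u k t x)
    (fun x => S₁.rho0 x * (S₂.u0 k x + d.U k 0 x)) (fun t => (d.X t).dm k) :=
  (d.rep_m_X k).weak d.T_pos (d.sol₁.locInt_momentum k) (d.locInt_dm_X k)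
    (d.locallyIntegrable_m0 k)

/-- The initial value of the curve `u₁ - u₂`. -/
lemma u0_sub (k : Fin 2) : ∀ᵐ x, S₁.u0 k x - S₂.u0 k x = d.U k 0 x := by
  -- Both are initial values of the same momentum, one found along lines and the other in the weak
  -- momentum equation. Afterwards `ρ₀₁ ≥ a` is divided out.
  have h : (fun x => S₁.rho0 x * (S₂.u0 k x + d.U k 0 x)) =ᵐ[volume]
      fun x => S₁.rho0 x * S₁.u0 k x := by
    refine ae_eq_of_test (d.locallyIntegrable_m0 k) (d.sol₁.locInt_momentum0 k) fun ψ hψ => ?_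
    obtain ⟨G, -, -, hrep⟩ := d.sol₁.momentum_rep1 d.T_pos k hψ
    exact (Rep1.unique d.T_pos (d.weakRep_m_X k ψ hψ) hrep).1
  filter_upwards [h, d.rep_r_X, ae_line_of_slab d.path_X.ae_lower_slab] with x h1 h2 h3
  have h0 := h2.le_init d.T_pos h3
  have := mul_left_cancel₀ (d.a_pos.trans_le h0).ne' h1
  linarith

/-- Two representations of the same function of time, from the curve in L² and from the mass
equations, have equal initial values and derivatives. -/
lemma rep1_δr {ψ : Plane → ℝ} (hψ : IsTest ψ) :
    (∫ x, d.R 0 x * ψ x = ∫ x, (S₁.rho0 x - S₂.rho0 x) * ψ x) ∧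
      ∀ᵐ t ∂(volume.restrict (Icc 0 T)),
        ∫ x, d.R' t x * ψ x = ∫ x, ((d.X t).dr x - (d.Y t).dr x) * ψ x := by
  have h : Rep T (fun t x => S₁.rho t x - S₂.rho t x) (fun x => S₁.rho0 x - S₂.rho0 x)
      (fun t x => (d.X t).dr x - (d.Y t).dr x) := by
    filter_upwards [d.rep_r_X, d.rep_r_Y] with x h1 h2 using h1.sub d.T_pos.le h2
  exact Rep1.unique d.T_pos (d.curve_r.weakRep d.T_pos ψ hψ) (h.weak d.T_pos
    (d.sol₁.locInt_rho.sub d.sol₂.locInt_rho) (d.path_X.dr_bdd.sub d.path_Y.dr_bdd).locInt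
    (d.sol₁.locInt_rho0.sub d.sol₂.locInt_rho0) ψ hψ)

/-- The initial value of the curve `ρ₁ - ρ₂`. -/
lemma rho0_sub : ∀ᵐ x, S₁.rho0 x - S₂.rho0 x = d.R 0 x :=
  ae_eq_of_test (d.sol₁.locInt_rho0.sub d.sol₂.locInt_rho0)
    ((Lp.memLp (d.R 0)).locallyIntegrable (by norm_num)) fun _ hψ => (d.rep1_δr hψ).1.symm

lemma ae_R' : ∀ᵐ t ∂(volume.restrict (Icc 0 T)),
    ∀ᵐ x, d.R' t x = (d.X t).dr x - (d.Y t).dr x := by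
  have h : ∀ᵐ t ∂(volume.restrict (Icc 0 T)), ∀ n m, ∫ x, d.R' t x * testFam n m x =
      ∫ x, ((d.X t).dr x - (d.Y t).dr x) * testFam n m x :=
    ae_all_iff.2 fun n => ae_all_iff.2 fun m => (d.rep1_δr (testFam_isTest n m)).2
  filter_upwards [h, d.path_X.basic, d.path_Y.basic] with t h1 h2 h3
  exact ae_eq_of_testFam (memLp_l2loc (Lp.memLp (d.R' t))) (h2.dr_l2loc.sub h3.dr_l2loc) h1

lemma v₂_l2loc : ∀ᵐ t ∂(volume.restrict (Icc 0 T)), ∀ k, L2loc (d.h₂ k t) ∧ L2loc (d.v₂ k t) := by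
  filter_upwards [d.path_Y.basic, ae_all_iff.2 fun k => (d.h₂_mem k).ae_memLp one_le_two
    ENNReal.ofNat_ne_top] with t h1 h2 k
  have hh : L2loc (d.h₂ k t) := l2loc_of_memLp le_top (h2 k)
  refine ⟨hh, (h1.conv_l2loc k).neg.sub ((hh.add (h1.Q_l2loc k)).bdd_mul h1.h1_s.l2.1 (C := a⁻¹) ?_)⟩
  filter_upwards [h1.lower] with x hx
  have hx' : a ≤ (S₂.state d.p₂ d.H₂ 0 d.h₂ t).r x := hx
  rw [State.s, abs_inv, abs_of_pos (d.a_pos.trans_le hx')]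
  exact inv_anti₀ d.a_pos hx'

lemma v₁_l2loc : ∀ᵐ t ∂(volume.restrict (Icc 0 T)), ∀ k, L2loc (d.v₁ k t) ∧ L2loc (d.h₁ k t) := by
  filter_upwards [d.path_X.basic, d.v₂_l2loc, ae_restrict_mem measurableSet_Icc] with t h1 h2 ht k
  have hv : L2loc (d.v₁ k t) := (h2 k).2.add
    (memLp_l2loc ((memLp_congr_ae (d.w_eq k t ht)).2 (Lp.memLp (d.U' k t))))
  exact ⟨hv, ((hv.bdd_mul h1.h1_r.l2.1 h1.r_le).add
    ((h1.conv_l2loc k).bdd_mul h1.h1_r.l2.1 h1.r_le)).add (h1.Q_l2loc k) |>.neg⟩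

/-- As `h₁` is defined as the residual of the momentum balance, equating the two time derivatives of
the momentum exhibits it as the distributional gradient of `π₁ - ρ₁ω₁`. -/
lemma zeroInt_momentum_X {ψ : Plane → ℝ} (hψ : IsTest ψ) (k : Fin 2) :
    ∀ᵐ t ∂(volume.restrict (Icc 0 T)), ZeroInt (fun x =>
      (S₁.press t x - (d.X t).r x * (d.X t).om x) * pd k ψ x + (d.X t).h k x * ψ x) := by
  obtain ⟨G, hG, hG', hrep⟩ := d.sol₁.momentum_rep1 d.T_pos k hψ
  filter_upwards [(Rep1.unique d.T_pos (d.weakRep_m_X k ψ hψ) hrep).2, hG, d.path_X.basic,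
    (d.locInt_dm_X k).ae_slice] with t h1 h2 h3 h4
  exact h3.zeroInt_momentum hψ k (ae_of_all _ fun x => d.momentum_X t k x)
    ((ZeroInt.of_eq h2 (integrable_mul_test h4 hψ) h1.symm).congr (ae_of_all _ fun x => by
      simp only [hG']; rfl))

/-- The components are tested with `∂₁ψ` and `∂₀ψ`; by symmetry of second derivatives `π - ρω` drops
out of the difference. -/
lemma curl_h_X : ∀ᵐ t ∂(volume.restrict (Icc 0 T)), ∀ ψ, IsTest ψ →
    ∫ x, (d.X t).h 0 x * pd 1 ψ x = ∫ x, (d.X t).h 1 x * pd 0 ψ x := by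
  have h : ∀ᵐ t ∂(volume.restrict (Icc 0 T)), ∀ n m,
      ZeroInt (fun x => (S₁.press t x - (d.X t).r x * (d.X t).om x) * pd 0 (pd 1 (testFam n m)) x +
        (d.X t).h 0 x * pd 1 (testFam n m) x) ∧
      ZeroInt (fun x => (S₁.press t x - (d.X t).r x * (d.X t).om x) * pd 1 (pd 0 (testFam n m)) x +
        (d.X t).h 1 x * pd 0 (testFam n m) x) :=
    ae_all_iff.2 fun n => ae_all_iff.2 fun m =>
      (d.zeroInt_momentum_X ((testFam_isTest n m).pd 1) 0).and
        (d.zeroInt_momentum_X ((testFam_isTest n m).pd 0) 1)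
  filter_upwards [h, d.v₁_l2loc] with t h1 h2 ψ hψ
  have hz : L2loc (fun _ : Plane => (0 : ℝ)) := continuous_l2loc continuous_const
  have h0 : L2loc ((d.X t).h 0) := (h2 0).2
  have h1' : L2loc (fun x => -(d.X t).h 1 x) := (h2 1).2.neg
  have := forall_test_of_testFam hz h1' h0 hz (fun n m => by
    have i0 := integrable_mul_test h0.locallyIntegrable ((testFam_isTest n m).pd 1)
    have i1 := integrable_mul_test h1'.locallyIntegrable ((testFam_isTest n m).pd 0)
    simp only [zero_mul, integral_zero, zero_add, add_zero]
    rw [← integral_add i1 i0, ← ((h1 n m).1.sub (h1 n m).2).2]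
    refine integral_congr_ae (ae_of_all _ fun x => ?_)
    simp only [pd_comm (testFam_isTest n m).1 0 1]
    ring) hψ
  simp only [zero_mul, integral_zero, zero_add, add_zero, neg_mul, integral_neg] at this
  linarith

end Pair

lemma IsTest.lap {ψ : Plane → ℝ} (hψ : IsTest ψ) : IsTest (OddFluid.lap ψ) := by
  rw [show OddFluid.lap ψ = fun x => OddFluid.pd 0 (OddFluid.pd 0 ψ) x +
    OddFluid.pd 1 (OddFluid.pd 1 ψ) x from funext fun x => by simp only [OddFluid.lap, Fin.sum_univ_two]]
  exact ((hψ.pd 0).pd 0).add ((hψ.pd 1).pd 1)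

lemma integral_curl_sub_lap {A B C ψ : Plane → ℝ} (hA : LocallyIntegrable A volume)
    (hB : LocallyIntegrable B volume) (hC : LocallyIntegrable C volume) (hψ : IsTest ψ) :
    ∫ x, (A x * pd 1 ψ x - B x * pd 0 ψ x - C x * lap ψ x) =
      (∫ x, A x * pd 1 ψ x) - (∫ x, B x * pd 0 ψ x) - ∫ x, C x * lap ψ x := by
  have i0 := integrable_mul_test hA (hψ.pd 1)
  have i1 := integrable_mul_test hB (hψ.pd 0)
  have i2 := integrable_mul_test hC hψ.lap
  have i01 : Integrable (fun x => A x * pd 1 ψ x - B x * pd 0 ψ x) := i0.sub i1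
  rw [integral_sub i01 i2, integral_sub i0 i1]

namespace State.Valid

variable {X : State} {a c M : ℝ} (hX : X.Valid a c M)
include hX

lemma th_l2loc : L2loc X.th := by
  have h := fun i k => (hX.h1_u k).l2.bdd_mul (hX.h1_p i).l2.1 (hX.p_le i)
  have h' := fun i k => ((hX.h1_u k).dl2 i).bdd_mul hX.h1_r.l2.1 hX.r_le
  exact (((((h 0 1).add (h' 0 1)).sub (h 1 0)).sub (h' 1 0)).sub (hX.H_l2loc 0 0)).sub
    (hX.H_l2loc 1 1)

/-- The function `th` represents the distribution `θ`, which links the curve assumed in L² to the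
pointwise algebra. -/
lemma integral_th {ψ : Plane → ℝ} (hψ : IsTest ψ) : ∫ x, X.th x * ψ x =
    ∫ x, (X.r x * X.u 0 x * pd 1 ψ x - X.r x * X.u 1 x * pd 0 ψ x - X.r x * lap ψ x) := by
  have z := fun k i => hX.h1_r.zeroInt_mul (hX.h1_u k) hψ i
  have y := fun i => ((hX.weak_r i).2.2 _ (hψ.pd i)).trans
    (neg_eq_iff_eq_neg.2 ((hX.weak_p i i).2.2 ψ hψ))
  have zz := fun i => ZeroInt.of_eq (integrable_mul_test hX.h1_r.l2.locallyIntegrable ((hψ.pd i).pd i))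
    (integrable_mul_test (hX.H_l2loc i i).locallyIntegrable hψ) (y i)
  have key := (((z 0 1).sub (z 1 0)).sub (zz 0)).sub (zz 1)
  have i0 := integrable_mul_test hX.th_l2loc.locallyIntegrable hψ
  have i1 : Integrable (fun x => X.r x * X.u 0 x * pd 1 ψ x - X.r x * X.u 1 x * pd 0 ψ x -
      X.r x * lap ψ x) :=
    ((integrable_mul_test (hX.h1_m 0).l2.locallyIntegrable (hψ.pd 1)).sub
      (integrable_mul_test (hX.h1_m 1).l2.locallyIntegrable (hψ.pd 0))).sub
      (integrable_mul_test hX.h1_r.l2.locallyIntegrable hψ.lap)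
  have e := integral_sub i1 i0
  have e' : ∫ x, (X.r x * X.u 0 x * pd 1 ψ x - X.r x * X.u 1 x * pd 0 ψ x -
      X.r x * lap ψ x - X.th x * ψ x) = 0 := by
    rw [← key.2]
    refine integral_congr_ae (ae_of_all _ fun x => ?_)
    simp only [State.th, lap, Fin.sum_univ_two]
    ring
  linarith

end State.Valid

/-! ### Assembling a snapshot at almost every time. -/

namespace Pair

variable {T a c : ℝ} {M : ℝ≥0} {q : ℝ≥0∞} {S₁ S₂ : Flow} (d : Pair T a c M q S₁ S₂)

lemma ae_dp (i : Fin 2) : ∀ᵐ t ∂(volume.restrict (Icc 0 T)),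
    ∀ᵐ x, d.p₁ i t x - d.p₂ i t x = d.dp i t x := by
  filter_upwards [(d.path₁ 0 0 0).basic, (d.path₂ 0 0 0).basic,
    ae_restrict_mem measurableSet_Icc] with t h1 h2 ht
  exact ((h1.weak_r i).sub (h2.weak_r i)).unique (d.weak_dp i t ht) (ae_eq_refl _)

lemma ae_dD (i k : Fin 2) : ∀ᵐ t ∂(volume.restrict (Icc 0 T)),
    ∀ᵐ x, S₁.gradu i k t x - S₂.gradu i k t x = d.dD i k t x := by
  filter_upwards [(d.path₁ 0 0 0).basic, (d.path₂ 0 0 0).basic,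
    ae_restrict_mem measurableSet_Icc] with t h1 h2 ht
  exact ((h1.weak_u i k).sub (h2.weak_u i k)).unique (d.weak_dD i k t ht) (ae_eq_refl _)

lemma one_le_exponent : (1 : ℝ≥0∞) ≤ (2⁻¹ - q⁻¹)⁻¹ := by
  rw [ENNReal.one_le_inv]
  exact tsub_le_self.trans (ENNReal.inv_le_one.2 one_le_two)

include d in
lemma exponent_ne_top : (2⁻¹ - q⁻¹)⁻¹ ≠ (⊤ : ℝ≥0∞) := by
  rw [ENNReal.inv_ne_top]
  exact (tsub_pos_iff_lt.2 (ENNReal.inv_lt_inv.2 d.two_lt_q)).ne'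

lemma valid_Y : ∀ᵐ t ∂(volume.restrict (Icc 0 T)), (d.Y t).Valid a c M := by
  filter_upwards [d.path_Y.basic, ae_all_iff.2 fun i => ae_all_iff.2 (d.weak_H₂ i),
    ae_all_iff.2 fun i => ae_all_iff.2 fun k => (d.H₂_mem i k).ae_memLp le_rfl ENNReal.one_ne_top,
    ae_all_iff.2 d.weak_h₂, d.v₂_l2loc, d.momentum_Y] with t h1 h2 h3 h4 h5 h6
  refine ⟨h1.a_pos, h1.lower, h1.upper, h1.M_nonneg, h1.weak_r, h2,
    fun i k => l2loc_of_memLp le_top (h3 i k), h1.weak_u, h1.p_le, h1.u_le, h1.D_le, h1.div,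
    fun k => (h5 k).1, h6, fun ψ hψ => ?_⟩
  have e0 := (h4 0).2.2 _ (hψ.pd 1)
  have e1 := (h4 1).2.2 _ (hψ.pd 0)
  simp only [pd_comm hψ.1 0 1] at e0
  exact neg_injective (e0.symm.trans e1)

lemma valid_X : ∀ᵐ t ∂(volume.restrict (Icc 0 T)), (d.X t).Valid a c M := by
  filter_upwards [d.path_X.basic, d.valid_Y, ae_all_iff.2 d.ae_dp, d.v₁_l2loc, d.curl_h_X,
    ae_restrict_mem measurableSet_Icc] with t h1 h2 h3 h4 h5 ht
  refine ⟨h1.a_pos, h1.lower, h1.upper, h1.M_nonneg, h1.weak_r, fun i k => ?_,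
    fun i k => (h2.H_l2loc i k).add (memLp_l2loc ((d.curve_H i k).memLp ht)), h1.weak_u, h1.p_le,
    h1.u_le, h1.D_le, h1.div, fun k => (h4 k).2,
    fun k => ae_of_all _ fun x => d.momentum_X t k x, h5⟩
  refine ((h2.weak_p i k).add (d.weak_dH i k t ht)).congr ?_ (ae_eq_refl _)
  filter_upwards [h3 k] with x hx
  exact (eq_add_of_sub_eq' hx).symm

/-- Both sides are derivatives of the same function of time: the pairing of `θ₁ - θ₂` with `ψ`, once
as a curve in L² and once through the equations. -/
lemma theta_rate {ψ : Plane → ℝ} (hψ : IsTest ψ) : ∀ᵐ t ∂(volume.restrict (Icc 0 T)),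
    ∫ x, d.Θ' t x * ψ x = (d.X t).thRate ψ - (d.Y t).thRate ψ := by
  have pair : ∀ {S : Flow} {m0 : Fin 2 → Plane → ℝ} {Z : ℝ → State} (_ : IsSolution T S)
      (_ : ∀ k, LocInt T (fun t => (Z t).dm k)) (_ : LocInt T (fun t => (Z t).dr))
      (_ : WeakRep T S.rho S.rho0 (fun t => (Z t).dr))
      (_ : ∀ k, WeakRep T (fun t x => S.rho t x * S.u k t x) (m0 k) (fun t => (Z t).dm k)),
      ∃ C, Rep1 T (fun t => S.thetaPairing t ψ) C (fun t => (Z t).thRate ψ) := by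
    intro S m0 Z hS hm hr h1 h2
    refine ⟨_, (((h2 0 _ (hψ.pd 1)).sub d.T_pos.le (h2 1 _ (hψ.pd 0))).sub d.T_pos.le
      (h1 _ hψ.lap)).congr ?_ ?_⟩
    · filter_upwards [(hS.locInt_momentum 0).ae_slice, (hS.locInt_momentum 1).ae_slice,
        hS.locInt_rho.ae_slice] with t i0 i1 i2
      exact integral_curl_sub_lap i0 i1 i2 hψ
    · filter_upwards [(hm 0).ae_slice, (hm 1).ae_slice, hr.ae_slice] with t i0 i1 i2
      exact integral_curl_sub_lap i0 i1 i2 hψ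
  obtain ⟨C1, r1⟩ := pair d.sol₁ d.locInt_dm_X d.path_X.dr_bdd.locInt d.weakRep_r_X d.weakRep_m_X
  obtain ⟨C2, r2⟩ := pair d.sol₂ d.locInt_dm_Y d.path_Y.dr_bdd.locInt d.weakRep_r_Y d.weakRep_m_Y
  refine (Rep1.unique d.T_pos ((d.curve_θ.weakRep d.T_pos ψ hψ).congr ?_
    (ae_of_all _ fun _ => rfl)) (r1.sub d.T_pos.le r2)).2
  filter_upwards [ae_restrict_mem measurableSet_Icc] with t ht
  exact (d.theta_eq t ht ψ hψ).symm

/-- The countable family makes the exceptional times independent of `ψ`. -/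
lemma ae_theta_rate : ∀ᵐ t ∂(volume.restrict (Icc 0 T)), ∀ ψ, IsTest ψ →
    ∫ x, d.Θ' t x * ψ x = (d.X t).thRate ψ - (d.Y t).thRate ψ := by
  have h : ∀ᵐ t ∂(volume.restrict (Icc 0 T)), ∀ n m, ∫ x, d.Θ' t x * testFam n m x =
      (d.X t).thRate (testFam n m) - (d.Y t).thRate (testFam n m) :=
    ae_all_iff.2 fun n => ae_all_iff.2 fun m => d.theta_rate (testFam_isTest n m)
  filter_upwards [h, d.valid_X, d.valid_Y] with t h1 hX hY ψ hψ
  have e : ∀ {φ : Plane → ℝ}, IsTest φ → (d.X t).thRate φ - (d.Y t).thRate φ =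
      -((∫ x, ((d.X t).dm 1 x - (d.Y t).dm 1 x) * pd 0 φ x) +
        (∫ x, ((d.Y t).dm 0 x - (d.X t).dm 0 x) * pd 1 φ x) +
        ∫ x, ((d.X t).dr x - (d.Y t).dr x) * lap φ x) := by
    intro φ hφ
    have hl := fun {Z : State} (hZ : Z.Valid a c M) k => (hZ.dm_l2loc k).locallyIntegrable
    have hr := fun {Z : State} (hZ : Z.Valid a c M) => hZ.dr_l2loc.locallyIntegrable
    have s : ∀ {A B ψ : Plane → ℝ}, LocallyIntegrable A volume → LocallyIntegrable B volume →
        IsTest ψ → ∫ x, (A x - B x) * ψ x = (∫ x, A x * ψ x) - ∫ x, B x * ψ x := by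
      intro A B ψ hA hB hψ
      rw [← integral_sub (integrable_mul_test hA hψ) (integrable_mul_test hB hψ)]
      simp only [sub_mul]
    unfold State.thRate
    rw [integral_curl_sub_lap (hl hX 0) (hl hX 1) (hr hX) hφ,
      integral_curl_sub_lap (hl hY 0) (hl hY 1) (hr hY) hφ, s (hl hX 1) (hl hY 1) (hφ.pd 0),
      s (hl hY 0) (hl hX 0) (hφ.pd 1), s (hr hX) (hr hY) hφ.lap]
    ring
  have := forall_test_of_testFam (memLp_l2loc (Lp.memLp (d.Θ' t)))
    ((hX.dm_l2loc 1).sub (hY.dm_l2loc 1)) ((hY.dm_l2loc 0).sub (hX.dm_l2loc 0))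
    (hX.dr_l2loc.sub hY.dr_l2loc) (fun n m => by
      rw [h1 n m, e (testFam_isTest n m)]; ring) hψ
  rw [e hψ]
  linarith

/-- The weight in the energy estimate. -/
def κ (t : ℝ) : ℝ :=
  1 + (∑ k, (eLpNorm (d.h₂ k t) ⊤ volume).toReal) +
    (∑ i, ∑ k, (eLpNorm (d.H₂ i k t) ⊤ volume).toReal) +
    (∑ i, ∑ j, ∑ k, (eLpNorm (d.W i j k t) q volume).toReal) +
    ∑ i, (eLpNorm (d.Λ i t) q volume).toReal

/-- The energy of the difference. -/
def energy (t : ℝ) : ℝ :=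
  n2 (fun x => S₁.rho t x - S₂.rho t x) ^ 2 + n2 (fun x => S₁.u 0 t x - S₂.u 0 t x) ^ 2 +
    n2 (fun x => S₁.u 1 t x - S₂.u 1 t x) ^ 2 + n2 (fun x => d.dD 0 1 t x - d.dD 1 0 t x) ^ 2 +
    n2 (d.Θ t) ^ 2

/-- The time derivative of the energy. -/
def energyRate (t : ℝ) : ℝ :=
  2 * (∫ x, (S₁.rho t x - S₂.rho t x) * d.R' t x) +
    2 * (∫ x, (S₁.u 0 t x - S₂.u 0 t x) * d.U' 0 t x) +
    2 * (∫ x, (S₁.u 1 t x - S₂.u 1 t x) * d.U' 1 t x) +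
    2 * (∫ x, (d.dD 0 1 t x - d.dD 1 0 t x) * (d.E' 0 1 t - d.E' 1 0 t : Lp ℝ 2 volume) x) +
    2 * ∫ x, d.Θ t x * d.Θ' t x

/-- The square of the distance between the flows. -/
def dist2 (t : ℝ) : ℝ :=
  n2 (fun x => S₁.rho t x - S₂.rho t x) ^ 2 + (n2 (d.dp 0 t) ^ 2 + n2 (d.dp 1 t) ^ 2) +
    (n2 (d.dH 0 0 t) ^ 2 + n2 (d.dH 0 1 t) ^ 2 + n2 (d.dH 1 0 t) ^ 2 + n2 (d.dH 1 1 t) ^ 2) +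
    (n2 (fun x => S₁.u 0 t x - S₂.u 0 t x) ^ 2 + n2 (fun x => S₁.u 1 t x - S₂.u 1 t x) ^ 2) +
    (n2 (d.dD 0 0 t) ^ 2 + n2 (d.dD 0 1 t) ^ 2 + n2 (d.dD 1 0 t) ^ 2 + n2 (d.dD 1 1 t) ^ 2)

lemma le_κ (t : ℝ) : 1 ≤ d.κ t ∧ (∀ k, (eLpNorm (d.h₂ k t) ⊤ volume).toReal ≤ d.κ t) ∧
    (∀ i k, (eLpNorm (d.H₂ i k t) ⊤ volume).toReal ≤ d.κ t) ∧
    (∀ i j k, (eLpNorm (d.W i j k t) q volume).toReal ≤ d.κ t) ∧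
    ∀ i, (eLpNorm (d.Λ i t) q volume).toReal ≤ d.κ t := by
  have hn := fun (f : Plane → ℝ) (p : ℝ≥0∞) => (ENNReal.toReal_nonneg : 0 ≤ (eLpNorm f p volume).toReal)
  have s1 := Finset.sum_nonneg fun k (_ : k ∈ Finset.univ) => hn (d.h₂ k t) ⊤
  have s2 := Finset.sum_nonneg fun i (_ : i ∈ Finset.univ) =>
    Finset.sum_nonneg fun k (_ : k ∈ Finset.univ) => hn (d.H₂ i k t) ⊤
  have s3 := Finset.sum_nonneg fun i (_ : i ∈ Finset.univ) =>
    Finset.sum_nonneg fun j (_ : j ∈ Finset.univ) =>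
      Finset.sum_nonneg fun k (_ : k ∈ Finset.univ) => hn (d.W i j k t) q
  have s4 := Finset.sum_nonneg fun i (_ : i ∈ Finset.univ) => hn (d.Λ i t) q
  unfold κ
  refine ⟨by linarith, fun k => ?_, fun i k => ?_, fun i j k => ?_, fun i => ?_⟩
  · have := Finset.single_le_sum (fun k _ => hn (d.h₂ k t) ⊤) (Finset.mem_univ k)
    linarith
  · have h1 := Finset.single_le_sum (fun k _ => hn (d.H₂ i k t) ⊤) (Finset.mem_univ k)
    have h2 := Finset.single_le_sum (f := fun i => ∑ k, (eLpNorm (d.H₂ i k t) ⊤ volume).toReal)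
      (fun i _ => Finset.sum_nonneg fun k _ => hn (d.H₂ i k t) ⊤) (Finset.mem_univ i)
    linarith
  · have h1 := Finset.single_le_sum (fun k _ => hn (d.W i j k t) q) (Finset.mem_univ k)
    have h2 := Finset.single_le_sum (f := fun j => ∑ k, (eLpNorm (d.W i j k t) q volume).toReal)
      (fun j _ => Finset.sum_nonneg fun k _ => hn (d.W i j k t) q) (Finset.mem_univ j)
    have h3 := Finset.single_le_sum
      (f := fun i => ∑ j, ∑ k, (eLpNorm (d.W i j k t) q volume).toReal)
      (fun i _ => Finset.sum_nonneg fun j _ => Finset.sum_nonneg fun k _ => hn (d.W i j k t) q)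
      (Finset.mem_univ i)
    linarith
  · have := Finset.single_le_sum (fun i _ => hn (d.Λ i t) q) (Finset.mem_univ i)
    linarith

lemma ae_abs_le_of_memLp {f : Plane → ℝ} (hf : MemLp f ⊤ volume) {C : ℝ}
    (h : (eLpNorm f ⊤ volume).toReal ≤ C) : ∀ᵐ x, |f x| ≤ C := by
  have := enorm_ae_le_eLpNormEssSup f volume
  rw [← eLpNorm_exponent_top] at this
  filter_upwards [this] with x hx
  refine le_trans ?_ h
  have := ENNReal.toReal_mono hf.eLpNorm_ne_top hx
  simpa using this

/-- At almost every time the two flows form a snapshot. -/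
theorem exists_snapshot : ∀ᵐ t ∂(volume.restrict (Icc 0 T)), ∃ s : Snapshot a c M q,
    s.κ = d.κ t ∧ s.en = d.energy t ∧ s.rate = d.energyRate t ∧ s.dist2 = d.dist2 t := by
  have hr := exponent_ne_top d
  filter_upwards [d.valid_X, d.valid_Y, ae_all_iff.2 d.ae_dp,
    ae_all_iff.2 fun i => ae_all_iff.2 (d.ae_dD i), d.ae_R', d.ae_theta_rate,
    ae_all_iff.2 fun k => (d.h₂_mem k).ae_memLp one_le_two ENNReal.ofNat_ne_top,
    ae_all_iff.2 fun i => ae_all_iff.2 fun k => (d.H₂_mem i k).ae_memLp le_rfl ENNReal.one_ne_top,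
    ae_all_iff.2 fun i => ae_all_iff.2 fun j => ae_all_iff.2 fun k =>
      (d.W_mem i j k).ae_memLp one_le_exponent hr,
    ae_all_iff.2 fun i => (d.Λ_mem i).ae_memLp le_rfl ENNReal.one_ne_top,
    ae_all_iff.2 fun i => ae_all_iff.2 fun j => ae_all_iff.2 (d.weak_W i j), ae_all_iff.2 d.weak_Λ,
    ae_restrict_mem measurableSet_Icc] with t hX hY hp hD hR hθ h1 h2 h3 h4 h5 h6 ht
  obtain ⟨k0, k1, k2, k3, k4⟩ := d.le_κ t
  have hdiv : ∀ᵐ x, d.E' 0 0 t x + d.E' 1 1 t x = 0 := by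
    refine (d.curve_D 0 0).add_eq_zero d.T_pos (d.curve_D 1 1) ?_ ht
    filter_upwards [d.path_X.basic, d.path_Y.basic, d.ae_dD 0 0, d.ae_dD 1 1] with t g1 g2 g3 g4
    filter_upwards [g1.div, g2.div, g3, g4] with x e1 e2 e3 e4
    have e1' : S₁.gradu 0 0 t x + S₁.gradu 1 1 t x = 0 := e1
    have e2' : S₂.gradu 0 0 t x + S₂.gradu 1 1 t x = 0 := e2
    linarith
  have hv : ∀ k x, (d.X t).v k x - (d.Y t).v k x = d.w k t x := fun k x =>
    add_sub_cancel_left _ _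
  have hw : ∀ k, (fun x => (d.X t).v k x - (d.Y t).v k x) =ᵐ[volume] d.U' k t := fun k => by
    filter_upwards [d.w_eq k t ht] with x hx
    rw [hv, hx]
  have hH : ∀ i k x, (d.X t).H i k x - (d.Y t).H i k x = d.dH i k t x := fun i k x =>
    add_sub_cancel_left _ _
  let s : Snapshot a c M q :=
    { X := d.X t, Y := d.Y t, hX := hX, hY := hY, κ := d.κ t, one_le := k0
      h_le := fun k => ae_abs_le_of_memLp (h1 k) (k1 k)
      H_le := fun i k => ae_abs_le_of_memLp (h2 i k) (k2 i k)
      W := fun i j k => d.W i j k t, weak_W := h5, W_mem := h3, W_le := k3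
      Λ := fun i => d.Λ i t, weak_Λ := h6, Λ_mem := h4, Λ_le := k4
      r_mem := d.curve_r.memLp ht
      p_mem := fun i => (memLp_congr_ae (hp i)).2 ((d.curve_p i).memLp ht)
      H_mem := fun i k => (memLp_congr_ae (ae_of_all _ (hH i k))).2 ((d.curve_H i k).memLp ht)
      u_mem := fun k => (d.curve_u k).memLp ht
      D_mem := fun i k => (memLp_congr_ae (hD i k)).2 ((d.curve_D i k).memLp ht)
      v_mem := fun k => (memLp_congr_ae (hw k)).2 (Lp.memLp (d.U' k t))
      V := fun i k => d.E' i k t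
      weak_V := fun i k => ((d.curve_u k).weak_partial d.T_pos (d.curve_D i k) (d.weak_dD i k) ht).congr
        (hw k).symm (ae_eq_refl _)
      V_mem := fun i k => Lp.memLp (d.E' i k t)
      V_div := hdiv
      T := d.Θ' t, T_mem := Lp.memLp (d.Θ' t), T_eq := hθ }
  have hom : Snapshot.δ State.om s =ᵐ[volume] fun x => d.dD 0 1 t x - d.dD 1 0 t x := by
    filter_upwards [hD 0 1, hD 1 0] with x e1 e2
    rw [← e1, ← e2]
    simp only [Snapshot.δ, State.om, s, X, Y, Flow.state]; ring
  -- Both functions represent the distribution `θ₁ - θ₂` at this time.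
  have hth : Snapshot.δ State.th s =ᵐ[volume] d.Θ t := by
    refine ae_eq_of_test (hX.th_l2loc.sub hY.th_l2loc).locallyIntegrable
      ((Lp.memLp (d.Θ t)).locallyIntegrable (by norm_num)) fun ψ hψ => ?_
    have e : ∫ x, Snapshot.δ State.th s x * ψ x =
        (∫ x, (d.X t).th x * ψ x) - ∫ x, (d.Y t).th x * ψ x := by
      rw [← integral_sub (integrable_mul_test hX.th_l2loc.locallyIntegrable hψ)
        (integrable_mul_test hY.th_l2loc.locallyIntegrable hψ)]
      exact integral_congr_ae (ae_of_all _ fun x => by simp only [Snapshot.δ, s]; ring)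
    rw [e, hX.integral_th hψ, hY.integral_th hψ, d.theta_eq t ht ψ hψ]
    rfl
  refine ⟨s, rfl, ?_, ?_, ?_⟩
  · unfold Snapshot.en energy
    rw [n2_congr hom, n2_congr hth]
    rfl
  · have e1 : ∫ x, Snapshot.δ State.r s x * Snapshot.δ State.dr s x =
        ∫ x, (S₁.rho t x - S₂.rho t x) * d.R' t x :=
      integral_congr_ae (by filter_upwards [hR] with x hx; rw [hx]; rfl)
    have e2 : ∀ k, ∫ x, Snapshot.δ (fun X => X.u k) s x * Snapshot.δ (fun X => X.v k) s x =
        ∫ x, (S₁.u k t x - S₂.u k t x) * d.U' k t x := fun k =>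
      integral_congr_ae (by filter_upwards [hw k] with x hx; rw [← hx]; rfl)
    have e3 : ∫ x, Snapshot.δ State.om s x * (s.V 0 1 x - s.V 1 0 x) =
        ∫ x, (d.dD 0 1 t x - d.dD 1 0 t x) * (d.E' 0 1 t - d.E' 1 0 t : Lp ℝ 2 volume) x :=
      integral_congr_ae (by
        filter_upwards [hom, Lp.coeFn_sub (d.E' 0 1 t) (d.E' 1 0 t)] with x hx hx'
        rw [hx, hx']; rfl)
    have e4 : ∫ x, Snapshot.δ State.th s x * s.T x = ∫ x, d.Θ t x * d.Θ' t x :=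
      integral_congr_ae (by filter_upwards [hth] with x hx; rw [hx])
    unfold Snapshot.rate energyRate
    rw [e1, e2, e2, e3, e4]
    ring
  · have e1 : ∀ i, n2 (Snapshot.δ (fun X => X.p i) s) = n2 (d.dp i t) := fun i => n2_congr (hp i)
    have e2 : ∀ i k, n2 (Snapshot.δ (fun X => X.H i k) s) = n2 (d.dH i k t) := fun i k =>
      n2_congr (ae_of_all _ (hH i k))
    have e3 : ∀ i k, n2 (Snapshot.δ (fun X => X.D i k) s) = n2 (d.dD i k t) := fun i k =>
      n2_congr (hD i k)
    unfold Snapshot.dist2 dist2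
    simp only [e1, e2, e3]
    rfl

end Pair

/-! ### Grönwall's inequality with an integrable rate -/

/-- The logarithm of `f + ε` is differentiated, since `f` may vanish, and `ε` is sent to zero.
Continuity of `f'` lets the inequality, valid almost everywhere, be integrated. -/
lemma gronwall_ae {T : ℝ} {f f' κ : ℝ → ℝ} (hT : 0 ≤ T)
    (hf : ∀ t ∈ Icc 0 T, HasDerivWithinAt f (f' t) (Icc 0 T) t) (hf' : ContinuousOn f' (Icc 0 T))
    (h0 : ∀ t ∈ Icc 0 T, 0 ≤ f t) (hκ : IntegrableOn κ (Icc 0 T) volume) (hκ0 : ∀ t, 0 ≤ κ t)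
    (h : ∀ᵐ t ∂(volume.restrict (Icc 0 T)), f' t ≤ κ t * f t) {t : ℝ} (ht : t ∈ Icc 0 T) :
    f t ≤ Real.exp (∫ s in Icc 0 T, κ s) * f 0 := by
  have hfc : ContinuousOn f (Icc 0 T) := fun s hs => (hf s hs).continuousWithinAt
  have hsub : Icc 0 t ⊆ Icc 0 T := Icc_subset_Icc_right ht.2
  have key : ∀ ε > 0, f t ≤ Real.exp (∫ s in Icc 0 T, κ s) * (f 0 + ε) := by
    intro ε hε
    have hpos : ∀ s ∈ Icc 0 T, 0 < f s + ε := fun s hs => add_pos_of_nonneg_of_pos (h0 s hs) hε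
    have hd : ∀ s ∈ Icc 0 T, HasDerivWithinAt (fun s => Real.log (f s + ε)) (f' s / (f s + ε))
        (Icc 0 T) s := fun s hs => ((hf s hs).add_const ε).log (hpos s hs).ne'
    have hq : ContinuousOn (fun s => f' s / (f s + ε)) (Icc 0 T) :=
      hf'.div (hfc.add continuousOn_const) fun s hs => (hpos s hs).ne'
    have hint := intervalIntegral.integral_eq_sub_of_hasDerivAt_of_le ht.1
      (fun s hs => ((hd s (hsub hs)).continuousWithinAt).mono hsub)
      (fun s hs => (hd s ⟨hs.1.le, hs.2.le.trans ht.2⟩).hasDerivAt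
        (Icc_mem_nhds hs.1 (hs.2.trans_le ht.2)))
      (intervalIntegrable_of_Icc ht.1 ((hq.mono hsub).integrableOn_Icc))
    rw [intervalIntegral.integral_of_le ht.1, ← integral_Icc_eq_integral_Ioc] at hint
    have h1 : ∫ s in Icc 0 t, f' s / (f s + ε) ≤ ∫ s in Icc 0 t, κ s := by
      refine setIntegral_mono_ae_restrict ((hq.mono hsub).integrableOn_Icc) (hκ.mono_set hsub) ?_
      filter_upwards [ae_restrict_of_ae_restrict_of_subset hsub h, ae_restrict_mem measurableSet_Icc]
        with s h1 h2
      have hp := hpos s (hsub h2)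
      rw [div_le_iff₀ hp]
      nlinarith [hκ0 s]
    have h2 : ∫ s in Icc 0 t, κ s ≤ ∫ s in Icc 0 T, κ s :=
      setIntegral_mono_set hκ (ae_of_all _ hκ0) hsub.eventuallyLE
    have h3 : Real.log (f t + ε) ≤ (∫ s in Icc 0 T, κ s) + Real.log (f 0 + ε) := by linarith
    have h4 := Real.exp_le_exp.2 h3
    rw [Real.exp_add, Real.exp_log (hpos t ht), Real.exp_log (hpos 0 ⟨le_rfl, hT⟩)] at h4
    linarith
  refine le_of_forall_pos_le_add fun δ hδ => ?_
  have hE := Real.exp_pos (∫ s in Icc 0 T, κ s)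
  have := key (δ / Real.exp (∫ s in Icc 0 T, κ s)) (by positivity)
  rwa [mul_add, mul_div_cancel₀ _ hE.ne'] at this

/-! ### Sobolev norms from weak derivatives -/

lemma hasWeakPartial_congr_left {i : Fin 2} {f f' g : Plane → ℝ} (h : f =ᵐ[volume] f') :
    HasWeakPartial i f g ↔ HasWeakPartial i f' g :=
  ⟨fun h' => h'.congr h (ae_eq_refl _), fun h' => h'.congr h.symm (ae_eq_refl _)⟩

lemma sobolevSq_congr (k : ℕ) {f g : Plane → ℝ} (h : f =ᵐ[volume] g) :
    sobolevSq k f = sobolevSq k g := by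
  cases k with
  | zero => simp only [sobolevSq, eLpNorm_congr_ae h]
  | succ k => simp only [sobolevSq, eLpNorm_congr_ae h, hasWeakPartial_congr_left h]

/-- Weak derivatives are unique up to null sets, so the infimum is attained at any of them. -/
lemma sobolevSq_succ (k : ℕ) {f : Plane → ℝ} {g : Fin 2 → Plane → ℝ}
    (h : ∀ i, HasWeakPartial i f (g i)) :
    sobolevSq (k + 1) f = eLpNorm f 2 volume ^ 2 + ∑ i, sobolevSq k (g i) := by
  rw [sobolevSq]
  congr 1
  refine Finset.sum_congr rfl fun i _ => le_antisymm (iInf₂_le _ (h i)) ?_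
  exact le_iInf₂ fun g' hg' => (sobolevSq_congr k ((h i).unique hg' (ae_eq_refl _))).le

lemma eLpNorm_sq_eq {f : Plane → ℝ} (hf : MemLp f 2 volume) :
    eLpNorm f 2 volume ^ 2 = ENNReal.ofReal (n2 f ^ 2) := by
  rw [n2, ENNReal.ofReal_pow ENNReal.toReal_nonneg, ENNReal.ofReal_toReal hf.eLpNorm_ne_top]

namespace Pair

variable {T a c : ℝ} {M : ℝ≥0} {q : ℝ≥0∞} {S₁ S₂ : Flow} (d : Pair T a c M q S₁ S₂)

/-! ### Integrability of the weight -/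

/-- A bound for the integral of a norm in `L^r([0,T])`. -/
def normBound (T : ℝ) (M : ℝ≥0) (r : ℝ≥0∞) : ℝ :=
  (ENNReal.ofReal T + (M : ℝ≥0∞) ^ r.toReal).toReal

/-- A bound for the integral of the weight. -/
def κBound (T : ℝ) (M : ℝ≥0) (q : ℝ≥0∞) : ℝ :=
  T + (∑ _k : Fin 2, normBound T M 2) + (∑ _i : Fin 2, ∑ _k : Fin 2, normBound T M 1) +
    (∑ _i : Fin 2, ∑ _j : Fin 2, ∑ _k : Fin 2, normBound T M (2⁻¹ - q⁻¹)⁻¹) +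
    ∑ _i : Fin 2, normBound T M 1

lemma integral_sum_le {f : Fin 2 → ℝ → ℝ} {B : Fin 2 → ℝ}
    (h : ∀ i, IntegrableOn (f i) (Icc 0 T) volume ∧ ∫ t in Icc 0 T, f i t ≤ B i) :
    IntegrableOn (fun t => ∑ i, f i t) (Icc 0 T) volume ∧
      ∫ t in Icc 0 T, ∑ i, f i t ≤ ∑ i, B i := by
  refine ⟨integrable_finsetSum _ fun i _ => (h i).1, ?_⟩
  rw [integral_finsetSum _ fun i _ => (h i).1]
  exact Finset.sum_le_sum fun i _ => (h i).2

lemma integral_κ_le : IntegrableOn d.κ (Icc 0 T) volume ∧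
    ∫ t in Icc 0 T, d.κ t ≤ κBound T M q := by
  have s1 := integral_sum_le fun k => (d.h₂_mem k).integrableOn_norm one_le_two ENNReal.ofNat_ne_top
  have s2 := integral_sum_le fun i => integral_sum_le fun k =>
    (d.H₂_mem i k).integrableOn_norm le_rfl ENNReal.one_ne_top
  have s3 := integral_sum_le fun i => integral_sum_le fun j => integral_sum_le fun k =>
    (d.W_mem i j k).integrableOn_norm one_le_exponent (exponent_ne_top d)
  have s4 := integral_sum_le fun i => (d.Λ_mem i).integrableOn_norm le_rfl ENNReal.one_ne_top
  have s0 : IntegrableOn (fun _ : ℝ => (1 : ℝ)) (Icc 0 T) volume ∧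
      ∫ _t in Icc 0 T, (1 : ℝ) ≤ T := by
    refine ⟨integrableOn_const (by simp), ?_⟩
    simp [d.T_pos.le]
  have add : ∀ {f g : ℝ → ℝ} {A B : ℝ}, (IntegrableOn f (Icc 0 T) volume ∧ ∫ t in Icc 0 T, f t ≤ A) →
      (IntegrableOn g (Icc 0 T) volume ∧ ∫ t in Icc 0 T, g t ≤ B) →
      IntegrableOn (fun t => f t + g t) (Icc 0 T) volume ∧ ∫ t in Icc 0 T, (f t + g t) ≤ A + B :=
    fun hf hg => ⟨hf.1.add hg.1, by rw [integral_add hf.1 hg.1]; exact add_le_add hf.2 hg.2⟩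
  exact add (add (add (add s0 s1) s2) s3) s4

/-! ### The stability estimate -/

lemma hasDerivWithinAt_energy {t : ℝ} (ht : t ∈ Icc 0 T) :
    HasDerivWithinAt d.energy (d.energyRate t) (Icc 0 T) t :=
  ((((d.curve_r.hasDerivWithinAt_sq ht).add ((d.curve_u 0).hasDerivWithinAt_sq ht)).add
    ((d.curve_u 1).hasDerivWithinAt_sq ht)).add
    (((d.curve_D 0 1).sub (d.curve_D 1 0)).hasDerivWithinAt_sq ht)).add
    (d.curve_θ.hasDerivWithinAt_sq ht)

lemma continuousOn_energyRate : ContinuousOn d.energyRate (Icc 0 T) :=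
  (((d.curve_r.continuousOn_deriv_sq.add (d.curve_u 0).continuousOn_deriv_sq).add
    (d.curve_u 1).continuousOn_deriv_sq).add
    ((d.curve_D 0 1).sub (d.curve_D 1 0)).continuousOn_deriv_sq).add
    d.curve_θ.continuousOn_deriv_sq

lemma continuousOn_dist2 : ContinuousOn d.dist2 (Icc 0 T) := by
  have hp := fun i => (d.curve_p i).continuousOn_sq
  have hH := fun i k => (d.curve_H i k).continuousOn_sq
  have hu := fun k => (d.curve_u k).continuousOn_sq
  have hD := fun i k => (d.curve_D i k).continuousOn_sq
  exact (((d.curve_r.continuousOn_sq.add ((hp 0).add (hp 1))).add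
    ((((hH 0 0).add (hH 0 1)).add (hH 1 0)).add (hH 1 1))).add ((hu 0).add (hu 1))).add
    ((((hD 0 0).add (hD 0 1)).add (hD 1 0)).add (hD 1 1))

lemma energy_nonneg (t : ℝ) : 0 ≤ d.energy t := by unfold energy; positivity

lemma dist2_nonneg (t : ℝ) : 0 ≤ d.dist2 t := by unfold dist2; positivity

/-- The chain distance, energy, initial energy, initial distance. Snapshots exist only at almost
every time; continuity of energy and distance gives the comparisons at `t` and at 0. -/
theorem dist2_le {K₁ K₂ K₃ : ℝ} (h0 : 0 ≤ K₁) (h2 : 0 ≤ K₂)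
    (hr : ∀ s : Snapshot a c M q, s.rate ≤ K₁ * (s.κ * s.en))
    (hd : ∀ s : Snapshot a c M q, s.dist2 ≤ K₂ * s.en)
    (he : ∀ s : Snapshot a c M q, s.en ≤ K₃ * s.dist2) {t : ℝ} (ht : t ∈ Icc 0 T) :
    d.dist2 t ≤ K₂ * K₃ * Real.exp (K₁ * ∫ s in Icc 0 T, d.κ s) * d.dist2 0 := by
  have hec : ContinuousOn d.energy (Icc 0 T) := fun s hs =>
    (d.hasDerivWithinAt_energy hs).continuousWithinAt
  have hec2 : ContinuousOn (fun t => K₂ * d.energy t) (Icc 0 T) := continuousOn_const.mul hec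
  have hdc3 : ContinuousOn (fun t => K₃ * d.dist2 t) (Icc 0 T) :=
    continuousOn_const.mul d.continuousOn_dist2
  have e1 : d.dist2 t ≤ K₂ * d.energy t := forall_le_of_ae_Icc d.T_pos d.continuousOn_dist2 hec2 (by
    filter_upwards [d.exists_snapshot] with τ hτ
    obtain ⟨s, -, e1, -, e2⟩ := hτ
    rw [← e2, ← e1]; exact hd s) t ht
  have e3 : d.energy 0 ≤ K₃ * d.dist2 0 := forall_le_of_ae_Icc d.T_pos hec hdc3 (by
    filter_upwards [d.exists_snapshot] with τ hτ
    obtain ⟨s, -, e1, -, e2⟩ := hτ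
    rw [← e2, ← e1]; exact he s) 0 ⟨le_rfl, d.T_pos.le⟩
  have e2 := gronwall_ae (κ := fun t => K₁ * d.κ t) d.T_pos.le
    (fun s hs => d.hasDerivWithinAt_energy hs) d.continuousOn_energyRate
    (fun s _ => d.energy_nonneg s) (d.integral_κ_le.1.const_mul K₁)
    (fun s => mul_nonneg h0 (zero_le_one.trans (d.le_κ s).1)) (by
      filter_upwards [d.exists_snapshot] with τ hτ
      obtain ⟨s, e0, e1, e2, -⟩ := hτ
      rw [← e0, ← e1, ← e2, mul_assoc]; exact hr s) ht
  rw [integral_const_mul] at e2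
  have hE := (Real.exp_pos (K₁ * ∫ s in Icc 0 T, d.κ s)).le
  calc d.dist2 t ≤ K₂ * d.energy t := e1
    _ ≤ K₂ * (Real.exp (K₁ * ∫ s in Icc 0 T, d.κ s) * (K₃ * d.dist2 0)) := by
        gcongr; exact e2.trans (by gcongr)
    _ = _ := by ring

lemma distSq_eq {t : ℝ} (ht : t ∈ Icc 0 T) : distSq S₁ S₂ t = ENNReal.ofReal (d.dist2 t) := by
  have z := fun (f : Plane → ℝ) => sq_nonneg (n2 f)
  have e1 : sobolevSq 2 (fun x => S₁.rho t x - S₂.rho t x) =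
      eLpNorm (fun x => S₁.rho t x - S₂.rho t x) 2 volume ^ 2 +
      ∑ i, (eLpNorm (d.dp i t) 2 volume ^ 2 + ∑ j, eLpNorm (d.dH j i t) 2 volume ^ 2) := by
    rw [sobolevSq_succ 1 fun i => d.weak_dp i t ht]
    congr 1
    refine Finset.sum_congr rfl fun i _ => ?_
    rw [sobolevSq_succ 0 fun j => d.weak_dH j i t ht]
    rfl
  have e2 : ∀ k, sobolevSq 1 (fun x => S₁.u k t x - S₂.u k t x) =
      eLpNorm (fun x => S₁.u k t x - S₂.u k t x) 2 volume ^ 2 +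
      ∑ i, eLpNorm (d.dD i k t) 2 volume ^ 2 := by
    intro k
    rw [sobolevSq_succ 0 fun i => d.weak_dD i k t ht]
    rfl
  simp only [distSq, e1, e2, Fin.sum_univ_two, eLpNorm_sq_eq (d.curve_r.memLp ht),
    eLpNorm_sq_eq ((d.curve_p _).memLp ht), eLpNorm_sq_eq ((d.curve_H _ _).memLp ht),
    eLpNorm_sq_eq ((d.curve_u _).memLp ht), eLpNorm_sq_eq ((d.curve_D _ _).memLp ht)]
  have add : ∀ {x y : ℝ}, 0 ≤ x → 0 ≤ y →
      ENNReal.ofReal x + ENNReal.ofReal y = ENNReal.ofReal (x + y) := fun hx hy =>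
    (ENNReal.ofReal_add hx hy).symm
  repeat rw [add (by positivity) (by positivity)]
  congr 1
  unfold dist2
  ring

/-- The initial data differ by the values of the curves at time 0, so they inherit their Sobolev
regularity; finiteness of the initial distance follows. -/
lemma distSq0_eq : distSq0 S₁ S₂ = ENNReal.ofReal (d.dist2 0) := by
  have h0 : (0 : ℝ) ∈ Icc 0 T := ⟨le_rfl, d.T_pos.le⟩
  rw [← d.distSq_eq h0, distSq0, distSq]
  have hr : (fun x => S₁.rho0 x - S₂.rho0 x) =ᵐ[volume] fun x => S₁.rho 0 x - S₂.rho 0 x :=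
    EventuallyEq.trans d.rho0_sub (d.curve_r.ae_eq 0 h0)
  have hu : ∀ k, (fun x => S₁.u0 k x - S₂.u0 k x) =ᵐ[volume] fun x => S₁.u k 0 x - S₂.u k 0 x :=
    fun k => EventuallyEq.trans (d.u0_sub k) ((d.curve_u k).ae_eq 0 h0)
  rw [sobolevSq_congr 2 hr]
  congr 1
  exact Finset.sum_congr rfl fun k _ => sobolevSq_congr 1 (hu k)

end Pair

/-! ### From the hypotheses to the stability bound. -/

lemma curve_of_contDiffOn {T : ℝ} (hT : 0 < T) {F : ℝ → Lp ℝ 2 (volume : Measure Plane)}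
    (hF : ContDiffOn ℝ 1 F (Icc 0 T)) : Curve T (fun t => F t) F (derivWithin F (Icc 0 T)) :=
  ⟨fun t ht => (hF.differentiableOn (by simp) t ht).hasDerivWithinAt,
    hF.continuousOn_derivWithin (uniqueDiffOn_Icc hT) le_rfl, fun _ _ => ae_eq_refl _⟩

lemma HasWeakLaplacian.ae_eq {r l : Plane → ℝ} {p : Fin 2 → Plane → ℝ}
    {H : Fin 2 → Fin 2 → Plane → ℝ} (h : HasWeakLaplacian r l) (hp : ∀ i, HasWeakPartial i r (p i))
    (hH : ∀ i k, HasWeakPartial i (p k) (H i k)) : l =ᵐ[volume] fun x => H 0 0 x + H 1 1 x := by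
  refine ae_eq_of_test h.2.1 ((hH 0 0).2.1.add (hH 1 1).2.1) fun φ hφ => ?_
  rw [← h.2.2 φ hφ]
  have e := fun i => ((hp i).2.2 _ (hφ.pd i)).trans
    (neg_eq_iff_eq_neg.2 ((hH i i).2.2 φ hφ))
  simp only [lap, Fin.sum_univ_two, mul_add, add_mul]
  rw [integral_add (integrable_mul_test h.1 ((hφ.pd 0).pd 0))
    (integrable_mul_test h.1 ((hφ.pd 1).pd 1)), e, e,
    integral_add (integrable_mul_test (hH 0 0).2.1 hφ) (integrable_mul_test (hH 1 1).2.1 hφ)]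

theorem StabilityAssumptions.nonempty_pair {T a c : ℝ} {M : ℝ≥0} {q : ℝ≥0∞} {S₁ S₂ : Flow}
    (hT : 0 < T) (h₁ : IsSolution T S₁) (h₂ : IsSolution T S₂)
    (h : StabilityAssumptions T a c q M S₁ S₂) : Nonempty (Pair T a c M q S₁ S₂) := by
  obtain ⟨p₁, hp₁, hp₁M⟩ := h.grad_rho₁
  obtain ⟨p₂, hp₂, hp₂M⟩ := h.grad_rho₂
  have path₁ := fun H v g => h₁.path (H := H) (v := v) (h := g) h.lower_pos h.bounds₁ hp₁ hp₁M h.u₁_mem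
  have path₂ := fun H v g => h₂.path (H := H) (v := v) (h := g) h.lower_pos h.bounds₂ hp₂ hp₂M h.u₂_mem
  obtain ⟨g, hg, hgM⟩ := h.grad_press_vort₂
  obtain ⟨G, hG, hGM⟩ := h.hess_rho₂
  choose H hH hHM using hGM
  -- The gradient behind the Hessian hypothesis may be another representative than `p₂`; uniqueness
  -- reconciles them, as for `W` and `Λ` below.
  have weak_H : ∀ i k, ∀ᵐ t ∂(volume.restrict (Icc 0 T)), HasWeakPartial i (p₂ k t) (H k i t) := by
    intro i k
    filter_upwards [hp₂ k, hG k, hH k i] with t e1 e2 e3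
    exact e3.congr (e2.unique e1 (ae_eq_refl _)) (ae_eq_refl _)
  choose V hV hVM using h.hess_u₂
  choose W hW hWM using hVM
  obtain ⟨L, hL, Λ, hΛ, hΛM⟩ := h.grad_lap_rho₂
  obtain ⟨hr, dp, hdp, hdp1⟩ := h.diff_rho
  choose hdp0 dH hdH hdH0 using hdp1
  choose hu dD hdD hdD0 using h.diff_u
  obtain ⟨R, R', hR⟩ := C1L2.exists_curve hT hr
  choose P P' hP using fun i => C1L2.exists_curve hT (hdp0 i)
  choose N N' hN using fun i k => C1L2.exists_curve hT (hdH0 k i)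
  choose U U' hU using fun k => C1L2.exists_curve hT (hu k)
  choose E E' hE using fun i k => C1L2.exists_curve hT (hdD0 k i)
  obtain ⟨Θ, hΘ, hθ⟩ := h.diff_theta
  choose w hw hwe using fun k => exists_joint_rep (hU k).cont'
  exact ⟨{
    T_pos := hT, a_pos := h.lower_pos, two_lt_q := h.two_lt_q, sol₁ := h₁, sol₂ := h₂
    p₁ := p₁, p₂ := p₂, path₁ := path₁, path₂ := path₂
    H₂ := fun i k => H k i, weak_H₂ := weak_H, H₂_mem := fun i k => hHM k i
    h₂ := g, weak_h₂ := hg, h₂_mem := hgM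
    W := fun i j k => W k j i
    weak_W := fun i j k => by
      filter_upwards [h₂.grad_u k j, hV k j, hW k j i] with t e1 e2 e3
      exact e3.congr (e2.unique e1 (ae_eq_refl _)) (ae_eq_refl _)
    W_mem := fun i j k => hWM k j i
    Λ := Λ
    weak_Λ := fun i => by
      filter_upwards [ae_all_iff.2 hp₂, ae_all_iff.2 fun i => ae_all_iff.2 (weak_H i), hL, hΛ i]
        with t e1 e2 e3 e4
      exact e4.congr (e3.ae_eq (H := fun i k => H k i t) e1 e2) (ae_eq_refl _)
    Λ_mem := hΛM
    rho0_mem := h.rho0_mem.1, u0_mem := fun k => (h.u0_mem k).1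
    R := R, R' := R', curve_r := hR
    dp := dp, weak_dp := hdp, P := P, P' := P', curve_p := hP
    dH := fun i k => dH k i, weak_dH := fun i k => hdH k i, N := N, N' := N', curve_H := hN
    U := U, U' := U', curve_u := hU
    dD := fun i k => dD k i, weak_dD := fun i k => hdD k i, E := E, E' := E', curve_D := hE
    Θ := Θ, Θ' := _, curve_θ := curve_of_contDiffOn hT hΘ, theta_eq := hθ
    w := w, w_meas := hw, w_eq := hwe }⟩

/-- The comparison constants depend on `M`, which the prefactor of the final estimate may not. They
are therefore moved into the exponent by adding to `I` a constant with integral `L`. -/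
theorem exists_stability_bound (T a c : ℝ) (q : ℝ≥0∞) (M : ℝ≥0) : ∃ B : ℝ, ∀ S₁ S₂ : Flow,
    0 < T → IsSolution T S₁ → IsSolution T S₂ → StabilityAssumptions T a c q M S₁ S₂ →
    distSq0 S₁ S₂ < ⊤ ∧ ∃ I : ℝ → ℝ, (∀ t, 0 ≤ I t) ∧ IntegrableOn I (Icc 0 T) volume ∧
      (∫ t in Icc 0 T, I t) ≤ B ∧
      (⨆ t ∈ Icc 0 T, distSq S₁ S₂ t) ≤
        ENNReal.ofReal (Real.exp (∫ t in Icc 0 T, (1 + I t))) * distSq0 S₁ S₂ := by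
  -- The bound is chosen before the flows, so the condition on `q` is not yet available from the
  -- assumptions.
  by_cases hq : 2 < q
  swap
  · exact ⟨0, fun S₁ S₂ _ _ _ h => absurd h.two_lt_q hq⟩
  obtain ⟨K₁, h1, hr⟩ := Snapshot.exists_rate_le a c M hq
  obtain ⟨K₂, h2, hd⟩ := Snapshot.exists_dist2_le a c M q
  obtain ⟨K₃, h3, he⟩ := Snapshot.exists_en_le a c M q
  -- The maximum with 1 keeps `L`, and hence `I`, nonnegative.
  set L := Real.log (max 1 (K₂ * K₃)) with hL
  have hL0 : 0 ≤ L := Real.log_nonneg (le_max_left _ _)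
  refine ⟨K₁ * Pair.κBound T M q + L, fun S₁ S₂ hT s₁ s₂ h => ?_⟩
  obtain ⟨d⟩ := h.nonempty_pair hT s₁ s₂
  obtain ⟨hκ, hκB⟩ := d.integral_κ_le
  have hκ0 : ∀ t, 0 ≤ d.κ t := fun t => zero_le_one.trans (d.le_κ t).1
  have hconst : ∀ b : ℝ, IntegrableOn (fun _ : ℝ => b) (Icc 0 T) volume ∧
      ∫ _t in Icc 0 T, b = T * b := fun b => by
    refine ⟨integrableOn_const (by simp), ?_⟩
    simp [hT.le]
  have hI : IntegrableOn (fun t => K₁ * d.κ t + L / T) (Icc 0 T) volume :=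
    (hκ.const_mul K₁).add (hconst _).1
  have hIe : ∫ t in Icc 0 T, (K₁ * d.κ t + L / T) = K₁ * (∫ t in Icc 0 T, d.κ t) + L := by
    rw [integral_add (hκ.const_mul K₁) (hconst _).1, integral_const_mul, (hconst _).2,
      mul_div_cancel₀ _ hT.ne']
  have hI1 : ∫ t in Icc 0 T, (1 + (K₁ * d.κ t + L / T)) =
      T + (K₁ * (∫ t in Icc 0 T, d.κ t) + L) := by
    rw [integral_add (hconst 1).1 hI, hIe, (hconst 1).2, mul_one]
  rw [d.distSq0_eq]
  refine ⟨ENNReal.ofReal_lt_top, fun t => K₁ * d.κ t + L / T, fun t => ?_, hI, ?_, ?_⟩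
  · have := hκ0 t
    positivity
  · rw [hIe]
    gcongr
  · refine iSup₂_le fun t ht => ?_
    rw [d.distSq_eq ht, hI1, ← ENNReal.ofReal_mul (Real.exp_pos _).le]
    refine ENNReal.ofReal_le_ofReal ((d.dist2_le h1 h2 hr hd he ht).trans ?_)
    refine mul_le_mul_of_nonneg_right ?_ (d.dist2_nonneg 0)
    rw [Real.exp_add, Real.exp_add (K₁ * _), hL, Real.exp_log (lt_max_of_lt_left one_pos)]
    have hE := Real.exp_pos (K₁ * ∫ t in Icc 0 T, d.κ t)
    have hT1 : 1 ≤ Real.exp T := Real.one_le_exp hT.le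
    calc K₂ * K₃ * Real.exp (K₁ * ∫ t in Icc 0 T, d.κ t)
        ≤ max 1 (K₂ * K₃) * Real.exp (K₁ * ∫ t in Icc 0 T, d.κ t) := by
          gcongr; exact le_max_right _ _
      _ = 1 * (Real.exp (K₁ * ∫ t in Icc 0 T, d.κ t) * max 1 (K₂ * K₃)) := by ring
      _ ≤ _ := by gcongr

end OddFluid

end

theorem proposition5p4 :
    ∃ C : ℝ, 0 < C ∧
    ∃ K₀ : ℝ → ℝ → ℝ → ℝ → ℝ → ℝ,
    ∃ Φ : ℝ → ℝ → ℝ → ℝ≥0∞ → ℝ≥0 → ℝ,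
    ∀ (T a b : ℝ) (q : ℝ≥0∞) (M : ℝ≥0) (S₁ S₂ : Flow),
      0 < T → IsSolution T S₁ → IsSolution T S₂ → StabilityAssumptions T a b q M S₁ S₂ →
      distSq0 S₁ S₂ < ⊤ ∧
      ∃ I : ℝ → ℝ, (∀ t, 0 ≤ I t) ∧ IntegrableOn I (Icc 0 T) volume ∧
        (∫ t in Icc 0 T, I t) ≤ Φ T a b q M ∧
        (⨆ t ∈ Icc 0 T, distSq S₁ S₂ t) ≤
          ENNReal.ofReal
            (K₀ a b (∑ i, partialSup i S₁.rho0).toReal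
                (∑ j, eLpNorm (S₂.u0 j) ⊤ volume).toReal
                (∑ i, ∑ j, partialSup i (S₂.u0 j)).toReal
              * Real.exp (C * ∫ t in Icc 0 T, (1 + I t)))
          * distSq0 S₁ S₂ := by
  choose B hB using exists_stability_bound
  -- Every constant already sits in `I`, so the absolute constant and the prefactor can both be 1.
  refine ⟨1, one_pos, fun _ _ _ _ _ => 1, B, fun T a b q M S₁ S₂ hT h₁ h₂ h => ?_⟩
  obtain ⟨h0, I, hI0, hI, hIB, hsup⟩ := hB T a b q M S₁ S₂ hT h₁ h₂ h
  refine ⟨h0, I, hI0, hI, hIB, ?_⟩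
  simpa only [one_mul] using hsup
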